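/- Fix countably infinite, pairwise disjoint sets $N_C$, $N_R$, $N_I$ of concept, role and individual names, and let $u\notin N_R$ be the universal role. For $n\ge 0$, the terms $\tau$ and concepts $C$ of the language $\mathcal{ML}^n_{\mathcal{ALCO}_u^\iota}$ are given by $$\tau ::= a \mid \iota C,\qquad C ::= A \mid \{\tau\}\mid \neg C\mid C\sqcap C\mid \exists r.C\mid \exists u.C\mid \Diamond_i C,$$ with $a\in N_I$, $A\in N_C$, $r\in N_R$, $1\le i\le n$. An ontology $\mathcal O$ is a finite set of concept inclusions $C\sqsubseteq D$. A frame is $\mathfrak F=(W,R_1,\dots,R_n)$ with $W\neq\emptyset$ and $R_i\subseteq W\times W$; it is a $\mathbf{K}^n$-frame without further conditions, and an $\mathbf{S5}^n$-frame if all $R_i$ are equivalence relations. An interpretation based on $\mathfrak F$ assigns to each $w\in W$ a non-empty domain $\Delta^w$, with $\Delta^w\subseteq\Delta^v$ whenever $wR_iv$, together with sets $A^w\subseteq\Delta^w$, relations $r^w\subseteq\Delta^w\times\Delta^w$, and a partial map $a\mapsto a^w\in\Delta^w$ on $N_I$. It has constant domain if all $\Delta^w$ coincide (the unrestricted case is called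 expanding domains), and it is total if every $a^w$ is defined (the unrestricted case is called partial). Names need not be rigid. The extension $C^w\subseteq \Delta^w$ is defined as usual for $\neg,\sqcap,\exists r$; further, $u^w=\Delta^w\times\Delta^w$; $(\Diamond_iC)^w=\{d\in\Delta^w\mid \exists v\,(wR_iv,\ d\in C^v)\}$; $(\iota C)^w=d$ if $C^w=\{d\}$, and $(\iota C)^w$ is undefined if $C^w$ is not a singleton; $\{\tau\}^w=\{\tau^w\}$ if $\tau^w$ is defined, and $\{\tau\}^w=\emptyset$ otherwise. A concept $C$ is satisfiable under the global ontology $\mathcal O$ in a class of interpretations if some interpretation of the class satisfies $D^w\subseteq E^w$ for all $D\sqsubseteq E$ in $\mathcal O$ and all worlds $w$, and $C^w\ne\emptyset$ for some $w$; it is satisfiable if this holds for $\mathcal O=\emptyset$. Theorem. For each of the four combinations of constant or expanding domains with total or partial semantics: 1. for every (fixed) $n$, the concept satisfiability problem for $\mathbf{K}^n_{\mathcal{ALCO}_u^\iota}$ and for $\mathbf{S5}^n_{\mathcal{ALCO}_u^\iota}$ (given $C$, is it satisfiable in an interpretation based on a $\mathbf{K}^n$-frame, respectively $\mathbf{S5}^n$-frame?)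 is in $\mathrm{NExpTime}$; 2. the concept satisfiability problem under global ontologies for $\mathbf{S5}_{\mathcal{ALCO}_u^\iota}$, i.e. $\mathbf{S5}^n_{\mathcal{ALCO}_u^\iota}$ with $n=1$ (given $C$ and $\mathcal O$), is in $\mathrm{NExpTime}$. Here concepts and ontologies are given as words over a finite alphabet, with names written in binary. -/

import Mathlib

/-! ## Nondeterministic multi-tape Turing machines and the class NExpTime -/

/-- A nondeterministic Turing machine over the input alphabet `α`: finitely many two-way infinite
tapes (at least one, tape `0` carries the input), a finite set `Q` of states, a finite tape
alphabet `Γ` whose blank is `default`, and a transition relation. If `(q', a) ∈ δ q s`, then in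
state `q`, reading the symbol `s j` on each tape `j`, the machine may go to state `q'`, write
`(a j).1` on tape `j`, and then move the head of tape `j` as told by `(a j).2`
(`none`: do not move). -/
structure NTM (α : Type) where
  k : ℕ
  Q : Type
  Γ : Type
  [finiteQ : Finite Q]
  [finiteΓ : Finite Γ]
  [blank : Inhabited Γ]
  inp : α → Γ
  inp_injective : Function.Injective inp
  inp_ne_blank : ∀ a, inp a ≠ default
  start : Q
  accept : Set Q
  δ : Q → (Fin (k + 1) → Γ) → Set (Q × (Fin (k + 1) → Γ × Option Turing.Dir))

namespace NTM

variable {α : Type}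

attribute [instance] NTM.finiteQ NTM.finiteΓ NTM.blank

/-- A configuration: the current state and the tapes with their head positions. -/
structure Cfg (M : NTM α) where
  q : M.Q
  tape : Fin (M.k + 1) → Turing.Tape M.Γ

/-- Moving a head one cell to the left or to the right, or not at all. -/
def moveHead {Γ : Type} [Inhabited Γ] : Option Turing.Dir → Turing.Tape Γ → Turing.Tape Γ
  | none, T => T
  | some d, T => T.move d

/-- The initial configuration on input `x`: the head of tape `0` scans the first letter of `x`,
and all other tapes are blank. -/
def init (M : NTM α) (x : List α) : M.Cfg where
  q := M.start
  tape := fun j => if j = 0 then Turing.Tape.mk₁ (x.map M.inp) else Turing.Tape.mk₁ []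

/-- One step of a computation. -/
def Step (M : NTM α) (c c' : M.Cfg) : Prop :=
  ∃ a : Fin (M.k + 1) → M.Γ × Option Turing.Dir,
    (c'.q, a) ∈ M.δ c.q (fun j => (c.tape j).head) ∧
      ∀ j, c'.tape j = moveHead (a j).2 ((c.tape j).write (a j).1)

/-- `M.StepsIn m c c'`: there is a computation of exactly `m` steps from `c` to `c'`. -/
inductive StepsIn (M : NTM α) : ℕ → M.Cfg → M.Cfg → Prop
  | refl (c : M.Cfg) : StepsIn M 0 c c
  | tail {m : ℕ} {c c' c'' : M.Cfg} :
      StepsIn M m c c' → M.Step c' c'' → StepsIn M (m + 1) c c''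

/-- `M` accepts `x` if some computation on `x` reaches an accepting state. -/
def Accepts (M : NTM α) (x : List α) : Prop :=
  ∃ (m : ℕ) (c : M.Cfg), M.StepsIn m (M.init x) c ∧ c.q ∈ M.accept

/-- Every computation of `M`, on every input `x`, has at most `T |x|` steps. -/
def RunsInTime (M : NTM α) (T : ℕ → ℕ) : Prop :=
  ∀ (x : List α) (m : ℕ) (c : M.Cfg), M.StepsIn m (M.init x) c → m ≤ T x.length

end NTM

/-- The complexity class NExpTime: languages decided by a nondeterministic Turing machine all of
whose computations on inputs of length `N` have at most `2 ^ p(N)` steps, for a polynomial `p`. -/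
def InNExpTime {α : Type} (L : Language α) : Prop :=
  ∃ (M : NTM α) (p : Polynomial ℕ),
    M.RunsInTime (fun N => 2 ^ p.eval N) ∧ ∀ x : List α, x ∈ L ↔ M.Accepts x

/-! ## Modal free description logic with nominals, universal role and definite descriptions -/

namespace ModalDL

/-- Concepts of the language with modalities `◇ᵢ`, `i : Fin n`. Concept names, role names and
individual names are three disjoint copies of `ℕ`. Terms are individual names `a` and definite
descriptions `ιC`; they occur in concepts only as (term) nominals, so the two forms `{a}` and
`{ιC}` are given by one constructor each. -/
inductive Concept (n : ℕ) : Type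
  /-- concept name `A` -/
  | atom (A : ℕ)
  /-- nominal `{a}` -/
  | nom (a : ℕ)
  /-- nominal `{ιC}` -/
  | desc (C : Concept n)
  /-- `¬C` -/
  | neg (C : Concept n)
  /-- `C ⊓ D` -/
  | inter (C D : Concept n)
  /-- `∃r.C` -/
  | ex (r : ℕ) (C : Concept n)
  /-- `∃u.C`, for the universal role `u` -/
  | exU (C : Concept n)
  /-- `◇ᵢC` -/
  | dia (i : Fin n) (C : Concept n)

/-- An ontology is a finite list of concept inclusions `C ⊑ D`, given as pairs `(C, D)`. -/
abbrev Ontology (n : ℕ) : Type := List (Concept n × Concept n)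

/-- Frames: a non-empty set of worlds with `n` accessibility relations. -/
structure KripkeFrame (n : ℕ) where
  W : Type
  [nonempty : Nonempty W]
  R : Fin n → W → W → Prop

/-- (Partial) interpretations with expanding domains, based on the frame `F`. The domain of each
world is a non-empty subset of the type `Obj`. The interpretation of all names, including
individual names, may differ from world to world, and individual names may fail to designate. -/
structure Interpretation {n : ℕ} (F : KripkeFrame n) where
  Obj : Type
  dom : F.W → Set Obj
  dom_nonempty : ∀ w, (dom w).Nonempty
  dom_mono : ∀ i w v, F.R i w v → dom w ⊆ dom v
  conc : ℕ → F.W → Set Obj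
  conc_sub : ∀ A w, conc A w ⊆ dom w
  role : ℕ → F.W → Obj → Obj → Prop
  role_sub : ∀ r w d e, role r w d e → d ∈ dom w ∧ e ∈ dom w
  ind : ℕ → F.W → Option Obj
  ind_mem : ∀ a w d, ind a w = some d → d ∈ dom w

namespace Interpretation

variable {n : ℕ} {F : KripkeFrame n}

/-- The extension of a concept at a world. The description `ιC` designates `d` at `w` exactly if
`d` is the only element of the extension of `C` at `w`; a nominal whose term does not designate
has empty extension. -/
def ext (M : Interpretation F) : Concept n → F.W → Set M.Obj
  | .atom A, w => M.conc A w
  | .nom a, w => {d | M.ind a w = some d}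
  | .desc C, w => {d | M.ext C w = {d}}
  | .neg C, w => M.dom w \ M.ext C w
  | .inter C D, w => M.ext C w ∩ M.ext D w
  | .ex r C, w => {d | d ∈ M.dom w ∧ ∃ e, M.role r w d e ∧ e ∈ M.ext C w}
  | .exU C, w => {d | d ∈ M.dom w ∧ ∃ e, e ∈ M.dom w ∧ e ∈ M.ext C w}
  | .dia i C, w => {d | d ∈ M.dom w ∧ ∃ v, F.R i w v ∧ d ∈ M.ext C v}

/-- The ontology holds globally: each inclusion is true at every world. -/
def Models (M : Interpretation F) (O : Ontology n) : Prop :=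
  ∀ ci ∈ O, ∀ w, M.ext ci.1 w ⊆ M.ext ci.2 w

end Interpretation

/-- The modal logics `K^n` and `S5^n`, given by their classes of frames. -/
inductive FrameClass
  | K
  | S5

/-- `K^n`: all frames; `S5^n`: the frames in which every accessibility relation is an
equivalence relation. -/
def FrameClass.Mem {n : ℕ} : FrameClass → KripkeFrame n → Prop
  | .K, _ => True
  | .S5, F => ∀ i, Equivalence (F.R i)

/-- Constant or expanding domains. -/
inductive DomainKind
  | const
  | expanding

/-- In the case `const`, all worlds have the same domain. -/
def DomainKind.Ok {n : ℕ} {F : KripkeFrame n} : DomainKind → Interpretation F → Prop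
  | .const, M => ∀ w v, M.dom w = M.dom v
  | .expanding, _ => True

/-- Total or partial semantics of individual names. -/
inductive NameKind
  | totalNames
  | partialNames

/-- In the case `totalNames`, every individual name designates at every world. -/
def NameKind.Ok {n : ℕ} {F : KripkeFrame n} : NameKind → Interpretation F → Prop
  | .totalNames, M => ∀ a w, ∃ d, M.ind a w = some d
  | .partialNames, _ => True

/-- The concept `C` is satisfiable under the global ontology `O`: in some interpretation of the
given kind, based on a frame of the given class, `O` is true at all worlds and `C` has non-empty
extension at some world. -/
def Satisfiable {n : ℕ} (L : FrameClass) (dk : DomainKind) (nk : NameKind)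
    (O : Ontology n) (C : Concept n) : Prop :=
  ∃ (F : KripkeFrame n) (M : Interpretation F),
    L.Mem F ∧ dk.Ok M ∧ nk.Ok M ∧ M.Models O ∧ ∃ w, (M.ext C w).Nonempty

/-! ## Concepts and ontologies as words over a finite alphabet -/

/-- The letters of words that encode concepts and ontologies. -/
inductive Letter (n : ℕ) : Type
  | atom
  | nom
  | desc
  | neg
  | inter
  | ex
  | exU
  | dia (i : Fin n)
  | bit (b : Bool)
  | sep
  | incl

/-- Names are written in binary, followed by a separator. -/
def encodeName {n : ℕ} (a : ℕ) : List (Letter n) := a.bits.map Letter.bit ++ [Letter.sep]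

/-- Concepts are written in prefix (Polish) notation. -/
def Concept.encode {n : ℕ} : Concept n → List (Letter n)
  | .atom A => Letter.atom :: encodeName A
  | .nom a => Letter.nom :: encodeName a
  | .desc C => Letter.desc :: C.encode
  | .neg C => Letter.neg :: C.encode
  | .inter C D => Letter.inter :: (C.encode ++ D.encode)
  | .ex r C => Letter.ex :: (encodeName r ++ C.encode)
  | .exU C => Letter.exU :: C.encode
  | .dia i C => Letter.dia i :: C.encode

/-- An ontology is written as the sequence of its inclusions. -/
def encodeOntology {n : ℕ} (O : Ontology n) : List (Letter n) :=
  O.flatMap fun ci => Letter.incl :: (ci.1.encode ++ ci.2.encode)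

/-- Concept satisfiability, without ontology, as a language. -/
def conceptSat (n : ℕ) (L : FrameClass) (dk : DomainKind) (nk : NameKind) : Language (Letter n) :=
  {x | ∃ C : Concept n, x = C.encode ∧ Satisfiable L dk nk [] C}

/-- Concept satisfiability under global ontologies as a language; the input is the concept
followed by the ontology. -/
def conceptSatUnderOntology (n : ℕ) (L : FrameClass) (dk : DomainKind) (nk : NameKind) :
    Language (Letter n) :=
  {x | ∃ (C : Concept n) (O : Ontology n),
    x = C.encode ++ encodeOntology O ∧ Satisfiable L dk nk O C}

end ModalDL

/-! Small models. Let `Sg` be the set of concepts that occur in an input of length `N`, and let the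
type of an object at a world record which of them are true of it. Within one world, `Sg` can only
see which types occur and, because of nominals and descriptions, whether a type occurs once or more
often. So a world can be represented by a finite sample of its objects in which types are counted up
to two. Objects persist from world to world, however, so one sample has to serve all worlds. This is
achieved by `Agree.transfer`. Suppose that there are `P` types and that a sample counts the types at
`w` correctly up to `P * B + 2`. For every successor `v` the sample points can then be reassigned to
objects of the same types at `w`, so that the types at `v` are counted correctly up to `B`, and a
prescribed witness of a diamond stays at its point. Iterating this along paths of diamond steps from
a world where the concept is true unravels any interpretation into a tree over one finite sample.

Without ontology, depth `N` suffices, because modal depth is at most `N`. For `S5^n`, paths never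
make two consecutive steps for the same modality, and accessibility is equality of points of
departure. With a single `S5` modality the paths then have length at most one, nothing is cut off,
and global ontologies survive. The sample has `2 ^ O(N ^ 2)` points and there are `2 ^ O(N ^ 3)`
paths, so worlds and objects have codes of `O(N ^ 3)` bits (`exists_small_interpretation`).

Certificates. Such a model is written as a set of rows of length `O(N ^ 3)`. There is a row for each
world and object, with their codes and with truth values placed at the positions of the subconcepts
in the input, and further rows describe the syntax of the input. Correctness is a fixed list of
conditions: for all rows `r₁`, `r₂` there is a row `r₃` such that the columns of the input and the
three rows form a word of a regular language. A model can be read off from any set of rows that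
meets the conditions (`Certifies.satisfiable`), and small models give such sets
(`fulfils_conditions`).

Machines. A program is a regular language of tape actions, and its finitely many left quotients are
the states of a Turing machine. The machine for `inNExpTime_of_rows` writes a unary clock of length
`c ^ (N ^ 3)`, guesses the rows, and checks each condition by nested loops over `r₁` and `r₂` with a
guess of `r₃`. Each action after the construction of the clock consumes one of its marks, so that
all computations are bounded, including the useless ones. -/

/-! ## Regular languages are closed under products and iteration -/

namespace Language

open Computability

variable {α : Type*}

/-- The language of the words with a given property. -/
def ofPred (p : List α → Prop) : Language α := {w | p w}

@[simp]
theorem mem_ofPred {p : List α → Prop} {w : List α} : w ∈ ofPred p ↔ p w := Iff.rfl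

/-- Regularity is used as finiteness of the set of left quotients. After `x` has been read, either
the factor from `L` is unfinished, or it was a prefix `u` of `x` and the rest `v` was read in `K`.
So the quotient depends only on one quotient of `L` and a set of quotients of `K`. -/
theorem leftQuotient_mul (L K : Language α) (x : List α) :
    (L * K).leftQuotient x = L.leftQuotient x * K +
      ofPred fun y => ∃ q ∈ {q | ∃ u v, u ∈ L ∧ u ++ v = x ∧ q = K.leftQuotient v}, y ∈ q := by
  ext y
  rw [mem_leftQuotient, mem_mul, mem_add, mem_mul]
  constructor
  · rintro ⟨u, hu, v, hv, h⟩
    rcases List.append_eq_append_iff.1 h with ⟨z, rfl, rfl⟩ | ⟨z, rfl, rfl⟩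
    · exact Or.inr ⟨_, ⟨u, z, hu, rfl, rfl⟩, hv⟩
    · exact Or.inl ⟨z, hu, v, hv, rfl⟩
  · rintro (⟨z, hz, v, hv, rfl⟩ | ⟨_, ⟨u, v, hu, rfl, rfl⟩, hy⟩)
    · exact ⟨x ++ z, hz, v, hv, by simp⟩
    · exact ⟨u, hu, v ++ y, hy, by simp⟩

theorem IsRegular.mul {L K : Language α} (hL : L.IsRegular) (hK : K.IsRegular) :
    (L * K).IsRegular := by
  refine .of_finite_range_leftQuotient ?_
  have h1 := hL.finite_range_leftQuotient
  have h2 := hK.finite_range_leftQuotient.finite_subsets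
  refine ((h1.prod h2).image fun p : Language α × Set (Language α) =>
    p.1 * K + ofPred fun y => ∃ q ∈ p.2, y ∈ q).subset ?_
  rintro _ ⟨x, rfl⟩
  refine ⟨(L.leftQuotient x, {q | ∃ u v, u ∈ L ∧ u ++ v = x ∧ q = K.leftQuotient v}),
    ⟨⟨x, rfl⟩, ?_⟩, (leftQuotient_mul L K x).symm⟩
  rintro _ ⟨u, v, -, -, rfl⟩
  exact ⟨v, rfl⟩

/-- Empty factors can be dropped, so the first factor contains the first letter. This makes
inductions on the length of the word possible. -/
theorem mem_kstar_cons_iff {L : Language α} {a : α} {x : List α} :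
    a :: x ∈ L∗ ↔ ∃ u v, a :: u ∈ L ∧ v ∈ L∗ ∧ x = u ++ v := by
  constructor
  · intro h
    obtain ⟨S, hS, hne⟩ := mem_kstar_iff_exists_nonempty.1 h
    cases S with
    | nil => simp at hS
    | cons w S =>
      obtain ⟨hw, hwne⟩ := hne w (by simp)
      cases w with
      | nil => exact absurd rfl hwne
      | cons b w =>
        simp only [List.flatten_cons, List.cons_append, List.cons.injEq] at hS
        obtain ⟨rfl, rfl⟩ := hS
        exact ⟨w, S.flatten, hw, join_mem_kstar fun y hy => (hne y (by simp [hy])).1, rfl⟩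
  · rintro ⟨u, v, hu, hv, rfl⟩
    rw [← one_add_self_mul_kstar_eq_kstar]
    exact Or.inr (append_mem_mul hu hv)

theorem kstar_append_mem {L : Language α} {u v : List α} (hu : u ∈ L∗) (hv : v ∈ L∗) :
    u ++ v ∈ L∗ := by
  rw [← kstar_mul_kstar]
  exact append_mem_mul hu hv

/-- At the end of `x` some factor is being read, which began after a prefix in `L∗`. Only the set of
quotients of `L` that arise in this way matters. For `x = []` the right side would be `L * L∗`,
which may lack the empty word. -/
theorem leftQuotient_kstar (L : Language α) {x : List α} (hx : x ≠ []) :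
    L∗.leftQuotient x =
      (ofPred fun y => ∃ q ∈ {q | ∃ u v, u ∈ L∗ ∧ u ++ v = x ∧ q = L.leftQuotient v}, y ∈ q)
        * L∗ := by
  ext y
  rw [mem_leftQuotient, mem_mul]
  constructor
  · intro h
    induction hn : x.length using Nat.strong_induction_on generalizing x with
    | _ n ih =>
      obtain ⟨a, x, rfl⟩ := List.exists_cons_of_ne_nil hx
      obtain ⟨u, v, hu, hv, he⟩ := mem_kstar_cons_iff.1 h
      rcases List.append_eq_append_iff.1 he with ⟨z, rfl, rfl⟩ | ⟨z, rfl, rfl⟩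
      · exact ⟨z, ⟨_, ⟨[], a :: x, nil_mem_kstar _, rfl, rfl⟩, hu⟩, v, hv, rfl⟩
      -- If the first factor ends exactly where `x` ends, it counts as an open factor that is
      -- completed by the empty word.
      · rcases eq_or_ne z [] with rfl | hz
        · refine ⟨[], ⟨_, ⟨[], _, nil_mem_kstar _, rfl, rfl⟩, ?_⟩, y, hv, rfl⟩
          simpa using hu
        · obtain ⟨b, ⟨q, ⟨u', v', hu', rfl, rfl⟩, hb⟩, c, hc, rfl⟩ :=
            ih z.length (by simp at hn; omega) hz hv rfl
          refine ⟨b, ⟨_, ⟨(a :: u) ++ u', v', ?_, by simp, rfl⟩, hb⟩, c, hc, rfl⟩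
          have := append_mem_mul hu hu'
          rw [← one_add_self_mul_kstar_eq_kstar]
          exact Or.inr this
  · rintro ⟨b, ⟨q, ⟨u, v, hu, rfl, rfl⟩, hb⟩, c, hc, rfl⟩
    have h1 := append_mem_mul (l := L) hb hc
    have h2 : (v ++ b) ++ c ∈ L∗ := by
      rw [← one_add_self_mul_kstar_eq_kstar]
      exact Or.inr h1
    have := kstar_append_mem hu h2
    simpa using this

theorem IsRegular.kstar {L : Language α} (hL : L.IsRegular) : (L∗).IsRegular := by
  refine .of_finite_range_leftQuotient ?_
  have h2 := hL.finite_range_leftQuotient.finite_subsets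
  refine ((h2.image fun p : Set (Language α) =>
    (ofPred fun y => ∃ q ∈ p, y ∈ q) * L∗).union (Set.finite_singleton L∗)).subset ?_
  rintro _ ⟨x, rfl⟩
  rcases eq_or_ne x [] with rfl | hx
  · exact Or.inr rfl
  · refine Or.inl ⟨{q | ∃ u v, u ∈ L∗ ∧ u ++ v = x ∧ q = L.leftQuotient v}, ?_,
      (leftQuotient_kstar L hx).symm⟩
    rintro _ ⟨u, v, -, -, rfl⟩
    exact ⟨v, rfl⟩

theorem IsRegular.letters (p : α → Prop) : (ofPred fun w => ∃ a, p a ∧ w = [a]).IsRegular := by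
  refine .of_finite_range_leftQuotient ?_
  refine Set.Finite.subset (Set.toFinite
    ({(ofPred fun w => ∃ a, p a ∧ w = [a]), 1, 0} : Set (Language α))) ?_
  rintro _ ⟨x, rfl⟩
  rcases x with _ | ⟨a, _ | ⟨b, x⟩⟩
  · simp
  · by_cases h : p a
    · right; left
      ext y
      rw [mem_leftQuotient, mem_one]
      constructor
      · rintro ⟨b, -, hb⟩
        exact (List.cons.inj hb).2
      · rintro rfl
        exact ⟨a, h, rfl⟩
    · right; right
      ext y
      rw [mem_leftQuotient]
      refine ⟨?_, fun h => h.elim⟩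
      rintro ⟨b, hb, he⟩
      simp only [List.cons_append, List.nil_append, List.cons.injEq] at he
      exact h (he.1 ▸ hb)
  · right; right
    ext y
    rw [mem_leftQuotient]
    refine ⟨?_, fun h => h.elim⟩
    rintro ⟨b, hb, he⟩
    simp at he

theorem IsRegular.one : (1 : Language α).IsRegular := by
  refine .of_finite_range_leftQuotient ?_
  refine Set.Finite.subset (Set.toFinite ({1, 0} : Set (Language α))) ?_
  rintro _ ⟨x, rfl⟩
  rcases x with _ | ⟨a, x⟩
  · simp
  · right
    ext y
    rw [mem_leftQuotient, mem_one]
    simp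

theorem IsRegular.zero : (0 : Language α).IsRegular := by
  have := IsRegular.letters (fun _ : α => False)
  convert this using 1
  ext w
  refine ⟨fun h => h.elim, ?_⟩
  rintro ⟨a, h, -⟩
  exact h.elim

theorem IsRegular.pow {L : Language α} (hL : L.IsRegular) (k : ℕ) : (L ^ k).IsRegular := by
  induction k with
  | zero => simpa using IsRegular.one
  | succ k ih => rw [pow_succ]; exact ih.mul hL

theorem IsRegular.iUnion {κ : Type*} [Finite κ] {L : κ → Language α} (hL : ∀ k, (L k).IsRegular) :
    (ofPred fun w => ∃ k, w ∈ L k).IsRegular := by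
  classical
  have := Fintype.ofFinite κ
  have : ∀ s : Finset κ, (ofPred fun w => ∃ k ∈ s, w ∈ L k).IsRegular := by
    intro s
    induction s using Finset.induction_on with
    | empty =>
      convert IsRegular.zero (α := α) using 1
      ext w
      refine ⟨?_, fun h => h.elim⟩
      rintro ⟨k, hk, -⟩
      simp at hk
    | insert a s _ ih =>
      convert (hL a).add ih using 1
      ext w
      rw [mem_add]
      constructor
      · rintro ⟨k, hk, hw⟩
        rcases Finset.mem_insert.1 hk with rfl | hk
        · exact Or.inl hw
        · exact Or.inr ⟨k, hk, hw⟩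
      · rintro (hw | ⟨k, hk, hw⟩)
        · exact ⟨a, by simp, hw⟩
        · exact ⟨k, by simp [hk], hw⟩
  convert this Finset.univ using 1
  ext w
  constructor
  · rintro ⟨k, hk⟩
    exact ⟨k, by simp, hk⟩
  · rintro ⟨k, -, hk⟩
    exact ⟨k, hk⟩

theorem IsRegular.comap {β : Type*} {L : Language β} (hL : L.IsRegular) (f : α → β) :
    (ofPred fun w => w.map f ∈ L).IsRegular := by
  refine .of_finite_range_leftQuotient ?_
  refine (hL.finite_range_leftQuotient.image
    fun q : Language β => (ofPred fun w => w.map f ∈ q)).subset ?_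
  rintro _ ⟨x, rfl⟩
  refine ⟨_, ⟨x.map f, rfl⟩, ?_⟩
  ext y
  rw [mem_leftQuotient, mem_ofPred, mem_ofPred, mem_leftQuotient, List.map_append]

end Language

/-! ## Programs: regular languages of elementary actions on tapes -/

namespace TapeProgram

open Turing

/-- The displacement of a head. -/
def disp : Option Dir → ℤ
  | none => 0
  | some .left => -1
  | some .right => 1

/-- The contents of a tape and the position of its head. -/
abbrev TapeState (Γ : Type) := (ℤ → Γ) × ℤ

/-- An action: the symbols that it expects to read, the symbols that it writes, the moves. -/
abbrev Action (ι Γ : Type) := (ι → Γ) × (ι → Γ × Option Dir)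

variable {ι Γ : Type}

/-- The symbols under the heads. -/
def scan (s : ι → TapeState Γ) : ι → Γ := fun j => (s j).1 (s j).2

/-- Writing and moving. -/
def apply (a : ι → Γ × Option Dir) (s : ι → TapeState Γ) : ι → TapeState Γ :=
  fun j => (Function.update (s j).1 (s j).2 (a j).1, (s j).2 + disp (a j).2)

/-- Executing a sequence of actions. -/
def Exec : List (Action ι Γ) → (ι → TapeState Γ) → (ι → TapeState Γ) → Prop
  | [], s, s' => s' = s
  | a :: σ, s, s' => a.1 = scan s ∧ Exec σ (apply a.2 s) s'

theorem exec_append {σ τ : List (Action ι Γ)} {s s' : ι → TapeState Γ} :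
    Exec (σ ++ τ) s s' ↔ ∃ s₁, Exec σ s s₁ ∧ Exec τ s₁ s' := by
  induction σ generalizing s with
  | nil => simp [Exec]
  | cons a σ ih => simp [Exec, ih, and_assoc]

/-- A run of exactly `t` actions of the program `P`. -/
def Run (P : Language (Action ι Γ)) (s : ι → TapeState Γ) (t : ℕ) (s' : ι → TapeState Γ) : Prop :=
  ∃ σ ∈ P, σ.length = t ∧ Exec σ s s'

/-- All executions of `P` from `s`, including unfinished ones, have at most `T` actions. -/
def Bounded (P : Language (Action ι Γ)) (s : ι → TapeState Γ) (T : ℕ) : Prop :=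
  ∀ σ τ s', σ ++ τ ∈ P → Exec σ s s' → σ.length ≤ T

/-- The contents of a tape that carries a word. -/
def content [Inhabited Γ] (l : List Γ) : ℤ → Γ :=
  fun i => if 0 ≤ i then l.getD i.toNat default else default

/-- The initial state on input `x`, given on tape `i₀`. -/
noncomputable def initState {α : Type} [Inhabited Γ] (i₀ : ι) (inp : α → Γ) (x : List α) :
    ι → TapeState Γ :=
  open Classical in fun j => (content (if j = i₀ then x.map inp else []), 0)

/-! ### Compiling regular programs into Turing machines -/

section Compile

variable [Inhabited Γ]

/-- The tape `T` is in the state `s`. -/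
def Represents (T : Tape Γ) (s : TapeState Γ) : Prop := ∀ i, T.nth i = s.1 (s.2 + i)

theorem represents_mk₁ (l : List Γ) : Represents (Tape.mk₁ l) (content l, 0) := by
  intro i
  simp only [zero_add, content]
  rcases i with n | n
  · have : (Tape.mk₁ l).nth (n : ℤ) = (ListBlank.mk l).nth n := Tape.mk'_nth_nat _ _ _
    simp only [Int.ofNat_eq_natCast, this, ListBlank.nth_mk]
    simp [List.getI_eq_getElem?_getD]
  · have : (Tape.mk₁ l).nth (Int.negSucc n) = (ListBlank.mk ([] : List Γ)).nth n := rfl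
    rw [this, ListBlank.nth_mk]
    simp

theorem Represents.head {T : Tape Γ} {s : TapeState Γ} (h : Represents T s) : T.head = s.1 s.2 := by
  simpa using h 0

theorem Represents.act {T : Tape Γ} {s : TapeState Γ} (h : Represents T s) (a : Γ × Option Dir) :
    Represents (NTM.moveHead a.2 (T.write a.1))
      (Function.update s.1 s.2 a.1, s.2 + disp a.2) := by
  have key : ∀ i, (T.write a.1).nth i = Function.update s.1 s.2 a.1 (s.2 + i) := by
    intro i
    rw [Tape.write_nth]
    split_ifs with hi
    · simp [hi]
    · rw [Function.update_of_ne (by simpa using hi), h i]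
  intro i
  rcases a with ⟨b, _ | _ | _⟩
  · simpa [NTM.moveHead, disp] using key i
  · simp only [NTM.moveHead, disp, Tape.move_left_nth, key]
    congr 1; ring
  · simp only [NTM.moveHead, disp, Tape.move_right_nth, key]
    congr 1; ring

variable {α : Type} {k : ℕ}

/-- The machine whose control is the minimal automaton of a program, without the dead state. -/
def machine [Finite Γ] (inp : α → Γ) (h₁ : Function.Injective inp) (h₂ : ∀ a, inp a ≠ default)
    (P : Language (Action (Fin (k + 1)) Γ)) (hP : P.IsRegular) : NTM α where
  k := k
  Q := Set.range P.leftQuotient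
  Γ := Γ
  finiteQ := hP.finite_range_leftQuotient.to_subtype
  inp := inp
  inp_injective := h₁
  inp_ne_blank := h₂
  start := ⟨P, [], rfl⟩
  accept := {q | [] ∈ q.1}
  -- Only nonempty quotients are entered. Hence the actions of every computation form a prefix of a
  -- word of `P`, and `Bounded` limits all computations, not only the accepting ones.
  δ q r := {p | p.1.1 = q.1.leftQuotient [(r, p.2)] ∧ ∃ w, w ∈ p.1.1}

variable [Finite Γ] {inp : α → Γ} {h₁ : Function.Injective inp} {h₂ : ∀ a, inp a ≠ default}
    {P : Language (Action (Fin (k + 1)) Γ)} {hP : P.IsRegular}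

theorem represents_init {x : List α} (j : Fin (k + 1)) :
    Represents (Γ := Γ) (((machine inp h₁ h₂ P hP).init x).tape j) (initState 0 inp x j) := by
  have : initState 0 inp x j = (content (if j = 0 then x.map inp else []), 0) := by
    simp only [initState]
    congr 2
    split_ifs <;> rfl
  rw [this]
  by_cases hj : j = 0
  · rw [if_pos hj]
    have : ((machine inp h₁ h₂ P hP).init x).tape j = Tape.mk₁ (x.map inp) := if_pos hj
    rw [this]
    exact represents_mk₁ _
  · rw [if_neg hj]
    have : ((machine inp h₁ h₂ P hP).init x).tape j = Tape.mk₁ [] := if_neg hj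
    rw [this]
    exact represents_mk₁ (Γ := Γ) []

theorem scan_eq {c : (machine inp h₁ h₂ P hP).Cfg} {s : Fin (k + 1) → TapeState Γ}
    (h : ∀ j : Fin (k + 1), Represents (Γ := Γ) (c.tape j) (s j)) :
    (fun j => (c.tape j).head) = scan s :=
  funext fun j => (h j).head

/-- The state of the machine is the quotient of `P` by the word of actions performed so far. The
alternative `m = 0` is there because the start state may itself be the empty quotient. -/
theorem machine_sound {x : List α} {m : ℕ} {c : (machine inp h₁ h₂ P hP).Cfg}
    (h : (machine inp h₁ h₂ P hP).StepsIn m ((machine inp h₁ h₂ P hP).init x) c) :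
    ∃ σ s, σ.length = m ∧ c.q.1 = P.leftQuotient σ ∧ (m = 0 ∨ ∃ w, w ∈ c.q.1) ∧
      Exec σ (initState 0 inp x) s ∧ ∀ j, Represents (c.tape j) (s j) := by
  generalize hc : (machine inp h₁ h₂ P hP).init x = c₀ at h
  induction h with
  | refl =>
    subst hc
    exact ⟨[], _, rfl, rfl, Or.inl rfl, rfl, represents_init⟩
  | @tail m c₁ c' c'' h1 h2 ih =>
    obtain ⟨σ, s, rfl, hq, -, hex, hrep⟩ := ih hc
    obtain ⟨a, ⟨hδ, hne⟩, ht⟩ := h2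
    refine ⟨σ ++ [((scan s, a) : Action (Fin (k + 1)) Γ)], apply (ι := Fin (k + 1)) a s, by simp, ?_, Or.inr hne, ?_, fun j => ?_⟩
    · rw [Language.leftQuotient_append, ← hq]
      exact Eq.trans hδ (congrArg (fun r : Fin (k + 1) → Γ =>
        Language.leftQuotient (α := Action (Fin (k + 1)) Γ) c'.q.1 [(r, a)]) (scan_eq hrep))
    · rw [exec_append]
      exact ⟨s, hex, rfl, rfl⟩
    · rw [ht j]
      exact (hrep j).act (a j)

/-- The continuation `τ` shows that all quotients on the way are nonempty, as the transitions
demand. -/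
theorem machine_complete {x : List α} {σ : List (Action (Fin (k + 1)) Γ)}
    {s : Fin (k + 1) → TapeState Γ} (hex : Exec σ (initState 0 inp x) s) (τ : List _)
    (hσ : σ ++ τ ∈ P) :
    ∃ c, (machine inp h₁ h₂ P hP).StepsIn σ.length ((machine inp h₁ h₂ P hP).init x) c ∧
      c.q.1 = P.leftQuotient σ ∧ ∀ j, Represents (c.tape j) (s j) := by
  induction σ using List.reverseRecOn generalizing s τ with
  | nil =>
    obtain rfl : s = _ := hex
    exact ⟨_, .refl _, rfl, represents_init⟩
  | append_singleton σ a ih =>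
    obtain ⟨s₁, hs₁, ha, hs⟩ := exec_append.1 hex
    obtain rfl : s = _ := hs
    rw [List.append_assoc] at hσ
    obtain ⟨c, hc, hq, hrep⟩ := ih hs₁ _ hσ
    refine ⟨⟨⟨P.leftQuotient (σ ++ [a]), _, rfl⟩,
      fun j => NTM.moveHead (a.2 j).2 ((c.tape j).write (a.2 j).1)⟩, ?_, rfl,
      fun j => (hrep j).act (a.2 j)⟩
    rw [List.length_append]
    refine .tail hc ⟨a.2, ⟨?_, τ, ?_⟩, fun j => rfl⟩
    · change P.leftQuotient (σ ++ [a]) = c.q.1.leftQuotient [((fun j => (c.tape j).head), a.2)]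
      have h1 : a = (scan s₁, a.2) := Prod.ext ha rfl
      have h2 : P.leftQuotient (σ ++ [a]) = (P.leftQuotient σ).leftQuotient [(scan s₁, a.2)] := by
        rw [Language.leftQuotient_append, ← h1]
      refine h2.trans ?_
      rw [← hq]
      exact congrArg (fun r : Fin (k + 1) → Γ =>
        Language.leftQuotient (α := Action (Fin (k + 1)) Γ) c.q.1 [(r, a.2)]) (scan_eq hrep).symm
    · simpa using hσ

theorem inNExpTime_fin (inp : α → Γ) (h₁ : Function.Injective inp) (h₂ : ∀ a, inp a ≠ default)
    (P : Language (Action (Fin (k + 1)) Γ)) (hP : P.IsRegular) (p : Polynomial ℕ)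
    (hB : ∀ x, Bounded P (initState 0 inp x) (2 ^ p.eval x.length)) :
    InNExpTime (Language.ofPred fun x => ∃ t s, Run P (initState 0 inp x) t s) := by
  refine ⟨machine inp h₁ h₂ P hP, p, ?_, ?_⟩
  · intro x m c h
    obtain ⟨σ, s, rfl, hq, hne, hex, -⟩ := machine_sound h
    rcases hne with h0 | ⟨w, hw⟩
    · simp [h0]
    · rw [hq] at hw
      exact hB x σ w s hw hex
  · intro x
    constructor
    · rintro ⟨t, s, σ, hσ, -, hex⟩
      obtain ⟨c, hc, hq, -⟩ := machine_complete (h₁ := h₁) (h₂ := h₂) (hP := hP) hex []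
        (by simpa using hσ)
      refine ⟨_, c, hc, ?_⟩
      change [] ∈ c.q.1
      rw [hq]
      simpa using hσ
    · rintro ⟨m, c, h, hacc⟩
      obtain ⟨σ, s, rfl, hq, -, hex, -⟩ := machine_sound h
      have : [] ∈ c.q.1 := hacc
      rw [hq] at this
      exact ⟨_, s, σ, by simpa using this, rfl, hex⟩

end Compile

/-! ### Composition of programs -/

open Computability

section Rules

variable {P P' : Language (Action ι Γ)} {s s' : ι → TapeState Γ} {t : ℕ}

theorem run_mul : Run (P * P') s t s' ↔
    ∃ t₁ t₂ s₁, t = t₁ + t₂ ∧ Run P s t₁ s₁ ∧ Run P' s₁ t₂ s' := by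
  constructor
  · rintro ⟨_, ⟨u, hu, v, hv, rfl⟩, rfl, hex⟩
    obtain ⟨s₁, h₁, h₂⟩ := exec_append.1 hex
    exact ⟨_, _, s₁, by simp, ⟨u, hu, rfl, h₁⟩, ⟨v, hv, rfl, h₂⟩⟩
  · rintro ⟨_, _, s₁, rfl, ⟨u, hu, rfl, h₁⟩, ⟨v, hv, rfl, h₂⟩⟩
    exact ⟨u ++ v, ⟨u, hu, v, hv, rfl⟩, by simp, exec_append.2 ⟨s₁, h₁, h₂⟩⟩

theorem run_add : Run (P + P') s t s' ↔ Run P s t s' ∨ Run P' s t s' := by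
  constructor
  · rintro ⟨u, hu | hu, h⟩
    · exact Or.inl ⟨u, hu, h⟩
    · exact Or.inr ⟨u, hu, h⟩
  · rintro (⟨u, hu, h⟩ | ⟨u, hu, h⟩)
    · exact ⟨u, Or.inl hu, h⟩
    · exact ⟨u, Or.inr hu, h⟩

theorem run_one : Run (1 : Language (Action ι Γ)) s t s' ↔ t = 0 ∧ s' = s := by
  constructor
  · rintro ⟨u, rfl, rfl, h⟩
    exact ⟨rfl, h⟩
  · rintro ⟨rfl, rfl⟩
    exact ⟨[], rfl, rfl, rfl⟩

theorem run_iUnion {κ : Type*} {L : κ → Language (Action ι Γ)} :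
    Run (Language.ofPred fun w => ∃ k, w ∈ L k) s t s' ↔ ∃ k, Run (L k) s t s' := by
  constructor
  · rintro ⟨u, ⟨k, hk⟩, h⟩
    exact ⟨k, u, hk, h⟩
  · rintro ⟨k, u, hk, h⟩
    exact ⟨u, ⟨k, hk⟩, h⟩

theorem kstar_mul_eq : P∗ * P' = P' + P * (P∗ * P') := by
  rw [← mul_assoc]
  conv_lhs => rw [← Language.one_add_self_mul_kstar_eq_kstar, add_mul, one_mul]

/-- The elementary program that requires `g` of the symbols read, then writes and moves. -/
def op (g : (ι → Γ) → Prop) (wr : ι → Option Γ) (mv : ι → Option Dir) :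
    Language (Action ι Γ) :=
  Language.ofPred fun w => ∃ a : Action ι Γ,
    (g a.1 ∧ a.2 = fun j => ((wr j).getD (a.1 j), mv j)) ∧ w = [a]

theorem op_isRegular (g : (ι → Γ) → Prop) (wr : ι → Option Γ) (mv : ι → Option Dir) :
    (op g wr mv).IsRegular :=
  Language.IsRegular.letters _

/-- The effect of an elementary program. -/
def effect (wr : ι → Option Γ) (mv : ι → Option Dir) (s : ι → TapeState Γ) : ι → TapeState Γ :=
  fun j => ((wr j).elim (s j).1 (Function.update (s j).1 (s j).2), (s j).2 + disp (mv j))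

theorem apply_eq_effect (wr : ι → Option Γ) (mv : ι → Option Dir) (s : ι → TapeState Γ) :
    apply (fun j => ((wr j).getD (scan s j), mv j)) s = effect wr mv s := by
  funext j
  unfold apply effect
  cases h : wr j <;> simp [scan, h]

theorem run_op {g : (ι → Γ) → Prop} {wr : ι → Option Γ} {mv : ι → Option Dir} :
    Run (op g wr mv) s t s' ↔ t = 1 ∧ g (scan s) ∧ s' = effect wr mv s := by
  constructor
  · rintro ⟨_, ⟨⟨r, f⟩, ⟨hg, hf⟩, rfl⟩, rfl, hr, hs⟩
    dsimp only at hr hf hg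
    subst hr hf
    refine ⟨rfl, hg, ?_⟩
    rw [← apply_eq_effect]
    exact hs
  · rintro ⟨rfl, hg, rfl⟩
    refine ⟨_, ⟨(scan s, fun j => ((wr j).getD (scan s j), mv j)), ⟨hg, rfl⟩, rfl⟩, rfl, rfl, ?_⟩
    exact (apply_eq_effect _ _ _).symm

theorem Bounded.mono {T T' : ℕ} (h : Bounded P s T) (hT : T ≤ T') : Bounded P s T' :=
  fun σ τ s' h1 h2 => (h σ τ s' h1 h2).trans hT

/-- An unfinished execution of the product stops inside the first factor or after a complete run of
it; the second bound is only needed at states that such runs reach. -/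
theorem bounded_mul {T₁ T₂ : ℕ} (h₁ : Bounded P s T₁)
    (h₂ : ∀ t s₁, Run P s t s₁ → Bounded P' s₁ T₂) : Bounded (P * P') s (T₁ + T₂) := by
  rintro σ τ s' ⟨u, hu, v, hv, h⟩ hex
  rcases List.append_eq_append_iff.1 h with ⟨z, rfl, rfl⟩ | ⟨z, rfl, rfl⟩
  · obtain ⟨s₁, hs₁, hs₂⟩ := exec_append.1 hex
    have e₁ := h₁ u [] s₁ (by rw [List.append_nil]; exact hu) hs₁
    have e₂ := h₂ _ s₁ ⟨u, hu, rfl, hs₁⟩ z τ s' hv hs₂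
    simp only [List.length_append]
    omega
  · have := h₁ σ z s' hu hex
    omega

theorem bounded_add {T : ℕ} (h₁ : Bounded P s T) (h₂ : Bounded P' s T) :
    Bounded (P + P') s T := by
  rintro σ τ s' (h | h) hex
  · exact h₁ σ τ s' h hex
  · exact h₂ σ τ s' h hex

theorem bounded_op {g : (ι → Γ) → Prop} {wr : ι → Option Γ} {mv : ι → Option Dir} :
    Bounded (op g wr mv) s 1 := by
  rintro σ τ s' ⟨a, -, h⟩ -
  have := congrArg List.length h
  simp at this
  omega

theorem bounded_op_of_not {g : (ι → Γ) → Prop} {wr : ι → Option Γ} {mv : ι → Option Dir}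
    (hg : ¬ g (scan s)) : Bounded (op g wr mv) s 0 := by
  rintro (_ | ⟨b, σ⟩) τ s' ⟨a, ⟨ha, -⟩, h⟩ hex
  · rfl
  · simp only [List.cons_append, List.cons.injEq] at h
    rw [← h.1, hex.1] at ha
    exact absurd ha hg

/-! ### Deterministic programs -/

/-- From `s`, the program `P` has exactly one result, namely `s'`, and needs at most `T` steps. -/
structure Det (P : Language (Action ι Γ)) (s : ι → TapeState Γ) (T : ℕ)
    (s' : ι → TapeState Γ) : Prop where
  exists_run : ∃ t, Run P s t s'
  unique : ∀ t s₁, Run P s t s₁ → s₁ = s'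
  bounded : Bounded P s T

/-- From `s`, the program `P` fails within `T` steps. -/
structure Fails (P : Language (Action ι Γ)) (s : ι → TapeState Γ) (T : ℕ) : Prop where
  no_run : ∀ t s', ¬ Run P s t s'
  bounded : Bounded P s T

theorem Det.mono {T T' : ℕ} (h : Det P s T s') (hT : T ≤ T') : Det P s T' s' :=
  ⟨h.1, h.2, h.3.mono hT⟩

theorem Det.mul {T₁ T₂ : ℕ} {s₁ : ι → TapeState Γ} (h₁ : Det P s T₁ s₁) (h₂ : Det P' s₁ T₂ s') :
    Det (P * P') s (T₁ + T₂) s' := by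
  obtain ⟨t₁, r₁⟩ := h₁.1
  obtain ⟨t₂, r₂⟩ := h₂.1
  refine ⟨⟨_, run_mul.2 ⟨t₁, t₂, s₁, rfl, r₁, r₂⟩⟩, ?_, ?_⟩
  · intro t s₂ h
    obtain ⟨t₁, t₂, s₃, -, h3, h4⟩ := run_mul.1 h
    cases h₁.2 _ _ h3
    exact h₂.2 _ _ h4
  · refine bounded_mul h₁.3 fun t s₂ h => ?_
    cases h₁.2 _ _ h
    exact h₂.3

/-- With exclusive guards, a sum of programs is deterministic although it looks like a choice. The
construction of the clock has to be deterministic, because the time bound depends on the exact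
number of marks it leaves. -/
theorem Det.add_fails {T : ℕ} (h₁ : Det P s T s') (h₂ : Fails P' s T) : Det (P + P') s T s' := by
  obtain ⟨t₁, r₁⟩ := h₁.1
  refine ⟨⟨_, run_add.2 (.inl r₁)⟩, ?_, bounded_add h₁.3 h₂.2⟩
  intro t s₂ h
  rcases run_add.1 h with h | h
  · exact h₁.2 _ _ h
  · exact absurd h (h₂.1 _ _)

theorem Fails.op_mul {g : (ι → Γ) → Prop} {wr : ι → Option Γ} {mv : ι → Option Dir}
    (hg : ¬ g (scan s)) (T : ℕ) : Fails (op g wr mv * P) s T := by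
  constructor
  · intro t s' h
    obtain ⟨_, _, _, -, h, -⟩ := run_mul.1 h
    exact hg (run_op.1 h).2.1
  · refine (bounded_mul (T₂ := 0) (bounded_op_of_not hg) ?_).mono (Nat.zero_le _)
    intro t s₁ h
    exact absurd (run_op.1 h).2.1 hg

theorem Fails.op {g : (ι → Γ) → Prop} {wr : ι → Option Γ} {mv : ι → Option Dir}
    (hg : ¬ g (scan s)) (T : ℕ) : Fails (op g wr mv) s T :=
  ⟨fun _ _ h => hg (run_op.1 h).2.1, (bounded_op_of_not hg).mono (Nat.zero_le _)⟩

theorem Det.op {g : (ι → Γ) → Prop} {wr : ι → Option Γ} {mv : ι → Option Dir}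
    (hg : g (scan s)) (hs : effect wr mv s = s') : Det (op g wr mv) s 1 s' := by
  subst hs
  exact ⟨⟨1, run_op.2 ⟨rfl, hg, rfl⟩⟩, fun t s₁ h => (run_op.1 h).2.2, bounded_op⟩

/-- A loop whose body and exit have exclusive guards. -/
theorem Det.loop {g g' : (ι → Γ) → Prop} {wr wr' : ι → Option Γ} {mv mv' : ι → Option Dir}
    {T m : ℕ} (st : ℕ → ι → TapeState Γ)
    (hbody : ∀ i < m, Det (TapeProgram.op g wr mv * P) (st i) T (st (i + 1)))
    (hcont : ∀ i < m, ¬ g' (scan (st i))) (hdone : ¬ g (scan (st m)))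
    (hexit : g' (scan (st m))) (hs : effect wr' mv' (st m) = s') :
    Det ((TapeProgram.op g wr mv * P)∗ * TapeProgram.op g' wr' mv') (st 0) (m * T + 1) s' := by
  induction m generalizing st with
  | zero =>
    rw [kstar_mul_eq, mul_assoc]
    simpa using (Det.op hexit hs).add_fails (Fails.op_mul hdone 1)
  | succ m ih =>
    have h1 := ih (fun i => st (i + 1)) (fun i hi => hbody (i + 1) (by omega))
      (fun i hi => hcont (i + 1) (by omega)) hdone hexit hs
    have h2 := (hbody 0 (by omega)).mul h1
    rw [kstar_mul_eq, add_comm]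
    refine (h2.mono ?_).add_fails (Fails.op (hcont 0 (by omega)) _)
    rw [Nat.succ_mul]
    omega

end Rules

end TapeProgram

/-! ## A clock that runs for `k ^ (N ^ 3)` steps -/

namespace TapeProgram

open Turing Computability

/-- The tape symbols: letters of the input, symbols of rows, a separator of rows, marks. -/
inductive Cell (α Γ : Type) : Type
  | blank
  | mark
  | sep
  | inp (a : α)
  | row (c : Γ)

instance {α Γ : Type} : Inhabited (Cell α Γ) := ⟨.blank⟩

theorem cell_default {α Γ : Type} : (default : Cell α Γ) = .blank := rfl

instance {α Γ : Type} [Finite α] [Finite Γ] : Finite (Cell α Γ) := by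
  refine Finite.of_injective (β := Fin 3 ⊕ α ⊕ Γ) (fun
    | .blank => .inl 0
    | .mark => .inl 1
    | .sep => .inl 2
    | .inp a => .inr (.inl a)
    | .row c => .inr (.inr c)) ?_
  intro a b h
  cases a <;> cases b <;> simp_all

variable {α Γ : Type}

/-- The effect of an elementary program on one tape. -/
def effectOne {Γ : Type} (w : Option Γ) (m : Option Dir) (t : TapeState Γ) : TapeState Γ :=
  (w.elim t.1 (Function.update t.1 t.2), t.2 + disp m)

@[simp]
theorem effectOne_none_none {Γ : Type} (t : TapeState Γ) : effectOne none none t = t := by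
  simp [effectOne, disp]

@[simp]
theorem effectOne_right {Γ : Type} (f : ℤ → Γ) (h : ℤ) :
    effectOne none (some .right) (f, h) = (f, h + 1) := rfl

@[simp]
theorem effectOne_left {Γ : Type} (f : ℤ → Γ) (h : ℤ) :
    effectOne none (some .left) (f, h) = (f, h - 1) := rfl

@[simp]
theorem effectOne_write {Γ : Type} (f : ℤ → Γ) (h : ℤ) (a : Γ) :
    effectOne (some a) none (f, h) = (Function.update f h a, h) := by
  simp [effectOne, disp]

@[simp]
theorem effectOne_write_right {Γ : Type} (f : ℤ → Γ) (h : ℤ) (a : Γ) :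
    effectOne (some a) (some .right) (f, h) = (Function.update f h a, h + 1) := rfl

@[simp]
theorem effectOne_write_left {Γ : Type} (f : ℤ → Γ) (h : ℤ) (a : Γ) :
    effectOne (some a) (some .left) (f, h) = (Function.update f h a, h - 1) := rfl

theorem effect_vec {Γ : Type} (w₀ w₁ w₂ w₃ w₄ w₅ w₆ w₇ w₈ : Option Γ)
    (m₀ m₁ m₂ m₃ m₄ m₅ m₆ m₇ m₈ : Option Dir) (t₀ t₁ t₂ t₃ t₄ t₅ t₆ t₇ t₈ : TapeState Γ) :
    effect ![w₀, w₁, w₂, w₃, w₄, w₅, w₆, w₇, w₈] ![m₀, m₁, m₂, m₃, m₄, m₅, m₆, m₇, m₈]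
      ![t₀, t₁, t₂, t₃, t₄, t₅, t₆, t₇, t₈] =
    ![effectOne w₀ m₀ t₀, effectOne w₁ m₁ t₁, effectOne w₂ m₂ t₂, effectOne w₃ m₃ t₃,
      effectOne w₄ m₄ t₄, effectOne w₅ m₅ t₅, effectOne w₆ m₆ t₆, effectOne w₇ m₇ t₇,
      effectOne w₈ m₈ t₈] := by
  funext j
  fin_cases j <;> rfl

theorem effect_move_update {Γ : Type} {n : ℕ} (s : Fin n → TapeState Γ) (j : Fin n) (f : ℤ → Γ)
    (h : ℤ) (d : Dir) :
    effect (fun _ => none) (fun i => if i = j then some d else none)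
      (Function.update s j (f, h)) = Function.update s j (f, h + disp (some d)) := by
  funext i
  rcases eq_or_ne i j with rfl | hij
  · simp [effect]
  · simp [effect, hij, disp]

/-- A tape with `v` marks. -/
def marks (v : ℕ) : ℤ → Cell α Γ := fun i => if 0 ≤ i ∧ i < v then .mark else .blank

theorem marks_of_lt {v i : ℕ} (h : i < v) : (marks v (i : ℤ) : Cell α Γ) = .mark := by
  simp [marks, h]

theorem marks_of_le {v : ℕ} {i : ℤ} (h : v ≤ i) : (marks v i : Cell α Γ) = .blank := by
  simp only [marks]
  rw [if_neg]
  omega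

theorem marks_neg_one {v : ℕ} : (marks v (-1) : Cell α Γ) = .blank := by
  simp [marks]

theorem update_marks_blank (v : ℕ) :
    Function.update (marks (v + 1) : ℤ → Cell α Γ) (v : ℤ) .blank = marks v := by
  funext i
  rcases eq_or_ne i (v : ℤ) with rfl | h
  · simp [marks]
  · rw [Function.update_of_ne h]
    simp only [marks]
    congr 1
    apply propext
    push_cast
    omega

theorem update_marks_mark (v : ℕ) :
    Function.update (marks v : ℤ → Cell α Γ) (v : ℤ) .mark = marks (v + 1) := by
  funext i
  rcases eq_or_ne i (v : ℤ) with rfl | h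
  · simp [marks]
  · rw [Function.update_of_ne h]
    simp only [marks]
    congr 1
    apply propext
    push_cast
    omega

theorem content_nil : (content [] : ℤ → Cell α Γ) = marks 0 := by
  funext i
  simp only [content, marks, List.getD_nil, ite_self, cell_default]
  rw [if_neg]
  omega

theorem Det.one {ι Γ : Type} (s : ι → TapeState Γ) : Det (1 : Language (Action ι Γ)) s 0 s := by
  refine ⟨⟨0, run_one.2 ⟨rfl, rfl⟩⟩, fun t s₁ h => (run_one.1 h).2, ?_⟩
  rintro σ τ s' h -
  have := congrArg List.length ((Language.mem_one _).1 h)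
  simp at this
  simp [this.1]

theorem Det.loop_op {ι Γ : Type} {s' : ι → TapeState Γ} {g g' : (ι → Γ) → Prop}
    {wr wr' : ι → Option Γ} {mv mv' : ι → Option Dir} {m : ℕ} (st : ℕ → ι → TapeState Γ)
    (hbody : ∀ i < m, g (scan (st i)) ∧ effect wr mv (st i) = st (i + 1))
    (hcont : ∀ i < m, ¬ g' (scan (st i))) (hdone : ¬ g (scan (st m)))
    (hexit : g' (scan (st m))) (hs : effect wr' mv' (st m) = s') :
    Det ((TapeProgram.op g wr mv)∗ * TapeProgram.op g' wr' mv') (st 0) (m + 1) s' := by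
  have := Det.loop (P := 1) (T := 1) st
    (fun i hi => by simpa using (Det.op (hbody i hi).1 (hbody i hi).2)) hcont hdone hexit hs
  simpa using this

section Clock

/-- Programs for the nine tapes: `0` input, `1 2 3` rows, `4` clock, `5` auxiliary tape of the
clock, `6 7 8` loop counters. -/
abbrev Prog (α Γ : Type) := Language (Action (Fin 9) (Cell α Γ))

/-- Executing `body` once for every mark on tape `j`. -/
def forMarks (j : Fin 9) (body : Prog α Γ) : Prog α Γ :=
  (op (fun r => r j = .mark) (fun _ => none) (fun i => if i = j then some .right else none)
      * body)∗
    * op (fun r => r j = .blank) (fun _ => none) (fun i => if i = j then some .left else none)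
    * ((op (fun r => r j = .mark) (fun _ => none) (fun i => if i = j then some .left else none))∗
    * op (fun r => r j = .blank) (fun _ => none) (fun i => if i = j then some .right else none))

/-- `base i` is the state after `i` rounds, tape `j` aside. The head of tape `j` stands elsewhere in
each round, so the body has to work for every position `p`. Its final return to `0` makes the
counter reusable in nested loops. -/
theorem forMarks_det {j : Fin 9} {body : Prog α Γ} {N T : ℕ}
    (base : ℕ → Fin 9 → TapeState (Cell α Γ))
    (hbody : ∀ i < N, ∀ p, Det body (Function.update (base i) j (marks N, p)) T
      (Function.update (base (i + 1)) j (marks N, p))) :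
    Det (forMarks j body) (Function.update (base 0) j (marks N, 0)) (N * (1 + T) + 1 + (N + 1))
      (Function.update (base N) j (marks N, 0)) := by
  have hscan : ∀ (s : Fin 9 → TapeState (Cell α Γ)) (p : ℤ),
      scan (Function.update s j (marks N, p)) j = marks N p := by
    intro s p
    simp [scan]
  refine Det.mul (s₁ := Function.update (base N) j (marks N, (N : ℤ) - 1)) ?_ ?_
  · refine Det.loop (fun i => Function.update (base i) j (marks N, (i : ℤ))) ?_ ?_ ?_ ?_ ?_
    · intro i hi
      refine Det.mul (Det.op ?_ (effect_move_update _ _ _ _ _)) ?_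
      · rw [hscan]
        exact marks_of_lt hi
      · have := hbody i hi ((i : ℤ) + disp (some .right))
        simpa [disp] using this
    · intro i hi
      rw [hscan, marks_of_lt hi]
      simp
    · rw [hscan, marks_of_le le_rfl]
      simp
    · rw [hscan, marks_of_le le_rfl]
    · exact effect_move_update _ _ _ _ _
  · have key := Det.loop_op (m := N) (s' := Function.update (base N) j (marks N, 0))
      (g := fun r : Fin 9 → Cell α Γ => r j = .mark) (g' := fun r => r j = .blank)
      (wr := fun _ => none) (wr' := fun _ => none)
      (mv := fun i => if i = j then some .left else none)
      (mv' := fun i => if i = j then some .right else none)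
      (fun i => Function.update (base N) j (marks N, (N : ℤ) - 1 - i)) ?_ ?_ ?_ ?_ ?_
    · simpa using key
    · intro i hi
      constructor
      · rw [hscan]
        have : (N : ℤ) - 1 - i = ((N - 1 - i : ℕ) : ℤ) := by omega
        rw [this]
        exact marks_of_lt (by omega)
      · rw [effect_move_update]
        congr 2
        simp only [disp]
        push_cast
        ring
    · intro i hi
      rw [hscan]
      have : (N : ℤ) - 1 - i = ((N - 1 - i : ℕ) : ℤ) := by omega
      rw [this, marks_of_lt (by omega)]
      simp
    · rw [hscan]
      have : (N : ℤ) - 1 - N = -1 := by ring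
      rw [this, marks_neg_one]
      simp
    · rw [hscan]
      have : (N : ℤ) - 1 - N = -1 := by ring
      rw [this, marks_neg_one]
    · rw [effect_move_update]
      congr 2
      simp [disp]

/-- The states of the clock under construction. -/
def clockState (X : TapeState (Cell α Γ)) (B C : TapeState (Cell α Γ))
    (y₁ y₂ y₃ : TapeState (Cell α Γ)) : Fin 9 → TapeState (Cell α Γ) :=
  ![X, (marks 0, 0), (marks 0, 0), (marks 0, 0), B, C, y₁, y₂, y₃]

/-- Multiplying the number of marks on tape `4` by `k + 1`. -/
def multiply (k : ℕ) : Prog α Γ :=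
  (op (fun r => r 4 = .mark)
      ![none, none, none, none, some .blank, some .mark, none, none, none]
      ![none, none, none, none, some .left, some .right, none, none, none]
    * (op (fun _ => True) ![none, none, none, none, none, some .mark, none, none, none]
      ![none, none, none, none, none, some .right, none, none, none]) ^ k)∗
    * op (fun r => r 4 = .blank) ![none, none, none, none, none, none, none, none, none]
      ![none, none, none, none, some .right, some .left, none, none, none]
    * ((op (fun r => r 5 = .mark)
        ![none, none, none, none, some .mark, some .blank, none, none, none]
        ![none, none, none, none, some .right, some .left, none, none, none])∗
    * op (fun r => r 5 = .blank) ![none, none, none, none, none, none, none, none, none]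
      ![none, none, none, none, some .left, some .right, none, none, none])

theorem push_pow_det (X B : TapeState (Cell α Γ)) (y₁ y₂ y₃ : TapeState (Cell α Γ)) (k c : ℕ) :
    Det ((op (fun _ => True) ![none, none, none, none, none, some .mark, none, none, none]
        ![none, none, none, none, none, some .right, none, none, none]) ^ k)
      (clockState X B (marks c, c) y₁ y₂ y₃) k
      (clockState X B (marks (c + k), (c + k : ℕ)) y₁ y₂ y₃) := by
  induction k with
  | zero => simpa using Det.one _
  | succ k ih =>
    rw [pow_succ]
    refine ih.mul (Det.op trivial ?_)
    simp only [clockState]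
    rw [effect_vec]
    simp [add_assoc]
    have : ((c : ℤ) + k) = ((c + k : ℕ) : ℤ) := by push_cast; ring
    rw [this, update_marks_mark, add_assoc]

/-- The first loop exchanges each mark of tape 4 for `k + 1` marks on tape 5, and the second loop
moves all marks back. The head rests on the last mark, at `v - 1`, so marks are removed while moving
left. -/
theorem multiply_det (X y₁ y₂ y₃ : TapeState (Cell α Γ)) (k v : ℕ) :
    Det (multiply k) (clockState X (marks v, (v : ℤ) - 1) (marks 0, 0) y₁ y₂ y₃)
      (v * (1 + k) + 1 + ((k + 1) * v + 1))
      (clockState X (marks ((k + 1) * v), (((k + 1) * v : ℕ) : ℤ) - 1) (marks 0, 0) y₁ y₂ y₃) := by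
  refine Det.mul (s₁ := clockState X (marks 0, 0)
    (marks ((k + 1) * v), (((k + 1) * v : ℕ) : ℤ) - 1) y₁ y₂ y₃) ?_ ?_
  · have key := Det.loop (T := 1 + k) (m := v)
      (P := (op (fun _ => True) ![none, none, none, none, none, some .mark, none, none, none]
        ![none, none, none, none, none, some .right, none, none, none]) ^ k)
      (g := fun r : Fin 9 → Cell α Γ => r 4 = .mark) (g' := fun r => r 4 = .blank)
      (wr := ![none, none, none, none, some .blank, some .mark, none, none, none])
      (mv := ![none, none, none, none, some .left, some .right, none, none, none])
      (wr' := ![none, none, none, none, none, none, none, none, none])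
      (mv' := ![none, none, none, none, some .right, some .left, none, none, none])
      (s' := clockState X (marks 0, 0) (marks ((k + 1) * v), (((k + 1) * v : ℕ) : ℤ) - 1) y₁ y₂ y₃)
      (fun i => clockState X (marks (v - i), (v : ℤ) - 1 - i)
        (marks ((k + 1) * i), ((k + 1) * i : ℕ)) y₁ y₂ y₃) ?_ ?_ ?_ ?_ ?_
    · simpa using key
    · intro i hi
      obtain ⟨u, hu⟩ : ∃ u, v - i = u + 1 := ⟨v - i - 1, by omega⟩
      have h1 : (v : ℤ) - 1 - i = u := by omega
      have h2 : v - (i + 1) = u := by omega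
      have h3 : (k + 1) * (i + 1) = (k + 1) * i + 1 + k := by ring
      refine Det.mul (s₁ := clockState X (marks u, (u : ℤ) - 1)
        (marks ((k + 1) * i + 1), ((k + 1) * i + 1 : ℕ)) y₁ y₂ y₃) (Det.op ?_ ?_) ?_
      · change marks (v - i) ((v : ℤ) - 1 - i) = _
        rw [h1, hu]
        exact marks_of_lt (by omega)
      · simp only [clockState]
        rw [effect_vec, h1, hu]
        simp only [effectOne_none_none, effectOne_write_left, effectOne_write_right,
          update_marks_blank, update_marks_mark]
        push_cast
        rfl
      · have := push_pow_det X (marks u, (u : ℤ) - 1) y₁ y₂ y₃ k ((k + 1) * i + 1)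
        rw [h2, h3]
        have e : (v : ℤ) - 1 - ((i + 1 : ℕ) : ℤ) = (u : ℤ) - 1 := by omega
        rw [e]
        exact this
    · intro i hi
      change ¬ marks (v - i) ((v : ℤ) - 1 - i) = _
      have h1 : (v : ℤ) - 1 - i = ((v - i - 1 : ℕ) : ℤ) := by omega
      rw [h1, marks_of_lt (by omega)]
      simp
    · change ¬ marks (v - v) ((v : ℤ) - 1 - v) = _
      have h1 : (v : ℤ) - 1 - v = -1 := by omega
      rw [h1, marks_neg_one]
      simp
    · change marks (v - v) ((v : ℤ) - 1 - v) = _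
      have h1 : (v : ℤ) - 1 - v = -1 := by omega
      rw [h1, marks_neg_one]
    · simp only [clockState]
      rw [effect_vec]
      simp
  · have key := Det.loop_op (m := (k + 1) * v)
      (g := fun r : Fin 9 → Cell α Γ => r 5 = .mark) (g' := fun r => r 5 = .blank)
      (wr := ![none, none, none, none, some .mark, some .blank, none, none, none])
      (mv := ![none, none, none, none, some .right, some .left, none, none, none])
      (wr' := ![none, none, none, none, none, none, none, none, none])
      (mv' := ![none, none, none, none, some .left, some .right, none, none, none])
      (s' := clockState X (marks ((k + 1) * v), (((k + 1) * v : ℕ) : ℤ) - 1) (marks 0, 0) y₁ y₂ y₃)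
      (fun i => clockState X (marks i, i)
        (marks ((k + 1) * v - i), (((k + 1) * v : ℕ) : ℤ) - 1 - i) y₁ y₂ y₃) ?_ ?_ ?_ ?_ ?_
    · simpa using key
    all_goals generalize (k + 1) * v = u
    · intro i hi
      obtain ⟨z, hz⟩ : ∃ z, u - i = z + 1 := ⟨u - i - 1, by omega⟩
      have h1 : (u : ℤ) - 1 - i = z := by omega
      have h2 : u - (i + 1) = z := by omega
      constructor
      · change marks (u - i) ((u : ℤ) - 1 - i) = _
        rw [h1, hz]
        exact marks_of_lt (by omega)
      · simp only [clockState]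
        rw [effect_vec, h1, h2, hz]
        simp only [effectOne_none_none, effectOne_write_left, effectOne_write_right,
          update_marks_blank, update_marks_mark]
        have : (z : ℤ) - 1 = (u : ℤ) - 1 - (i + 1 : ℕ) := by push_cast; omega
        rw [this]
        push_cast
        rfl
    · intro i hi
      change ¬ marks (u - i) ((u : ℤ) - 1 - i) = _
      have h1 : (u : ℤ) - 1 - i = ((u - i - 1 : ℕ) : ℤ) := by omega
      rw [h1, marks_of_lt (by omega)]
      simp
    · change ¬ marks (u - u) ((u : ℤ) - 1 - u) = _
      have h1 : (u : ℤ) - 1 - u = -1 := by omega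
      rw [h1, marks_neg_one]
      simp
    · change marks (u - u) ((u : ℤ) - 1 - u) = _
      have h1 : (u : ℤ) - 1 - u = -1 := by omega
      rw [h1, marks_neg_one]
    · simp only [clockState]
      rw [effect_vec]
      simp

/-- Copying the length of the input in unary to the loop counters. -/
def copyLength : Prog α Γ :=
  (op (fun r => ∃ a, r 0 = .inp a)
      ![none, none, none, none, none, none, some .mark, some .mark, some .mark]
      ![some .right, none, none, none, none, none, some .right, some .right, some .right])∗
    * op (fun r => r 0 = .blank) ![none, none, none, none, none, none, none, none, none]
      ![some .left, none, none, none, none, none, some .left, some .left, some .left]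
    * ((op (fun r => ∃ a, r 0 = .inp a) ![none, none, none, none, none, none, none, none, none]
        ![some .left, none, none, none, none, none, some .left, some .left, some .left])∗
    * op (fun r => r 0 = .blank) ![none, none, none, none, some .mark, none, none, none, none]
      ![none, none, none, none, none, none, some .right, some .right, some .right])

theorem content_of_lt {Γ : Type} [Inhabited Γ] {l : List Γ} {i : ℕ} (h : i < l.length) :
    content l (i : ℤ) = l[i] := by
  simp [content, h]

theorem content_of_le {Γ : Type} [Inhabited Γ] {l : List Γ} {i : ℤ} (h : l.length ≤ i) :
    content l i = default := by
  obtain ⟨n, rfl⟩ := Int.eq_ofNat_of_zero_le (a := i) (by omega)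
  simp only [content]
  rw [if_pos (by omega), List.getD_eq_default]
  simpa using h

theorem content_of_neg {Γ : Type} [Inhabited Γ] {l : List Γ} {i : ℤ} (h : i < 0) :
    content l i = default := by
  simp only [content]
  rw [if_neg (by omega)]

theorem content_input_of_lt {x : List α} {i : ℕ} (h : i < x.length) :
    ∃ a, content (x.map (Cell.inp (Γ := Γ))) (i : ℤ) = .inp a := by
  rw [content_of_lt (by simpa using h)]
  exact ⟨x[i], by simp⟩

/-- The first pass puts one mark on each loop counter per letter. The second pass goes back and
leaves a single mark on the clock, the value `(k + 1) ^ 0`. The input head stays at `-1`, which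
later corresponds to the row heads standing on separators. -/
theorem copyLength_det (x : List α) :
    Det (copyLength (Γ := Γ)) (initState 0 Cell.inp x) (x.length + 1 + (x.length + 1))
      (clockState (content (x.map .inp), -1) (marks 1, 0) (marks 0, 0)
        (marks x.length, 0) (marks x.length, 0) (marks x.length, 0)) := by
  have hinit : initState 0 (Cell.inp (Γ := Γ)) x = clockState (content (x.map .inp), 0)
      (marks 0, 0) (marks 0, 0) (marks 0, 0) (marks 0, 0) (marks 0, 0) := by
    funext j
    simp only [← content_nil]
    fin_cases j <;> simp [initState, clockState, ← content_nil]
  rw [hinit]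
  set N := x.length with hN
  refine Det.mul (s₁ := clockState (content (x.map .inp), (N : ℤ) - 1) (marks 0, 0) (marks 0, 0)
    (marks N, (N : ℤ) - 1) (marks N, (N : ℤ) - 1) (marks N, (N : ℤ) - 1)) ?_ ?_
  · have key := Det.loop_op (m := N)
      (g := fun r : Fin 9 → Cell α Γ => ∃ a, r 0 = .inp a) (g' := fun r => r 0 = .blank)
      (wr := ![none, none, none, none, none, none, some .mark, some .mark, some .mark])
      (mv := ![some .right, none, none, none, none, none, some .right, some .right, some .right])
      (wr' := ![none, none, none, none, none, none, none, none, none])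
      (mv' := ![some .left, none, none, none, none, none, some .left, some .left, some .left])
      (s' := clockState (content (x.map .inp), (N : ℤ) - 1) (marks 0, 0) (marks 0, 0)
        (marks N, (N : ℤ) - 1) (marks N, (N : ℤ) - 1) (marks N, (N : ℤ) - 1))
      (fun i => clockState (content (x.map .inp), i) (marks 0, 0) (marks 0, 0)
        (marks i, i) (marks i, i) (marks i, i)) ?_ ?_ ?_ ?_ ?_
    · simpa using key
    · intro i hi
      refine ⟨content_input_of_lt hi, ?_⟩
      simp only [clockState]
      rw [effect_vec]
      simp [update_marks_mark]
    · intro i hi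
      obtain ⟨a, ha⟩ := content_input_of_lt (Γ := Γ) hi
      change ¬ content (x.map Cell.inp) (i : ℤ) = Cell.blank
      rw [ha]
      simp
    · rintro ⟨a, ha⟩
      change content (x.map Cell.inp) (N : ℤ) = Cell.inp a at ha
      rw [content_of_le (by simp [hN])] at ha
      cases ha
    · exact content_of_le (l := x.map Cell.inp) (i := (N : ℤ)) (by simp [hN])
    · simp only [clockState]
      rw [effect_vec]
      simp
  · have key := Det.loop_op (m := N)
      (g := fun r : Fin 9 → Cell α Γ => ∃ a, r 0 = .inp a) (g' := fun r => r 0 = .blank)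
      (wr := ![none, none, none, none, none, none, none, none, none])
      (mv := ![some .left, none, none, none, none, none, some .left, some .left, some .left])
      (wr' := ![none, none, none, none, some .mark, none, none, none, none])
      (mv' := ![none, none, none, none, none, none, some .right, some .right, some .right])
      (s' := clockState (content (x.map .inp), -1) (marks 1, 0) (marks 0, 0)
        (marks N, 0) (marks N, 0) (marks N, 0))
      (fun i => clockState (content (x.map .inp), (N : ℤ) - 1 - i) (marks 0, 0) (marks 0, 0)
        (marks N, (N : ℤ) - 1 - i) (marks N, (N : ℤ) - 1 - i) (marks N, (N : ℤ) - 1 - i))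
        ?_ ?_ ?_ ?_ ?_
    · simpa using key
    · intro i hi
      have h1 : (N : ℤ) - 1 - i = ((N - 1 - i : ℕ) : ℤ) := by omega
      have h2 : (N : ℤ) - 1 - (i + 1 : ℕ) = (N : ℤ) - 1 - i - 1 := by push_cast; ring
      constructor
      · change ∃ a, content _ _ = _
        rw [h1]
        exact content_input_of_lt (by omega)
      · simp only [clockState]
        rw [effect_vec, h2]
        simp
    · intro i hi
      have h1 : (N : ℤ) - 1 - i = ((N - 1 - i : ℕ) : ℤ) := by omega
      obtain ⟨a, ha⟩ := content_input_of_lt (Γ := Γ) (x := x) (i := N - 1 - i) (by omega)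
      change ¬ content (x.map Cell.inp) ((N : ℤ) - 1 - i) = Cell.blank
      rw [h1, ha]
      simp
    · rintro ⟨a, ha⟩
      change content (x.map Cell.inp) ((N : ℤ) - 1 - N) = Cell.inp a at ha
      rw [content_of_neg (by omega)] at ha
      cases ha
    · exact content_of_neg (l := x.map Cell.inp) (i := (N : ℤ) - 1 - N) (by omega)
    · have := update_marks_mark (α := α) (Γ := Γ) 0
      simp only [clockState]
      rw [effect_vec]
      simp only [effectOne_none_none, effectOne_write, effectOne_right]
      rw [Nat.cast_zero, zero_add] at this
      rw [this]
      simp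

/-- The construction of the clock. -/
def buildClock (k : ℕ) : Prog α Γ :=
  copyLength * forMarks 6 (forMarks 7 (forMarks 8 (multiply k)))

/-- The time for a loop over `N` marks whose body needs time `T`. -/
def loopTime (N T : ℕ) : ℕ := N * (1 + T) + 1 + (N + 1)

/-- A bound for the time that the construction of the clock takes. -/
def buildTime (k N : ℕ) : ℕ :=
  N + 1 + (N + 1) + loopTime N (loopTime N (loopTime N (2 * (k + 1) ^ N ^ 3 + 2)))

theorem buildClock_det (k : ℕ) (x : List α) :
    Det (buildClock (Γ := Γ) k) (initState 0 Cell.inp x) (buildTime k x.length)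
      (clockState (content (x.map .inp), -1)
        (marks ((k + 1) ^ x.length ^ 3), (((k + 1) ^ x.length ^ 3 : ℕ) : ℤ) - 1) (marks 0, 0)
        (marks x.length, 0) (marks x.length, 0) (marks x.length, 0)) := by
  refine (copyLength_det x).mul ?_
  set N := x.length with hN
  set X : TapeState (Cell α Γ) := (content (x.map .inp), -1) with hX
  -- `e` counts the multiplications done so far. Since the clock only grows, all rounds get the time
  -- bound of the last one.
  have hb : ∀ e p q r, e < N ^ 3 →
      Det (multiply k) (clockState X (marks ((k + 1) ^ e), (((k + 1) ^ e : ℕ) : ℤ) - 1)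
        (marks 0, 0) (marks N, p) (marks N, q) (marks N, r)) (2 * (k + 1) ^ N ^ 3 + 2)
      (clockState X (marks ((k + 1) ^ (e + 1)), (((k + 1) ^ (e + 1) : ℕ) : ℤ) - 1)
        (marks 0, 0) (marks N, p) (marks N, q) (marks N, r)) := by
    intro e p q r he
    have h1 := multiply_det X (marks N, p) (marks N, q) (marks N, r) k ((k + 1) ^ e)
    have h2 : (k + 1) * (k + 1) ^ e = (k + 1) ^ (e + 1) := by ring
    rw [h2] at h1
    refine h1.mono ?_
    have h3 : (k + 1) ^ (e + 1) ≤ (k + 1) ^ N ^ 3 := Nat.pow_le_pow_right (by omega) he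
    have h4 : (k + 1) ^ e * (1 + k) = (k + 1) ^ (e + 1) := by ring
    omega
  have h8 : ∀ e p q, e + N ≤ N ^ 3 →
      Det (forMarks 8 (multiply k))
        (clockState X (marks ((k + 1) ^ e), (((k + 1) ^ e : ℕ) : ℤ) - 1)
          (marks 0, 0) (marks N, p) (marks N, q) (marks N, 0))
        (loopTime N (2 * (k + 1) ^ N ^ 3 + 2))
        (clockState X (marks ((k + 1) ^ (e + N)), (((k + 1) ^ (e + N) : ℕ) : ℤ) - 1)
          (marks 0, 0) (marks N, p) (marks N, q) (marks N, 0)) := by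
    intro e p q he
    have hu : ∀ i r, Function.update (clockState X
        (marks ((k + 1) ^ (e + i)), (((k + 1) ^ (e + i) : ℕ) : ℤ) - 1)
        (marks 0, 0) (marks N, p) (marks N, q) (marks N, 0)) 8 (marks N, r) = clockState X
        (marks ((k + 1) ^ (e + i)), (((k + 1) ^ (e + i) : ℕ) : ℤ) - 1)
        (marks 0, 0) (marks N, p) (marks N, q) (marks N, r) := by
      intro i r
      funext j
      fin_cases j <;> rfl
    have := forMarks_det (j := 8) (body := multiply k) (N := N) (T := 2 * (k + 1) ^ N ^ 3 + 2)
      (fun i => clockState X (marks ((k + 1) ^ (e + i)), (((k + 1) ^ (e + i) : ℕ) : ℤ) - 1)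
          (marks 0, 0) (marks N, p) (marks N, q) (marks N, 0)) ?_
    · simp only [hu] at this
      exact this
    · intro i hi r
      simp only [hu]
      exact hb (e + i) p q r (by omega)
  have h7 : ∀ e p, e + N * N ≤ N ^ 3 →
      Det (forMarks 7 (forMarks 8 (multiply k)))
        (clockState X (marks ((k + 1) ^ e), (((k + 1) ^ e : ℕ) : ℤ) - 1)
          (marks 0, 0) (marks N, p) (marks N, 0) (marks N, 0))
        (loopTime N (loopTime N (2 * (k + 1) ^ N ^ 3 + 2)))
        (clockState X (marks ((k + 1) ^ (e + N * N)), (((k + 1) ^ (e + N * N) : ℕ) : ℤ) - 1)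
          (marks 0, 0) (marks N, p) (marks N, 0) (marks N, 0)) := by
    intro e p he
    have hu : ∀ i q, Function.update (clockState X
        (marks ((k + 1) ^ (e + i * N)), (((k + 1) ^ (e + i * N) : ℕ) : ℤ) - 1)
        (marks 0, 0) (marks N, p) (marks N, 0) (marks N, 0)) 7 (marks N, q) = clockState X
        (marks ((k + 1) ^ (e + i * N)), (((k + 1) ^ (e + i * N) : ℕ) : ℤ) - 1)
        (marks 0, 0) (marks N, p) (marks N, q) (marks N, 0) := by
      intro i q
      funext j
      fin_cases j <;> rfl
    have := forMarks_det (j := 7) (body := forMarks 8 (multiply k)) (N := N)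
      (T := loopTime N (2 * (k + 1) ^ N ^ 3 + 2))
      (fun i => clockState X (marks ((k + 1) ^ (e + i * N)),
        (((k + 1) ^ (e + i * N) : ℕ) : ℤ) - 1)
          (marks 0, 0) (marks N, p) (marks N, 0) (marks N, 0)) ?_
    · simp only [hu] at this
      simp only [zero_mul, add_zero] at this
      exact this
    · intro i hi q
      simp only [hu]
      have h1 : (i + 1) * N ≤ N * N := Nat.mul_le_mul_right _ hi
      rw [Nat.succ_mul] at h1
      have h2 : e + (i + 1) * N = e + i * N + N := by rw [Nat.succ_mul]; omega
      rw [h2]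
      exact h8 (e + i * N) p q (by omega)
  have hN3 : N * (N * N) = N ^ 3 := by ring
  have hu : ∀ i p, Function.update (clockState X
      (marks ((k + 1) ^ (i * (N * N))), (((k + 1) ^ (i * (N * N)) : ℕ) : ℤ) - 1)
      (marks 0, 0) (marks N, 0) (marks N, 0) (marks N, 0)) 6 (marks N, p) = clockState X
      (marks ((k + 1) ^ (i * (N * N))), (((k + 1) ^ (i * (N * N)) : ℕ) : ℤ) - 1)
      (marks 0, 0) (marks N, p) (marks N, 0) (marks N, 0) := by
    intro i q
    funext j
    fin_cases j <;> rfl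
  have := forMarks_det (j := 6) (body := forMarks 7 (forMarks 8 (multiply k))) (N := N)
    (T := loopTime N (loopTime N (2 * (k + 1) ^ N ^ 3 + 2)))
    (fun i => clockState X (marks ((k + 1) ^ (i * (N * N))),
      (((k + 1) ^ (i * (N * N)) : ℕ) : ℤ) - 1)
        (marks 0, 0) (marks N, 0) (marks N, 0) (marks N, 0)) ?_
  · simp only [hu] at this
    simp only [zero_mul, hN3, pow_zero, Nat.cast_one, sub_self] at this
    exact this
  · intro i hi q
    simp only [hu]
    have h1 : (i + 1) * (N * N) ≤ N * (N * N) := Nat.mul_le_mul_right _ hi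
    rw [Nat.succ_mul, hN3] at h1
    have h2 : (i + 1) * (N * N) = i * (N * N) + N * N := by rw [Nat.succ_mul]
    rw [h2]
    exact h7 (i * (N * N)) q (by omega)

theorem forMarks_isRegular {j : Fin 9} {body : Prog α Γ} (h : body.IsRegular) :
    (forMarks j body).IsRegular :=
  ((((op_isRegular _ _ _).mul h).kstar).mul (op_isRegular _ _ _)).mul
    ((op_isRegular _ _ _).kstar.mul (op_isRegular _ _ _))

theorem buildClock_isRegular (k : ℕ) : (buildClock k : Prog α Γ).IsRegular := by
  have h1 : (multiply k : Prog α Γ).IsRegular :=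
    ((((op_isRegular _ _ _).mul ((op_isRegular _ _ _).pow k)).kstar).mul
      (op_isRegular _ _ _)).mul ((op_isRegular _ _ _).kstar.mul (op_isRegular _ _ _))
  have h2 : (copyLength : Prog α Γ).IsRegular :=
    ((op_isRegular _ _ _).kstar.mul (op_isRegular _ _ _)).mul
      ((op_isRegular _ _ _).kstar.mul (op_isRegular _ _ _))
  exact h2.mul (forMarks_isRegular (forMarks_isRegular (forMarks_isRegular h1)))

theorem loopTime_le {N T : ℕ} (hT : 1 ≤ T) : loopTime N T ≤ (4 * N + 2) * T := by
  unfold loopTime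
  nlinarith [Nat.mul_le_mul_left N hT]

/-- Each level of nesting costs a factor of at most `4 * N + 2 ≤ 2 ^ (4 * N + 2)`, and there are
three. The value of the clock is added because it bounds the time of everything after its
construction. -/
theorem buildTime_le (k N : ℕ) :
    buildTime k N + (k + 1) ^ N ^ 3 ≤ 2 ^ ((k + 1) * N ^ 3 + 3 * (4 * N + 2) + N + 5) := by
  set V := (k + 1) ^ N ^ 3 with hV
  have hV1 : 1 ≤ V := Nat.one_le_pow _ _ (by omega)
  have hT1 : ∀ T, 1 ≤ loopTime N T := fun T => by unfold loopTime; omega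
  have h1 : loopTime N (2 * V + 2) ≤ (4 * N + 2) * (2 * V + 2) := loopTime_le (by omega)
  have h2 := loopTime_le (N := N) (hT1 (2 * V + 2))
  have h3 := loopTime_le (N := N) (hT1 (loopTime N (2 * V + 2)))
  have h4 : loopTime N (loopTime N (loopTime N (2 * V + 2))) ≤
      (4 * N + 2) * ((4 * N + 2) * ((4 * N + 2) * (2 * V + 2))) :=
    h3.trans (Nat.mul_le_mul_left _ (h2.trans (Nat.mul_le_mul_left _ h1)))
  have h5 : 4 * N + 2 ≤ 2 ^ (4 * N + 2) := Nat.lt_two_pow_self.le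
  have h6 : (4 * N + 2) * ((4 * N + 2) * ((4 * N + 2) * (2 * V + 2))) ≤
      2 ^ (4 * N + 2) * (2 ^ (4 * N + 2) * (2 ^ (4 * N + 2) * (4 * V))) := by
    gcongr
    omega
  have hVp : V ≤ 2 ^ ((k + 1) * N ^ 3) := by
    rw [hV, pow_mul]
    exact Nat.pow_le_pow_left Nat.lt_two_pow_self.le _
  have hN : N + 1 ≤ 2 ^ N := Nat.lt_two_pow_self
  set A := 2 ^ (4 * N + 2) with hA
  have hA1 : 1 ≤ A := Nat.one_le_two_pow
  have h7 : buildTime k N + V ≤ A * (A * (A * (4 * V))) + 2 * (N + 1) + V := by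
    unfold buildTime
    rw [← hV]
    omega
  have hA3 : 1 ≤ A * A * A := Nat.one_le_iff_ne_zero.2 (by positivity)
  have h8 : A * (A * (A * (4 * V))) + 2 * (N + 1) + V ≤ (A * A * A) * V * (N + 1) * 7 := by
    have e1 : 1 ≤ A * A * A * V := Nat.one_le_iff_ne_zero.2 (by positivity)
    have e2 : V ≤ A * A * A * V := Nat.le_mul_of_pos_left _ (by omega)
    have e3 : A * (A * (A * (4 * V))) = 4 * (A * A * A * V) := by ring
    rw [e3]
    generalize A * A * A * V = z at *
    nlinarith
  have h9 : (A * A * A) * V * (N + 1) * 7 ≤ (A * A * A) * 2 ^ ((k + 1) * N ^ 3) * 2 ^ N * 2 ^ 5 := by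
    gcongr
    norm_num
  refine h7.trans (h8.trans (h9.trans_eq ?_))
  rw [hA]
  ring

end Clock

end TapeProgram

/-! ## Verification of a guessed list of rows -/

namespace TapeProgram

open Turing Computability

section Rules

variable {ι Γ : Type} {P P' : Language (Action ι Γ)}

theorem run_kstar_induction {Inv : (ι → TapeState Γ) → Prop}
    (hstep : ∀ s t s', Inv s → Run P s t s' → Inv s') {s s' : ι → TapeState Γ} {t : ℕ}
    (h : Run P∗ s t s') (hs : Inv s) : Inv s' := by
  obtain ⟨σ, ⟨S, rfl, hS⟩, -, hex⟩ := h
  induction S generalizing s with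
  | nil =>
    cases hex
    exact hs
  | cons w S ih =>
    rw [List.flatten_cons] at hex
    obtain ⟨s₁, h₁, h₂⟩ := exec_append.1 hex
    exact ih (hstep s _ s₁ hs ⟨w, hS w (by simp), rfl, h₁⟩)
      (fun y hy => hS y (by simp [hy])) h₂

theorem run_kstar_zero (s : ι → TapeState Γ) : Run P∗ s 0 s :=
  ⟨[], Language.nil_mem_kstar _, rfl, rfl⟩

theorem run_kstar_snoc {s s₁ s' : ι → TapeState Γ} {t t' : ℕ} (h : Run P∗ s t s₁)
    (h' : Run P s₁ t' s') : Run P∗ s (t + t') s' := by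
  rw [← Language.one_add_kstar_mul_self_eq_kstar]
  exact run_add.2 (.inr (run_mul.2 ⟨_, _, _, rfl, h, h'⟩))

end Rules

variable {α Γ : Type}

/-- A column of the input word and three rows. -/
abbrev Col (α Γ : Type) := Option α × Γ × Γ × Γ

/-- `w` is the list of the columns of `x` and the rows `r₁`, `r₂`, `r₃`. -/
def Columns (x : List α) (r₁ r₂ r₃ : List Γ) (w : List (Col α Γ)) : Prop :=
  (∃ j, w.map (fun c => c.1) = x.map some ++ List.replicate j none) ∧
    w.map (fun c => c.2.1) = r₁ ∧ w.map (fun c => c.2.2.1) = r₂ ∧ w.map (fun c => c.2.2.2) = r₃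

/-- The word that represents a list of rows. -/
def rowsWord (R : List (List Γ)) : List (Cell α Γ) :=
  R.flatMap fun r => .sep :: r.map .row

/-- The position of the `a`-th row. -/
def rowPos (R : List (List Γ)) (a : ℕ) : ℕ := (rowsWord (α := α) (R.take a)).length

/-- The letter on the input tape, if there is one. -/
def letterCell : Option α → Cell α Γ
  | none => .blank
  | some a => .inp a

/-- A clocked elementary program that does not write. -/
def tick (g : (Fin 4 → Cell α Γ) → Prop) (m : Fin 4 → Option Dir) : Prog α Γ :=
  op (fun r => r 4 = .mark ∧ g ![r 0, r 1, r 2, r 3]) (fun _ => none)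
    ![m 0, m 1, m 2, m 3, some .left, none, none, none, none]

/-- A clocked elementary program that appends a symbol to each of the three row tapes. -/
def tickWrite (a : Cell α Γ) : Prog α Γ :=
  op (fun r => r 4 = .mark) ![none, some a, some a, some a, none, none, none, none, none]
    ![none, some .right, some .right, some .right, some .left, none, none, none, none]

/-- Moving head `j` only. -/
def only (j : Fin 4) (d : Dir) : Fin 4 → Option Dir := fun i => if i = j then some d else none

/-- Moving head `j` to the next row. -/
def advance (j : Fin 4) : Prog α Γ :=
  tick (fun r => r j = .sep) (only j .right)
    * ((tick (fun r => ∃ c, r j = .row c) (only j .right))∗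
    * tick (fun r => ¬ ∃ c, r j = .row c) (fun _ => none))

/-- Moving head `j` back to the first row. -/
def rewind (j : Fin 4) : Prog α Γ :=
  (tick (fun r => r j ≠ .blank) (only j .left))∗
    * tick (fun r => r j = .blank) (only j .right)

/-- The action that reads a column. -/
def ReadsCol (a : Action (Fin 9) (Cell α Γ)) (c : Col α Γ) : Prop :=
  a.1 4 = .mark ∧ a.1 0 = letterCell c.1 ∧ a.1 1 = .row c.2.1 ∧ a.1 2 = .row c.2.2.1 ∧
    a.1 3 = .row c.2.2.2 ∧
    a.2 = fun j => (a.1 j, (![some .right, some .right, some .right, some .right, some .left, none,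
      none, none, none] : Fin 9 → Option Dir) j)

/-- Reading columns that form a word of `E`. -/
def readCols (E : Language (Col α Γ)) : Prog α Γ :=
  Language.ofPred fun σ => ∃ w ∈ E, List.Forall₂ ReadsCol σ w

/-- Checking the condition `E` on the columns, with all heads back in place at the end. -/
def checkCols (E : Language (Col α Γ)) : Prog α Γ :=
  tick (fun r => r 1 = .sep ∧ r 2 = .sep ∧ r 3 = .sep) (fun _ => some .right)
    * (readCols E
    * (tick (fun r => r 0 = .blank ∧ ∀ j, j ≠ 0 → ¬ ∃ c, r j = .row c) (fun _ => some .left)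
    * ((tick (fun r => ∃ c, r 1 = .row c) (fun _ => some .left))∗
    * tick (fun r => r 1 = .sep) (fun _ => none))))

/-- Choosing the third row, checking, and going to the next second row. -/
def chooseAndCheck (E : Language (Col α Γ)) : Prog α Γ :=
  (advance 3)∗ * (checkCols E * (rewind 3 * advance 2))

/-- The loop over the second row. -/
def innerLoop (E : Language (Col α Γ)) : Prog α Γ :=
  (chooseAndCheck E)∗ * (tick (fun r => r 2 = .blank) (only 2 .left) * rewind 2)

/-- The loop over the first row. -/
def outerLoop (E : Language (Col α Γ)) : Prog α Γ :=
  (innerLoop E * advance 1)∗ * (tick (fun r => r 1 = .blank) (only 1 .left) * rewind 1)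

/-- Checking several conditions. -/
def verify : List (Language (Col α Γ)) → Prog α Γ
  | [] => 1
  | E :: cs => outerLoop E * verify cs

/-- The moves of the three row heads. -/
def rowHeads (d : Dir) : Fin 4 → Option Dir := fun i => if i = 0 then none else some d

/-- Guessing a list of rows. -/
def guess : Prog α Γ :=
  tickWrite .sep
    * ((Language.ofPred fun σ => ∃ c : Option Γ, σ ∈ tickWrite (c.elim .sep .row))∗
    * (tick (fun _ => True) (rowHeads .left)
    * ((tick (fun r => r 1 ≠ .blank) (rowHeads .left))∗
    * tick (fun r => r 1 = .blank) (rowHeads .right))))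

/-! ### Regularity and the clock -/

theorem _root_.Language.IsRegular.forall_letters {β : Type*} (p : β → Prop) :
    (Language.ofPred fun w : List β => ∀ a ∈ w, p a).IsRegular := by
  refine .of_finite_range_leftQuotient ?_
  refine Set.Finite.subset (Set.toFinite
    ({(Language.ofPred fun w : List β => ∀ a ∈ w, p a), 0} : Set (Language β))) ?_
  rintro _ ⟨x, rfl⟩
  by_cases h : ∀ a ∈ x, p a
  · left
    ext y
    rw [Language.mem_leftQuotient, Language.mem_ofPred, Language.mem_ofPred]
    constructor
    · intro h' a ha
      exact h' a (by simp [ha])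
    · intro h' a ha
      rcases List.mem_append.1 ha with ha | ha
      · exact h a ha
      · exact h' a ha
  · right
    ext y
    rw [Language.mem_leftQuotient]
    refine ⟨fun h' => h fun a ha => h' a (by simp [ha]), fun h' => h'.elim⟩

theorem letterCell_injective : Function.Injective (letterCell : Option α → Cell α Γ) := by
  intro a b h
  cases a <;> cases b <;> simp_all [letterCell]

theorem ReadsCol.unique {a : Action (Fin 9) (Cell α Γ)} {c c' : Col α Γ} (h : ReadsCol a c)
    (h' : ReadsCol a c') : c = c' := by
  obtain ⟨-, h0, h1, h2, h3, -⟩ := h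
  obtain ⟨-, h0', h1', h2', h3', -⟩ := h'
  have e0 := letterCell_injective (h0.symm.trans h0')
  have e1 := Cell.row.inj (h1.symm.trans h1')
  have e2 := Cell.row.inj (h2.symm.trans h2')
  have e3 := Cell.row.inj (h3.symm.trans h3')
  ext1
  · exact e0
  · ext1
    · exact e1
    · ext1 <;> assumption

/-- An action reads at most one column (`ReadsCol.unique`). So the program is the preimage of `E`
under a map of letters, restricted to actions that read some column; the values of this map at other
actions are irrelevant. -/
theorem readCols_isRegular [Nonempty Γ] {E : Language (Col α Γ)} (hE : E.IsRegular) :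
    (readCols E).IsRegular := by
  classical
  obtain ⟨c₀⟩ := ‹Nonempty Γ›
  let f : Action (Fin 9) (Cell α Γ) → Col α Γ := fun a =>
    if h : ∃ c, ReadsCol a c then h.choose else (none, c₀, c₀, c₀)
  have hf : ∀ a, (∃ c, ReadsCol a c) → ReadsCol a (f a) := by
    intro a h
    simp only [f, dif_pos h]
    exact h.choose_spec
  convert (hE.comap f).inf (Language.IsRegular.forall_letters fun a => ∃ c, ReadsCol a c) using 1
  ext σ
  rw [Language.mem_inf, Language.mem_ofPred, Language.mem_ofPred]
  constructor
  · rintro ⟨w, hw, h⟩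
    have hall : ∀ a ∈ σ, ∃ c, ReadsCol a c := by
      intro a ha
      obtain ⟨i, hi, rfl⟩ := List.getElem_of_mem ha
      exact ⟨_, h.get hi (h.length_eq ▸ hi)⟩
    have : σ.map f = w := by
      clear hw hall
      induction h with
      | nil => rfl
      | cons h _ ih =>
        rw [List.map_cons, ih, (hf _ ⟨_, h⟩).unique h]
    exact ⟨this ▸ hw, hall⟩
  · rintro ⟨h1, h2⟩
    refine ⟨_, h1, ?_⟩
    rw [List.forall₂_map_right_iff]
    exact List.forall₂_same.2 fun a ha => hf a (h2 a ha)

theorem tick_isRegular (g : (Fin 4 → Cell α Γ) → Prop) (m : Fin 4 → Option Dir) :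
    (tick g m).IsRegular := op_isRegular _ _ _

theorem advance_isRegular (j : Fin 4) : (advance j : Prog α Γ).IsRegular :=
  (tick_isRegular _ _).mul ((tick_isRegular _ _).kstar.mul (tick_isRegular _ _))

theorem rewind_isRegular (j : Fin 4) : (rewind j : Prog α Γ).IsRegular :=
  (tick_isRegular _ _).kstar.mul (tick_isRegular _ _)

theorem verify_isRegular [Nonempty Γ] {cs : List (Language (Col α Γ))}
    (h : ∀ E ∈ cs, E.IsRegular) : (verify cs).IsRegular := by
  induction cs with
  | nil => exact Language.IsRegular.one
  | cons E cs ih =>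
    have hE := h E (by simp)
    have h1 : (checkCols E).IsRegular :=
      (tick_isRegular _ _).mul ((readCols_isRegular hE).mul ((tick_isRegular _ _).mul
        ((tick_isRegular _ _).kstar.mul (tick_isRegular _ _))))
    have h2 : (chooseAndCheck E).IsRegular :=
      (advance_isRegular 3).kstar.mul (h1.mul ((rewind_isRegular 3).mul (advance_isRegular 2)))
    have h3 : (innerLoop E).IsRegular :=
      h2.kstar.mul ((tick_isRegular _ _).mul (rewind_isRegular 2))
    exact (((h3.mul (advance_isRegular 1)).kstar).mul
      ((tick_isRegular _ _).mul (rewind_isRegular 1))).mul (ih fun E' hE' => h E' (by simp [hE']))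

theorem guess_isRegular [Finite Γ] : (guess : Prog α Γ).IsRegular :=
  (op_isRegular _ _ _).mul ((Language.IsRegular.iUnion fun _ => op_isRegular _ _ _).kstar.mul
    ((tick_isRegular _ _).mul ((tick_isRegular _ _).kstar.mul (tick_isRegular _ _))))

/-- The actions that consume a mark of the clock. -/
def Ticks (a : Action (Fin 9) (Cell α Γ)) : Prop :=
  a.1 4 = .mark ∧ a.2 4 = (.mark, some .left)

/-- The programs all of whose actions consume a mark of the clock. -/
def Clocked (P : Prog α Γ) : Prop := ∀ σ ∈ P, ∀ a ∈ σ, Ticks a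

theorem Clocked.mul {P P' : Prog α Γ} (h : Clocked P) (h' : Clocked P') : Clocked (P * P') := by
  rintro _ ⟨u, hu, v, hv, rfl⟩ a ha
  rcases List.mem_append.1 ha with ha | ha
  · exact h u hu a ha
  · exact h' v hv a ha

theorem Clocked.kstar {P : Prog α Γ} (h : Clocked P) : Clocked P∗ := by
  rintro _ ⟨S, rfl, hS⟩ a ha
  obtain ⟨w, hw, ha⟩ := List.mem_flatten.1 ha
  exact h w (hS w hw) a ha

theorem clocked_tick (g : (Fin 4 → Cell α Γ) → Prop) (m : Fin 4 → Option Dir) :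
    Clocked (tick g m) := by
  rintro _ ⟨b, ⟨⟨hb, -⟩, hb'⟩, rfl⟩ a ha
  obtain rfl := List.mem_singleton.1 ha
  refine ⟨hb, ?_⟩
  rw [hb']
  simp [hb]

theorem clocked_tickWrite (c : Cell α Γ) : Clocked (tickWrite c) := by
  rintro _ ⟨b, ⟨hb, hb'⟩, rfl⟩ a ha
  obtain rfl := List.mem_singleton.1 ha
  refine ⟨hb, ?_⟩
  rw [hb']
  simp [hb]

theorem clocked_readCols (E : Language (Col α Γ)) : Clocked (readCols E) := by
  rintro σ ⟨w, -, h⟩ a ha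
  obtain ⟨i, hi, rfl⟩ := List.getElem_of_mem ha
  have := h.get hi (h.length_eq ▸ hi)
  refine ⟨this.1, ?_⟩
  have e := this.2.2.2.2.2
  simp only [List.get_eq_getElem] at e this
  rw [e]
  simp [this.1]

theorem clocked_verify (cs : List (Language (Col α Γ))) : Clocked (verify cs) := by
  have ha : ∀ j, Clocked (advance j : Prog α Γ) := fun j =>
    (clocked_tick _ _).mul ((clocked_tick _ _).kstar.mul (clocked_tick _ _))
  have hr : ∀ j, Clocked (rewind j : Prog α Γ) := fun j =>
    (clocked_tick _ _).kstar.mul (clocked_tick _ _)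
  induction cs with
  | nil =>
    rintro σ rfl a ha
    simp at ha
  | cons E cs ih =>
    have h1 : Clocked (checkCols E) :=
      (clocked_tick _ _).mul ((clocked_readCols E).mul ((clocked_tick _ _).mul
        ((clocked_tick _ _).kstar.mul (clocked_tick _ _))))
    have h2 : Clocked (chooseAndCheck E) := (ha 3).kstar.mul (h1.mul ((hr 3).mul (ha 2)))
    have h3 : Clocked (innerLoop E) := h2.kstar.mul ((clocked_tick _ _).mul (hr 2))
    exact (((h3.mul (ha 1)).kstar).mul ((clocked_tick _ _).mul (hr 1))).mul ih

theorem clocked_guess : Clocked (guess : Prog α Γ) := by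
  refine (clocked_tickWrite _).mul (Clocked.mul (Clocked.kstar ?_)
    ((clocked_tick _ _).mul ((clocked_tick _ _).kstar.mul (clocked_tick _ _))))
  rintro σ ⟨c, hc⟩
  exact clocked_tickWrite _ σ hc

/-- Every action reads a mark on tape 4 and moves left there, so with the head at `v - 1` at most
`v` actions are possible. This limits iterations such as the guessing of rows, which have no bound
of their own. -/
theorem Clocked.bounded {P : Prog α Γ} (h : Clocked P) {s : Fin 9 → TapeState (Cell α Γ)} {V v : ℕ}
    (hs : s 4 = (marks V, (v : ℤ) - 1)) : Bounded P s v := by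
  intro σ τ s' hσ hex
  have hall : ∀ a ∈ σ, Ticks a := fun a ha => h _ hσ a (by simp [ha])
  clear hσ
  induction σ generalizing s v with
  | nil => exact Nat.zero_le _
  | cons a σ ih =>
    obtain ⟨ha, hex⟩ := hex
    obtain ⟨h1, h2⟩ := hall a (by simp)
    have hr : marks V ((v : ℤ) - 1) = (Cell.mark : Cell α Γ) := by
      rw [← h1, ha]
      simp [scan, hs]
    cases v with
    | zero => simp [marks_neg_one] at hr
    | succ v =>
      have h4 : apply a.2 s 4 = (marks V, (v : ℤ) - 1) := by
        simp only [apply, h2, hs, disp]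
        ext1
        · dsimp only
          rw [← hr]
          simp
        · push_cast
          ring
      have := ih h4 hex fun b hb => hall b (by simp [hb])
      simpa using this

end TapeProgram

/-! ### Rules for clocked programs: soundness and reachability -/

namespace TapeProgram

open Turing Computability

variable {α Γ : Type}

/-- The states of the verification of the word `W`: `v` marks of the clock are left, and the heads
of the first four tapes are at `h`. -/
def mainState (x : List α) (V : ℕ) (W : List (Cell α Γ)) (v : ℕ) (h : Fin 4 → ℤ) :
    Fin 9 → TapeState (Cell α Γ) :=
  ![(content (x.map .inp), h 0), (content W, h 1), (content W, h 2), (content W, h 3),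
    (marks V, (v : ℤ) - 1), (marks 0, 0), (marks x.length, 0), (marks x.length, 0),
    (marks x.length, 0)]

/-- The symbols under the first four heads. -/
def reads (x : List α) (W : List (Cell α Γ)) (h : Fin 4 → ℤ) : Fin 4 → Cell α Γ :=
  ![content (x.map .inp) (h 0), content W (h 1), content W (h 2), content W (h 3)]

/-- The positions of the heads after a move. -/
def moved (m : Fin 4 → Option Dir) (h : Fin 4 → ℤ) : Fin 4 → ℤ := fun j => h j + disp (m j)

/-- All results of runs of `P` that start with the heads at `h` satisfy `φ`. -/
def Sound (x : List α) (V : ℕ) (W : List (Cell α Γ)) (P : Prog α Γ) (h : Fin 4 → ℤ)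
    (φ : (Fin 4 → ℤ) → Prop) : Prop :=
  ∀ v t s', Run P (mainState x V W v h) t s' → ∃ v' h', s' = mainState x V W v' h' ∧ φ h'

/-- `P` can take the heads from `h` to `h'` in at most `T` steps. -/
def Reach (x : List α) (V : ℕ) (W : List (Cell α Γ)) (P : Prog α Γ) (h : Fin 4 → ℤ) (T : ℕ)
    (h' : Fin 4 → ℤ) : Prop :=
  -- The number `t` is the same for all readings of the clock. Hence costs simply add up under
  -- composition, and the clock is inspected only once, at the very end.
  ∃ t ≤ T, ∀ v, v + t ≤ V → Run P (mainState x V W (v + t) h) t (mainState x V W v h')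

variable {x : List α} {V : ℕ} {W : List (Cell α Γ)} {P P' : Prog α Γ} {h h' : Fin 4 → ℤ}
  {φ ψ : (Fin 4 → ℤ) → Prop} {T T' : ℕ}

theorem effect_tick (m : Fin 4 → Option Dir) (v : ℕ) :
    effect (fun _ => none) ![m 0, m 1, m 2, m 3, some .left, none, none, none, none]
      (mainState x V W (v + 1) h) = mainState x V W v (moved m h) := by
  have : (fun _ => none : Fin 9 → Option (Cell α Γ)) =
    ![none, none, none, none, none, none, none, none, none] := by
    funext j
    fin_cases j <;> rfl
  simp only [mainState]
  rw [this, effect_vec]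
  simp [effectOne, moved, disp, sub_eq_add_neg]

theorem Sound.tick {g : (Fin 4 → Cell α Γ) → Prop} {m : Fin 4 → Option Dir}
    (hφ : g (reads x W h) → φ (moved m h)) : Sound x V W (tick g m) h φ := by
  intro v t s' hr
  obtain ⟨-, ⟨h4, hg⟩, rfl⟩ := run_op.1 hr
  cases v with
  | zero =>
    change marks V (((0 : ℕ) : ℤ) - 1) = _ at h4
    rw [Nat.cast_zero, zero_sub, marks_neg_one] at h4
    cases h4
  | succ v => exact ⟨v, _, effect_tick m v, hφ hg⟩

theorem Reach.tick {g : (Fin 4 → Cell α Γ) → Prop} {m : Fin 4 → Option Dir}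
    (hg : g (reads x W h)) (hm : moved m h = h') : Reach x V W (tick g m) h 1 h' := by
  refine ⟨1, le_rfl, fun v hv => run_op.2 ⟨rfl, ⟨?_, hg⟩, ?_⟩⟩
  · change marks V (((v + 1 : ℕ) : ℤ) - 1) = _
    have : ((v + 1 : ℕ) : ℤ) - 1 = v := by push_cast; ring
    rw [this]
    exact marks_of_lt (by omega)
  · rw [effect_tick, hm]

theorem Sound.mono (hs : Sound x V W P h φ) (hφ : ∀ h', φ h' → ψ h') : Sound x V W P h ψ := by
  intro v t s' hr
  obtain ⟨v', h', e, hh⟩ := hs v t s' hr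
  exact ⟨v', h', e, hφ _ hh⟩

theorem Sound.mul (hs : Sound x V W P h φ) (hs' : ∀ h', φ h' → Sound x V W P' h' ψ) :
    Sound x V W (P * P') h ψ := by
  intro v t s' hr
  obtain ⟨t₁, t₂, s₁, -, h₁, h₂⟩ := run_mul.1 hr
  obtain ⟨v', h', rfl, hh⟩ := hs v _ _ h₁
  exact hs' h' hh _ _ _ h₂

theorem Sound.kstar (I : (Fin 4 → ℤ) → Prop) (h0 : I h) (hs : ∀ h, I h → Sound x V W P h I) :
    Sound x V W P∗ h I := by
  intro v t s' hr
  refine run_kstar_induction (Inv := fun s => ∃ v' h', s = mainState x V W v' h' ∧ I h') ?_ hr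
    ⟨v, h, rfl, h0⟩
  rintro _ t s₂ ⟨v', h', rfl, hI⟩ hr'
  exact hs h' hI _ _ _ hr'

theorem Reach.mono (hr : Reach x V W P h T h') (hT : T ≤ T') : Reach x V W P h T' h' := by
  obtain ⟨t, ht, hr⟩ := hr
  exact ⟨t, ht.trans hT, hr⟩

theorem Reach.mul {h₁ : Fin 4 → ℤ} (hr : Reach x V W P h T h₁) (hr' : Reach x V W P' h₁ T' h') :
    Reach x V W (P * P') h (T + T') h' := by
  obtain ⟨t, ht, hr⟩ := hr
  obtain ⟨t', ht', hr'⟩ := hr'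
  refine ⟨t + t', by omega, fun v hv => run_mul.2 ⟨t, t', mainState x V W (v + t') h₁, rfl, ?_, ?_⟩⟩
  · have := hr (v + t') (by omega)
    rwa [add_assoc, add_comm t' t] at this
  · exact hr' v (by omega)

theorem Reach.kstar {m : ℕ} (hh : ℕ → Fin 4 → ℤ)
    (hr : ∀ i < m, Reach x V W P (hh i) T (hh (i + 1))) :
    Reach x V W P∗ (hh 0) (m * T) (hh m) := by
  induction m with
  | zero => exact ⟨0, Nat.zero_le _, fun v hv => run_kstar_zero _⟩
  | succ m ih =>
    obtain ⟨t, ht, h1⟩ := ih fun i hi => hr i (by omega)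
    obtain ⟨t', ht', h2⟩ := hr m (by omega)
    refine ⟨t + t', by rw [Nat.succ_mul]; omega, fun v hv => ?_⟩
    have e1 := h1 (v + t') (by omega)
    have e2 := h2 v (by omega)
    rw [add_assoc, add_comm t' t] at e1
    exact run_kstar_snoc e1 e2

theorem moved_only (j : Fin 4) (d : Dir) :
    moved (only j d) h = Function.update h j (h j + disp (some d)) := by
  funext i
  rcases eq_or_ne i j with rfl | hij
  · simp [moved, only]
  · simp [moved, only, hij, disp]

theorem moved_none : moved (fun _ => none) h = h := by
  funext i
  simp [moved, disp]

theorem reads_row {j : Fin 4} (hj : j ≠ 0) : reads x W h j = content W (h j) := by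
  fin_cases j
  · exact absurd rfl hj
  all_goals rfl

/-! ### Words of rows -/

section RowsWord

variable {R : List (List Γ)} {a : ℕ}

theorem rowsWord_append (R S : List (List Γ)) :
    (rowsWord (R ++ S) : List (Cell α Γ)) = rowsWord R ++ rowsWord S := by
  simp [rowsWord]

theorem rowPos_zero : rowPos (α := α) R 0 = 0 := rfl

theorem rowPos_succ (ha : a < R.length) :
    rowPos (α := α) R (a + 1) = rowPos (α := α) R a + 1 + R[a].length := by
  simp only [rowPos]
  rw [List.take_add_one, rowsWord_append]
  simp [rowsWord, ha]
  omega

theorem rowPos_length : rowPos (α := α) R R.length = (rowsWord R : List (Cell α Γ)).length := by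
  simp [rowPos]

theorem rowsWord_eq (ha : a < R.length) : (rowsWord R : List (Cell α Γ)) =
    rowsWord (R.take a) ++ (.sep :: R[a].map .row) ++ rowsWord (R.drop (a + 1)) := by
  have h : R = R.take a ++ (R[a] :: R.drop (a + 1)) := by
    rw [← List.drop_eq_getElem_cons ha, List.take_append_drop]
  have h2 : (rowsWord (R[a] :: R.drop (a + 1)) : List (Cell α Γ)) =
      (.sep :: R[a].map .row) ++ rowsWord (R.drop (a + 1)) :=
    List.flatMap_cons
  rw [List.append_assoc, ← h2, ← rowsWord_append, ← h]

theorem rowPos_lt (ha : a < R.length) :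
    rowPos (α := α) R a + R[a].length < (rowsWord R : List (Cell α Γ)).length := by
  rw [rowsWord_eq ha]
  simp only [rowPos, List.length_append, List.length_cons, List.length_map]
  omega

theorem content_rowPos (ha : a < R.length) :
    content (rowsWord R : List (Cell α Γ)) (rowPos (α := α) R a) = .sep := by
  have hlt : rowPos (α := α) R a < (rowsWord R : List (Cell α Γ)).length := by
    have := rowPos_lt (α := α) ha
    omega
  rw [content_of_lt hlt]
  have h : (rowsWord R : List (Cell α Γ))[rowPos (α := α) R a]? = some .sep := by
    rw [rowsWord_eq ha, List.append_assoc, List.getElem?_append_right (by simp [rowPos])]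
    simp [rowPos]
  rw [List.getElem?_eq_getElem hlt] at h
  exact Option.some.inj h

theorem content_rowPos_add (ha : a < R.length) {i : ℕ} (hi : i < R[a].length) :
    content (rowsWord R : List (Cell α Γ)) (rowPos (α := α) R a + 1 + i) = .row R[a][i] := by
  have hlt : rowPos (α := α) R a + 1 + i < (rowsWord R : List (Cell α Γ)).length := by
    have := rowPos_lt (α := α) ha
    omega
  have e : ((rowPos (α := α) R a : ℤ) + 1 + i) = ((rowPos (α := α) R a + 1 + i : ℕ) : ℤ) := by
    push_cast; ring
  rw [e, content_of_lt hlt]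
  have h : (rowsWord R : List (Cell α Γ))[rowPos (α := α) R a + 1 + i]? = some (.row R[a][i]) := by
    have e2 : rowPos (α := α) R a + 1 + i - (rowsWord (R.take a) : List (Cell α Γ)).length =
        i + 1 := by
      simp only [rowPos]
      omega
    rw [rowsWord_eq ha, List.append_assoc, List.getElem?_append_right (by simp only [rowPos]; omega),
      e2, List.cons_append, List.getElem?_cons_succ, List.getElem?_append_left (by simpa using hi)]
    simp [hi]
  rw [List.getElem?_eq_getElem hlt] at h
  exact Option.some.inj h

theorem content_rowPos_length :
    content (rowsWord R : List (Cell α Γ)) (rowPos (α := α) R R.length) = .blank := by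
  rw [rowPos_length]
  exact content_of_le le_rfl

/-- After a row comes a separator or the end of the word. This is how the programs recognize the end
of a row. -/
theorem content_rowPos_ne_row (ha : a ≤ R.length) (c : Γ) :
    content (rowsWord R : List (Cell α Γ)) (rowPos (α := α) R a) ≠ .row c := by
  rcases ha.lt_or_eq with h | rfl
  · rw [content_rowPos h]
    simp
  · rw [content_rowPos_length]
    simp

theorem rowsWord_ne_blank {i : ℕ} (hi : i < (rowsWord R : List (Cell α Γ)).length) :
    content (rowsWord R : List (Cell α Γ)) i ≠ .blank := by
  rw [content_of_lt hi]
  intro hb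
  have hm : (rowsWord R : List (Cell α Γ))[i] ∈ (rowsWord R : List (Cell α Γ)) :=
    List.getElem_mem hi
  rw [hb] at hm
  simp [rowsWord] at hm

theorem length_le_rowsWord : R.length ≤ (rowsWord R : List (Cell α Γ)).length := by
  induction R with
  | nil => simp
  | cons r R ih =>
    have : (rowsWord (r :: R) : List (Cell α Γ)) = (.sep :: r.map .row) ++ rowsWord R := by
      simp [rowsWord]
    rw [this]
    simp
    omega

theorem row_length_lt (ha : a < R.length) :
    R[a].length < (rowsWord R : List (Cell α Γ)).length := by
  have := rowPos_lt (α := α) ha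
  omega

end RowsWord

/-! ### Moving the heads -/

section Heads

variable {R : List (List Γ)} {a : ℕ} {j : Fin 4}

theorem advance_sound (hj : j ≠ 0) (ha : a ≤ R.length) (hh : h j = rowPos (α := α) R a) :
    Sound x V (rowsWord R) (advance j) h fun h' =>
      a < R.length ∧ h' = Function.update h j (rowPos (α := α) R (a + 1) : ℤ) := by
  refine Sound.mul (φ := fun h' => a < R.length ∧
    h' = Function.update h j ((rowPos (α := α) R a : ℤ) + 1)) (Sound.tick ?_) ?_
  · rw [reads_row hj, hh]
    intro hsep
    have : a < R.length := by
      rcases ha.lt_or_eq with h | rfl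
      · exact h
      · rw [content_rowPos_length] at hsep
        cases hsep
    refine ⟨this, ?_⟩
    rw [moved_only, hh]
    rfl
  rintro _ ⟨ha, rfl⟩
  refine Sound.mul (φ := fun h' => ∃ i ≤ R[a].length,
    h' = Function.update h j ((rowPos (α := α) R a : ℤ) + 1 + i))
    (Sound.kstar _ ⟨0, Nat.zero_le _, by simp⟩ ?_) ?_
  · rintro _ ⟨i, hi, rfl⟩
    refine Sound.tick ?_
    rintro ⟨c, hc⟩
    rw [reads_row hj, Function.update_self] at hc
    rcases hi.lt_or_eq with hi | rfl
    · refine ⟨i + 1, hi, ?_⟩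
      rw [moved_only]
      simp [disp, add_assoc]
    · have := content_rowPos_ne_row (α := α) (R := R) (a := a + 1) ha c
      rw [rowPos_succ ha] at this
      push_cast at this
      exact absurd hc this
  · rintro _ ⟨i, hi, rfl⟩
    refine Sound.tick ?_
    intro hc
    rw [reads_row hj, Function.update_self] at hc
    refine ⟨ha, ?_⟩
    rw [moved_none, rowPos_succ ha]
    rcases hi.lt_or_eq with hi | rfl
    · exact absurd ⟨_, content_rowPos_add ha hi⟩ hc
    · push_cast
      rfl

theorem advance_reach (hj : j ≠ 0) (ha : a < R.length) (hh : h j = rowPos (α := α) R a) :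
    Reach x V (rowsWord R) (advance j) h ((rowsWord (α := α) R).length + 2)
      (Function.update h j (rowPos (α := α) R (a + 1) : ℤ)) := by
  have h1 : Reach x V (rowsWord R) (tick (fun r => r j = .sep) (only j .right)) h 1
      (Function.update h j ((rowPos (α := α) R a : ℤ) + 1 + (0 : ℕ))) := by
    refine Reach.tick ?_ ?_
    · rw [reads_row hj, hh]
      exact content_rowPos ha
    · rw [moved_only, hh]
      simp [disp]
  have h2 := Reach.kstar (x := x) (V := V) (W := (rowsWord R))
    (P := tick (fun r => ∃ c, r j = .row c) (only j .right)) (T := 1) (m := R[a].length)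
    (fun i => Function.update h j ((rowPos (α := α) R a : ℤ) + 1 + i)) ?_
  · have h3 : Reach x V (rowsWord R) (tick (fun r => ¬ ∃ c, r j = .row c) (fun _ => none))
        (Function.update h j ((rowPos (α := α) R a : ℤ) + 1 + R[a].length)) 1
        (Function.update h j (rowPos (α := α) R (a + 1) : ℤ)) := by
      refine Reach.tick ?_ ?_
      · rintro ⟨c, hc⟩
        rw [reads_row hj, Function.update_self] at hc
        have := content_rowPos_ne_row (α := α) (R := R) (a := a + 1) ha c
        rw [rowPos_succ ha] at this
        push_cast at this
        exact this hc
      · rw [moved_none, rowPos_succ ha]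
        push_cast
        rfl
    refine (h1.mul (h2.mul h3)).mono ?_
    have := row_length_lt (α := α) ha
    omega
  · intro i hi
    refine Reach.tick ?_ ?_
    · refine ⟨R[a][i], ?_⟩
      rw [reads_row hj, Function.update_self]
      exact content_rowPos_add ha hi
    · rw [moved_only]
      simp [disp, add_assoc]

/-- A word of rows contains no blank, so the first blank met on the way left is at position `-1`. -/
theorem rewind_sound (hj : j ≠ 0) {p : ℤ} (hp : -1 ≤ p) (hp' : p < (rowsWord (α := α) R).length) :
    Sound x V (rowsWord R) (rewind j) (Function.update h j p) fun h' => h' = Function.update h j 0 := by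
  refine Sound.mul (φ := fun h' => ∃ q : ℤ, -1 ≤ q ∧ q < (rowsWord (α := α) R).length ∧ h' = Function.update h j q)
    (Sound.kstar _ ⟨p, hp, hp', rfl⟩ ?_) ?_
  · rintro _ ⟨q, hq, hq', rfl⟩
    refine Sound.tick ?_
    intro hne
    rw [reads_row hj, Function.update_self] at hne
    have : q ≠ -1 := by
      rintro rfl
      exact hne (content_of_neg (by omega))
    refine ⟨q - 1, by omega, by omega, ?_⟩
    rw [moved_only]
    simp [disp, sub_eq_add_neg]
  · rintro _ ⟨q, hq, hq', rfl⟩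
    refine Sound.tick ?_
    intro hb
    rw [reads_row hj, Function.update_self] at hb
    obtain rfl | hq0 : q = -1 ∨ 0 ≤ q := by omega
    · rw [moved_only]
      simp [disp]
    · obtain ⟨n, rfl⟩ := Int.eq_ofNat_of_zero_le hq0
      exact absurd hb (rowsWord_ne_blank (by exact_mod_cast hq'))

theorem rewind_reach (hj : j ≠ 0) {p : ℤ} (hp : -1 ≤ p) (hp' : p < (rowsWord (α := α) R).length) :
    Reach x V (rowsWord R) (rewind j) (Function.update h j p) ((rowsWord (α := α) R).length + 2) (Function.update h j 0) := by
  obtain ⟨n, hn⟩ := Int.eq_ofNat_of_zero_le (a := p + 1) (by omega)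
  have h2 := Reach.kstar (x := x) (V := V) (W := (rowsWord R))
    (P := tick (fun r => r j ≠ .blank) (only j .left)) (T := 1) (m := n)
    (fun i => Function.update h j (p - i)) ?_
  · have h3 : Reach x V (rowsWord R) (tick (fun r => r j = .blank) (only j .right))
        (Function.update h j (p - n)) 1 (Function.update h j 0) := by
      refine Reach.tick ?_ ?_
      · rw [reads_row hj, Function.update_self]
        exact content_of_neg (by omega)
      · rw [moved_only]
        have : p - n = -1 := by omega
        simp [disp, this]
    have h4 := h2.mul h3
    rw [Nat.cast_zero, sub_zero] at h4
    exact h4.mono (by omega)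
  · intro i hi
    refine Reach.tick ?_ ?_
    · rw [reads_row hj, Function.update_self]
      have e : p - i = ((n - 1 - i : ℕ) : ℤ) := by omega
      rw [e]
      exact rowsWord_ne_blank (by omega)
    · rw [moved_only]
      simp [disp]
      congr 1
      ring

theorem endRewind_sound (hj : j ≠ 0) (ha : a ≤ R.length) (hh : h j = rowPos (α := α) R a) :
    Sound x V (rowsWord R) (tick (fun r => r j = .blank) (only j .left) * rewind j) h
      fun h' => a = R.length ∧ h' = Function.update h j 0 := by
  refine Sound.mul (φ := fun h' => a = R.length ∧
    h' = Function.update h j (((rowsWord (α := α) R).length : ℤ) - 1)) (Sound.tick ?_) ?_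
  · rw [reads_row hj, hh]
    intro hb
    rcases ha.lt_or_eq with h1 | rfl
    · rw [content_rowPos h1] at hb
      cases hb
    · refine ⟨rfl, ?_⟩
      rw [moved_only, hh, rowPos_length]
      rfl
  · rintro _ ⟨ha', rfl⟩
    exact (rewind_sound hj (by omega) (by omega)).mono fun h' hh' => ⟨ha', hh'⟩

theorem endRewind_reach (hj : j ≠ 0) (hh : h j = rowPos (α := α) R R.length) :
    Reach x V (rowsWord R) (tick (fun r => r j = .blank) (only j .left) * rewind j) h ((rowsWord (α := α) R).length + 3)
      (Function.update h j 0) := by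
  have h1 : Reach x V (rowsWord R) (tick (fun r => r j = .blank) (only j .left)) h 1
      (Function.update h j (((rowsWord (α := α) R).length : ℤ) - 1)) := by
    refine Reach.tick ?_ ?_
    · rw [reads_row hj, hh]
      exact content_rowPos_length
    · rw [moved_only, hh, rowPos_length]
      rfl
  exact (h1.mul (rewind_reach hj (by omega) (by omega))).mono (by omega)

end Heads

/-! ### Checking columns -/

section Check

/-- The columns from the positions `h` on are those of `w`. -/
def ColumnsAt (x : List α) (W : List (Cell α Γ)) (h : Fin 4 → ℤ) (w : List (Col α Γ)) : Prop :=
  ∀ (i : ℕ) (hi : i < w.length), content (x.map .inp) (h 0 + i) = letterCell (Γ := Γ) w[i].1 ∧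
    content W (h 1 + i) = .row w[i].2.1 ∧ content W (h 2 + i) = .row w[i].2.2.1 ∧
    content W (h 3 + i) = .row w[i].2.2.2

theorem columnsAt_cons {c : Col α Γ} {w : List (Col α Γ)} : ColumnsAt x W h (c :: w) ↔
    (content (x.map .inp) (h 0) = letterCell (Γ := Γ) c.1 ∧ content W (h 1) = .row c.2.1 ∧
      content W (h 2) = .row c.2.2.1 ∧ content W (h 3) = .row c.2.2.2) ∧
    ColumnsAt x W (fun j => h j + 1) w := by
  constructor
  · intro hc
    have h0 := hc 0 (by simp)
    simp only [Nat.cast_zero, add_zero] at h0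
    refine ⟨h0, fun i hi => ?_⟩
    have := hc (i + 1) (by simpa using hi)
    simpa [add_assoc, add_comm (1 : ℤ)] using this
  · rintro ⟨h0, hc⟩ i hi
    cases i with
    | zero => simpa using h0
    | succ i =>
      have := hc i (by simpa using hi)
      simpa [add_assoc, add_comm (1 : ℤ)] using this

theorem apply_readsCol (v : ℕ) (r : Fin 9 → Cell α Γ) (hr : r = scan (mainState x V W (v + 1) h)) :
    apply (fun j => (r j, (![some .right, some .right, some .right, some .right, some .left, none,
      none, none, none] : Fin 9 → Option Dir) j)) (mainState x V W (v + 1) h) =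
    mainState x V W v (fun j => h j + 1) := by
  subst hr
  have := apply_eq_effect (fun _ => none) (![some .right, some .right, some .right, some .right,
    some .left, none, none, none, none] : Fin 9 → Option Dir) (mainState x V W (v + 1) h)
  exact this.trans (effect_tick (h := h) (fun _ => some .right) v)

theorem readCols_exec_sound {σ : List (Action (Fin 9) (Cell α Γ))} {w : List (Col α Γ)}
    (hσ : List.Forall₂ ReadsCol σ w) {v : ℕ} {s' : Fin 9 → TapeState (Cell α Γ)}
    (hex : Exec σ (mainState x V W v h) s') :
    ColumnsAt x W h w ∧ ∃ v', s' = mainState x V W v' (fun j => h j + w.length) := by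
  induction hσ generalizing v h with
  | nil =>
    cases hex
    exact ⟨fun i hi => by simp at hi, v, by simp⟩
  | @cons a c σ w hac _ ih =>
    obtain ⟨hr, hex⟩ := hex
    obtain ⟨h4, h0, h1, h2, h3, hw⟩ := hac
    cases v with
    | zero =>
      rw [hr] at h4
      change marks V (((0 : ℕ) : ℤ) - 1) = _ at h4
      rw [Nat.cast_zero, zero_sub, marks_neg_one] at h4
      cases h4
    | succ v =>
      rw [hw, apply_readsCol v a.1 hr] at hex
      obtain ⟨e1, v', e2⟩ := ih hex
      rw [hr] at h0 h1 h2 h3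
      refine ⟨columnsAt_cons.2 ⟨⟨h0, h1, h2, h3⟩, e1⟩, v', ?_⟩
      rw [e2]
      congr 1
      funext j
      simp only [List.length_cons]
      push_cast
      ring

theorem readCols_exec_complete {w : List (Col α Γ)} (hw : ColumnsAt x W h w) {v : ℕ}
    (hv : v + w.length ≤ V) :
    ∃ σ, List.Forall₂ ReadsCol σ w ∧ σ.length = w.length ∧
      Exec σ (mainState x V W (v + w.length) h) (mainState x V W v (fun j => h j + w.length)) := by
  induction w generalizing h with
  | nil => exact ⟨[], .nil, rfl, by simp [Exec]⟩
  | cons c w ih =>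
    obtain ⟨⟨h0, h1, h2, h3⟩, hw⟩ := columnsAt_cons.1 hw
    simp only [List.length_cons] at hv
    obtain ⟨σ, hσ, hl, hex⟩ := ih hw (by omega)
    refine ⟨(scan (mainState x V W (v + w.length + 1) h), fun j => (scan _ j, _)) :: σ,
      .cons ⟨?_, h0, h1, h2, h3, rfl⟩ hσ, by simp [hl], rfl, ?_⟩
    · change marks V (((v + w.length + 1 : ℕ) : ℤ) - 1) = _
      have : ((v + w.length + 1 : ℕ) : ℤ) - 1 = (v + w.length : ℕ) := by push_cast; ring
      rw [this]
      exact marks_of_lt (by omega)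
    · dsimp only
      rw [List.length_cons, ← add_assoc, apply_readsCol _ _ rfl]
      convert hex using 1
      congr 1
      funext j
      push_cast
      ring

variable {R : List (List Γ)} {E : Language (Col α Γ)}

/-- The heads are at the left end of the input and at the given rows. -/
def atRows (α : Type) (R : List (List Γ)) (a b d : ℕ) : Fin 4 → ℤ :=
  ![-1, (rowPos (α := α) R a : ℤ), (rowPos (α := α) R b : ℤ), (rowPos (α := α) R d : ℤ)]

/-- The condition `E` holds for some list of columns of the given rows. -/
def Holds (x : List α) (E : Language (Col α Γ)) (r₁ r₂ r₃ : List Γ) : Prop :=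
  ∃ w ∈ E, Columns x r₁ r₂ r₃ w

theorem content_map_inp_letter (x : List α) (i : ℕ) :
    content (x.map (Cell.inp (Γ := Γ))) (i : ℤ) = letterCell x[i]? := by
  rcases lt_or_ge i x.length with hi | hi
  · rw [content_of_lt (by simpa using hi)]
    simp [hi, letterCell]
  · rw [content_of_le (by simpa using hi), List.getElem?_eq_none hi]
    rfl

theorem map_fst_eq_pad {x : List α} {w : List (Col α Γ)} :
    (∃ j, w.map (fun c => c.1) = x.map some ++ List.replicate j none) ↔
      x.length ≤ w.length ∧ ∀ (i : ℕ) (hi : i < w.length), w[i].1 = x[i]? := by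
  constructor
  · rintro ⟨j, hj⟩
    have hl := congrArg List.length hj
    simp only [List.length_map, List.length_append, List.length_replicate] at hl
    refine ⟨by omega, fun i hi => ?_⟩
    have : (w.map (fun c => c.1))[i]? = some w[i].1 := by simp [hi]
    rw [hj] at this
    rcases lt_or_ge i x.length with h | h
    · rw [List.getElem?_append_left (by simpa using h)] at this
      simp [h] at this
      rw [← this]
      simp [h]
    · rw [List.getElem?_append_right (by simpa using h)] at this
      have h2 : i - x.length < j := by omega
      simp [h2] at this
      rw [← this]
      simp [h]
  · rintro ⟨hl, hw⟩
    refine ⟨w.length - x.length, ?_⟩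
    apply List.ext_getElem
    · simp
      omega
    · intro i h1 h2
      rw [List.length_map] at h1
      rw [List.getElem_map, hw i h1]
      rcases lt_or_ge i x.length with h | h
      · rw [List.getElem_append_left (by simpa using h)]
        simp [h]
      · rw [List.getElem_append_right (by simpa using h)]
        simp [h]

/-- This connects lists of columns with what the heads see. The shift by one passes the separators
on the row tapes and leads from `-1` to `0` on the input tape. -/
theorem columns_iff {a b d : ℕ} (ha : a < R.length) (hb : b < R.length) (hd : d < R.length)
    {w : List (Col α Γ)} :
    Columns x R[a] R[b] R[d] w ↔
      w.length = R[a].length ∧ w.length = R[b].length ∧ w.length = R[d].length ∧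
      x.length ≤ w.length ∧ ColumnsAt x (rowsWord R) (fun j => atRows α R a b d j + 1) w := by
  have key : ∀ (f : Col α Γ → Γ) (e : ℕ) (he : e < R.length), w.map f = R[e] ↔
      w.length = R[e].length ∧ ∀ (i : ℕ) (hi : i < w.length),
        content (rowsWord (α := α) R) ((rowPos (α := α) R e : ℤ) + 1 + i) = .row (f w[i]) := by
    intro f e he
    constructor
    · intro h
      have hl := congrArg List.length h
      rw [List.length_map] at hl
      refine ⟨hl, fun i hi => ?_⟩
      rw [content_rowPos_add he (hl ▸ hi)]
      congr 1
      have : (w.map f)[i]? = R[e][i]? := by rw [h]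
      simpa [hi, hl ▸ hi] using this.symm
    · rintro ⟨hl, h⟩
      apply List.ext_getElem (by simpa using hl)
      intro i h1 h2
      rw [List.length_map] at h1
      have := h i h1
      rw [content_rowPos_add he h2] at this
      rw [List.getElem_map]
      exact (Cell.row.inj this).symm
  rw [Columns, map_fst_eq_pad, key _ a ha, key _ b hb, key _ d hd]
  constructor
  · rintro ⟨⟨h0, hx⟩, ⟨h1, e1⟩, ⟨h2, e2⟩, h3, e3⟩
    refine ⟨h1, h2, h3, h0, fun i hi => ⟨?_, e1 i hi, e2 i hi, e3 i hi⟩⟩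
    have : atRows α R a b d 0 + 1 + i = i := by
      simp [atRows]
    rw [this, content_map_inp_letter, hx i hi]
  · rintro ⟨h1, h2, h3, h0, h⟩
    refine ⟨⟨h0, fun i hi => ?_⟩, ⟨h1, fun i hi => (h i hi).2.1⟩,
      ⟨h2, fun i hi => (h i hi).2.2.1⟩, h3, fun i hi => (h i hi).2.2.2⟩
    have := (h i hi).1
    have e : atRows α R a b d 0 + 1 + i = i := by
      simp [atRows]
    rw [e, content_map_inp_letter] at this
    exact letterCell_injective this.symm

end Check

end TapeProgram

/-! ### The column check with four heads in lockstep -/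

namespace TapeProgram

open Turing Computability

variable {α Γ : Type} {x : List α} {V : ℕ} {R : List (List Γ)} {E : Language (Col α Γ)}

theorem moved_const (d : Dir) (h : Fin 4 → ℤ) :
    moved (fun _ => some d) h = fun j => h j + disp (some d) := rfl

theorem length_eq_of_rows {e n : ℕ} (he : e < R.length)
    (h : ∀ i < n, ∃ c, content (rowsWord (α := α) R) ((rowPos (α := α) R e : ℤ) + 1 + i) = .row c)
    (h' : ¬ ∃ c, content (rowsWord (α := α) R) ((rowPos (α := α) R e : ℤ) + 1 + n) = .row c) :
    n = R[e].length := by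
  rcases lt_trichotomy n R[e].length with hlt | heq | hgt
  · exact absurd ⟨_, content_rowPos_add he hlt⟩ h'
  · exact heq
  · obtain ⟨c, hc⟩ := h _ hgt
    have := content_rowPos_ne_row (α := α) (R := R) (a := e + 1) he c
    rw [rowPos_succ he] at this
    push_cast at this
    exact absurd hc this

/-- The heads move together. If none of the row heads is on a row symbol after the columns have been
read, all three rows have the length of the column word, and the blank on the input tape shows that
the input is exhausted. As the heads also return together, it suffices to watch for the separator on
tape 1. -/
theorem checkCols_sound {a b d : ℕ} (ha : a ≤ R.length) (hb : b ≤ R.length) (hd : d ≤ R.length) :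
    Sound x V (rowsWord R) (checkCols E) (atRows α R a b d) fun h' =>
      h' = atRows α R a b d ∧ ∃ (ha : a < R.length) (hb : b < R.length) (hd : d < R.length),
        Holds x E R[a] R[b] R[d] := by
  have hsep : ∀ {e : ℕ}, e ≤ R.length →
      content (rowsWord (α := α) R) (rowPos (α := α) R e) = .sep → e < R.length := by
    intro e he hs
    rcases he.lt_or_eq with h | rfl
    · exact h
    · rw [content_rowPos_length] at hs
      cases hs
  refine Sound.mul (φ := fun h' => h' = (fun j => atRows α R a b d j + 1) ∧ a < R.length ∧
    b < R.length ∧ d < R.length) (Sound.tick ?_) ?_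
  · rintro ⟨h1, h2, h3⟩
    exact ⟨rfl, hsep ha h1, hsep hb h2, hsep hd h3⟩
  rintro _ ⟨rfl, ha, hb, hd⟩
  refine Sound.mul (φ := fun h' => ∃ w ∈ E,
    ColumnsAt x (rowsWord R) (fun j => atRows α R a b d j + 1) w ∧
    h' = fun j => atRows α R a b d j + 1 + w.length) ?_ ?_
  · rintro v t s' ⟨σ, ⟨w, hw, hσ⟩, -, hex⟩
    obtain ⟨h1, v', h2⟩ := readCols_exec_sound hσ hex
    exact ⟨v', _, h2, w, hw, h1, rfl⟩
  rintro _ ⟨w, hw, hcol, rfl⟩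
  refine Sound.mul (φ := fun h' => Columns x R[a] R[b] R[d] w ∧
    h' = fun j => atRows α R a b d j + w.length) (Sound.tick ?_) ?_
  · rintro ⟨h0, hr⟩
    refine ⟨(columns_iff ha hb hd).2 ⟨?_, ?_, ?_, ?_, hcol⟩, ?_⟩
    · refine length_eq_of_rows ha (fun i hi => ⟨_, (hcol i hi).2.1⟩) (hr 1 (by simp))
    · refine length_eq_of_rows hb (fun i hi => ⟨_, (hcol i hi).2.2.1⟩) (hr 2 (by simp))
    · refine length_eq_of_rows hd (fun i hi => ⟨_, (hcol i hi).2.2.2⟩) (hr 3 (by simp))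
    · by_contra hlt
      push Not at hlt
      have e : (-1 : ℤ) + 1 + w.length = w.length := by ring
      change content (x.map .inp) ((-1 : ℤ) + 1 + w.length) = Cell.blank at h0
      obtain ⟨c, hc⟩ := content_input_of_lt (Γ := Γ) hlt
      rw [e, hc] at h0
      cases h0
    · rw [moved_const]
      funext j
      simp only [disp]
      ring
  rintro _ ⟨hC, rfl⟩
  have hlen := ((columns_iff ha hb hd).1 hC).1
  refine Sound.mul (φ := fun h' => ∃ i ≤ w.length, h' = fun j => atRows α R a b d j + (i : ℕ))
    (Sound.kstar _ ⟨_, le_rfl, rfl⟩ ?_) ?_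
  · rintro _ ⟨i, hi, rfl⟩
    refine Sound.tick ?_
    rintro ⟨c, hc⟩
    cases i with
    | zero =>
      change content _ ((rowPos (α := α) R a : ℤ) + (0 : ℕ)) = _ at hc
      rw [Nat.cast_zero, add_zero, content_rowPos ha] at hc
      cases hc
    | succ i =>
      refine ⟨i, by omega, ?_⟩
      rw [moved_const]
      funext j
      simp only [disp]
      push_cast
      ring
  · rintro _ ⟨i, hi, rfl⟩
    refine Sound.tick ?_
    intro hc
    cases i with
    | zero =>
      rw [moved_none]
      exact ⟨by simp, ha, hb, hd, w, hw, hC⟩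
    | succ i =>
      change content _ ((rowPos (α := α) R a : ℤ) + (i + 1 : ℕ)) = _ at hc
      have e : ((rowPos (α := α) R a : ℤ) + (i + 1 : ℕ)) = (rowPos (α := α) R a : ℤ) + 1 + i := by
        push_cast
        ring
      rw [e, content_rowPos_add ha (by omega)] at hc
      cases hc

theorem checkCols_reach {a b d : ℕ} (ha : a < R.length) (hb : b < R.length) (hd : d < R.length)
    (hE : Holds x E R[a] R[b] R[d]) :
    Reach x V (rowsWord R) (checkCols E) (atRows α R a b d) (2 * (rowsWord (α := α) R).length + 3)
      (atRows α R a b d) := by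
  obtain ⟨w, hw, hC⟩ := hE
  obtain ⟨h1, h2, h3, h0, hcol⟩ := (columns_iff ha hb hd).1 hC
  have r1 : Reach x V (rowsWord R)
      (tick (fun r => r 1 = .sep ∧ r 2 = .sep ∧ r 3 = .sep) (fun _ => some .right))
      (atRows α R a b d) 1 (fun j => atRows α R a b d j + 1) :=
    Reach.tick ⟨content_rowPos ha, content_rowPos hb, content_rowPos hd⟩ rfl
  have r2 : Reach x V (rowsWord R) (readCols E) (fun j => atRows α R a b d j + 1) w.length
      (fun j => atRows α R a b d j + 1 + w.length) := by
    refine ⟨w.length, le_rfl, fun v hv => ?_⟩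
    obtain ⟨σ, hσ, hl, hex⟩ := readCols_exec_complete hcol hv
    exact ⟨σ, ⟨w, hw, hσ⟩, hl, hex⟩
  have hend : ∀ {e : ℕ} (he : e < R.length), w.length = R[e].length → ∀ c,
      content (rowsWord (α := α) R) ((rowPos (α := α) R e : ℤ) + 1 + w.length) ≠ .row c := by
    intro e he hl c
    have := content_rowPos_ne_row (α := α) (R := R) (a := e + 1) he c
    rw [rowPos_succ he, ← hl] at this
    push_cast at this
    exact this
  have r3 : Reach x V (rowsWord R)
      (tick (fun r => r 0 = .blank ∧ ∀ j, j ≠ 0 → ¬ ∃ c, r j = .row c) (fun _ => some .left))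
      (fun j => atRows α R a b d j + 1 + w.length) 1
      (fun j => atRows α R a b d j + ((w.length - 0 : ℕ) : ℤ)) := by
    refine Reach.tick ⟨?_, ?_⟩ ?_
    · change content (x.map .inp) ((-1 : ℤ) + 1 + w.length) = Cell.blank
      have e : (-1 : ℤ) + 1 + w.length = w.length := by ring
      rw [e]
      exact content_of_le (by simpa using h0)
    · intro j hj
      rintro ⟨c, hc⟩
      fin_cases j
      · exact hj rfl
      · exact hend ha h1 c hc
      · exact hend hb h2 c hc
      · exact hend hd h3 c hc
    · rw [moved_const]
      funext j
      simp only [disp, Nat.sub_zero]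
      ring
  have r4 := Reach.kstar (x := x) (V := V) (W := rowsWord R)
    (P := tick (fun r => ∃ c, r 1 = .row c) (fun _ => some .left)) (T := 1) (m := w.length)
    (fun i j => atRows α R a b d j + ((w.length - i : ℕ) : ℤ)) ?_
  · have r5 : Reach x V (rowsWord R) (tick (fun r => r 1 = .sep) (fun _ => none))
        (fun j => atRows α R a b d j + ((w.length - w.length : ℕ) : ℤ)) 1
        (atRows α R a b d) := by
      refine Reach.tick ?_ ?_
      · change content _ ((rowPos (α := α) R a : ℤ) + ((w.length - w.length : ℕ) : ℤ)) = _
        rw [Nat.sub_self, Nat.cast_zero, add_zero]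
        exact content_rowPos ha
      · rw [moved_none]
        simp
    refine (r1.mul (r2.mul (r3.mul (r4.mul r5)))).mono ?_
    have := row_length_lt (α := α) ha
    omega
  · intro i hi
    obtain ⟨z, hz⟩ : ∃ z, w.length - i = z + 1 := ⟨w.length - i - 1, by omega⟩
    have hz' : w.length - (i + 1) = z := by omega
    refine Reach.tick ⟨R[a][z]'(by omega), ?_⟩ ?_
    · change content _ ((rowPos (α := α) R a : ℤ) + ((w.length - i : ℕ) : ℤ)) = _
      have e : ((rowPos (α := α) R a : ℤ) + ((w.length - i : ℕ) : ℤ)) =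
          (rowPos (α := α) R a : ℤ) + 1 + z := by
        rw [hz]
        push_cast
        ring
      rw [e]
      exact content_rowPos_add ha (by omega)
    · rw [moved_const]
      funext j
      simp only [disp]
      rw [hz', hz]
      push_cast
      ring

/-! ### The loops -/

theorem update_atRows_one (a b d p : ℕ) :
    Function.update (atRows α R a b d) 1 (rowPos (α := α) R p : ℤ) = atRows α R p b d := by
  funext j
  fin_cases j <;> rfl

theorem update_atRows_two (a b d p : ℕ) :
    Function.update (atRows α R a b d) 2 (rowPos (α := α) R p : ℤ) = atRows α R a p d := by
  funext j
  fin_cases j <;> rfl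

theorem update_atRows_three (a b d p : ℕ) :
    Function.update (atRows α R a b d) 3 (rowPos (α := α) R p : ℤ) = atRows α R a b p := by
  funext j
  fin_cases j <;> rfl

theorem rewind_three_sound {a b d : ℕ} (hd : d < R.length) :
    Sound x V (rowsWord R) (rewind 3) (atRows α R a b d) fun h' => h' = atRows α R a b 0 := by
  have := rowPos_lt (α := α) hd
  have h := rewind_sound (x := x) (V := V) (h := atRows α R a b d) (R := R) (j := 3) (by simp)
    (p := (rowPos (α := α) R d : ℤ)) (by omega) (by omega)
  rw [update_atRows_three] at h
  refine h.mono ?_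
  rintro _ rfl
  exact update_atRows_three a b d 0

theorem rewind_three_reach {a b d : ℕ} (hd : d < R.length) :
    Reach x V (rowsWord R) (rewind 3) (atRows α R a b d) ((rowsWord (α := α) R).length + 2)
      (atRows α R a b 0) := by
  have := rowPos_lt (α := α) hd
  have h := rewind_reach (x := x) (V := V) (h := atRows α R a b d) (R := R) (j := 3) (by simp)
    (p := (rowPos (α := α) R d : ℤ)) (by omega) (by omega)
  rw [update_atRows_three] at h
  have e := update_atRows_three (α := α) (R := R) a b d 0
  rw [rowPos_zero, Nat.cast_zero] at e
  rwa [e] at h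

/-- The number of iterations of `advance 3` is free; it is the guess of `r₃`. Tape 3 is rewound
afterwards, so that the guess for the next second row is independent. -/
theorem chooseAndCheck_sound {a b : ℕ} (ha : a ≤ R.length) (hb : b ≤ R.length) :
    Sound x V (rowsWord R) (chooseAndCheck E) (atRows α R a b 0) fun h' =>
      h' = atRows α R a (b + 1) 0 ∧ ∃ (ha : a < R.length) (hb : b < R.length),
        ∃ r ∈ R, Holds x E R[a] R[b] r := by
  refine Sound.mul (φ := fun h' => ∃ d ≤ R.length, h' = atRows α R a b d)
    (Sound.kstar _ ⟨0, Nat.zero_le _, rfl⟩ ?_) ?_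
  · rintro _ ⟨d, hd, rfl⟩
    refine (advance_sound (j := 3) (by simp) hd rfl).mono ?_
    rintro _ ⟨hd', rfl⟩
    exact ⟨d + 1, hd', update_atRows_three _ _ _ _⟩
  rintro _ ⟨d, hd, rfl⟩
  refine Sound.mul (checkCols_sound ha hb hd) ?_
  rintro _ ⟨rfl, ha, hb, hd, hE⟩
  refine Sound.mul (rewind_three_sound hd) ?_
  rintro _ rfl
  refine (advance_sound (j := 2) (by simp) hb.le rfl).mono ?_
  rintro _ ⟨-, rfl⟩
  exact ⟨update_atRows_two _ _ _ _, ha, hb, R[d], List.getElem_mem hd, hE⟩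

theorem chooseAndCheck_reach {a b d : ℕ} (ha : a < R.length) (hb : b < R.length)
    (hd : d < R.length) (hE : Holds x E R[a] R[b] R[d]) {Z : ℕ}
    (hZ : (rowsWord (α := α) R).length + 10 ≤ Z) :
    Reach x V (rowsWord R) (chooseAndCheck E) (atRows α R a b 0) (Z * Z + 4 * Z)
      (atRows α R a (b + 1) 0) := by
  have r1 := Reach.kstar (x := x) (V := V) (W := rowsWord R) (P := advance 3) (T := Z) (m := d)
    (fun i => atRows α R a b i) fun i hi => by
      have := advance_reach (x := x) (V := V) (h := atRows α R a b i) (R := R) (j := 3) (by simp)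
        (hi.trans hd) rfl
      rw [update_atRows_three] at this
      exact this.mono (by omega)
  have r2 := checkCols_reach (V := V) ha hb hd hE
  have r3 := rewind_three_reach (x := x) (V := V) (a := a) (b := b) hd
  have r4 := advance_reach (x := x) (V := V) (h := atRows α R a b 0) (R := R) (j := 2) (by simp)
    hb rfl
  rw [update_atRows_two] at r4
  -- Choosing `r₃` takes at most `Z` advances of cost `Z`; the check, the rewinding and the last
  -- advance take at most `4 * Z` together.
  refine (r1.mul (r2.mul (r3.mul r4))).mono ?_
  have h1 : d * Z ≤ Z * Z := by
    refine Nat.mul_le_mul_right _ ?_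
    have := length_le_rowsWord (α := α) (R := R)
    omega
  omega

/-- The loop moves the second row on by one in each round and can be left only at the blank behind
the last row. Hence every second row has been checked. -/
theorem innerLoop_sound {a : ℕ} (ha : a ≤ R.length) :
    Sound x V (rowsWord R) (innerLoop E) (atRows α R a 0 0) fun h' =>
      h' = atRows α R a 0 0 ∧ ∀ b (hb : b < R.length), ∃ ha : a < R.length,
        ∃ r ∈ R, Holds x E R[a] R[b] r := by
  refine Sound.mul (φ := fun h' => ∃ b ≤ R.length, h' = atRows α R a b 0 ∧
    ∀ b' (hb : b' < R.length), b' < b → ∃ ha : a < R.length, ∃ r ∈ R, Holds x E R[a] R[b'] r)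
    (Sound.kstar _ ⟨0, Nat.zero_le _, rfl, fun b' _ h => by omega⟩ ?_) ?_
  · rintro _ ⟨b, hb, rfl, hprev⟩
    refine (chooseAndCheck_sound ha hb).mono ?_
    rintro _ ⟨rfl, ha', hb', hr⟩
    refine ⟨b + 1, hb', rfl, fun b' hb'' hlt => ?_⟩
    rcases Nat.lt_succ_iff_lt_or_eq.1 hlt with h | rfl
    · exact hprev b' hb'' h
    · exact ⟨ha', hr⟩
  · rintro _ ⟨b, hb, rfl, hprev⟩
    refine (endRewind_sound (j := 2) (by simp) hb rfl).mono ?_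
    rintro _ ⟨rfl, rfl⟩
    exact ⟨update_atRows_two a _ 0 0, fun b hb => hprev b hb hb⟩

theorem innerLoop_reach {a : ℕ} (ha : a < R.length)
    (hE : ∀ b (hb : b < R.length), ∃ r ∈ R, Holds x E R[a] R[b] r) {Z : ℕ}
    (hZ : (rowsWord (α := α) R).length + 10 ≤ Z) :
    Reach x V (rowsWord R) (innerLoop E) (atRows α R a 0 0) (Z * (Z * Z + 4 * Z) + Z)
      (atRows α R a 0 0) := by
  have r1 := Reach.kstar (x := x) (V := V) (W := rowsWord R) (P := chooseAndCheck E)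
    (T := Z * Z + 4 * Z) (m := R.length) (fun i => atRows α R a i 0) fun i hi => by
      obtain ⟨r, hr, hE⟩ := hE i hi
      obtain ⟨d, hd, rfl⟩ := List.getElem_of_mem hr
      exact chooseAndCheck_reach ha hi hd hE hZ
  have r2 := endRewind_reach (x := x) (V := V) (h := atRows α R a R.length 0) (R := R) (j := 2)
    (by simp) rfl
  have e := update_atRows_two (α := α) (R := R) a R.length 0 0
  rw [rowPos_zero, Nat.cast_zero] at e
  rw [e] at r2
  refine (r1.mul r2).mono ?_
  have := length_le_rowsWord (α := α) (R := R)
  exact Nat.add_le_add (Nat.mul_le_mul_right _ (by omega)) (by omega)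

theorem outerLoop_sound :
    Sound x V (rowsWord R) (outerLoop E) (atRows α R 0 0 0) fun h' =>
      h' = atRows α R 0 0 0 ∧ ∀ r₁ ∈ R, ∀ r₂ ∈ R, ∃ r₃ ∈ R, Holds x E r₁ r₂ r₃ := by
  refine Sound.mul (φ := fun h' => ∃ a ≤ R.length, h' = atRows α R a 0 0 ∧
    ∀ a' (_ : a' < R.length), a' < a → ∀ b (_ : b < R.length), ∃ r ∈ R, Holds x E R[a'] R[b] r)
    (Sound.kstar _ ⟨0, Nat.zero_le _, rfl, fun b' _ h => by omega⟩ ?_) ?_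
  · rintro _ ⟨a, ha, rfl, hprev⟩
    refine Sound.mul (innerLoop_sound ha) ?_
    rintro _ ⟨rfl, hr⟩
    refine (advance_sound (j := 1) (by simp) ha rfl).mono ?_
    rintro _ ⟨ha', rfl⟩
    refine ⟨a + 1, ha', update_atRows_one _ _ _ _, fun a' ha'' hlt => ?_⟩
    rcases Nat.lt_succ_iff_lt_or_eq.1 hlt with h | rfl
    · exact hprev a' ha'' h
    · exact fun b hb => (hr b hb).2
  · rintro _ ⟨a, ha, rfl, hprev⟩
    refine (endRewind_sound (j := 1) (by simp) ha rfl).mono ?_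
    rintro _ ⟨rfl, rfl⟩
    refine ⟨update_atRows_one _ 0 0 0, fun r₁ h₁ r₂ h₂ => ?_⟩
    obtain ⟨a, ha, rfl⟩ := List.getElem_of_mem h₁
    obtain ⟨b, hb, rfl⟩ := List.getElem_of_mem h₂
    exact hprev a ha ha b hb

theorem outerLoop_reach (hE : ∀ r₁ ∈ R, ∀ r₂ ∈ R, ∃ r₃ ∈ R, Holds x E r₁ r₂ r₃) {Z : ℕ}
    (hZ : (rowsWord (α := α) R).length + 10 ≤ Z) :
    Reach x V (rowsWord R) (outerLoop E) (atRows α R 0 0 0)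
      (Z * (Z * (Z * Z + 4 * Z) + Z + Z) + Z) (atRows α R 0 0 0) := by
  have r1 := Reach.kstar (x := x) (V := V) (W := rowsWord R) (P := innerLoop E * advance 1)
    (T := Z * (Z * Z + 4 * Z) + Z + Z) (m := R.length) (fun i => atRows α R i 0 0) fun i hi => by
      have h1 := innerLoop_reach (V := V) hi
        (fun b hb => hE _ (List.getElem_mem hi) _ (List.getElem_mem hb)) hZ
      have h2 := advance_reach (x := x) (V := V) (h := atRows α R i 0 0) (R := R) (j := 1)
        (by simp) hi rfl
      rw [update_atRows_one] at h2
      exact (h1.mul h2).mono (by omega)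
  have r2 := endRewind_reach (x := x) (V := V) (h := atRows α R R.length 0 0) (R := R) (j := 1)
    (by simp) rfl
  have e := update_atRows_one (α := α) (R := R) R.length 0 0 0
  rw [rowPos_zero, Nat.cast_zero] at e
  rw [e] at r2
  refine (r1.mul r2).mono ?_
  have := length_le_rowsWord (α := α) (R := R)
  exact Nat.add_le_add (Nat.mul_le_mul_right _ (by omega)) (by omega)

theorem verify_sound (cs : List (Language (Col α Γ))) :
    Sound x V (rowsWord R) (verify cs) (atRows α R 0 0 0) fun _ =>
      ∀ E ∈ cs, ∀ r₁ ∈ R, ∀ r₂ ∈ R, ∃ r₃ ∈ R, Holds x E r₁ r₂ r₃ := by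
  induction cs with
  | nil =>
    intro v t s' h
    obtain ⟨-, rfl⟩ := run_one.1 h
    exact ⟨v, _, rfl, by simp⟩
  | cons E cs ih =>
    refine Sound.mul outerLoop_sound ?_
    rintro _ ⟨rfl, hE⟩
    refine ih.mono fun h' hcs E' hE' => ?_
    rcases List.mem_cons.1 hE' with rfl | hE'
    · exact hE
    · exact hcs E' hE'

theorem verify_reach {cs : List (Language (Col α Γ))}
    (hE : ∀ E ∈ cs, ∀ r₁ ∈ R, ∀ r₂ ∈ R, ∃ r₃ ∈ R, Holds x E r₁ r₂ r₃) {Z : ℕ}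
    (hZ : (rowsWord (α := α) R).length + 10 ≤ Z) :
    Reach x V (rowsWord R) (verify cs) (atRows α R 0 0 0)
      (cs.length * (Z * (Z * (Z * Z + 4 * Z) + Z + Z) + Z)) (atRows α R 0 0 0) := by
  induction cs with
  | nil => exact ⟨0, Nat.zero_le _, fun v _ => run_one.2 ⟨rfl, rfl⟩⟩
  | cons E cs ih =>
    have h1 := outerLoop_reach (V := V) (hE E (by simp)) hZ
    have h2 := ih fun E' hE' => hE E' (by simp [hE'])
    refine (h1.mul h2).mono ?_
    generalize Z * (Z * (Z * Z + 4 * Z) + Z + Z) + Z = T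
    rw [List.length_cons, add_mul, one_mul, add_comm]

/-! ### Guessing -/

section Guess

variable {W : List (Cell α Γ)}

/-- The heads are at the left end of the input and at the same position `p` of the row tapes. -/
def sameHeads (p : ℤ) : Fin 4 → ℤ := ![-1, p, p, p]

theorem update_content_append (W : List (Cell α Γ)) (c : Cell α Γ) :
    Function.update (content W) (W.length : ℤ) c = content (W ++ [c]) := by
  funext i
  rcases eq_or_ne i (W.length : ℤ) with rfl | hi
  · rw [Function.update_self, content_of_lt (l := W ++ [c]) (i := W.length) (by simp)]
    simp
  · rw [Function.update_of_ne hi]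
    rcases lt_trichotomy i (W.length : ℤ) with h | h | h
    · rcases lt_or_ge i 0 with h0 | h0
      · rw [content_of_neg h0, content_of_neg h0]
      · obtain ⟨n, rfl⟩ := Int.eq_ofNat_of_zero_le h0
        have hn : n < W.length := by exact_mod_cast h
        rw [content_of_lt hn, content_of_lt (by simp; omega), List.getElem_append_left hn]
    · exact absurd h hi
    · rw [content_of_le h.le, content_of_le (by simp; omega)]

theorem run_tickWrite {c : Cell α Γ} {v t : ℕ} {s' : Fin 9 → TapeState (Cell α Γ)} :
    Run (tickWrite c) (mainState x V W v (sameHeads W.length)) t s' ↔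
      t = 1 ∧ 1 ≤ v ∧ v ≤ V ∧ s' = mainState x V (W ++ [c]) (v - 1)
        (sameHeads (W ++ [c]).length) := by
  have heff : ∀ v : ℕ, effect ![none, some c, some c, some c, none, none, none, none, none]
      ![none, some .right, some .right, some .right, some .left, none, none, none, none]
      (mainState x V W (v + 1) (sameHeads W.length)) =
      mainState x V (W ++ [c]) v (sameHeads (W ++ [c]).length) := by
    intro v
    simp only [mainState, sameHeads]
    rw [effect_vec]
    simp [update_content_append]
  have hscan : ∀ v : ℕ, scan (mainState x V W v (sameHeads W.length)) 4 =
      marks V ((v : ℤ) - 1) := fun v => rfl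
  rw [tickWrite, run_op, hscan]
  constructor
  · rintro ⟨rfl, h4, rfl⟩
    cases v with
    | zero =>
      rw [Nat.cast_zero, zero_sub, marks_neg_one] at h4
      cases h4
    | succ v =>
      refine ⟨rfl, by omega, ?_, heff v⟩
      by_contra hlt
      rw [marks_of_le (by push_cast; omega)] at h4
      cases h4
  · rintro ⟨rfl, h1, h2, rfl⟩
    obtain ⟨v, rfl⟩ := Nat.exists_eq_add_of_le' h1
    refine ⟨rfl, ?_, (heff v).symm⟩
    have : ((v + 1 : ℕ) : ℤ) - 1 = v := by push_cast; ring
    rw [this]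
    exact marks_of_lt (by omega)

/-- A separator opens an empty row and a row symbol extends the last row. So after a first
separator, whatever is guessed is the word of a nonempty list of rows, and its form need not be
checked. -/
theorem exists_rows_snoc {R : List (List Γ)} (hR : R ≠ []) (c : Option Γ) :
    ∃ R' : List (List Γ), R' ≠ [] ∧
      (rowsWord R' : List (Cell α Γ)) = rowsWord R ++ [c.elim .sep .row] := by
  cases c with
  | none => exact ⟨R ++ [[]], by simp, by simp [rowsWord]⟩
  | some c =>
    obtain ⟨S, r, rfl⟩ : ∃ S r, R = S ++ [r] :=
      ⟨R.dropLast, R.getLast hR, (List.dropLast_append_getLast hR).symm⟩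
    exact ⟨S ++ [r ++ [c]], by simp, by simp [rowsWord]⟩

theorem rowsWord_eq_cons {R : List (List Γ)} (hR : R ≠ []) :
    ∃ u : List (Option Γ),
      (rowsWord R : List (Cell α Γ)) = .sep :: u.map fun c => c.elim .sep .row := by
  obtain ⟨r, R, rfl⟩ := List.exists_cons_of_ne_nil hR
  clear hR
  induction R using List.reverseRecOn with
  | nil =>
    refine ⟨r.map some, ?_⟩
    simp [rowsWord, Function.comp_def]
  | append_singleton S s ih =>
    obtain ⟨u, hu⟩ := ih
    refine ⟨u ++ none :: s.map some, ?_⟩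
    rw [← List.cons_append, rowsWord_append, hu]
    simp [rowsWord, Function.comp_def]

theorem moved_rowHeads (d : Dir) (p : ℤ) :
    moved (rowHeads d) (sameHeads p) = sameHeads (p + disp (some d)) := by
  funext j
  fin_cases j <;> simp [moved, rowHeads, sameHeads, disp]

theorem rewindAll_sound {p : ℤ} (hp : -1 ≤ p) (hp' : p < (rowsWord (α := α) R).length) :
    Sound x V (rowsWord R) ((tick (fun r => r 1 ≠ .blank) (rowHeads .left))∗
      * tick (fun r => r 1 = .blank) (rowHeads .right)) (sameHeads p)
      fun h' => h' = sameHeads 0 := by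
  refine Sound.mul (φ := fun h' => ∃ q : ℤ, -1 ≤ q ∧ q < (rowsWord (α := α) R).length ∧
    h' = sameHeads q) (Sound.kstar _ ⟨p, hp, hp', rfl⟩ ?_) ?_
  · rintro _ ⟨q, hq, hq', rfl⟩
    refine Sound.tick ?_
    intro hne
    have : q ≠ -1 := by
      rintro rfl
      exact hne ((content_of_neg (l := rowsWord R) (i := (-1 : ℤ)) (by norm_num) :
        content (rowsWord R) (-1) = (.blank : Cell α Γ)))
    exact ⟨q - 1, by omega, by omega, moved_rowHeads _ _⟩
  · rintro _ ⟨q, hq, hq', rfl⟩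
    refine Sound.tick ?_
    intro hb
    obtain rfl | hq0 : q = -1 ∨ 0 ≤ q := by omega
    · exact moved_rowHeads _ _
    · obtain ⟨n, rfl⟩ := Int.eq_ofNat_of_zero_le hq0
      exact absurd hb (rowsWord_ne_blank (by exact_mod_cast hq'))

theorem rewindAll_reach {n : ℕ} (hn : n ≤ (rowsWord (α := α) R).length) :
    Reach x V (rowsWord R) ((tick (fun r => r 1 ≠ .blank) (rowHeads .left))∗
      * tick (fun r => r 1 = .blank) (rowHeads .right)) (sameHeads ((n : ℤ) - 1)) (n + 1)
      (sameHeads 0) := by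
  have h2 := Reach.kstar (x := x) (V := V) (W := rowsWord R)
    (P := tick (fun r => r 1 ≠ .blank) (rowHeads .left)) (T := 1) (m := n)
    (fun i => sameHeads ((n : ℤ) - 1 - i)) ?_
  · have h3 : Reach x V (rowsWord R) (tick (fun r => r 1 = .blank) (rowHeads .right))
        (sameHeads ((n : ℤ) - 1 - n)) 1 (sameHeads 0) := by
      refine Reach.tick ?_ ?_
      · exact content_of_neg (i := (n : ℤ) - 1 - n) (by omega)
      · rw [moved_rowHeads]
        simp [disp]
    have h4 := h2.mul h3
    rw [Nat.cast_zero, sub_zero] at h4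
    exact h4.mono (by omega)
  · intro i hi
    refine Reach.tick ?_ ?_
    · change content _ ((n : ℤ) - 1 - i) ≠ _
      have e : (n : ℤ) - 1 - i = ((n - 1 - i : ℕ) : ℤ) := by omega
      rw [e]
      exact rowsWord_ne_blank (by omega)
    · rw [moved_rowHeads]
      congr 1
      simp only [disp]
      push_cast
      ring

theorem guess_sound {v t : ℕ} {s' : Fin 9 → TapeState (Cell α Γ)}
    (h : Run guess (mainState x V [] v (sameHeads 0)) t s') :
    ∃ R : List (List Γ), R ≠ [] ∧ ∃ v', s' = mainState x V (rowsWord R) v' (sameHeads 0) := by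
  obtain ⟨_, _, s₁, -, h₁, h₂⟩ := run_mul.1 h
  obtain ⟨-, -, -, rfl⟩ := run_tickWrite.1 h₁
  obtain ⟨_, _, s₂, -, h₃, h₄⟩ := run_mul.1 h₂
  have hinv := run_kstar_induction (Inv := fun s => ∃ R : List (List Γ), R ≠ [] ∧ ∃ v',
    s = mainState x V (rowsWord R) v' (sameHeads (rowsWord (α := α) R).length)) ?_ h₃
    ⟨[[]], by simp, v - 1, rfl⟩
  · obtain ⟨R, hR, v', rfl⟩ := hinv
    refine ⟨R, hR, ?_⟩
    have key : Sound x V (rowsWord R) (tick (fun _ => True) (rowHeads .left)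
        * ((tick (fun r => r 1 ≠ .blank) (rowHeads .left))∗
        * tick (fun r => r 1 = .blank) (rowHeads .right)))
        (sameHeads (rowsWord (α := α) R).length) fun h' => h' = sameHeads 0 := by
      refine Sound.mul (φ := fun h' => h' = sameHeads (((rowsWord (α := α) R).length : ℤ) - 1))
        (Sound.tick fun _ => moved_rowHeads _ _) ?_
      rintro _ rfl
      exact rewindAll_sound (by omega) (by omega)
    obtain ⟨v'', h', e, rfl⟩ := key _ _ _ h₄
    exact ⟨v'', e⟩
  · rintro _ t s' ⟨R, hR, v', rfl⟩ hr
    obtain ⟨c, hc⟩ := run_iUnion.1 hr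
    obtain ⟨-, -, -, rfl⟩ := run_tickWrite.1 hc
    obtain ⟨R', hR', e⟩ := exists_rows_snoc (α := α) hR c
    exact ⟨R', hR', v' - 1, by rw [e]⟩

theorem guess_reach (hR : R ≠ []) : ∃ t ≤ 2 * (rowsWord (α := α) R).length + 2, ∀ v, v + t ≤ V →
    Run guess (mainState x V [] (v + t) (sameHeads 0)) t
      (mainState x V (rowsWord R) v (sameHeads 0)) := by
  obtain ⟨u, hu⟩ := rowsWord_eq_cons (α := α) hR
  have h1 : ∀ (u : List (Option Γ)) v, v + u.length ≤ V →
      Run (Language.ofPred fun σ => ∃ c : Option Γ, σ ∈ tickWrite (α := α) (c.elim .sep .row))∗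
      (mainState x V [.sep] (v + u.length) (sameHeads ([.sep] : List (Cell α Γ)).length)) u.length
      (mainState x V (.sep :: u.map fun c => c.elim .sep .row) v
        (sameHeads ((.sep : Cell α Γ) :: u.map fun c => c.elim .sep .row).length)) := by
    intro u
    induction u using List.reverseRecOn with
    | nil => exact fun v _ => run_kstar_zero _
    | append_singleton u c ih =>
      intro v hv
      simp only [List.length_append, List.length_singleton] at hv
      have e1 := ih (v + 1) (by omega)
      have e2 : Run (Language.ofPred fun σ => ∃ c : Option Γ,
            σ ∈ tickWrite (α := α) (c.elim .sep .row))
          (mainState x V (.sep :: u.map fun c : Option Γ => c.elim .sep .row) (v + 1)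
            (sameHeads ((.sep : Cell α Γ) :: u.map fun c => c.elim .sep .row).length)) 1
          (mainState x V ((.sep :: u.map fun c : Option Γ => c.elim .sep .row) ++
              [(c.elim .sep .row : Cell α Γ)]) v
            (sameHeads (((.sep : Cell α Γ) :: u.map fun c : Option Γ => c.elim .sep .row) ++
              [(c.elim .sep .row : Cell α Γ)]).length)) :=
        run_iUnion.2 ⟨c, run_tickWrite.2 ⟨rfl, by omega, by omega, rfl⟩⟩
      have e3 := run_kstar_snoc e1 e2
      rw [List.map_append, ← List.cons_append, List.length_append]
      have e4 : v + (u.length + [c].length) = v + 1 + u.length := by simp; omega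
      rw [e4]
      exact e3
  have r2 : Reach x V (rowsWord R) (tick (fun _ => True) (rowHeads .left)
      * ((tick (fun r => r 1 ≠ .blank) (rowHeads .left))∗
      * tick (fun r => r 1 = .blank) (rowHeads .right)))
      (sameHeads (rowsWord (α := α) R).length) (1 + ((rowsWord (α := α) R).length + 1))
      (sameHeads 0) :=
    Reach.mul (Reach.tick trivial (moved_rowHeads _ _)) (rewindAll_reach le_rfl)
  obtain ⟨t₂, ht₂, r2⟩ := r2
  have hl : (rowsWord (α := α) R).length = u.length + 1 := by
    rw [hu]
    simp
  refine ⟨1 + (u.length + t₂), by omega, fun v hv => ?_⟩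
  refine run_mul.2 ⟨1, u.length + t₂, _, rfl, run_tickWrite.2 ⟨rfl, by omega, by omega, rfl⟩, ?_⟩
  have e1 := h1 u (v + t₂) (by omega)
  have e2 := r2 v (by omega)
  have e3 : v + (1 + (u.length + t₂)) - 1 = v + t₂ + u.length := by omega
  rw [e3]
  rw [hu] at e2 ⊢
  exact run_mul.2 ⟨_, _, _, rfl, e1, e2⟩

end Guess

/-! ### Nondeterministic exponential time -/

/-- Languages that have certificates in the form of lists of rows of exponential size, with
conditions of the form `∀ r₁ r₂, ∃ r₃, …` on the columns, are in NExpTime. -/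
theorem inNExpTime_of_rows [Finite α] [Finite Γ] [Nonempty Γ] (cs : List (Language (Col α Γ)))
    (hcs : ∀ E ∈ cs, E.IsRegular) (L : Language α) (k : ℕ)
    (hsound : ∀ x (R : List (List Γ)), R ≠ [] →
      (∀ E ∈ cs, ∀ r₁ ∈ R, ∀ r₂ ∈ R, ∃ r₃ ∈ R, Holds x E r₁ r₂ r₃) → x ∈ L)
    (hcomplete : ∀ x ∈ L, x ≠ [] ∧ ∃ R : List (List Γ), R ≠ [] ∧
      R.length ≤ k ^ x.length ^ 3 ∧ (∀ r ∈ R, r.length ≤ k ^ x.length ^ 3) ∧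
      ∀ E ∈ cs, ∀ r₁ ∈ R, ∀ r₂ ∈ R, ∃ r₃ ∈ R, Holds x E r₁ r₂ r₃) :
    InNExpTime L := by
  -- With `K = (k + 1) ^ N ^ 3`, the word of rows has length at most `K * (K + 1)`, so `Z ≤ 12 * K ^
  -- 2`. Guessing and verifying take at most `(5 * cs.length + 3) * Z ^ 4` steps, which is at most
  -- `c ^ N ^ 3`.
  set c := (5 * cs.length + 3) * (12 * (k + 1)) ^ 8 with hc
  -- This is the exponent of `buildTime_le`, where `3 * (4 * N + 2) + N + 5 = 13 * N + 11`.
  set p : Polynomial ℕ := Polynomial.C (c + 1) * Polynomial.X ^ 3 +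
    Polynomial.C 13 * Polynomial.X + Polynomial.C 11 with hp
  have hinp : Function.Injective (Cell.inp : α → Cell α Γ) := fun a b h => Cell.inp.inj h
  have hstate : ∀ x : List α, (clockState (content (x.map .inp), -1)
      (marks ((c + 1) ^ x.length ^ 3), (((c + 1) ^ x.length ^ 3 : ℕ) : ℤ) - 1) (marks 0, 0)
      (marks x.length, 0) (marks x.length, 0) (marks x.length, 0) :
        Fin 9 → TapeState (Cell α Γ)) =
      mainState x ((c + 1) ^ x.length ^ 3) [] ((c + 1) ^ x.length ^ 3) (sameHeads 0) := by
    intro x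
    simp only [clockState, mainState, content_nil]
    rfl
  have key := inNExpTime_fin (Cell.inp : α → Cell α Γ) hinp (by rintro a ⟨⟩)
    (buildClock c * (guess * verify cs) : Prog α Γ)
    ((buildClock_isRegular c).mul (guess_isRegular.mul (verify_isRegular hcs))) p ?_
  · convert key using 1
    ext x
    rw [Language.mem_ofPred]
    constructor
    · intro hx
      obtain ⟨hx0, R, hR, hlen, hrow, hE⟩ := hcomplete x hx
      obtain ⟨t₁, h₁⟩ := (buildClock_det (Γ := Γ) c x).1
      rw [hstate] at h₁
      set V := (c + 1) ^ x.length ^ 3 with hV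
      obtain ⟨t₂, ht₂, h₂⟩ := guess_reach (x := x) (V := V) hR
      obtain ⟨t₃, ht₃, h₃⟩ := verify_reach (V := V) hE le_rfl
      -- As the exponent is positive, constant factors can be moved into the base of the power.
      have hN : 1 ≤ x.length ^ 3 := Nat.one_le_pow _ _ (List.length_pos_iff.2 hx0)
      have hlt : t₂ + t₃ ≤ V := by
        set K := (k + 1) ^ x.length ^ 3 with hK
        have hkK : k ^ x.length ^ 3 ≤ K := Nat.pow_le_pow_left (by omega) _
        have hK1 : 1 ≤ K := Nat.one_le_pow _ _ (by omega)
        have hW : (rowsWord (α := α) R).length ≤ K * (K + 1) := by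
          have : ∀ S : List (List Γ), (∀ r ∈ S, r.length ≤ K) →
              (rowsWord (α := α) S).length ≤ S.length * (K + 1) := by
            intro S hS
            induction S with
            | nil => simp [rowsWord]
            | cons r S ih =>
              have e : (rowsWord (r :: S) : List (Cell α Γ)) =
                  (.sep :: r.map .row) ++ rowsWord S := List.flatMap_cons
              have := ih fun r' hr' => hS r' (by simp [hr'])
              have := hS r (by simp)
              rw [e, List.length_append, List.length_cons, List.length_map, List.length_cons,
                Nat.succ_mul]
              omega
          exact (this R fun r hr => (hrow r hr).trans hkK).trans
            (Nat.mul_le_mul_right _ (hlen.trans hkK))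
        set Z := (rowsWord (α := α) R).length + 10 with hZ
        have hZ1 : Z ≤ 12 * K ^ 2 := by nlinarith
        have hZ2 : 10 ≤ Z := by omega
        have h5 : t₂ + t₃ ≤ (5 * cs.length + 3) * Z ^ 4 := by
          have e1 : Z * (Z * (Z * Z + 4 * Z) + Z + Z) + Z = Z ^ 4 + 4 * Z ^ 3 + 2 * Z ^ 2 + Z := by
            ring
          have e2 : Z ^ 4 + 4 * Z ^ 3 + 2 * Z ^ 2 + Z ≤ 5 * Z ^ 4 := by
            have : 10 * Z ^ 3 ≤ Z ^ 4 := by rw [pow_succ Z 3]; nlinarith [Nat.zero_le (Z ^ 3)]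
            have : 10 * Z ^ 2 ≤ Z ^ 3 := by rw [pow_succ Z 2]; nlinarith [Nat.zero_le (Z ^ 2)]
            have : 10 * Z ≤ Z ^ 2 := by rw [pow_two]; nlinarith
            omega
          have e3 : Z ≤ Z ^ 4 := Nat.le_self_pow (by norm_num) Z
          have e4 := Nat.mul_le_mul_left cs.length e2
          rw [e1] at ht₃
          have e5 : (5 * cs.length + 3) * Z ^ 4 = cs.length * (5 * Z ^ 4) + 3 * Z ^ 4 := by ring
          omega
        have h6 : (5 * cs.length + 3) * Z ^ 4 ≤ c ^ x.length ^ 3 := by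
          have e1 : Z ^ 4 ≤ (12 ^ 4) * K ^ 8 := by
            calc Z ^ 4 ≤ (12 * K ^ 2) ^ 4 := Nat.pow_le_pow_left hZ1 4
              _ = _ := by ring
          have e2 : 5 * cs.length + 3 ≤ (5 * cs.length + 3) ^ x.length ^ 3 :=
            Nat.le_self_pow (by omega) _
          have e3 : 12 ^ 4 ≤ (12 ^ 8) ^ x.length ^ 3 :=
            (by norm_num : 12 ^ 4 ≤ 12 ^ 8).trans (Nat.le_self_pow (by omega) _)
          calc (5 * cs.length + 3) * Z ^ 4
              ≤ (5 * cs.length + 3) ^ x.length ^ 3 * ((12 ^ 8) ^ x.length ^ 3 * K ^ 8) :=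
                Nat.mul_le_mul e2 (e1.trans (Nat.mul_le_mul_right _ e3))
            _ = c ^ x.length ^ 3 := by
                rw [hK, hc, mul_pow, mul_pow 12 (k + 1) 8, mul_pow]
                congr 2
                rw [← pow_mul, ← pow_mul, mul_comm]
        exact h5.trans (h6.trans (Nat.pow_le_pow_left (by omega) _))
      have e0 : atRows α R 0 0 0 = sameHeads 0 := rfl
      rw [e0] at h₃
      refine ⟨_, _, run_mul.2 ⟨_, _, _, rfl, h₁, run_mul.2 ⟨t₂, t₃, _, rfl, ?_,
        h₃ (V - (t₂ + t₃)) (by omega)⟩⟩⟩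
      have := h₂ (V - (t₂ + t₃) + t₃) (by omega)
      have e1 : V - (t₂ + t₃) + t₃ + t₂ = V := by omega
      rwa [e1] at this
    · rintro ⟨t, s, h⟩
      obtain ⟨_, _, s₁, -, h₁, h₂⟩ := run_mul.1 h
      obtain rfl := (buildClock_det (Γ := Γ) c x).2 _ _ h₁
      rw [hstate] at h₂
      obtain ⟨_, _, s₂, -, h₃, h₄⟩ := run_mul.1 h₂
      obtain ⟨R, hR, v', rfl⟩ := guess_sound h₃
      obtain ⟨_, _, -, hE⟩ := verify_sound cs _ _ _ h₄
      exact hsound x R hR hE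
  · intro x
    have h1 := bounded_mul (buildClock_det (Γ := Γ) c x).3 (P' := guess * verify cs)
      (T₂ := (c + 1) ^ x.length ^ 3) ?_
    · refine h1.mono ((buildTime_le c x.length).trans ?_)
      refine Nat.pow_le_pow_right (by norm_num) ?_
      simp only [hp, Polynomial.eval_add, Polynomial.eval_mul, Polynomial.eval_C,
        Polynomial.eval_pow, Polynomial.eval_X]
      omega
    · intro t s₁ hs₁
      obtain rfl := (buildClock_det (Γ := Γ) c x).2 _ _ hs₁
      exact (clocked_guess.mul (clocked_verify cs)).bounded rfl

end TapeProgram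

/-! ## A logic for the columns of rows -/

/-- Formulas about infinite sequences of columns. -/
inductive ColFormula (β : Type) : Type
  /-- The first column has the property `A`. -/
  | first (A : β → Prop)
  /-- All pairs of consecutive columns are related by `A`. -/
  | all (A : β → β → Prop)
  /-- Some pair of consecutive columns is related by `A`. -/
  | ex (A : β → β → Prop)
  /-- Exactly one column has the property `A`. -/
  | one (A : β → Prop)
  | not (φ : ColFormula β)
  | and (φ ψ : ColFormula β)
  | or (φ ψ : ColFormula β)
  | imp (φ ψ : ColFormula β)

namespace ColFormula

open Language

variable {β : Type}

/-- Truth of a formula in a sequence of columns. -/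
def Sat (f : ℕ → β) : ColFormula β → Prop
  | first A => A (f 0)
  | all A => ∀ i, A (f i) (f (i + 1))
  | ex A => ∃ i, A (f i) (f (i + 1))
  | one A => ∃! i, A (f i)
  | not φ => ¬ φ.Sat f
  | and φ ψ => φ.Sat f ∧ ψ.Sat f
  | or φ ψ => φ.Sat f ∨ ψ.Sat f
  | imp φ ψ => φ.Sat f → ψ.Sat f

theorem sat_all {f : ℕ → β} {A : β → β → Prop} : (all A).Sat f ↔ ∀ i, A (f i) (f (i + 1)) := Iff.rfl

theorem sat_one {f : ℕ → β} {A : β → Prop} : (one A).Sat f ↔ ∃! i, A (f i) := Iff.rfl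

/-- The finite words that satisfy a formula when they are continued by the column `e`. -/
def language (e : β) (φ : ColFormula β) : Language β := ofPred fun w => φ.Sat fun i => w.getD i e

/-- The finite family plays the part of the states of a deterministic automaton. -/
theorem _root_.Language.IsRegular.of_forall_leftQuotient_mem {𝓕 : Set (Language β)}
    (h𝓕 : 𝓕.Finite) (h : ∀ L ∈ 𝓕, ∀ a, L.leftQuotient [a] ∈ 𝓕) {L : Language β} (hL : L ∈ 𝓕) :
    L.IsRegular := by
  refine .of_finite_range_leftQuotient (h𝓕.subset ?_)
  rintro _ ⟨x, rfl⟩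
  induction x generalizing L with
  | nil => exact hL
  | cons a x ih =>
    have := ih (h L hL a)
    rwa [← leftQuotient_append] at this

theorem mem_language {e : β} {φ : ColFormula β} {w : List β} :
    w ∈ language e φ ↔ φ.Sat fun i => w.getD i e := Iff.rfl

theorem language_first_isRegular (e : β) (A : β → Prop) : (language e (first A)).IsRegular := by
  refine .of_forall_leftQuotient_mem (𝓕 := {language e (first A), ⊤, 0}) (Set.toFinite _) ?_
    (by simp)
  rintro L (rfl | rfl | rfl) a
  · by_cases h : A a
    · right; left
      ext w
      exact ⟨fun _ => trivial, fun _ => h⟩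
    · right; right
      ext w
      exact ⟨fun h' => h h', fun h' => h'.elim⟩
  · right; left
    rfl
  · right; right
    rfl

/-- Only the last column has to be remembered: `K c` is the condition that remains after the column
`c`, and `0` is the state after a violation. -/
theorem language_all_isRegular [Finite β] (e : β) (A : β → β → Prop) :
    (language e (all A)).IsRegular := by
  set K : β → Language β := fun c => ofPred fun w =>
    A c (w.getD 0 e) ∧ ∀ i, A (w.getD i e) (w.getD (i + 1) e) with hK
  have key : ∀ (a : β) (w : List β), a :: w ∈ language e (all A) ↔ w ∈ K a := by
    intro a w
    rw [mem_language, sat_all, hK, mem_ofPred]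
    constructor
    · exact fun h => ⟨h 0, fun i => h (i + 1)⟩
    · rintro ⟨h0, h⟩ (_ | i)
      · exact h0
      · exact h i
  refine .of_forall_leftQuotient_mem (𝓕 := {language e (all A), 0} ∪ Set.range K)
    (Set.toFinite _) ?_ (by simp)
  rintro L ((rfl | rfl) | ⟨c, rfl⟩) a
  · exact Or.inr ⟨a, by ext w; exact (key a w).symm⟩
  · exact Or.inl (Or.inr rfl)
  · by_cases h : A c a
    · refine Or.inr ⟨a, ?_⟩
      ext w
      rw [mem_leftQuotient, ← key]
      exact ⟨fun h' => ⟨h, h'⟩, fun h' => h'.2⟩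
    · refine Or.inl (Or.inr ?_)
      ext w
      exact ⟨fun h' => h h'.1, fun h' => h'.elim⟩

/-- The three languages are the states in which no, one (`K`), or more than one column with the
property has been read. -/
theorem language_one_isRegular (e : β) (A : β → Prop) : (language e (one A)).IsRegular := by
  set K : Language β := ofPred fun w => ∀ i, ¬ A (w.getD i e) with hK
  refine .of_forall_leftQuotient_mem (𝓕 := {language e (one A), K, 0}) (Set.toFinite _) ?_
    (by simp)
  rintro L (rfl | rfl | rfl) a
  · by_cases h : A a
    · right; left
      ext w
      rw [mem_leftQuotient, mem_language, sat_one, hK, mem_ofPred]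
      constructor
      · intro h' i hi
        exact absurd (h'.unique (y₁ := 0) (y₂ := i + 1) h hi) (by simp)
      · intro h'
        refine ⟨0, h, ?_⟩
        rintro (_ | i) hi
        · rfl
        · exact absurd hi (h' i)
    · left
      ext w
      rw [mem_leftQuotient, mem_language, sat_one, mem_language, sat_one]
      constructor
      · rintro ⟨_ | i, hi, hu⟩
        · exact absurd hi h
        · exact ⟨i, hi, fun j hj => Nat.succ_injective (hu (j + 1) hj)⟩
      · rintro ⟨i, hi, hu⟩
        refine ⟨i + 1, hi, ?_⟩
        rintro (_ | j) hj
        · exact absurd hj h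
        · exact congrArg Nat.succ (hu j hj)
  · by_cases h : A a
    · right; right
      ext w
      exact ⟨fun h' => h' 0 h, fun h' => h'.elim⟩
    · right; left
      ext w
      constructor
      · exact fun h' i => h' (i + 1)
      · rintro h' (_ | i)
        · exact h
        · exact h' i
  · right; right
    rfl

theorem language_isRegular [Finite β] (e : β) (φ : ColFormula β) : (language e φ).IsRegular := by
  induction φ with
  | first A => exact language_first_isRegular e A
  | all A => exact language_all_isRegular e A
  | ex A =>
    have h : language e (ex A) = (language e (all fun a b => ¬ A a b))ᶜ := by
      ext w
      exact not_forall_not.symm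
    rw [h]
    exact (language_all_isRegular e _).compl
  | one A => exact language_one_isRegular e A
  | not φ ih => exact ih.compl
  | and φ ψ ih₁ ih₂ => exact ih₁.inf ih₂
  | or φ ψ ih₁ ih₂ => exact ih₁.add ih₂
  | imp φ ψ ih₁ ih₂ =>
    have h : language e (imp φ ψ) = (language e φ)ᶜ + language e ψ := by
      ext w
      exact imp_iff_not_or
    rw [h]
    exact ih₁.compl.add ih₂

end ColFormula

/-! ### From finite rows to sequences that are eventually constant -/

namespace TapeProgram

variable {α Γ : Type}

theorem getD_columns {x : List α} {r₁ r₂ r₃ : List Γ} {w : List (Col α Γ)}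
    (h : Columns x r₁ r₂ r₃ w) (e : Γ) (i : ℕ) :
    w.getD i (none, e, e, e) = (x[i]?, r₁.getD i e, r₂.getD i e, r₃.getD i e) := by
  obtain ⟨h, rfl, rfl, rfl⟩ := h
  obtain ⟨h1, h2⟩ := map_fst_eq_pad.1 h
  rcases lt_or_ge i w.length with hi | hi
  · simp [List.getD_eq_getElem?_getD, hi, ← h2 i hi]
  · have : x[i]? = none := by simp; omega
    simp [List.getD_eq_getElem?_getD, hi, this]

/-- The initial segment of a sequence, as a list. -/
def segment (ℓ : ℕ) (r : ℕ → Γ) : List Γ := (List.range ℓ).map r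

theorem getD_segment {ℓ : ℕ} {r : ℕ → Γ} {e : Γ} (h : ∀ i, ℓ ≤ i → r i = e) :
    (fun i => (segment ℓ r).getD i e) = r := by
  funext i
  rcases lt_or_ge i ℓ with hi | hi
  · simp [segment, List.getD_eq_getElem?_getD, hi]
  · simp [segment, List.getD_eq_getElem?_getD, hi, h i hi]

theorem columns_segment {x : List α} {ℓ : ℕ} (hx : x.length ≤ ℓ) (r₁ r₂ r₃ : ℕ → Γ) :
    Columns x (segment ℓ r₁) (segment ℓ r₂) (segment ℓ r₃)
      (segment ℓ fun i => (x[i]?, r₁ i, r₂ i, r₃ i)) := by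
  refine ⟨map_fst_eq_pad.2 ⟨by simpa [segment] using hx, fun i hi => ?_⟩, ?_, ?_, ?_⟩ <;>
    simp [segment]

/-- Languages that have certificates in the form of sets of rows of polynomial length, with
conditions of the form `∀ r₁ r₂, ∃ r₃, …` on the columns, are in NExpTime. -/
theorem inNExpTime_of_formulas [Finite α] [Finite Γ] (e : Γ) (cs : List (ColFormula (Col α Γ)))
    (L : Language α) (b : ℕ)
    (hsound : ∀ x (S : Set (ℕ → Γ)), S.Nonempty →
      (∀ φ ∈ cs, ∀ r₁ ∈ S, ∀ r₂ ∈ S, ∃ r₃ ∈ S, φ.Sat fun i => (x[i]?, r₁ i, r₂ i, r₃ i)) → x ∈ L)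
    (hcomplete : ∀ x ∈ L, x ≠ [] ∧ ∃ (ℓ : ℕ) (S : Set (ℕ → Γ)), x.length ≤ ℓ ∧
      ℓ ≤ b * x.length ^ 3 ∧ S.Nonempty ∧ (∀ r ∈ S, ∀ i, ℓ ≤ i → r i = e) ∧
      ∀ φ ∈ cs, ∀ r₁ ∈ S, ∀ r₂ ∈ S, ∃ r₃ ∈ S, φ.Sat fun i => (x[i]?, r₁ i, r₂ i, r₃ i)) :
    InNExpTime L := by
  have : Nonempty Γ := ⟨e⟩
  refine inNExpTime_of_rows (cs.map (ColFormula.language (none, e, e, e))) ?_ L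
    -- There are at most `Nat.card Γ ^ ℓ` rows, of length `ℓ ≤ 2 ^ ℓ`. Both numbers are at most
    -- `(Nat.card Γ + 2) ^ ℓ`, and `ℓ ≤ b * N ^ 3`.
    ((Nat.card Γ + 2) ^ b) ?_ ?_
  · intro E hE
    obtain ⟨φ, -, rfl⟩ := List.mem_map.1 hE
    exact ColFormula.language_isRegular _ _
  · intro x R hR h
    refine hsound x {r | ∃ l ∈ R, r = fun i => l.getD i e} ?_ ?_
    · obtain ⟨l, hl⟩ := List.exists_mem_of_ne_nil R hR
      exact ⟨_, l, hl, rfl⟩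
    · rintro φ hφ _ ⟨l₁, h₁, rfl⟩ _ ⟨l₂, h₂, rfl⟩
      obtain ⟨l₃, h₃, w, hw, hc⟩ := h _ (List.mem_map_of_mem hφ) l₁ h₁ l₂ h₂
      refine ⟨_, ⟨l₃, h₃, rfl⟩, ?_⟩
      rw [ColFormula.mem_language] at hw
      simpa only [getD_columns hc e] using hw
  · intro x hx
    obtain ⟨hne, ℓ, S, hℓ, hb, hS, hr, h⟩ := hcomplete x hx
    have hinj : Set.InjOn (segment ℓ) S := by
      intro r hrS r' hrS' he
      rw [← getD_segment (hr r hrS), ← getD_segment (hr r' hrS'), he]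
    have hlen : ∀ l ∈ segment ℓ '' S, l.length = ℓ := by
      rintro _ ⟨r, -, rfl⟩
      simp [segment]
    have hfin : (segment ℓ '' S).Finite :=
      (List.finite_length_eq Γ ℓ).subset hlen
    have hcard : hfin.toFinset.card ≤ Nat.card Γ ^ ℓ := by
      have := Fintype.ofFinite Γ
      classical
      rw [← Set.ncard_eq_toFinset_card _ hfin]
      calc (segment ℓ '' S).ncard ≤ (Set.range (List.ofFn (n := ℓ) (α := Γ))).ncard := by
            refine Set.ncard_le_ncard (fun l hl => ?_) (Set.finite_range _)
            have hl := hlen l hl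
            subst hl
            exact ⟨l.get, List.ofFn_get l⟩
        _ ≤ Nat.card (Fin ℓ → Γ) := by
            rw [← Nat.card_coe_set_eq]
            exact Finite.card_range_le _
        _ = Nat.card Γ ^ ℓ := by simp [Nat.card_eq_fintype_card]
    have h1 : 1 ≤ x.length := List.length_pos_iff.2 hne
    have hpow : ∀ c, c ≤ Nat.card Γ + 2 → c ^ ℓ ≤ ((Nat.card Γ + 2) ^ b) ^ x.length ^ 3 := by
      intro c hc
      rw [← pow_mul]
      exact (Nat.pow_le_pow_left hc _).trans (Nat.pow_le_pow_right (by omega) hb)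
    refine ⟨hne, hfin.toFinset.toList, ?_, ?_, ?_, ?_⟩
    · obtain ⟨r, hrS⟩ := hS
      intro h0
      have : segment ℓ r ∈ hfin.toFinset.toList := by simpa using ⟨r, hrS, rfl⟩
      simp [h0] at this
    · rw [Finset.length_toList]
      exact hcard.trans (hpow _ (by omega))
    · intro l hl
      rw [hlen l (by simpa using hl)]
      exact (Nat.lt_two_pow_self (n := ℓ)).le.trans (hpow 2 (by omega))
    · intro E hE
      obtain ⟨φ, hφ, rfl⟩ := List.mem_map.1 hE
      intro l₁ h₁ l₂ h₂
      rw [Finset.mem_toList, Set.Finite.mem_toFinset] at h₁ h₂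
      obtain ⟨r₁, h₁, rfl⟩ := h₁
      obtain ⟨r₂, h₂, rfl⟩ := h₂
      obtain ⟨r₃, h₃, hs⟩ := h φ hφ r₁ h₁ r₂ h₂
      refine ⟨segment ℓ r₃, by simpa using ⟨r₃, h₃, rfl⟩, _, ?_, columns_segment hℓ r₁ r₂ r₃⟩
      rw [ColFormula.mem_language]
      have := getD_columns (columns_segment hℓ r₁ r₂ r₃) e
      simp only [this]
      have e1 := fun i => congrFun (getD_segment (hr r₁ h₁)) i
      have e2 := fun i => congrFun (getD_segment (hr r₂ h₂)) i
      have e3 := fun i => congrFun (getD_segment (hr r₃ h₃)) i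
      simpa only [e1, e2, e3] using hs

end TapeProgram

/-! ## Counting up to a bound -/

namespace CappedCount

open Set

variable {X Y T : Type*}

/-- The maps `f` and `g` take each value equally often, where counting stops at `B`. -/
def Agree (B : ℕ) (f : X → T) (g : Y → T) : Prop :=
  ∀ t, min (f ⁻¹' {t}).encard B = min (g ⁻¹' {t}).encard B

theorem exists_capped_subset (s : Set X) (B : ℕ) : ∃ t ⊆ s, t.encard = min s.encard B :=
  exists_subset_encard_eq (min_le_left _ _)

/-- Up to `B` points are taken from each fibre. Since the fibres are disjoint, the union meets each
of them in exactly the points taken there. -/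
theorem exists_sample [Finite T] (f : X → T) (B : ℕ) :
    ∃ V : Set X, V.encard ≤ (Nat.card T * B : ℕ) ∧
      ∀ t, (V ∩ f ⁻¹' {t}).encard = min (f ⁻¹' {t}).encard B := by
  have := Fintype.ofFinite T
  choose V hV hc using fun t => exists_capped_subset (f ⁻¹' {t}) B
  refine ⟨⋃ t, V t, ?_, fun t => ?_⟩
  · calc (⋃ t, V t).encard ≤ ∑ t, (V t).encard := encard_iUnion_le_of_fintype _
      _ ≤ ∑ _t : T, (B : ℕ∞) := Finset.sum_le_sum fun t _ => (hc t).trans_le (min_le_right _ _)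
      _ = (Nat.card T * B : ℕ) := by
        simp [Nat.card_eq_fintype_card]
  · rw [← hc t]
    congr 1
    ext x
    constructor
    · rintro ⟨h, hx⟩
      obtain ⟨t', h⟩ := mem_iUnion.1 h
      have := hV t' h
      rw [mem_preimage, mem_singleton_iff] at hx this
      rwa [← hx, this]
    · exact fun h => ⟨mem_iUnion.2 ⟨t, h⟩, hV t h⟩

theorem agree_val (f : X → T) {B : ℕ} {V : Set X}
    (h : ∀ t, (V ∩ f ⁻¹' {t}).encard = min (f ⁻¹' {t}).encard B) :
    Agree B f fun y : V => f y := by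
  intro t
  have : ((fun y : V => f y) ⁻¹' {t}).encard = (V ∩ f ⁻¹' {t}).encard := by
    rw [← Subtype.val_injective.injOn.encard_image]
    congr 1
    ext x
    simp [and_comm]
  rw [this, h t, min_assoc, min_self]

theorem Agree.exists_eq {B : ℕ} {f : X → T} {g : Y → T} (h : Agree B f g) (hB : 1 ≤ B) (x : X) :
    ∃ y, g y = f x := by
  by_contra! hy
  have h1 : g ⁻¹' {f x} = ∅ := by
    ext y
    simpa using hy y
  have h2 : 1 ≤ (f ⁻¹' {f x}).encard := one_le_encard_iff_nonempty.2 ⟨x, rfl⟩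
  have h3 := h (f x)
  rw [h1, encard_empty, zero_min] at h3
  have : (1 : ℕ∞) ≤ min (f ⁻¹' {f x}).encard B := le_min h2 (by exact_mod_cast hB)
  rw [h3] at this
  simp at this

theorem Agree.nontrivial_iff {B : ℕ} {f : X → T} {g : Y → T} (h : Agree B f g) (hB : 2 ≤ B)
    (t : T) : (f ⁻¹' {t}).Nontrivial ↔ (g ⁻¹' {t}).Nontrivial := by
  rw [← one_lt_encard_iff_nontrivial, ← one_lt_encard_iff_nontrivial]
  have hB' : (1 : ℕ∞) < B := by exact_mod_cast hB
  have := h t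
  constructor
  · intro h1
    exact (lt_min_iff.1 (this ▸ lt_min h1 hB')).1
  · intro h1
    exact (lt_min_iff.1 (this ▸ lt_min h1 hB')).1

section Transfer

variable {f : X → T} {g : Y → T} {V : Set X}

theorem exists_injOn_of_encard_le (hV : V.Finite)
    (h : ∀ t, (V ∩ f ⁻¹' {t}).encard ≤ (g ⁻¹' {t}).encard) [Nonempty Y] :
    ∃ J : X → Y, InjOn J V ∧ ∀ x ∈ V, g (J x) = f x := by
  choose j hj hi using fun t => (hV.inter_of_left (f ⁻¹' {t})).exists_injOn_of_encard_le (h t)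
  have hg : ∀ x ∈ V, g (j (f x) x) = f x := fun x hx => hj (f x) ⟨hx, rfl⟩
  refine ⟨fun x => j (f x) x, fun x hx x' hx' he => ?_, hg⟩
  have he' : j (f x) x = j (f x') x' := he
  have hf : f x = f x' := by rw [← hg x hx, ← hg x' hx', he']
  refine hi (f x) ⟨hx, rfl⟩ ⟨hx', hf.symm⟩ ?_
  rw [he', hf]

/-- An injection that respects the fibres is corrected by the transposition of `J x₀` and `y₀`; both
lie in the same fibre of `g`, so nothing else is spoiled. -/
theorem exists_injOn_eq (hV : V.Finite) (h : ∀ t, (V ∩ f ⁻¹' {t}).encard ≤ (g ⁻¹' {t}).encard)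
    {x₀ : X} {y₀ : Y} (hx₀ : x₀ ∈ V) (h₀ : f x₀ = g y₀) :
    ∃ J : X → Y, InjOn J V ∧ (∀ x ∈ V, g (J x) = f x) ∧ J x₀ = y₀ := by
  classical
  have : Nonempty Y := ⟨y₀⟩
  obtain ⟨J, hi, hg⟩ := exists_injOn_of_encard_le hV h
  have hs : ∀ y, g (Equiv.swap (J x₀) y₀ y) = g y := by
    intro y
    have := hg x₀ hx₀
    by_cases h1 : y = J x₀
    · rw [h1, Equiv.swap_apply_left, this, h₀]
    · by_cases h2 : y = y₀
      · rw [h2, Equiv.swap_apply_right, this, h₀]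
      · rw [Equiv.swap_apply_of_ne_of_ne h1 h2]
  exact ⟨fun x => Equiv.swap (J x₀) y₀ (J x), (Equiv.injective _).comp_injOn hi,
    fun x hx => (hs _).trans (hg x hx), Equiv.swap_apply_left _ _⟩

/-- If `f` and `g` agree up to a large bound, then each map `f'` on the domain of `f` can be
copied to the domain of `g` up to a small bound. -/
theorem Agree.transfer [Finite T] [Finite Y] {B B' : ℕ} (h : Agree B f g)
    (hB : Nat.card T * B' + 2 ≤ B) (f' : X → T) {x₀ : X} {y₀ : Y} (h₀ : f x₀ = g y₀) :
    ∃ k : Y → X, (∀ y, f (k y) = g y) ∧ k y₀ = x₀ ∧ Agree B' f' fun y => f' (k y) := by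
  -- The sample `V'` represents `f'` up to `B'`. Even with `x₀` added it has fewer than `B` points,
  -- thanks to the `+ 2`, and so it embeds into `Y` along the fibres of `f` and `g`.
  obtain ⟨V', hV', hc'⟩ := exists_sample f' B'
  set V := insert x₀ V' with hV
  have hcard : V.encard + 1 ≤ B := by
    calc V.encard + 1 ≤ (V'.encard + 1) + 1 := by gcongr; exact encard_insert_le _ _
      _ ≤ ((Nat.card T * B' : ℕ) + 1) + 1 := by gcongr
      _ ≤ B := by exact_mod_cast hB
  have hfin : V.Finite := finite_of_encard_le_coe ((self_le_add_right _ _).trans hcard)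
  have hlt : V.encard < B := by
    rw [hfin.encard_eq_coe_toFinset_card] at hcard ⊢
    exact_mod_cast hcard
  have hle : ∀ t, (V ∩ f ⁻¹' {t}).encard ≤ (g ⁻¹' {t}).encard := by
    intro t
    have h1 : (V ∩ f ⁻¹' {t}).encard ≤ min (f ⁻¹' {t}).encard B :=
      le_min (encard_le_encard inter_subset_right)
        ((encard_le_encard inter_subset_left).trans hlt.le)
    exact (h1.trans_eq (h t)).trans (min_le_left _ _)
  obtain ⟨J, hi, hg, hJ⟩ := exists_injOn_eq hfin hle (mem_insert x₀ V') h₀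
  -- The map `k` inverts `J` on its image and takes values outside `V` elsewhere. If a fibre of `f`
  -- has no points outside `V`, it has fewer than `B` points, so the fibre of `g` has equally many
  -- and is exhausted by `J`.
  have hex : ∀ y, ∃ x, f x = g y ∧ ((x ∈ V ∧ J x = y) ∨ (x ∉ V ∧ y ∉ J '' V)) := by
    intro y
    by_cases hy : y ∈ J '' V
    · obtain ⟨x, hx, rfl⟩ := hy
      exact ⟨x, (hg x hx).symm, Or.inl ⟨hx, rfl⟩⟩
    · by_contra! hne
      have hsub : f ⁻¹' {g y} ⊆ V := fun x hx => by
        by_contra hxV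
        exact hy ((hne x hx).2 hxV)
      have hlt' : (f ⁻¹' {g y}).encard < B := (encard_le_encard hsub).trans_lt hlt
      have heq : (g ⁻¹' {g y}).encard = (f ⁻¹' {g y}).encard := by
        have := h (g y)
        rw [min_eq_left hlt'.le] at this
        rcases le_total (g ⁻¹' {g y}).encard B with h1 | h1
        · rw [this, min_eq_left h1]
        · rw [min_eq_right h1] at this
          exact absurd this hlt'.ne
      have himg : J '' (f ⁻¹' {g y}) = g ⁻¹' {g y} := by
        refine Finite.eq_of_subset_of_encard_le (toFinite _) ?_ ?_
        · rintro _ ⟨x, hx, rfl⟩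
          exact (hg x (hsub hx)).trans hx
        · rw [(hi.mono hsub).encard_image, heq]
      have : y ∈ J '' (f ⁻¹' {g y}) := by
        rw [himg]
        rfl
      exact hy (image_mono hsub this)
  choose k hk hk' using hex
  have hkJ : ∀ x ∈ V, k (J x) = x := by
    intro x hx
    rcases hk' (J x) with ⟨h1, h2⟩ | ⟨-, h2⟩
    · exact hi h1 hx h2
    · exact absurd ⟨x, hx, rfl⟩ h2
  refine ⟨k, hk, hJ ▸ hkJ x₀ (mem_insert x₀ V'), fun t => ?_⟩
  have hge : min (f' ⁻¹' {t}).encard B' ≤ ((fun y => f' (k y)) ⁻¹' {t}).encard := by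
    rw [← hc' t]
    have hsub : V' ∩ f' ⁻¹' {t} ⊆ V := fun x hx => mem_insert_of_mem _ hx.1
    refine encard_le_encard_of_injOn (f := J) (fun x hx => ?_) (hi.mono hsub)
    simpa [hkJ x (hsub hx)] using hx.2
  refine le_antisymm (le_min hge (min_le_right _ _)) ?_
  -- A fibre of `f'` with at most `B'` points is contained in `V'`. Points outside the image of `J`
  -- are mapped outside `V`, so they cannot enlarge the pulled back fibre.
  rcases le_total (B' : ℕ∞) (f' ⁻¹' {t}).encard with h1 | h1
  · rw [min_eq_right h1]
    exact min_le_right _ _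
  · rw [min_eq_left h1]
    refine (min_le_left _ _).trans ?_
    have hsub : f' ⁻¹' {t} ⊆ V := by
      have h2 := hc' t
      rw [min_eq_left h1] at h2
      have hfin' : (f' ⁻¹' {t}).Finite := finite_of_encard_le_coe h1
      have h3 := Finite.eq_of_subset_of_encard_le' hfin' (inter_subset_right (s := V')) h2.ge
      intro x hx
      rw [← h3] at hx
      exact mem_insert_of_mem _ hx.1
    refine encard_le_encard_of_injOn (f := k) (fun y hy => hy) fun y hy y' hy' he => ?_
    have key : ∀ z ∈ (fun y => f' (k y)) ⁻¹' {t}, J (k z) = z := by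
      intro z hz
      rcases hk' z with ⟨-, h2⟩ | ⟨h2, -⟩
      · exact h2
      · exact absurd (hsub hz) h2
    rw [← key y hy, ← key y' hy', he]

end Transfer

end CappedCount

/-! ## Sampled interpretations -/

namespace ModalDL

open CappedCount Set

variable {n : ℕ} {F : KripkeFrame n}

namespace Interpretation

theorem ext_sub (M : Interpretation F) (C : Concept n) (w : F.W) : M.ext C w ⊆ M.dom w := by
  induction C generalizing w with
  | atom A => exact M.conc_sub A w
  | nom a => exact fun d hd => M.ind_mem a w d hd
  | desc C ih =>
    intro d hd
    have hd' : M.ext C w = {d} := hd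
    exact ih w (hd' ▸ mem_singleton d)
  | neg C _ => exact fun d hd => hd.1
  | inter C D ih _ => exact fun d hd => ih w hd.1
  | ex r C _ => exact fun d hd => hd.1
  | exU C _ => exact fun d hd => hd.1
  | dia i C _ => exact fun d hd => hd.1

/-- The type of an object at a world: whether it is in the domain, and in which extensions of
concepts from `Sg` it is. -/
def type (M : Interpretation F) (Sg : Set (Concept n)) (w : F.W) (x : M.Obj) : Set (Option Sg) :=
  {o | o.elim (x ∈ M.dom w) fun C => x ∈ M.ext C w}

theorem type_eq_iff {M : Interpretation F} {Sg : Set (Concept n)} {w w' : F.W} {x x' : M.Obj} :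
    M.type Sg w x = M.type Sg w' x' ↔
      (x ∈ M.dom w ↔ x' ∈ M.dom w') ∧ ∀ C ∈ Sg, (x ∈ M.ext C w ↔ x' ∈ M.ext C w') := by
  rw [Set.ext_iff]
  constructor
  · exact fun h => ⟨h none, fun C hC => h (some ⟨C, hC⟩)⟩
  · rintro ⟨h1, h2⟩ (_ | ⟨C, hC⟩)
    · exact h1
    · exact h2 C hC

end Interpretation

/-- A family of samples of the objects of an interpretation, one for each world of another frame,
which represent each type as often as it occurs, where counting stops at two. -/
structure Sampling (M : Interpretation F) (Sg : Set (Concept n)) (F' : KripkeFrame n) where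
  Y : Type
  wd : F'.W → F.W
  obj : F'.W → Y → M.Obj
  agree : ∀ v, Agree 2 (M.type Sg (wd v)) fun y => M.type Sg (wd v) (obj v y)
  dom_mono : ∀ i v v', F'.R i v v' → ∀ y, obj v y ∈ M.dom (wd v) → obj v' y ∈ M.dom (wd v')

namespace Sampling

variable {M : Interpretation F} {Sg : Set (Concept n)} {F' : KripkeFrame n}
  (K : Sampling M Sg F')

theorem exists_type_eq (v : F'.W) (x : M.Obj) :
    ∃ y, M.type Sg (K.wd v) (K.obj v y) = M.type Sg (K.wd v) x :=
  (K.agree v).exists_eq (by norm_num) x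

theorem exists_mem_dom (v : F'.W) : ∃ y, K.obj v y ∈ M.dom (K.wd v) := by
  obtain ⟨x, hx⟩ := M.dom_nonempty (K.wd v)
  obtain ⟨y, hy⟩ := K.exists_type_eq v x
  exact ⟨y, (Interpretation.type_eq_iff.1 hy).1.2 hx⟩

/-- If an extension is a singleton in one of the structures, it is one in the other. -/
theorem singleton_iff {C : Concept n} (hC : C ∈ Sg) (v : F'.W) (y : K.Y) :
    {z | K.obj v z ∈ M.ext C (K.wd v)} = {y} ↔ M.ext C (K.wd v) = {K.obj v y} := by
  have htype : ∀ {x x'}, M.type Sg (K.wd v) x = M.type Sg (K.wd v) x' →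
      x ∈ M.ext C (K.wd v) → x' ∈ M.ext C (K.wd v) :=
    fun h hx => ((Interpretation.type_eq_iff.1 h).2 C hC).1 hx
  constructor
  · intro h
    have hy : K.obj v y ∈ M.ext C (K.wd v) := by
      have : y ∈ {z | K.obj v z ∈ M.ext C (K.wd v)} := h ▸ mem_singleton y
      exact this
    have hz : ∀ z, K.obj v z ∈ M.ext C (K.wd v) → z = y := fun z hz => by
      have : z ∈ {z | K.obj v z ∈ M.ext C (K.wd v)} := hz
      rwa [h] at this
    refine Subset.antisymm (fun x hx => ?_) (singleton_subset_iff.2 hy)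
    by_contra hne
    obtain ⟨z, hzx⟩ := K.exists_type_eq v x
    obtain rfl := hz z (htype hzx.symm hx)
    -- A second object in the extension shares its type with some sample, which can only be `z`. The
    -- type then occurs twice in `M`, so by counting up to two it belongs to a second sample, which
    -- is also in the extension.
    have h2 : (M.type Sg (K.wd v) ⁻¹' {M.type Sg (K.wd v) x}).Nontrivial :=
      ⟨x, rfl, K.obj v z, hzx, hne⟩
    rw [(K.agree v).nontrivial_iff le_rfl] at h2
    obtain ⟨y₁, h₁, hne₁⟩ := h2.exists_ne z
    exact hne₁ (hz y₁ (htype h₁.symm hx))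
  · intro h
    have hy : K.obj v y ∈ M.ext C (K.wd v) := h ▸ mem_singleton _
    refine Subset.antisymm (fun z hz => ?_) (singleton_subset_iff.2 hy)
    by_contra hne
    have hzy : K.obj v z = K.obj v y := by
      have : K.obj v z ∈ M.ext C (K.wd v) := hz
      rwa [h] at this
    -- Different samples may stand for the same object. Even so their type is counted twice, so `M`
    -- has a second object of this type.
    have h2 : ((fun y => M.type Sg (K.wd v) (K.obj v y)) ⁻¹'
        {M.type Sg (K.wd v) (K.obj v y)}).Nontrivial :=
      ⟨z, by simp [hzy], y, rfl, hne⟩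
    rw [← (K.agree v).nontrivial_iff le_rfl] at h2
    obtain ⟨x, hx, hne'⟩ := h2.exists_ne (K.obj v y)
    have : x ∈ M.ext C (K.wd v) := htype (x := K.obj v y) (Eq.symm hx) hy
    rw [h] at this
    exact hne' this

open Classical in
/-- The interpretation of an individual name in a sampled interpretation. -/
noncomputable def ind (a : ℕ) (v : F'.W) : Option K.Y :=
  if h : ∃ y, M.ind a (K.wd v) = some (K.obj v y) then some h.choose
  -- The object that `a` designates need not be sampled if `nom a` is not in `Sg`. An arbitrary
  -- value preserves whether `a` designates, as total semantics requires.
  else (M.ind a (K.wd v)).map fun _ => (K.exists_mem_dom v).choose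

/-- The interpretation whose objects at each world are the samples. -/
noncomputable def model : Interpretation F' where
  Obj := K.Y
  dom v := {y | K.obj v y ∈ M.dom (K.wd v)}
  dom_nonempty v := K.exists_mem_dom v
  dom_mono i v v' h y hy := K.dom_mono i v v' h y hy
  conc A v := {y | K.obj v y ∈ M.conc A (K.wd v)}
  conc_sub A v y hy := M.conc_sub A (K.wd v) hy
  -- Roles are lifted from objects to types, since the actual successor of a sampled object need not
  -- be sampled. Truth of `∃r.C` in `Sg` depends on the type only, so nothing becomes true or false.
  role r v y y' := ∃ x x', M.type Sg (K.wd v) x = M.type Sg (K.wd v) (K.obj v y) ∧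
    M.type Sg (K.wd v) x' = M.type Sg (K.wd v) (K.obj v y') ∧ M.role r (K.wd v) x x'
  role_sub := by
    rintro r v y y' ⟨x, x', hx, hx', h⟩
    have h' := M.role_sub r (K.wd v) x x' h
    exact ⟨(Interpretation.type_eq_iff.1 hx).1.1 h'.1, (Interpretation.type_eq_iff.1 hx').1.1 h'.2⟩
  ind := K.ind
  ind_mem := by
    intro a v y hy
    unfold ind at hy
    split_ifs at hy with h
    · obtain rfl := Option.some.inj hy
      exact M.ind_mem a _ _ h.choose_spec
    · obtain ⟨x, -, rfl⟩ := Option.map_eq_some_iff.1 hy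
      exact (K.exists_mem_dom v).choose_spec

theorem ind_isSome (a : ℕ) (v : F'.W) : (K.ind a v).isSome ↔ (M.ind a (K.wd v)).isSome := by
  unfold ind
  split_ifs with h
  · obtain ⟨y, hy⟩ := h
    simp [hy]
  · simp

theorem mem_ext_nom {a : ℕ} (ha : Concept.nom a ∈ Sg) (v : F'.W) (y : K.Y) :
    K.ind a v = some y ↔ M.ind a (K.wd v) = some (K.obj v y) := by
  have hext : ∀ x, M.ind a (K.wd v) = some x → M.ext (.nom a) (K.wd v) = {x} := by
    intro x hx
    ext x'
    simp [Interpretation.ext, hx, eq_comm]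
  unfold ind
  split_ifs with h
  · have h1 := (K.singleton_iff ha v h.choose).2 (hext _ h.choose_spec)
    constructor
    · intro h2
      obtain rfl := Option.some.inj h2
      exact h.choose_spec
    · intro h2
      have : y ∈ {z | K.obj v z ∈ M.ext (.nom a) (K.wd v)} := h2
      rw [h1] at this
      rw [mem_singleton_iff.1 this]
  · refine ⟨fun h2 => ?_, fun h2 => absurd ⟨y, h2⟩ h⟩
    obtain ⟨x, hx, -⟩ := Option.map_eq_some_iff.1 h2
    obtain ⟨z, hz⟩ := K.exists_type_eq v x
    exact absurd ⟨z, ((Interpretation.type_eq_iff.1 hz).2 _ ha).2 hx⟩ h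

/-- Sets of concepts that contain the immediate subconcepts, except below modalities. -/
structure SubClosed (G : Set (Concept n)) : Prop where
  desc : ∀ {C}, Concept.desc C ∈ G → C ∈ G
  neg : ∀ {C}, Concept.neg C ∈ G → C ∈ G
  inter : ∀ {C D}, Concept.inter C D ∈ G → C ∈ G ∧ D ∈ G
  ex : ∀ {r C}, Concept.ex r C ∈ G → C ∈ G
  exU : ∀ {C}, Concept.exU C ∈ G → C ∈ G

/-- Truth lemma for sampled interpretations. The set `G v` may depend on the world, since near the
places where a tree is cut off only concepts of small modal depth are preserved. All constructors
but the diamonds are settled by types counted up to two; `hdia` provides what the diamonds need. -/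
theorem mem_ext_model {G : F'.W → Set (Concept n)} (hG : ∀ v, G v ⊆ Sg)
    (hs : ∀ v, SubClosed (G v))
    (hdia : ∀ i C v, .dia i C ∈ G v → (∀ v', F'.R i v v' → C ∈ G v') ∧
      (∀ v' y, F'.R i v v' → K.obj v y ∈ M.dom (K.wd v) → K.obj v' y ∈ M.ext C (K.wd v') →
        K.obj v y ∈ M.ext (.dia i C) (K.wd v)) ∧
      ∀ y, K.obj v y ∈ M.ext (.dia i C) (K.wd v) →
        ∃ v', F'.R i v v' ∧ K.obj v' y ∈ M.ext C (K.wd v')) (C : Concept n) :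
    ∀ v, C ∈ G v → K.model.ext C v = {y | K.obj v y ∈ M.ext C (K.wd v)} := by
  induction C with
  | atom A => exact fun v _ => rfl
  | nom a =>
    intro v hC
    ext y
    exact K.mem_ext_nom (hG v hC) v y
  | desc C ih =>
    intro v hC
    have hC' := (hs v).desc hC
    ext y
    have : y ∈ K.model.ext (.desc C) v ↔ K.model.ext C v = {y} := Iff.rfl
    rw [this, ih v hC']
    exact K.singleton_iff (hG v hC') v y
  | neg C ih =>
    intro v hC
    rw [Interpretation.ext, ih v ((hs v).neg hC)]
    rfl
  | inter C D ih₁ ih₂ =>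
    intro v hC
    rw [Interpretation.ext, ih₁ v ((hs v).inter hC).1, ih₂ v ((hs v).inter hC).2]
    rfl
  | ex r C ih =>
    intro v hC
    have hC' := (hs v).ex hC
    rw [Interpretation.ext, ih v hC']
    ext y
    constructor
    · rintro ⟨-, y', ⟨x, x', hx, hx', hr⟩, hy'⟩
      refine ((Interpretation.type_eq_iff.1 hx).2 _ (hG v hC)).1 ⟨(M.role_sub _ _ _ _ hr).1, x',
        hr, ?_⟩
      exact ((Interpretation.type_eq_iff.1 hx').2 _ (hG v hC')).2 hy'
    · rintro ⟨hy, x', hr, hx'⟩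
      obtain ⟨y', hy'⟩ := K.exists_type_eq v x'
      exact ⟨hy, y', ⟨_, x', rfl, hy'.symm, hr⟩,
        ((Interpretation.type_eq_iff.1 hy').2 _ (hG v hC')).2 hx'⟩
  | exU C ih =>
    intro v hC
    have hC' := (hs v).exU hC
    rw [Interpretation.ext, ih v hC']
    ext y
    constructor
    · rintro ⟨hy, y', hy', hm⟩
      exact ⟨hy, _, hy', hm⟩
    · rintro ⟨hy, x', hx', hm⟩
      obtain ⟨y', hy'⟩ := K.exists_type_eq v x'
      exact ⟨hy, y', (Interpretation.type_eq_iff.1 hy').1.2 hx',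
        ((Interpretation.type_eq_iff.1 hy').2 _ (hG v hC')).2 hm⟩
  | dia i C ih =>
    intro v hC
    obtain ⟨h1, h2, h3⟩ := hdia i C v hC
    ext y
    constructor
    · rintro ⟨hy, v', hR, hm⟩
      rw [ih v' (h1 v' hR)] at hm
      exact h2 v' y hR hy hm
    · intro hy
      obtain ⟨v', hR, hm⟩ := h3 y hy
      refine ⟨M.ext_sub _ _ hy, v', hR, ?_⟩
      rw [ih v' (h1 v' hR)]
      exact hm

end Sampling

end ModalDL

/-! ## Small interpretations -/

namespace ModalDL

open CappedCount Set

variable {n : ℕ} {F : KripkeFrame n}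

theorem _root_.CappedCount.Agree.mono {X Y T : Type*} {B B' : ℕ} {f : X → T} {g : Y → T}
    (h : Agree B f g) (hB : B' ≤ B) : Agree B' f g := by
  intro t
  have hB' : (B' : ℕ∞) ≤ B := by exact_mod_cast hB
  have := congrArg (fun k => min k (B' : ℕ∞)) (h t)
  simpa only [min_assoc, min_eq_right hB'] using this

/-- The bounds on counting that suffice for unravelling to depth `j`, if there are `P` types. -/
def cap (P : ℕ) : ℕ → ℕ
  | 0 => 2
  -- This is the loss of precision in `Agree.transfer`; at the end of the paths the precision `2` of
  -- `Sampling` is left.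
  | j + 1 => P * cap P j + 2

theorem two_le_cap (P j : ℕ) : 2 ≤ cap P j := by
  cases j <;> simp [cap]

theorem cap_le (P j : ℕ) : cap P j ≤ 2 * (P + 1) ^ j := by
  induction j with
  | zero => simp [cap]
  | succ j ih =>
    have := two_le_cap P j
    calc cap P (j + 1) ≤ P * cap P j + cap P j := Nat.add_le_add_left this _
      _ = (P + 1) * cap P j := by ring
      _ ≤ (P + 1) * (2 * (P + 1) ^ j) := Nat.mul_le_mul_left _ ih
      _ = 2 * (P + 1) ^ (j + 1) := by ring

/-- A step of a path: the index of a modality, a sample, and a concept. -/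
abbrev PathStep (Y : Type) (Sg : Set (Concept n)) : Type := Fin n × Y × Sg

/-- The point of `i`-departure of a path. -/
def inId {S : Type} (L : FrameClass) (i : Fin n) : List (Fin n × S) → Option (List (Fin n × S))
  -- Paths grow at the head of the list. In the case of `S5` a path that does not end with an
  -- `i`-step is its own point of departure, so that equality of these points defines the
  -- `i`-clusters; in the case of `K` it has no `i`-predecessor.
  | a :: π => if a.1 = i then some π else L.casesOn none (some (a :: π))
  | [] => L.casesOn none (some [])

/-- The path from which `i`-steps are made. -/
def outId {S : Type} (L : FrameClass) (i : Fin n) (π : List (Fin n × S)) :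
    Option (List (Fin n × S)) :=
  L.casesOn (some π) (inId .S5 i π)

section Ids

variable {S : Type} {L : FrameClass} {i : Fin n} {π ρ : List (Fin n × S)}

theorem inId_eq_some : inId L i π = some ρ ↔
    (∃ a : Fin n × S, a.1 = i ∧ π = a :: ρ) ∨ L = .S5 ∧ π = ρ ∧ ∀ a ∈ ρ.head?, a.1 ≠ i := by
  rcases π with _ | ⟨a, π⟩
  · cases L
    · simp [inId]
    · simp only [inId, Option.some.injEq]
      constructor
      · rintro rfl
        exact Or.inr ⟨trivial, rfl, by simp⟩
      · rintro (⟨a, -, h⟩ | ⟨-, h, -⟩)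
        · simp at h
        · exact h
  · by_cases h : a.1 = i
    · simp only [inId, h, if_true, Option.some.injEq]
      constructor
      · rintro rfl
        exact Or.inl ⟨a, h, rfl⟩
      · rintro (⟨b, -, h'⟩ | ⟨-, rfl, h'⟩)
        · exact (List.cons.inj h').2
        · exact absurd h (h' a (by simp))
    · cases L
      · simp only [inId, h, if_false]
        constructor
        · simp
        · rintro (⟨b, hb, h'⟩ | ⟨h', -⟩)
          · exact absurd ((List.cons.inj h').1 ▸ hb) h
          · cases h'
      · simp only [inId, h, if_false, Option.some.injEq]
        constructor
        · rintro rfl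
          refine Or.inr ⟨trivial, rfl, fun b hb => ?_⟩
          simp only [List.head?_cons, Option.mem_def, Option.some.injEq] at hb
          exact hb ▸ h
        · rintro (⟨b, hb, h'⟩ | ⟨-, h', -⟩)
          · exact absurd ((List.cons.inj h').1 ▸ hb) h
          · exact h'

theorem outId_eq_some : outId L i π = some ρ ↔
    L = .K ∧ π = ρ ∨ L = .S5 ∧ inId L i π = some ρ := by
  cases L <;> simp [outId]

theorem exists_outId (L : FrameClass) (i : Fin n) (π : List (Fin n × S)) :
    ∃ ρ, outId L i π = some ρ ∧ ρ.length ≤ π.length := by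
  cases L with
  | K => exact ⟨π, rfl, le_rfl⟩
  | S5 =>
    rcases π with _ | ⟨a, π⟩
    · exact ⟨[], rfl, le_rfl⟩
    · by_cases h : a.1 = i
      · exact ⟨π, by simp [outId, inId, h], by simp⟩
      · exact ⟨a :: π, by simp [outId, inId, h], le_rfl⟩

theorem inId_length (h : inId L i π = some ρ) : ρ.length ≤ π.length ∧ π.length ≤ ρ.length + 1 := by
  rcases inId_eq_some.1 h with ⟨a, -, rfl⟩ | ⟨-, rfl, -⟩ <;> simp

end Ids

/-! ### Unravelling an interpretation along diamond steps -/

section Tree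

variable (M : Interpretation F) (Sg : Set (Concept n)) {Y : Type}

/-- The worlds with samples that may be reached by a step, where counting stops at `B`. -/
def IsChild (B : ℕ) (p : F.W × (Y → M.Obj)) (a : PathStep Y Sg) (p' : F.W × (Y → M.Obj)) : Prop :=
  F.R a.1 p.1 p'.1 ∧ p'.2 a.2.1 ∈ M.ext a.2.2 p'.1 ∧
    -- A sample point may stand for another object at the new world. It is only required that the
    -- new object has the type of the old one at the old world.
    (∀ z, M.type Sg p.1 (p'.2 z) = M.type Sg p.1 (p.2 z)) ∧
    Agree B (M.type Sg p'.1) fun y => M.type Sg p'.1 (p'.2 y)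

/-- The samples of the world `p.1` represent all types, where counting stops at `B`. -/
def Represents (B : ℕ) (p : F.W × (Y → M.Obj)) : Prop :=
  Agree B (M.type Sg p.1) fun y => M.type Sg p.1 (p.2 y)

/-- This is `Agree.transfer` from the types at `p.1` to the types at the witnessing world. The
object that witnesses the diamond is the distinguished point, so it remains assigned to the sample
`a.2.1`. -/
theorem exists_isChild [Finite Sg] [Finite Y] {B : ℕ} {p : F.W × (Y → M.Obj)}
    (hp : Represents M Sg (Nat.card (Set (Option Sg)) * B + 2) p) {a : PathStep Y Sg}
    (ha : p.2 a.2.1 ∈ M.ext (.dia a.1 a.2.2) p.1) : ∃ p', IsChild M Sg B p a p' := by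
  obtain ⟨-, w', hR, hm⟩ := ha
  obtain ⟨k, hk, hk', hagree⟩ := Agree.transfer hp le_rfl (M.type Sg w')
    (x₀ := p.2 a.2.1) (y₀ := a.2.1) rfl
  refine ⟨(w', k), hR, ?_, hk, hagree⟩
  rwa [← hk'] at hm

variable (D : ℕ) (root : F.W × (Y → M.Obj))

open Classical in
/-- The world and the samples at the end of a path of length at most `D`. -/
noncomputable def node : List (PathStep Y Sg) → F.W × (Y → M.Obj)
  | [] => root
  | a :: π =>
    if h : ∃ p', IsChild M Sg (cap (Nat.card (Set (Option Sg))) (D - (π.length + 1))) (node π) a p'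
    then h.choose else node π

/-- The paths of length at most `D` whose steps lead to witnesses; in the case of `S5^n`, no two
consecutive steps are for the same modality. -/
def IsPath (L : FrameClass) : List (PathStep Y Sg) → Prop
  | [] => True
  | a :: π => IsPath L π ∧ π.length < D ∧
    (node M Sg D root π).2 a.2.1 ∈ M.ext (.dia a.1 a.2.2) (node M Sg D root π).1 ∧
    (L = .S5 → ∀ b ∈ π.head?, b.1 ≠ a.1)

variable {M Sg D root} {L : FrameClass}

theorem IsPath.length_le {π : List (PathStep Y Sg)} (h : IsPath M Sg D root L π) :
    π.length ≤ D := by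
  cases π with
  | nil => simp
  | cons a π => exact h.2.1

/-- On paths the default branch of `node` is never taken: after `π.length` steps the samples are
precise up to the cap for the remaining `D - π.length` steps, which is what the next step consumes.
-/
theorem isChild_node [Finite Sg] [Finite Y]
    (hroot : Represents M Sg (cap (Nat.card (Set (Option Sg))) D) root) {a : PathStep Y Sg}
    {π : List (PathStep Y Sg)} (h : IsPath M Sg D root L (a :: π)) :
    IsChild M Sg (cap (Nat.card (Set (Option Sg))) (D - (π.length + 1))) (node M Sg D root π) a
      (node M Sg D root (a :: π)) ∧
    Represents M Sg (cap (Nat.card (Set (Option Sg))) (D - π.length)) (node M Sg D root π) := by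
  induction π generalizing a with
  | nil =>
    have hD : D = D - 1 + 1 := (Nat.succ_pred_eq_of_pos h.2.1).symm
    have hex : ∃ p', IsChild M Sg (cap (Nat.card (Set (Option Sg))) (D - (0 + 1))) root a p' := by
      refine exists_isChild M Sg ?_ h.2.2.1
      rw [hD] at hroot
      exact hroot
    refine ⟨?_, hroot⟩
    have : node M Sg D root [a] = hex.choose := dif_pos hex
    rw [this]
    exact hex.choose_spec
  | cons b π ih =>
    have h1 := (ih h.1).1.2.2.2
    have h2 : Represents M Sg (cap (Nat.card (Set (Option Sg))) (D - (b :: π).length))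
        (node M Sg D root (b :: π)) := h1
    refine ⟨?_, h2⟩
    have hlt := h.2.1
    have hD : D - (b :: π).length = D - ((b :: π).length + 1) + 1 := by omega
    have hex : ∃ p', IsChild M Sg (cap (Nat.card (Set (Option Sg))) (D - ((b :: π).length + 1)))
        (node M Sg D root (b :: π)) a p' := by
      refine exists_isChild M Sg ?_ h.2.2.1
      rw [hD] at h2
      exact h2
    have : node M Sg D root (a :: b :: π) = hex.choose := dif_pos hex
    rw [this]
    exact hex.choose_spec

theorem represents_node [Finite Sg] [Finite Y]
    (hroot : Represents M Sg (cap (Nat.card (Set (Option Sg))) D) root)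
    {π : List (PathStep Y Sg)} (h : IsPath M Sg D root L π) :
    Represents M Sg 2 (node M Sg D root π) := by
  cases π with
  | nil => exact Agree.mono hroot (two_le_cap _ _)
  | cons a π => exact Agree.mono (isChild_node hroot h).1.2.2.2 (two_le_cap _ _)

/-- The samples that are in the domain. -/
def sampleDom (M : Interpretation F) (p : F.W × (Y → M.Obj)) : Set Y := {y | p.2 y ∈ M.dom p.1}

/-- The samples that are in the extension of a concept. -/
def sampleExt (M : Interpretation F) (C : Concept n) (p : F.W × (Y → M.Obj)) : Set Y :=
  {y | p.2 y ∈ M.ext C p.1}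

section Child

variable {B : ℕ} {p p' : F.W × (Y → M.Obj)} {a : PathStep Y Sg}

theorem IsChild.mem_dom_iff (h : IsChild M Sg B p a p') (z : Y) :
    p'.2 z ∈ M.dom p.1 ↔ z ∈ sampleDom M p :=
  (Interpretation.type_eq_iff.1 (h.2.2.1 z)).1

theorem IsChild.mem_ext_iff (h : IsChild M Sg B p a p') {C : Concept n} (hC : C ∈ Sg) (z : Y) :
    p'.2 z ∈ M.ext C p.1 ↔ z ∈ sampleExt M C p :=
  (Interpretation.type_eq_iff.1 (h.2.2.1 z)).2 C hC

theorem IsChild.dom_subset (h : IsChild M Sg B p a p') : sampleDom M p ⊆ sampleDom M p' :=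
  fun z hz => M.dom_mono a.1 _ _ h.1 ((h.mem_dom_iff z).2 hz)

/-- The object of `z` at the child satisfies the diamond at the parent world in `M`, and there it
has the same type as the object of `z` at the parent. -/
theorem IsChild.mem_dia (h : IsChild M Sg B p a p') {C : Concept n} (hC : .dia a.1 C ∈ Sg) {z : Y}
    (hz : z ∈ sampleDom M p) (hz' : z ∈ sampleExt M C p') : z ∈ sampleExt M (.dia a.1 C) p :=
  (h.mem_ext_iff hC z).1 ⟨(h.mem_dom_iff z).2 hz, _, h.1, hz'⟩

variable (hF : Equivalence (F.R a.1))

include hF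

theorem IsChild.dom_eq (h : IsChild M Sg B p a p') : sampleDom M p' = sampleDom M p :=
  Subset.antisymm
    (fun z hz => (h.mem_dom_iff z).1 (M.dom_mono a.1 _ _ (hF.symm h.1) hz)) h.dom_subset

theorem IsChild.dia_eq (h : IsChild M Sg B p a p') {C : Concept n} (hC : .dia a.1 C ∈ Sg) :
    sampleExt M (.dia a.1 C) p' = sampleExt M (.dia a.1 C) p := by
  ext z
  rw [← h.mem_ext_iff hC z]
  constructor
  · rintro ⟨hz, v, hR, hm⟩
    exact ⟨M.dom_mono a.1 _ _ (hF.symm h.1) hz, v, hF.trans h.1 hR, hm⟩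
  · rintro ⟨hz, v, hR, hm⟩
    exact ⟨M.dom_mono a.1 _ _ h.1 hz, v, hF.trans (hF.symm h.1) hR, hm⟩

end Child

/-- All paths with the same point of `i`-departure are alike for `◇ᵢ` in the case of `S5^n`. -/
theorem cluster_eq [Finite Sg] [Finite Y]
    (hroot : Represents M Sg (cap (Nat.card (Set (Option Sg))) D) root)
    {i : Fin n} (hF : Equivalence (F.R i)) {π ρ : List (PathStep Y Sg)}
    (h : IsPath M Sg D root L π) (hρ : inId L i π = some ρ) :
    sampleDom M (node M Sg D root π) = sampleDom M (node M Sg D root ρ) ∧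
    ∀ C, .dia i C ∈ Sg →
      sampleExt M (.dia i C) (node M Sg D root π) = sampleExt M (.dia i C) (node M Sg D root ρ) ∧
      sampleExt M C (node M Sg D root π) ⊆ sampleExt M (.dia i C) (node M Sg D root ρ) := by
  rcases inId_eq_some.1 hρ with ⟨a, rfl, rfl⟩ | ⟨-, rfl, -⟩
  · have hc := (isChild_node hroot h).1
    refine ⟨hc.dom_eq hF, fun C hC => ⟨hc.dia_eq hF hC, fun z hz => ?_⟩⟩
    exact hc.mem_dia hC ((hc.dom_eq hF) ▸ M.ext_sub _ _ hz) hz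
  · exact ⟨rfl, fun C hC => ⟨rfl, fun z hz => ⟨M.ext_sub _ _ hz, _, hF.refl _, hz⟩⟩⟩

variable (M Sg D root L) in
/-- The frame of paths. -/
def pathFrame : KripkeFrame n where
  W := {π : List (PathStep Y Sg) // IsPath M Sg D root L π}
  nonempty := ⟨[], trivial⟩
  -- As accessibility is an equality of two data, a certificate can check it column by column. For
  -- `S5` the two data coincide, and the relation is an equivalence.
  R i π π' := outId L i π.1 = inId L i π'.1

theorem IsPath.of_inId {i : Fin n} {π ρ : List (PathStep Y Sg)} (h : IsPath M Sg D root L π)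
    (hρ : inId L i π = some ρ) :
    IsPath M Sg D root L ρ ∧ (L = .S5 → ∀ b ∈ ρ.head?, b.1 ≠ i) := by
  rcases inId_eq_some.1 hρ with ⟨a, rfl, rfl⟩ | ⟨hL, rfl, h'⟩
  · exact ⟨h.1, h.2.2.2⟩
  · exact ⟨h, fun _ => h'⟩

theorem IsPath.of_outId {i : Fin n} {π ρ : List (PathStep Y Sg)} (h : IsPath M Sg D root L π)
    (hρ : outId L i π = some ρ) :
    IsPath M Sg D root L ρ ∧ (L = .S5 → ∀ b ∈ ρ.head?, b.1 ≠ i) := by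
  rcases outId_eq_some.1 hρ with ⟨rfl, rfl⟩ | ⟨-, h'⟩
  · exact ⟨h, fun h => by cases h⟩
  · exact h.of_inId h'

section Related

variable [Finite Sg] [Finite Y] (hF : L.Mem F)
  (hroot : Represents M Sg (cap (Nat.card (Set (Option Sg))) D) root)
  {i : Fin n} {π π' : List (PathStep Y Sg)} (hπ : IsPath M Sg D root L π)
  (hπ' : IsPath M Sg D root L π') (hR : outId L i π = inId L i π')

include hF hroot hπ hπ' hR

theorem sampleDom_subset :
    sampleDom M (node M Sg D root π) ⊆ sampleDom M (node M Sg D root π') := by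
  obtain ⟨ρ, hρ, -⟩ := exists_outId L i π
  rw [hρ] at hR
  rcases outId_eq_some.1 hρ with ⟨rfl, rfl⟩ | ⟨rfl, h⟩
  · rcases inId_eq_some.1 hR.symm with ⟨a, rfl, rfl⟩ | ⟨h, -⟩
    · exact (isChild_node hroot hπ').1.dom_subset
    · cases h
  · rw [(cluster_eq hroot (hF i) hπ h).1, (cluster_eq hroot (hF i) hπ' hR.symm).1]

theorem mem_sampleExt_dia {C : Concept n} (hC : .dia i C ∈ Sg) {y : Y}
    (hy : y ∈ sampleDom M (node M Sg D root π)) (hy' : y ∈ sampleExt M C (node M Sg D root π')) :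
    y ∈ sampleExt M (.dia i C) (node M Sg D root π) := by
  obtain ⟨ρ, hρ, -⟩ := exists_outId L i π
  rw [hρ] at hR
  rcases outId_eq_some.1 hρ with ⟨rfl, rfl⟩ | ⟨rfl, h⟩
  · rcases inId_eq_some.1 hR.symm with ⟨a, rfl, rfl⟩ | ⟨h, -⟩
    · exact (isChild_node hroot hπ').1.mem_dia hC hy hy'
    · cases h
  · rw [((cluster_eq hroot (hF i) hπ h).2 C hC).1]
    exact ((cluster_eq hroot (hF i) hπ' hR.symm).2 C hC).2 hy'

end Related

/-- The witness is a child of the point of departure `ρ`, not of `π`. In the case of `S5` the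
diamond is true at `ρ` as well, since both are in one cluster, and `ρ` does not end with an
`i`-step, so an `i`-step may follow. -/
theorem exists_path_of_mem_dia [Finite Sg] [Finite Y] (hF : L.Mem F)
    (hroot : Represents M Sg (cap (Nat.card (Set (Option Sg))) D) root)
    {i : Fin n} {π : List (PathStep Y Sg)} (hπ : IsPath M Sg D root L π) {C : Concept n}
    (hC : C ∈ Sg) (hC' : .dia i C ∈ Sg)
    (hD : ∀ ρ, outId L i π = some ρ → ρ.length < D) {y : Y}
    (hy : y ∈ sampleExt M (.dia i C) (node M Sg D root π)) :
    ∃ π', IsPath M Sg D root L π' ∧ outId L i π = inId L i π' ∧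
      y ∈ sampleExt M C (node M Sg D root π') := by
  obtain ⟨ρ, hρ, -⟩ := exists_outId L i π
  have h1 := hπ.of_outId hρ
  have h2 : y ∈ sampleExt M (.dia i C) (node M Sg D root ρ) := by
    rcases outId_eq_some.1 hρ with ⟨rfl, rfl⟩ | ⟨rfl, h⟩
    · exact hy
    · rwa [((cluster_eq hroot (hF i) hπ h).2 C hC').1] at hy
  have h3 : IsPath M Sg D root L ((i, y, ⟨C, hC⟩) :: ρ) := ⟨h1.1, hD ρ hρ, h2, h1.2⟩
  refine ⟨_, h3, ?_, (isChild_node hroot h3).1.2.1⟩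
  rw [hρ]
  exact (inId_eq_some.2 (Or.inl ⟨_, rfl, rfl⟩)).symm

/-- The samples at the ends of paths. -/
noncomputable def pathSampling [Finite Sg] [Finite Y] (hF : L.Mem F)
    (hroot : Represents M Sg (cap (Nat.card (Set (Option Sg))) D) root) :
    Sampling M Sg (pathFrame M Sg D root L) where
  Y := Y
  wd π := (node M Sg D root π.1).1
  obj π := (node M Sg D root π.1).2
  agree π := represents_node hroot π.2
  dom_mono _ π π' h _ hy := sampleDom_subset hF hroot π.2 π'.2 h hy

/-- Types record membership in the domain. A step keeps the type at the old world, and with constant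
domains this also decides membership at the new world. -/
theorem sampleDom_eq_root [Finite Sg] [Finite Y]
    (hroot : Represents M Sg (cap (Nat.card (Set (Option Sg))) D) root)
    (hM : ∀ w v, M.dom w = M.dom v) {π : List (PathStep Y Sg)} (hπ : IsPath M Sg D root L π) :
    sampleDom M (node M Sg D root π) = sampleDom M root := by
  induction π with
  | nil => rfl
  | cons a π ih =>
    rw [← ih hπ.1]
    ext z
    rw [← (isChild_node hroot hπ).1.mem_dom_iff z, hM (node M Sg D root π).1]
    rfl

end Tree

end ModalDL

/-! ### The size of small interpretations -/

namespace ModalDL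

open CappedCount Set

variable {n : ℕ}

/-- The subconcepts of a concept. -/
def Concept.subs : Concept n → List (Concept n)
  | .atom A => [.atom A]
  | .nom a => [.nom a]
  | .desc C => .desc C :: C.subs
  | .neg C => .neg C :: C.subs
  | .inter C D => .inter C D :: (C.subs ++ D.subs)
  | .ex r C => .ex r C :: C.subs
  | .exU C => .exU C :: C.subs
  | .dia i C => .dia i C :: C.subs

/-- The nesting depth of modalities. -/
def Concept.depth : Concept n → ℕ
  | .atom _ => 0
  | .nom _ => 0
  | .desc C => C.depth
  | .neg C => C.depth
  | .inter C D => max C.depth D.depth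
  | .ex _ C => C.depth
  | .exU C => C.depth
  | .dia _ C => C.depth + 1

theorem Concept.length_subs_le (C : Concept n) : C.subs.length ≤ C.encode.length := by
  induction C <;> simp only [subs, encode, List.length_cons, List.length_append, List.length_nil] <;>
    omega

theorem Concept.depth_le (C : Concept n) : C.depth ≤ C.encode.length := by
  induction C <;> simp only [depth, encode, List.length_cons, List.length_append] <;> omega

theorem Concept.mem_subs_self (C : Concept n) : C ∈ C.subs := by
  cases C <;> simp [subs]

theorem Concept.subs_trans {C D E : Concept n} (hD : D ∈ C.subs) (hE : E ∈ D.subs) :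
    E ∈ C.subs := by
  induction C with
  | atom A => rwa [List.mem_singleton.1 hD] at hE
  | nom a => rwa [List.mem_singleton.1 hD] at hE
  | desc C ih | neg C ih | ex r C ih | exU C ih | dia i C ih =>
    rcases List.mem_cons.1 hD with rfl | h
    · exact hE
    · exact List.mem_cons_of_mem _ (ih h)
  | inter C C' ih ih' =>
    rcases List.mem_cons.1 hD with rfl | h
    · exact hE
    · refine List.mem_cons_of_mem _ (List.mem_append.2 ?_)
      exact (List.mem_append.1 h).imp ih ih'

/-- The concepts that occur in a concept or an ontology. -/
def parts (C : Concept n) (O : Ontology n) : List (Concept n) :=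
  C.subs ++ O.flatMap fun ci => ci.1.subs ++ ci.2.subs

theorem length_parts_le (C : Concept n) (O : Ontology n) :
    (parts C O).length ≤ (C.encode ++ encodeOntology O).length := by
  have hC := C.length_subs_le
  have hO : (O.flatMap fun ci => ci.1.subs ++ ci.2.subs).length ≤ (encodeOntology O).length := by
    unfold encodeOntology
    induction O with
    | nil => simp
    | cons ci O ih =>
      have h1 := ci.1.length_subs_le
      have h2 := ci.2.length_subs_le
      simp only [List.flatMap_cons, List.length_append, List.length_cons] at ih ⊢
      omega
  simp only [parts, List.length_append]
  omega

theorem mem_parts_of_mem_subs {C : Concept n} {O : Ontology n} {D E : Concept n}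
    (hD : D ∈ parts C O) (hE : E ∈ D.subs) : E ∈ parts C O := by
  simp only [parts, List.mem_append, List.mem_flatMap] at hD ⊢
  rcases hD with h | ⟨ci, hci, h | h⟩
  · exact Or.inl (Concept.subs_trans h hE)
  · exact Or.inr ⟨ci, hci, Or.inl (Concept.subs_trans h hE)⟩
  · exact Or.inr ⟨ci, hci, Or.inr (Concept.subs_trans h hE)⟩

theorem natCard_mem_list_le {β : Type*} (l : List β) : Nat.card {x // x ∈ l} ≤ l.length := by
  have hs : Function.Surjective fun i : Fin l.length => (⟨l[i], l.getElem_mem i.2⟩ : {x // x ∈ l}) := by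
    rintro ⟨x, hx⟩
    obtain ⟨i, hi, rfl⟩ := List.getElem_of_mem hx
    exact ⟨⟨i, hi⟩, rfl⟩
  simpa using Nat.card_le_card_of_surjective _ hs

theorem exists_code {β : Type*} {A : Set β} {ℓ : ℕ} (hA : A.encard ≤ (2 ^ ℓ : ℕ)) :
    ∃ c : β → ℕ → Bool, InjOn c A ∧ ∀ a i, ℓ ≤ i → c a i = false := by
  have hfin : A.Finite := finite_of_encard_le_coe hA
  have : A.encard ≤ (univ : Set (Fin (2 ^ ℓ))).encard := by
    simpa using hA
  obtain ⟨f, -, hf⟩ := hfin.exists_injOn_of_encard_le this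
  refine ⟨fun a i => (f a : ℕ).testBit i, fun a ha b hb he => hf ha hb ?_, fun a i hi => ?_⟩
  · exact Fin.ext (Nat.eq_of_testBit_eq fun i => congrFun he i)
  · exact Nat.testBit_lt_two_pow ((f a).2.trans_le (Nat.pow_le_pow_right (by norm_num) hi))

/-- A list of length at most `D` is determined by its first `D` entries, where missing entries are
`none`. -/
theorem encard_option_list_le {S : Type} [Finite S] (D : ℕ) :
    {o : Option (List S) | ∀ l ∈ o, l.length ≤ D}.encard ≤ ((Nat.card S + 1) ^ D + 1 : ℕ) := by
  have h1 : (univ : Set (Option (Fin D → Option S))).encard = ((Nat.card S + 1) ^ D + 1 : ℕ) := by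
    rw [encard_univ, ENat.card_eq_coe_natCard]
    congr 1
    have := Fintype.ofFinite S
    simp [Nat.card_eq_fintype_card]
  rw [← h1]
  refine encard_le_encard_of_injOn (f := fun o => o.map fun l i => l[(i : ℕ)]?) (fun _ _ => trivial) ?_
  rintro (_ | l) hl (_ | l') hl' he
  · rfl
  · simp at he
  · simp at he
  · simp only [Option.map_some, Option.some.injEq] at he
    refine congrArg some (List.ext_getElem? fun i => ?_)
    have hl : l.length ≤ D := hl l rfl
    have hl' : l'.length ≤ D := hl' l' rfl
    rcases lt_or_ge i D with hi | hi
    · exact congrFun he ⟨i, hi⟩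
    · rw [List.getElem?_eq_none (hl.trans hi), List.getElem?_eq_none (hl'.trans hi)]

/-- Here `s` is the number of relevant concepts, which gives `2 ^ (s + 1)` types, `y` is the size of
the sample, and the second bound is for optional paths with `n * (y * s)` possible steps. The
constant `9` comes from `N ^ 3 + 4 * N ^ 2 + 3 * N + 1 ≤ 9 * N ^ 3`. -/
theorem size_le {n N s y : ℕ} (hN : 1 ≤ N) (hs : s ≤ N)
    (hy : y ≤ 2 ^ (s + 1) * cap (2 ^ (s + 1)) N) :
    y ≤ 2 ^ ((n + 9) * N ^ 3) ∧ (n * (y * s) + 1) ^ N + 1 ≤ 2 ^ ((n + 9) * N ^ 3) := by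
  have h1 : y ≤ 2 ^ ((N + 2) * (N + 1)) := by
    calc y ≤ 2 ^ (s + 1) * (2 * (2 ^ (s + 1) + 1) ^ N) :=
          hy.trans (Nat.mul_le_mul_left _ (cap_le _ _))
      _ ≤ 2 ^ (N + 1) * (2 * (2 ^ (N + 2)) ^ N) := by
          have h2 : 2 ^ (s + 1) ≤ 2 ^ (N + 1) := Nat.pow_le_pow_right (by norm_num) (by omega)
          have h3 : 2 ^ (s + 1) + 1 ≤ 2 ^ (N + 2) := by
            have : 1 ≤ 2 ^ (N + 1) := Nat.one_le_two_pow
            rw [pow_succ 2 (N + 1)]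
            omega
          gcongr
      _ = 2 ^ ((N + 2) * (N + 1)) := by
          rw [← pow_mul, ← pow_succ', ← pow_add]
          congr 1
          ring
  have hsq : N ≤ N ^ 3 := Nat.le_self_pow (by norm_num) N
  have hsq' : N ^ 2 ≤ N ^ 3 := Nat.pow_le_pow_right hN (by norm_num)
  have hone : 1 ≤ N ^ 3 := Nat.one_le_pow _ _ hN
  constructor
  · refine h1.trans (Nat.pow_le_pow_right (by norm_num) ?_)
    nlinarith [Nat.zero_le (n * N ^ 3)]
  · have h2 : n * (y * s) + 1 ≤ 2 ^ (n + ((N + 2) * (N + 1) + N) + 1) := by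
      have h3 : n * (y * s) ≤ 2 ^ (n + ((N + 2) * (N + 1) + N)) := by
        rw [pow_add, pow_add]
        exact Nat.mul_le_mul Nat.lt_two_pow_self.le
          (Nat.mul_le_mul h1 (hs.trans Nat.lt_two_pow_self.le))
      have : 1 ≤ 2 ^ (n + ((N + 2) * (N + 1) + N)) := Nat.one_le_two_pow
      rw [pow_succ]
      omega
    calc (n * (y * s) + 1) ^ N + 1
        ≤ 2 ^ ((n + ((N + 2) * (N + 1) + N) + 1) * N) + 1 := by
          rw [pow_mul]
          gcongr
      _ ≤ 2 ^ ((n + ((N + 2) * (N + 1) + N) + 1) * N + 1) := by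
          have : 1 ≤ 2 ^ ((n + ((N + 2) * (N + 1) + N) + 1) * N) := Nat.one_le_two_pow
          rw [pow_succ]
          omega
      _ ≤ 2 ^ ((n + 9) * N ^ 3) := by
          refine Nat.pow_le_pow_right (by norm_num) ?_
          have e : (n + ((N + 2) * (N + 1) + N) + 1) * N + 1 =
            n * N + (N ^ 3 + 4 * N ^ 2 + 3 * N + 1) := by ring
          rw [e, add_mul]
          have := Nat.mul_le_mul_left n hsq
          omega

variable {F : KripkeFrame n} {L : FrameClass} {dk : DomainKind} {nk : NameKind}

/-- Satisfiable concepts are satisfiable in interpretations of exponential size. In the case of a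
non-empty ontology, this is claimed for the logic `S5` with one modality only. -/
theorem exists_small_interpretation {O : Ontology n} {C : Concept n}
    (h : Satisfiable L dk nk O C) (hO : O = [] ∨ L = .S5 ∧ Subsingleton (Fin n)) {N ℓ : ℕ}
    (hN : (C.encode ++ encodeOntology O).length = N) (hℓ : ℓ = (n + 9) * N ^ 3) :
    ∃ (F' : KripkeFrame n) (M' : Interpretation F') (cw : F'.W → ℕ → Bool)
      (cd : M'.Obj → ℕ → Bool) (out inn : Fin n → F'.W → ℕ → Bool),
      cw.Injective ∧ cd.Injective ∧ (∀ i w v, F'.R i w v ↔ out i w = inn i v) ∧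
      (L = .S5 → out = inn) ∧ dk.Ok M' ∧ nk.Ok M' ∧ M'.Models O ∧ (∃ w, (M'.ext C w).Nonempty) ∧
      ∀ j, ℓ ≤ j → (∀ w, cw w j = false) ∧ (∀ d, cd d j = false) ∧
        ∀ i w, out i w j = false ∧ inn i w j = false := by
  classical
  obtain ⟨F, M, hF, hdk, hnk, hM, w₀, x₀, hx₀⟩ := h
  set Sg : Set (Concept n) := {D | D ∈ parts C O} with hSg
  have hfinSg : Finite Sg := (parts C O).finite_toSet
  have hC1 : 1 ≤ N := by
    rw [← hN]
    cases C <;> simp [Concept.encode]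
  have hcardSg : Nat.card Sg ≤ N :=
    (natCard_mem_list_le _).trans (hN ▸ length_parts_le C O)
  have hcardT : Nat.card (Set (Option Sg)) = 2 ^ (Nat.card Sg + 1) := by
    have := Fintype.ofFinite Sg
    simp [Nat.card_eq_fintype_card]
  -- The sample at the root is precise enough for `N` steps. Its points are the objects of the small
  -- interpretation at all worlds.
  obtain ⟨V, hV, hVc⟩ := exists_sample (M.type Sg w₀) (cap (Nat.card (Set (Option Sg))) N)
  have hVfin : Finite V := (finite_of_encard_le_coe hV).to_subtype
  set root : F.W × (V → M.Obj) := (w₀, Subtype.val) with hrootdef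
  have hroot : Represents M Sg (cap (Nat.card (Set (Option Sg))) N) root := agree_val _ hVc
  have hcardV : Nat.card V ≤
      2 ^ (Nat.card Sg + 1) * cap (2 ^ (Nat.card Sg + 1)) N := by
    rw [hcardT] at hV
    rw [Nat.card_coe_set_eq, Set.ncard]
    exact ENat.toNat_le_of_le_natCast hV
  obtain ⟨hb1, hb2⟩ := size_le (n := n) hC1 hcardSg hcardV
  set K := pathSampling hF hroot with hK
  have hsub : ∀ {D E}, D ∈ Sg → E ∈ D.subs → E ∈ Sg := fun hD hE => mem_parts_of_mem_subs hD hE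
  -- In general only concepts whose modal depth fits into the rest of the tree are preserved. With a
  -- single `S5` modality there is no restriction, as needed for a global ontology.
  set G : (pathFrame M Sg N root L).W → Set (Concept n) := fun π =>
    {E | E ∈ Sg ∧ (E.depth + π.1.length ≤ N ∨ L = .S5 ∧ Subsingleton (Fin n))} with hG
  have hGs : ∀ π, Sampling.SubClosed (G π) := by
    intro π
    refine ⟨?_, ?_, ?_, ?_, ?_⟩
    · exact fun {E} h => ⟨hsub h.1 (List.mem_cons_of_mem _ E.mem_subs_self), h.2⟩
    · exact fun {E} h => ⟨hsub h.1 (List.mem_cons_of_mem _ E.mem_subs_self), h.2⟩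
    · refine fun {E E'} h =>
        ⟨⟨hsub h.1 (List.mem_cons_of_mem _ (List.mem_append_left _ E.mem_subs_self)),
          h.2.imp_left fun h => ?_⟩,
        ⟨hsub h.1 (List.mem_cons_of_mem _ (List.mem_append_right _ E'.mem_subs_self)),
          h.2.imp_left fun h => ?_⟩⟩ <;>
      · simp only [Concept.depth] at h
        omega
    · exact fun {r E} h => ⟨hsub h.1 (List.mem_cons_of_mem _ E.mem_subs_self), h.2⟩
    · exact fun {E} h => ⟨hsub h.1 (List.mem_cons_of_mem _ E.mem_subs_self), h.2⟩
  have htruth := K.mem_ext_model (G := G) (fun π E hE => hE.1) hGs (by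
    intro i E π hE
    have hE' : E ∈ Sg := hsub hE.1 (List.mem_cons_of_mem _ E.mem_subs_self)
    refine ⟨fun π' hR => ⟨hE', hE.2.imp_left fun h => ?_⟩, ?_, ?_⟩
    · obtain ⟨ρ, hρ, hle⟩ := exists_outId L i π.1
      have hR' : outId L i π.1 = inId L i π'.1 := hR
      have := (inId_length (hR' ▸ hρ)).2
      simp only [Concept.depth] at h
      omega
    · exact fun π' y hR hy hy' => mem_sampleExt_dia hF hroot π.2 π'.2 hR hE.1 hy hy'
    · intro y hy
      -- With one `S5` modality, a point of departure cannot end with a step at all, so it is the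
      -- empty path.
      have hlt : ∀ ρ, outId L i π.1 = some ρ → ρ.length < N := by
        intro ρ hρ
        rcases hE.2 with h | ⟨h1, h2⟩
        · obtain ⟨ρ', hρ', hle⟩ := exists_outId L i π.1
          obtain rfl := Option.some.inj (hρ.symm.trans hρ')
          simp only [Concept.depth] at h
          omega
        · rcases ρ with _ | ⟨a, ρ⟩
          · exact hC1
          · exact absurd (Subsingleton.elim _ _) ((π.2.of_outId hρ).2 h1 a rfl)
      obtain ⟨π', hπ', hR, hm⟩ := exists_path_of_mem_dia hF hroot π.2 hE' hE.1 hlt hy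
      exact ⟨⟨π', hπ'⟩, hR, hm⟩)
  have hcardStep : Nat.card (PathStep V Sg) = n * (Nat.card V * Nat.card Sg) := by
    simp [Nat.card_prod]
  -- One coding of optional paths serves for worlds and for both sides of the accessibility
  -- relations; points of departure may be undefined.
  obtain ⟨c, hc, hc0⟩ := exists_code (ℓ := ℓ) ((encard_option_list_le (S := PathStep V Sg) N).trans
    (by rw [hcardStep, hℓ]; exact_mod_cast hb2))
  have hle : ∀ π : (pathFrame M Sg N root L).W, π.1.length ≤ N := fun π => π.2.length_le
  have hVenc : (univ : Set V).encard ≤ (2 ^ ℓ : ℕ) := by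
    rw [encard_univ, ENat.card_eq_coe_natCard, hℓ]
    exact_mod_cast hb1
  obtain ⟨cd, hcd, hcd0⟩ := exists_code (ℓ := ℓ) hVenc
  refine ⟨pathFrame M Sg N root L, K.model, fun π => c (some π.1), cd,
    fun i π => c (outId L i π.1), fun i π => c (inId L i π.1), ?_, ?_, ?_, ?_, ?_, ?_, ?_, ?_, ?_⟩
  · intro π π' he
    refine Subtype.ext (Option.some.inj (hc ?_ ?_ he))
    · rintro l ⟨⟩
      exact hle π
    · rintro l ⟨⟩
      exact hle π'
  · exact injOn_univ.1 hcd
  · intro i π π'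
    have : (pathFrame M Sg N root L).R i π π' ↔ outId L i π.1 = inId L i π'.1 := Iff.rfl
    rw [this]
    refine ⟨congrArg c, fun he => hc ?_ ?_ he⟩
    · intro l hl
      obtain ⟨ρ, hρ, hle'⟩ := exists_outId L i π.1
      obtain rfl := Option.some.inj (hρ.symm.trans hl)
      exact hle'.trans (hle π)
    · intro l hl
      exact (inId_length hl).1.trans (hle π')
  · rintro rfl
    rfl
  · cases dk with
    | const =>
      intro π π'
      exact (sampleDom_eq_root hroot hdk π.2).trans (sampleDom_eq_root hroot hdk π'.2).symm
    | expanding => trivial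
  · cases nk with
    | totalNames =>
      intro a π
      refine Option.isSome_iff_exists.1 ((K.ind_isSome a π).2 (Option.isSome_iff_exists.2 ?_))
      exact hnk a _
    | partialNames => trivial
  · intro ci hci π
    have hS : L = .S5 ∧ Subsingleton (Fin n) := hO.resolve_left (by rintro rfl; simp at hci)
    have h1 : ci.1 ∈ G π := by
      refine ⟨?_, Or.inr hS⟩
      simp only [hSg, parts, mem_ofPred_eq, List.mem_append, List.mem_flatMap]
      exact Or.inr ⟨ci, hci, Or.inl ci.1.mem_subs_self⟩
    have h2 : ci.2 ∈ G π := by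
      refine ⟨?_, Or.inr hS⟩
      simp only [hSg, parts, mem_ofPred_eq, List.mem_append, List.mem_flatMap]
      exact Or.inr ⟨ci, hci, Or.inr ci.2.mem_subs_self⟩
    rw [htruth ci.1 π h1, htruth ci.2 π h2]
    exact fun y hy => hM ci hci _ hy
  · refine ⟨⟨[], trivial⟩, ?_⟩
    have h1 : C ∈ G ⟨[], trivial⟩ := by
      refine ⟨?_, Or.inl ?_⟩
      · simp only [hSg, parts, mem_ofPred_eq, List.mem_append]
        exact Or.inl C.mem_subs_self
      · have := C.depth_le
        simp only [List.length_append] at hN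
        simp only [List.length_nil]
        omega
    rw [htruth C _ h1]
    obtain ⟨y, hy⟩ := K.exists_type_eq ⟨[], trivial⟩ x₀
    exact ⟨y, ((Interpretation.type_eq_iff.1 hy).2 C h1.1).2 hx₀⟩
  · exact fun j hj => ⟨fun π => hc0 _ j hj, fun d => hcd0 d j hj,
      fun i π => ⟨hc0 _ j hj, hc0 _ j hj⟩⟩

end ModalDL

/-! ## Parsing -/

namespace ModalDL

variable {n : ℕ}

instance : Finite (Letter n) := by
  let f : Letter n → ℕ × Option (Fin n) := fun a => match a with
    | .atom => (0, none) | .nom => (1, none) | .desc => (2, none) | .neg => (3, none)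
    | .inter => (4, none) | .ex => (5, none) | .exU => (6, none) | .dia i => (7, some i)
    | .bit false => (8, none) | .bit true => (9, none) | .sep => (10, none) | .incl => (11, none)
  have hf : f.Injective := by
    rintro (_ | _ | _ | _ | _ | _ | _ | i | (_ | _) | _ | _)
      (_ | _ | _ | _ | _ | _ | _ | j | (_ | _) | _ | _) h <;> simp_all [f]
  have hr : (Set.range f).Finite := by
    refine ((Set.finite_Iio 12).prod Set.finite_univ).subset ?_
    rintro _ ⟨a, rfl⟩
    refine ⟨?_, trivial⟩
    cases a with
    | bit b => cases b <;> simp [f]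
    | _ => simp [f]
  have := hr.to_subtype
  exact Finite.of_injective (Set.rangeFactorization f) fun a b h => hf (congrArg Subtype.val h)

/-- The word `u` is written at the positions from `p` up to `q`. -/
def Reads (X : ℕ → Option (Letter n)) : ℕ → ℕ → List (Letter n) → Prop
  | p, q, [] => q = p
  | p, q, a :: u => X p = some a ∧ Reads X (p + 1) q u

/-- The word for the name with bits `u`. -/
def nameWord (u : List Bool) : List (Letter n) := u.map .bit ++ [.sep]

section Reads

variable {X : ℕ → Option (Letter n)} {p q q' : ℕ}

theorem reads_append {u v : List (Letter n)} :
    Reads X p q (u ++ v) ↔ ∃ m, Reads X p m u ∧ Reads X m q v := by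
  induction u generalizing p with
  | nil => simp [Reads]
  | cons a u ih => simp [Reads, ih, and_assoc]

theorem Reads.eq_add {u : List (Letter n)} (h : Reads X p q u) : q = p + u.length := by
  induction u generalizing p with
  | nil => exact h
  | cons a u ih =>
    rw [ih h.2, List.length_cons]
    omega

theorem reads_getElem?_iff {x u : List (Letter n)} (hp : p ≤ x.length) :
    Reads (fun i => x[i]?) p q u ↔ q = p + u.length ∧ ∃ v, x.drop p = u ++ v := by
  induction u generalizing p with
  | nil => simp [Reads]
  | cons a u ih =>
    rw [Reads]
    constructor
    · rintro ⟨h1, h2⟩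
      obtain ⟨hlt, rfl⟩ := List.getElem?_eq_some_iff.1 h1
      obtain ⟨rfl, v, hv⟩ := (ih hlt).1 h2
      refine ⟨by rw [List.length_cons]; omega, v, ?_⟩
      rw [List.drop_eq_getElem_cons hlt, hv]
      rfl
    · rintro ⟨rfl, v, hv⟩
      have hlt : p < x.length := by
        have := congrArg List.length hv
        simp only [List.length_drop, List.cons_append, List.length_cons] at this
        omega
      rw [List.drop_eq_getElem_cons hlt, List.cons_append] at hv
      obtain ⟨h1, h2⟩ := List.cons.inj hv
      refine ⟨by simp [hlt, h1], (ih hlt).2 ⟨by rw [List.length_cons]; omega, v, h2⟩⟩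

theorem reads_nameWord_unique {u u' : List Bool} (h : Reads X p q (nameWord u))
    (h' : Reads X p q' (nameWord u')) : u = u' ∧ q = q' := by
  induction u generalizing p u' with
  | nil =>
    cases u' with
    | nil => exact ⟨rfl, h.2.trans h'.2.symm⟩
    | cons b u' => exact absurd (h.1.symm.trans h'.1) (by simp)
  | cons b u ih =>
    cases u' with
    | nil => exact absurd (h.1.symm.trans h'.1) (by simp)
    | cons b' u' =>
      obtain rfl : b = b' := by
        have := h.1.symm.trans h'.1
        simpa using this
      obtain ⟨rfl, rfl⟩ := ih h.2 h'.2
      exact ⟨rfl, rfl⟩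

theorem encodeName_injective : Function.Injective (encodeName : ℕ → List (Letter n)) := by
  intro a b h
  have h1 := List.append_cancel_right h
  have h2 : a.bits = b.bits := List.map_injective_iff.2 (fun _ _ h => Letter.bit.inj h) h1
  exact Nat.eq_of_testBit_eq fun i => by rw [Nat.testBit_eq_inth, Nat.testBit_eq_inth, h2]

/-- Names with bits that do not end in `false` are binary representations. -/
theorem exists_encodeName {u : List Bool} (h : Reads X p q (nameWord u))
    (hX : ∀ i, ¬ (X i = some (.bit false) ∧ X (i + 1) = some .sep)) :
    ∃ a, nameWord u = (encodeName a : List (Letter n)) := by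
  have : ∃ a : ℕ, u = a.bits := by
    induction u generalizing p with
    | nil => exact ⟨0, by simp⟩
    | cons b u ih =>
      obtain ⟨a, rfl⟩ := ih h.2
      refine ⟨Nat.bit b a, (Nat.bits_append_bit a b ?_).symm⟩
      -- Bits are written from the lowest on. A last bit `false` would stand directly before the
      -- separator, which `hX` excludes.
      rintro rfl
      cases b with
      | true => rfl
      | false =>
        have h1 := h.2.1
        exact absurd ⟨h.1, h1⟩ (hX p)
  obtain ⟨a, rfl⟩ := this
  exact ⟨a, rfl⟩

end Reads

/-- The concept `C` is written at the positions from `p` up to `q`, and its last immediate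
subconcept starts at the position `m` (which is `q` if there is none). -/
inductive Parse (X : ℕ → Option (Letter n)) : Concept n → ℕ → ℕ → ℕ → Prop
  | atom {A p q} : X p = some .atom → Reads X (p + 1) q (encodeName A) → Parse X (.atom A) p q q
  | nom {a p q} : X p = some .nom → Reads X (p + 1) q (encodeName a) → Parse X (.nom a) p q q
  | desc {C p m q} : X p = some .desc → Parse X C (p + 1) m q → Parse X (.desc C) p (p + 1) q
  | neg {C p m q} : X p = some .neg → Parse X C (p + 1) m q → Parse X (.neg C) p (p + 1) q
  | inter {C D p m m₁ m₂ q} : X p = some .inter → Parse X C (p + 1) m₁ m → Parse X D m m₂ q →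
      Parse X (.inter C D) p m q
  | ex {r C p m m₁ q} : X p = some .ex → Reads X (p + 1) m (encodeName r) → Parse X C m m₁ q →
      Parse X (.ex r C) p m q
  | exU {C p m q} : X p = some .exU → Parse X C (p + 1) m q → Parse X (.exU C) p (p + 1) q
  | dia {i C p m q} : X p = some (.dia i) → Parse X C (p + 1) m q → Parse X (.dia i C) p (p + 1) q

section Parse

variable {X : ℕ → Option (Letter n)} {p m q : ℕ} {C : Concept n}

theorem reads_encodeName_unique {a b q' : ℕ} (h : Reads X p q (encodeName a))
    (h' : Reads X p q' (encodeName b)) : a = b ∧ q = q' := by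
  obtain ⟨h1, h2⟩ := reads_nameWord_unique (u := a.bits) (u' := b.bits) h h'
  refine ⟨encodeName_injective (n := n) ?_, h2⟩
  rw [encodeName, h1]
  rfl

/-- Unique readability of Polish notation: the letter at `p` determines the constructor, names end
at their separators, and so the ends of all parts are determined in turn. -/
theorem Parse.unique (h : Parse X C p m q) {C' : Concept n} {m' q' : ℕ}
    (h' : Parse X C' p m' q') : C = C' ∧ m = m' ∧ q = q' := by
  induction h generalizing C' m' q' with
  | atom h1 h2 =>
    cases h' with
    | atom h3 h4 =>
      obtain ⟨rfl, rfl⟩ := reads_encodeName_unique h2 h4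
      exact ⟨rfl, rfl, rfl⟩
    | _ h3 => rw [h1] at h3; cases h3
  | nom h1 h2 =>
    cases h' with
    | nom h3 h4 =>
      obtain ⟨rfl, rfl⟩ := reads_encodeName_unique h2 h4
      exact ⟨rfl, rfl, rfl⟩
    | _ h3 => rw [h1] at h3; cases h3
  | desc h1 _ ih | neg h1 _ ih | exU h1 _ ih | dia h1 _ ih =>
    cases h' with
    | atom h3 | nom h3 | inter h3 | ex h3 => rw [h1] at h3; cases h3
    | desc h3 h4 | neg h3 h4 | exU h3 h4 | dia h3 h4 =>
      rw [h1] at h3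
      first
        | cases h3; done
        | cases h3
          obtain ⟨rfl, -, rfl⟩ := ih h4
          exact ⟨rfl, rfl, rfl⟩
  | inter h1 _ _ ih₁ ih₂ =>
    cases h' with
    | inter h3 h4 h5 =>
      obtain ⟨rfl, -, rfl⟩ := ih₁ h4
      obtain ⟨rfl, -, rfl⟩ := ih₂ h5
      exact ⟨rfl, rfl, rfl⟩
    | _ h3 => rw [h1] at h3; cases h3
  | ex h1 h2 _ ih =>
    cases h' with
    | ex h3 h4 h5 =>
      obtain ⟨rfl, rfl⟩ := reads_encodeName_unique h2 h4
      obtain ⟨rfl, -, rfl⟩ := ih h5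
      exact ⟨rfl, rfl, rfl⟩
    | _ h3 => rw [h1] at h3; cases h3

theorem Parse.ne_none (h : Parse X C p m q) : X p ≠ none := by
  cases h <;> simp_all

theorem exists_parse_iff : (∃ m, Parse X C p m q) ↔ Reads X p q C.encode := by
  induction C generalizing p q with
  | atom A | nom a =>
    constructor
    · rintro ⟨m, h⟩
      cases h with
      | _ h1 h2 => exact ⟨h1, h2⟩
    · rintro ⟨h1, h2⟩
      first | exact ⟨_, .atom h1 h2⟩ | exact ⟨_, .nom h1 h2⟩
  | desc C ih | neg C ih | exU C ih | dia i C ih =>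
    constructor
    · rintro ⟨m, h⟩
      cases h with
      | _ h1 h2 => exact ⟨h1, ih.1 ⟨_, h2⟩⟩
    · rintro ⟨h1, h2⟩
      obtain ⟨m, h2⟩ := ih.2 h2
      first
        | exact ⟨_, .desc h1 h2⟩
        | exact ⟨_, .neg h1 h2⟩
        | exact ⟨_, .exU h1 h2⟩
        | exact ⟨_, .dia h1 h2⟩
  | inter C D ih₁ ih₂ =>
    rw [Concept.encode, Reads, reads_append]
    constructor
    · rintro ⟨m, h⟩
      cases h with
      | inter h1 h2 h3 => exact ⟨h1, m, ih₁.1 ⟨_, h2⟩, ih₂.1 ⟨_, h3⟩⟩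
    · rintro ⟨h1, m, h2, h3⟩
      obtain ⟨_, h2⟩ := ih₁.2 h2
      obtain ⟨_, h3⟩ := ih₂.2 h3
      exact ⟨m, .inter h1 h2 h3⟩
  | ex r C ih =>
    rw [Concept.encode, Reads, reads_append]
    constructor
    · rintro ⟨m, h⟩
      cases h with
      | ex h1 h2 h3 => exact ⟨h1, m, h2, ih.1 ⟨_, h3⟩⟩
    · rintro ⟨h1, m, h2, h3⟩
      obtain ⟨_, h3⟩ := ih.2 h3
      exact ⟨m, .ex h1 h2 h3⟩

theorem Parse.reads (h : Parse X C p m q) : Reads X p q C.encode := exists_parse_iff.1 ⟨m, h⟩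

theorem Parse.lt (h : Parse X C p m q) : p < q := by
  have := h.reads.eq_add
  have h1 : 0 < C.encode.length := by cases C <;> simp [Concept.encode]
  omega

end Parse

end ModalDL

/-! ## Certificates for satisfiability -/

namespace ModalDL

variable {n : ℕ}

/-- The kinds of rows of a certificate. -/
inductive RowTag
  | model
  | name
  | span
  | incl

/-- The cells of the rows of a certificate. In a model row, the tracks `w` and `d` give a world and
an object, `out` and `inn` describe the accessibility relations (`v` is accessible from `w` if `out`
at `w` is `inn` at `v`), the track `t` tells at the start of each concept whether it is true, and
`c` tells the same about its last immediate subconcept. The tracks `p`, `m`, `q` mark positions,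
and in rows for names the track `e` marks the positions at which the same name is written. -/
structure CertCell (n : ℕ) where
  tag : RowTag
  w : Bool
  d : Bool
  t : Bool
  c : Bool
  p : Bool
  m : Bool
  q : Bool
  e : Bool
  out : Fin n → Bool
  inn : Fin n → Bool

instance : Finite RowTag := by
  refine Finite.of_injective (fun T : RowTag => match T with
    | .model => (0 : Fin 4) | .name => 1 | .span => 2 | .incl => 3) ?_
  rintro (_ | _ | _ | _) (_ | _ | _ | _) h <;> simp_all

instance : Finite (CertCell n) := by
  refine Finite.of_injective
    (fun c : CertCell n => (c.tag, c.w, c.d, c.t, c.c, c.p, c.m, c.q, c.e, c.out, c.inn)) ?_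
  rintro ⟨⟩ ⟨⟩ h
  simpa using h

/-- Formulas about three rows of a certificate and the input. -/
abbrev CertFormula (n : ℕ) : Type := ColFormula (TapeProgram.Col (Letter n) (CertCell n))

namespace CertFormula

open ColFormula

def tag₁ (T : RowTag) : CertFormula n := first fun c => c.2.1.tag = T

def tag₂ (T : RowTag) : CertFormula n := first fun c => c.2.2.1.tag = T

def tag₃ (T : RowTag) : CertFormula n := first fun c => c.2.2.2.tag = T

/-- The letters of concepts without immediate subconcepts. -/
def IsLeaf (a : Option (Letter n)) : Prop := a = some .atom ∨ a = some .nom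

/-- The letters of concepts whose only immediate subconcept comes next. -/
def IsUnary (a : Option (Letter n)) : Prop :=
  a = some .desc ∨ a = some .neg ∨ a = some .exU ∨ ∃ i, a = some (.dia i)

/-! ### Words -/

/-- A row for a name is thus a pair of positions, and a row for a concept or an inclusion is a
triple. -/
def marked : CertFormula n :=
  and (imp (tag₁ .name) (and (one fun c => c.2.1.p = true) (one fun c => c.2.1.q = true)))
    (imp (or (tag₁ .span) (tag₁ .incl)) (and (one fun c => c.2.1.p = true)
      (and (one fun c => c.2.1.m = true) (one fun c => c.2.1.q = true))))

def canonical : CertFormula n :=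
  all fun c c' => ¬ (c.1 = some (.bit false) ∧ c'.1 = some .sep)

/-- The third row belongs to the rest of the name, from `p + 1` on. A position gets the mark `e` if
it carries the same bit and the next position is marked for the rest. Only this direction is
imposed: outside `nameStep` the track `e` occurs in premises only, so superfluous marks do no harm
to soundness. -/
def nameBit (b : Bool) : CertFormula n :=
  and (ex fun c _ => c.2.1.p = true ∧ c.1 = some (.bit b))
    (and (tag₃ .name) (and (all fun c c' => c.2.1.p = true → c'.2.2.2.p = true)
      (and (all fun c _ => c.2.1.q = true → c.2.2.2.q = true)
        (all fun c c' => c.1 = some (.bit b) ∧ c'.2.2.2.e = true → c.2.1.e = true))))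

def nameStep : CertFormula n :=
  imp (tag₁ .name) (or (and (ex fun c c' => c.2.1.p = true ∧ c.1 = some .sep ∧ c'.2.1.q = true)
      (all fun c _ => c.1 = some .sep → c.2.1.e = true))
    (or (nameBit true) (nameBit false)))

/-- There is one alternative for each form of concept. The third row accounts for the part before
the last immediate subconcept: a name, or the left operand of an intersection. Without subconcepts,
`m` and `q` coincide. -/
def spanFirst : CertFormula n :=
  imp (tag₁ .span) (or (and (ex fun c _ => c.2.1.p = true ∧ IsLeaf c.1)
      (and (tag₃ .name) (and (all fun c c' => c.2.1.p = true → c'.2.2.2.p = true)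
        (and (all fun c _ => c.2.1.q = true → c.2.2.2.q = true)
          (all fun c _ => c.2.1.m = true → c.2.1.q = true)))))
    (or (ex fun c c' => c.2.1.p = true ∧ IsUnary c.1 ∧ c'.2.1.m = true)
    (or (and (ex fun c _ => c.2.1.p = true ∧ c.1 = some .ex)
      (and (tag₃ .name) (and (all fun c c' => c.2.1.p = true → c'.2.2.2.p = true)
        (all fun c _ => c.2.1.m = true → c.2.2.2.q = true))))
    (and (ex fun c _ => c.2.1.p = true ∧ c.1 = some .inter)
      (and (tag₃ .span) (and (all fun c c' => c.2.1.p = true → c'.2.2.2.p = true)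
        (all fun c _ => c.2.1.m = true → c.2.2.2.q = true)))))))

def spanLast : CertFormula n :=
  imp (and (tag₁ .span) (not (ex fun c _ => c.2.1.p = true ∧ IsLeaf c.1)))
    (and (tag₃ .span) (and (all fun c _ => c.2.1.m = true → c.2.2.2.p = true)
      (all fun c _ => c.2.1.q = true → c.2.2.2.q = true)))

def inclFirst : CertFormula n :=
  imp (tag₁ .incl) (and (ex fun c _ => c.2.1.p = true ∧ c.1 = some .incl)
    (and (tag₃ .span) (and (all fun c c' => c.2.1.p = true → c'.2.2.2.p = true)
      (all fun c _ => c.2.1.m = true → c.2.2.2.q = true))))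

def inclLast : CertFormula n :=
  imp (tag₁ .incl) (and (tag₃ .span) (and (all fun c _ => c.2.1.m = true → c.2.2.2.p = true)
    (all fun c _ => c.2.1.q = true → c.2.2.2.q = true)))

/-- A span that starts at `0` is the main concept. After it, and after each inclusion, the input has
to end or another inclusion has to follow; this makes the whole input well-formed. -/
def tail (allow : Bool) : CertFormula n :=
  imp (or (tag₁ .incl) (and (tag₁ .span) (first fun c => c.2.1.p = true)))
    (or (ex fun c _ => c.2.1.q = true ∧ c.1 = none)
      (and (first fun _ => allow = true)
        (and (tag₃ .incl) (all fun c _ => c.2.1.q = true → c.2.2.2.p = true))))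

def start : CertFormula n := and (tag₃ .span) (first fun c => c.2.2.2.p = true)

/-! ### Semantics -/

def model₁₂ : CertFormula n := and (tag₁ .model) (tag₂ .model)

def world₁₂ : CertFormula n := all fun c _ => c.2.1.w = c.2.2.1.w

def object₁₂ : CertFormula n := all fun c _ => c.2.1.d = c.2.2.1.d

/-- The third row is a model row for the world of the first row. -/
def world₁₃ : CertFormula n := and (tag₃ .model) (all fun c _ => c.2.1.w = c.2.2.2.w)

/-- The third row is a model row for the object of the first row. -/
def object₁₃ : CertFormula n := and (tag₃ .model) (all fun c _ => c.2.1.d = c.2.2.2.d)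

/-- The third row is a model row for the object of the first row and the world of the second. -/
def worldObject₃ : CertFormula n := and object₁₃ (all fun c _ => c.2.2.1.w = c.2.2.2.w)

def target : CertFormula n := and (tag₃ .model) (first fun c => c.2.2.2.t = true)

/-- Accessibility is a property of the world, and truth is a property of world and object; without
this, rows with equal codes could contradict each other. -/
def functional : CertFormula n :=
  imp (and model₁₂ world₁₂) (and
    (all fun c _ => c.2.1.out = c.2.2.1.out ∧ c.2.1.inn = c.2.2.1.inn)
    (imp object₁₂ (all fun c _ => c.2.1.t = c.2.2.1.t ∧ c.2.1.c = c.2.2.1.c)))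

/-- The left operand of an intersection starts in the next column and the right one is seen through
the track `c`. Of the description, only the local part is treated here; `descUnique` and
`descWitness` add uniqueness. -/
def boolean : CertFormula n :=
  imp (and (tag₁ .model) (tag₂ .span)) (all fun c c' => c.2.2.1.p = true →
    (c.1 = some .neg → (c.2.1.t = true ↔ ¬ c.2.1.c = true)) ∧
    (c.1 = some .inter → (c.2.1.t = true ↔ c'.2.1.t = true ∧ c.2.1.c = true)) ∧
    (c.1 = some .desc → c.2.1.t = true → c.2.1.c = true))

/-- Formulas relate neighbouring columns only, but the last subconcept may start far away. Its truth
value at `m` is therefore repeated in the track `c` at `p`, and the marks of the span row are used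
to compare the two. -/
def relocate : CertFormula n :=
  imp (and (tag₁ .model) (and (tag₂ .span) (not (ex fun c _ => c.2.2.1.p = true ∧ IsLeaf c.1))))
    (and (imp (ex fun c _ => c.2.2.1.p = true ∧ c.2.1.c = true)
        (ex fun c _ => c.2.2.1.m = true ∧ c.2.1.t = true))
      (imp (ex fun c _ => c.2.2.1.m = true ∧ c.2.1.t = true)
        (ex fun c _ => c.2.2.1.p = true ∧ c.2.1.c = true)))

/-- Names start one column after their letter, hence the shift. Without this condition, two
occurrences of one atomic concept could differ in truth value. -/
def sameName (a : Letter n) : CertFormula n :=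
  imp (and (tag₁ .model) (and (tag₂ .name)
      (ex fun c c' => c'.2.2.1.e = true ∧ c.1 = some a ∧ c.2.1.t = true)))
    (all fun c c' => c'.2.2.1.p = true ∧ c.1 = some a → c.2.1.t = true)

def nomUnique : CertFormula n :=
  imp (and (and model₁₂ world₁₂)
    (ex fun c _ => c.1 = some .nom ∧ c.2.1.t = true ∧ c.2.2.1.t = true)) object₁₂

def nomTotal (nk : NameKind) : CertFormula n :=
  imp (and (first fun _ => nk = .totalNames) (and (tag₁ .model) (and (tag₂ .span)
      (ex fun c _ => c.2.2.1.p = true ∧ c.1 = some .nom))))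
    (and world₁₃ (all fun c _ => c.2.2.1.p = true → c.2.2.2.t = true))

def descUnique : CertFormula n :=
  imp (and (and model₁₂ world₁₂)
    (ex fun c _ => c.1 = some .desc ∧ c.2.1.t = true ∧ c.2.2.1.c = true)) object₁₂

def descWitness : CertFormula n :=
  imp (and (tag₁ .model) (and (tag₂ .span) (ex fun c _ => c.2.2.1.p = true ∧ c.1 = some .desc ∧
      c.2.1.c = true ∧ ¬ c.2.1.t = true)))
    (and world₁₃ (and (ex fun c _ => c.2.1.d ≠ c.2.2.2.d)
      (all fun c _ => c.2.2.1.p = true → c.2.2.2.c = true)))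

/-- The witness has to be usable as a successor for the role: wherever a restriction with the same
role is written and its body is true of the witness, the restriction is true of the object of the
first row. -/
def exWitness : CertFormula n :=
  imp (and (tag₁ .model) (and (tag₂ .name)
      (ex fun c c' => c'.2.2.1.p = true ∧ c.1 = some .ex ∧ c.2.1.t = true)))
    (and world₁₃ (and (all fun c c' => c'.2.2.1.p = true → c.2.2.2.c = true)
      (all fun c c' => c'.2.2.1.e = true ∧ c.1 = some .ex ∧ c.2.2.2.c = true → c.2.1.t = true)))

def exUGlobal : CertFormula n :=
  imp (and model₁₂ world₁₂) (all fun c _ => c.1 = some .exU ∧ c.2.2.1.c = true → c.2.1.t = true)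

def exUWitness : CertFormula n :=
  imp (and (tag₁ .model) (and (tag₂ .span)
      (ex fun c _ => c.2.2.1.p = true ∧ c.1 = some .exU ∧ c.2.1.t = true)))
    (and world₁₃ (all fun c _ => c.2.2.1.p = true → c.2.2.2.c = true))

/-- The second row only provides an accessible world. The third row combines it with the object of
the first, which expresses expanding domains, and truth of the subconcept there is passed back to
the diamond. -/
def diaGlobal (i : Fin n) : CertFormula n :=
  imp (and model₁₂ (all fun c _ => c.2.1.out i = c.2.2.1.inn i))
    (and worldObject₃ (all fun c _ => c.1 = some (.dia i) ∧ c.2.2.2.c = true → c.2.1.t = true))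

def diaWitness (i : Fin n) : CertFormula n :=
  imp (and (tag₁ .model) (and (tag₂ .span)
      (ex fun c _ => c.2.2.1.p = true ∧ c.1 = some (.dia i) ∧ c.2.1.t = true)))
    (and object₁₃ (and (all fun c _ => c.2.1.out i = c.2.2.2.inn i)
      (all fun c _ => c.2.2.1.p = true → c.2.2.2.c = true)))

def frame (L : FrameClass) : CertFormula n :=
  imp (and (first fun _ => L = .S5) (tag₁ .model)) (all fun c _ => c.2.1.out = c.2.1.inn)

def constant (dk : DomainKind) : CertFormula n :=
  imp (and (first fun _ => dk = .const) model₁₂) worldObject₃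

def inclTrue : CertFormula n :=
  imp (and (tag₁ .model) (and (tag₂ .incl)
      (ex fun c c' => c.2.2.1.p = true ∧ c'.2.1.t = true)))
    (all fun c _ => c.2.2.1.m = true → c.2.1.t = true)

/-- The conditions on certificates; `allow` tells whether ontologies may be non-empty. -/
def conditions (n : ℕ) (L : FrameClass) (dk : DomainKind) (nk : NameKind) (allow : Bool) :
    List (CertFormula n) :=
  [marked, canonical, nameStep, spanFirst, spanLast, inclFirst, inclLast, tail allow, start,
    target, functional, boolean, relocate, sameName .atom, sameName .nom, nomUnique, nomTotal nk,
    descUnique, descWitness, exWitness, exUGlobal, exUWitness, frame L, constant dk, inclTrue] ++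
    ((List.finRange n).map diaGlobal ++ (List.finRange n).map diaWitness)

end CertFormula

open CertFormula

/-- The rows in `S` certify the satisfiability of the input `X`. -/
def Certifies (L : FrameClass) (dk : DomainKind) (nk : NameKind) (allow : Bool)
    (X : ℕ → Option (Letter n)) (S : Set (ℕ → CertCell n)) : Prop :=
  ∀ φ ∈ conditions n L dk nk allow, ∀ r₁ ∈ S, ∀ r₂ ∈ S, ∃ r₃ ∈ S,
    φ.Sat fun i => (X i, r₁ i, r₂ i, r₃ i)

/-- The track `f` marks the position `p` only. -/
def Marks (f : ℕ → Bool) (p : ℕ) : Prop := ∀ i, f i = true ↔ i = p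

theorem marks_of_existsUnique {f : ℕ → Bool} (h : ∃! i, f i = true) : ∃ p, Marks f p := by
  obtain ⟨p, hp, hu⟩ := h
  exact ⟨p, fun i => ⟨hu i, fun h => h ▸ hp⟩⟩

/-- `r` is a row for the name from `p` up to `q`. -/
structure IsNameRow (S : Set (ℕ → CertCell n)) (p q : ℕ) (r : ℕ → CertCell n) : Prop where
  mem : r ∈ S
  tag : (r 0).tag = .name
  p : Marks (fun i => (r i).p) p
  q : Marks (fun i => (r i).q) q

/-- `r` is a row of kind `T` with marks `p`, `m`, `q`. -/
structure IsSpanRow (T : RowTag) (S : Set (ℕ → CertCell n)) (p m q : ℕ) (r : ℕ → CertCell n) :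
    Prop where
  mem : r ∈ S
  tag : (r 0).tag = T
  p : Marks (fun i => (r i).p) p
  m : Marks (fun i => (r i).m) m
  q : Marks (fun i => (r i).q) q

namespace Certifies

variable {L : FrameClass} {dk : DomainKind} {nk : NameKind} {allow : Bool}
  {X : ℕ → Option (Letter n)} {S : Set (ℕ → CertCell n)}

section Words

variable (h : Certifies L dk nk allow X S) (hX : ∃ N, ∀ i, N ≤ i → X i = none)

include h

theorem exists_isNameRow {r : ℕ → CertCell n} (hr : r ∈ S) (ht : (r 0).tag = .name) :
    ∃ p q, IsNameRow S p q r := by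
  obtain ⟨_, -, hs⟩ := h marked (by simp [conditions]) r hr r hr
  obtain ⟨h1, h2⟩ := hs.1 ht
  obtain ⟨p, hp⟩ := marks_of_existsUnique h1
  obtain ⟨q, hq⟩ := marks_of_existsUnique h2
  exact ⟨p, q, hr, ht, hp, hq⟩

theorem exists_isSpanRow {r : ℕ → CertCell n} (hr : r ∈ S) {T : RowTag} (ht : (r 0).tag = T)
    (hT : T = .span ∨ T = .incl) : ∃ p m q, IsSpanRow T S p m q r := by
  obtain ⟨_, -, hs⟩ := h marked (by simp [conditions]) r hr r hr
  obtain ⟨h1, h2, h3⟩ := hs.2 (hT.imp ht.trans ht.trans)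
  obtain ⟨p, hp⟩ := marks_of_existsUnique h1
  obtain ⟨m, hm⟩ := marks_of_existsUnique h2
  obtain ⟨q, hq⟩ := marks_of_existsUnique h3
  exact ⟨p, m, q, hr, ht, hp, hm, hq⟩

theorem not_canonical {r : ℕ → CertCell n} (hr : r ∈ S) (i : ℕ) :
    ¬ (X i = some (.bit false) ∧ X (i + 1) = some .sep) := by
  obtain ⟨_, -, hs⟩ := h canonical (by simp [conditions]) r hr r hr
  exact hs i

theorem name_step {p q : ℕ} {r : ℕ → CertCell n} (hr : IsNameRow S p q r) :
    (X p = some .sep ∧ q = p + 1 ∧ ∀ j, X j = some .sep → (r j).e = true) ∨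
    ∃ b r', X p = some (.bit b) ∧ IsNameRow S (p + 1) q r' ∧
      ∀ j, X j = some (.bit b) → (r' (j + 1)).e = true → (r j).e = true := by
  obtain ⟨r', hr', hs⟩ := h nameStep (by simp [conditions]) r hr.mem r hr.mem
  have key : ∀ b, (nameBit b).Sat (fun i => (X i, r i, r i, r' i)) →
      X p = some (.bit b) ∧ IsNameRow S (p + 1) q r' ∧
      ∀ j, X j = some (.bit b) → (r' (j + 1)).e = true → (r j).e = true := by
    rintro b ⟨⟨i, hi, hb⟩, ht, hp, hq, he⟩
    obtain rfl := (hr.p i).1 hi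
    obtain ⟨p', q', hr'⟩ := h.exists_isNameRow hr' ht
    obtain rfl := (hr'.p _).1 (hp i hi)
    obtain rfl := (hr'.q _).1 (hq q ((hr.q q).2 rfl))
    exact ⟨hb, hr', fun j hj hj' => he j ⟨hj, hj'⟩⟩
  rcases hs hr.tag with ⟨⟨i, hi, hX, hq⟩, he⟩ | hs | hs
  · obtain rfl := (hr.p i).1 hi
    exact Or.inl ⟨hX, ((hr.q _).1 hq).symm, he⟩
  · exact Or.inr ⟨true, r', key true hs⟩
  · exact Or.inr ⟨false, r', key false hs⟩

include hX in
theorem reads_name {p q : ℕ} {r : ℕ → CertCell n} (hr : IsNameRow S p q r) :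
    ∃ a, Reads X p q (encodeName a) ∧ ∀ j q', Reads X j q' (encodeName a) → (r j).e = true := by
  obtain ⟨N, hN⟩ := hX
  -- The induction is on the distance `k` to the end of the input; it shows that the chain of name
  -- rows stops at a separator.
  have key : ∀ k p r, N ≤ p + k → IsNameRow S p q r → ∃ u, Reads X p q (nameWord u) ∧
      ∀ j q', Reads X j q' (nameWord u) → (r j).e = true := by
    intro k
    induction k with
    | zero =>
      intro p r hp hr
      rcases h.name_step hr with ⟨h1, -⟩ | ⟨b, r', h1, -⟩ <;> simp [hN p hp] at h1
    | succ k ih =>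
      intro p r hp hr
      rcases h.name_step hr with ⟨h1, rfl, h2⟩ | ⟨b, r', h1, h2, h3⟩
      · exact ⟨[], ⟨h1, rfl⟩, fun j q' hj => h2 j hj.1⟩
      · obtain ⟨u, hu, he⟩ := ih (p + 1) r' (by omega) h2
        exact ⟨b :: u, ⟨h1, hu⟩, fun j q' hj => h3 j hj.1 (he _ _ hj.2)⟩
  obtain ⟨u, hu, he⟩ := key N p r (by omega) hr
  obtain ⟨a, ha⟩ := exists_encodeName hu (h.not_canonical hr.mem)
  rw [ha] at hu he
  exact ⟨a, hu, he⟩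

theorem span_last {T : RowTag} {p m q : ℕ} {r : ℕ → CertCell n} (hr : IsSpanRow T S p m q r)
    (hT : T = .span ∧ ¬ IsLeaf (X p) ∨ T = .incl) : ∃ m' r', IsSpanRow .span S m m' q r' := by
  have key : ∀ r' ∈ S, (r' 0).tag = .span → (∀ i, (r i).m = true → (r' i).p = true) →
      (∀ i, (r i).q = true → (r' i).q = true) → ∃ m' r', IsSpanRow .span S m m' q r' := by
    intro r' hr' ht hp hq
    obtain ⟨p', m', q', hr'⟩ := h.exists_isSpanRow hr' ht (Or.inl rfl)
    obtain rfl := (hr'.p _).1 (hp m ((hr.m m).2 rfl))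
    obtain rfl := (hr'.q _).1 (hq q ((hr.q q).2 rfl))
    exact ⟨m', r', hr'⟩
  rcases hT with ⟨rfl, hT⟩ | rfl
  · obtain ⟨r', hr', hs⟩ := h spanLast (by simp [conditions]) r hr.mem r hr.mem
    obtain ⟨h1, h2, h3⟩ := hs ⟨hr.tag, by
      rintro ⟨i, hi, hl⟩
      obtain rfl := (hr.p i).1 hi
      exact hT hl⟩
    exact key r' hr' h1 h2 h3
  · obtain ⟨r', hr', hs⟩ := h inclLast (by simp [conditions]) r hr.mem r hr.mem
    obtain ⟨h1, h2, h3⟩ := hs hr.tag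
    exact key r' hr' h1 h2 h3

/-- The first part of a concept, up to the last immediate subconcept. -/
theorem span_first {p m q : ℕ} {r : ℕ → CertCell n} (hr : IsSpanRow .span S p m q r) :
    (IsLeaf (X p) ∧ m = q ∧ ∃ r', IsNameRow S (p + 1) q r') ∨
    (IsUnary (X p) ∧ m = p + 1) ∨
    (X p = some .ex ∧ ∃ r', IsNameRow S (p + 1) m r') ∨
    (X p = some .inter ∧ ∃ m' r', IsSpanRow .span S (p + 1) m' m r') := by
  obtain ⟨r', hr', hs⟩ := h spanFirst (by simp [conditions]) r hr.mem r hr.mem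
  rcases hs hr.tag with ⟨⟨i, hi, hX⟩, ht, hp, hq, hm⟩ | ⟨i, hi, hX, hm⟩ | ⟨⟨i, hi, hX⟩, ht, hp, hq⟩
    | ⟨⟨i, hi, hX⟩, ht, hp, hq⟩
  all_goals obtain rfl := (hr.p i).1 hi
  · obtain ⟨p', q', hr'⟩ := h.exists_isNameRow hr' ht
    obtain rfl := (hr'.p _).1 (hp i hi)
    obtain rfl := (hr'.q _).1 (hq q ((hr.q q).2 rfl))
    exact Or.inl ⟨hX, (hr.q m).1 (hm m ((hr.m m).2 rfl)), r', hr'⟩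
  · exact Or.inr (Or.inl ⟨hX, ((hr.m _).1 hm).symm⟩)
  · obtain ⟨p', q', hr'⟩ := h.exists_isNameRow hr' ht
    obtain rfl := (hr'.p _).1 (hp i hi)
    obtain rfl := (hr'.q _).1 (hq m ((hr.m m).2 rfl))
    exact Or.inr (Or.inr (Or.inl ⟨hX, r', hr'⟩))
  · obtain ⟨p', m', q', hr'⟩ := h.exists_isSpanRow hr' ht (Or.inl rfl)
    obtain rfl := (hr'.p _).1 (hp i hi)
    obtain rfl := (hr'.q _).1 (hq m ((hr.m m).2 rfl))
    exact Or.inr (Or.inr (Or.inr ⟨hX, m', r', hr'⟩))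

include hX in
-- Each span row demands rows for its parts, which start further to the right. Since the input is
-- finite, the descent ends and yields a syntax tree.
theorem exists_parse {p m q : ℕ} {r : ℕ → CertCell n} (hr : IsSpanRow .span S p m q r) :
    ∃ C, Parse X C p m q := by
  have hX' := hX
  obtain ⟨N, hN⟩ := hX'
  have key : ∀ k p m q r, N ≤ p + k → IsSpanRow .span S p m q r → ∃ C, Parse X C p m q := by
    intro k
    induction k with
    | zero =>
      intro p m q r hp hr
      have h0 := hN p hp
      rcases h.span_first hr with ⟨h1 | h1, -⟩ | ⟨h1 | h1 | h1 | ⟨i, h1⟩, -⟩ | ⟨h1, -⟩ | ⟨h1, -⟩ <;>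
        simp [h0] at h1
    | succ k ih =>
      intro p m q r hp hr
      have hlast := h.span_last hr
      rcases h.span_first hr with ⟨h1, rfl, r', hr'⟩ | ⟨h1, rfl⟩ | ⟨h1, r', hr'⟩ | ⟨h1, m', r', hr'⟩
      · obtain ⟨a, ha, -⟩ := h.reads_name hX hr'
        rcases h1 with h1 | h1
        · exact ⟨_, .atom h1 ha⟩
        · exact ⟨_, .nom h1 ha⟩
      · obtain ⟨m', r', hr'⟩ := hlast (Or.inl ⟨rfl, by
          rcases h1 with h1 | h1 | h1 | ⟨i, h1⟩ <;> simp [IsLeaf, h1]⟩)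
        obtain ⟨C, hC⟩ := ih _ _ _ _ (by omega) hr'
        rcases h1 with h1 | h1 | h1 | ⟨i, h1⟩
        · exact ⟨_, .desc h1 hC⟩
        · exact ⟨_, .neg h1 hC⟩
        · exact ⟨_, .exU h1 hC⟩
        · exact ⟨_, .dia h1 hC⟩
      · obtain ⟨a, ha, -⟩ := h.reads_name hX hr'
        obtain ⟨m', r', hr'⟩ := hlast (Or.inl ⟨rfl, by simp [IsLeaf, h1]⟩)
        have := ha.eq_add
        obtain ⟨C, hC⟩ := ih _ _ _ _ (by omega) hr'
        exact ⟨_, .ex h1 ha hC⟩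
      · obtain ⟨C, hC⟩ := ih _ _ _ _ (by omega) hr'
        obtain ⟨m'', r'', hr''⟩ := hlast (Or.inl ⟨rfl, by simp [IsLeaf, h1]⟩)
        have := hC.lt
        obtain ⟨D, hD⟩ := ih _ _ _ _ (by omega) hr''
        exact ⟨_, .inter h1 hC hD⟩
  exact key N p m q r (by omega) hr

end Words

end Certifies

end ModalDL

/-! ### Soundness of certificates -/

namespace ModalDL

open CertFormula

variable {n : ℕ}

/-- There is a row for the concept `C` at the position `p`. -/
def ConceptAt (X : ℕ → Option (Letter n)) (S : Set (ℕ → CertCell n)) (p : ℕ) (C : Concept n) :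
    Prop :=
  ∃ m q r, IsSpanRow .span S p m q r ∧ Parse X C p m q

/-- There is a row for the inclusion `ci`. -/
def InclusionAt (X : ℕ → Option (Letter n)) (S : Set (ℕ → CertCell n))
    (ci : Concept n × Concept n) : Prop :=
  ∃ p m q r, IsSpanRow .incl S p m q r ∧ ConceptAt X S (p + 1) ci.1 ∧ ConceptAt X S m ci.2

/-- `r` is a row for the world `w` and the object `d`. -/
structure IsModelRow (S : Set (ℕ → CertCell n)) (w d : ℕ → Bool) (r : ℕ → CertCell n) : Prop where
  mem : r ∈ S
  tag : (r 0).tag = .model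
  w : (fun i => (r i).w) = w
  d : (fun i => (r i).d) = d

/-- The worlds of a certificate. -/
def CertWorld (S : Set (ℕ → CertCell n)) : Type := {w : ℕ → Bool // ∃ d r, IsModelRow S w d r}

namespace Certifies

variable {L : FrameClass} {dk : DomainKind} {nk : NameKind} {allow : Bool}
  {X : ℕ → Option (Letter n)} {S : Set (ℕ → CertCell n)}

section Words

variable (h : Certifies L dk nk allow X S) (hX : ∃ N, ∀ i, N ≤ i → X i = none)

include h

theorem incl_first {p m q : ℕ} {r : ℕ → CertCell n} (hr : IsSpanRow .incl S p m q r) :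
    X p = some .incl ∧ ∃ m' r', IsSpanRow .span S (p + 1) m' m r' := by
  obtain ⟨r', hr', hs⟩ := h inclFirst (by simp [conditions]) r hr.mem r hr.mem
  obtain ⟨⟨i, hi, hX⟩, ht, hp, hq⟩ := hs hr.tag
  obtain rfl := (hr.p i).1 hi
  obtain ⟨p', m', q', hr'⟩ := h.exists_isSpanRow hr' ht (Or.inl rfl)
  obtain rfl := (hr'.p _).1 (hp i hi)
  obtain rfl := (hr'.q _).1 (hq m ((hr.m m).2 rfl))
  exact ⟨hX, m', r', hr'⟩

theorem tail_step {T : RowTag} {p m q : ℕ} {r : ℕ → CertCell n} (hr : IsSpanRow T S p m q r)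
    (hT : T = .incl ∨ T = .span ∧ p = 0) :
    X q = none ∨ allow = true ∧ ∃ m' q' r', IsSpanRow .incl S q m' q' r' := by
  obtain ⟨r', hr', hs⟩ := h (tail allow) (by simp [conditions]) r hr.mem r hr.mem
  have h1 : (r 0).tag = .incl ∨ (r 0).tag = .span ∧ (r 0).p = true := by
    rcases hT with rfl | ⟨rfl, rfl⟩
    · exact Or.inl hr.tag
    · exact Or.inr ⟨hr.tag, (hr.p 0).2 rfl⟩
  rcases hs h1 with ⟨i, hi, hX⟩ | ⟨ha, ht, hp⟩
  · obtain rfl := (hr.q i).1 hi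
    exact Or.inl hX
  · obtain ⟨p', m', q', hr'⟩ := h.exists_isSpanRow hr' ht (Or.inr rfl)
    obtain rfl := (hr'.p _).1 (hp q ((hr.q q).2 rfl))
    exact Or.inr ⟨ha, m', q', r', hr'⟩

include hX

theorem exists_ontology {p m q : ℕ} {r : ℕ → CertCell n} (hr : IsSpanRow .incl S p m q r) :
    ∃ (O : Ontology n) (q' : ℕ), Reads X p q' (encodeOntology O) ∧ X q' = none ∧
      ∀ ci ∈ O, InclusionAt X S ci := by
  have hX' := hX
  obtain ⟨N, hN⟩ := hX'
  have key : ∀ k p m q r, N ≤ p + k → IsSpanRow .incl S p m q r →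
      ∃ (O : Ontology n) (q' : ℕ), Reads X p q' (encodeOntology O) ∧ X q' = none ∧
        ∀ ci ∈ O, InclusionAt X S ci := by
    intro k
    induction k with
    | zero =>
      intro p m q r hp hr
      have h1 := (h.incl_first hr).1
      simp [hN p hp] at h1
    | succ k ih =>
      intro p m q r hp hr
      obtain ⟨h1, m₁, r₁, hr₁⟩ := h.incl_first hr
      obtain ⟨m₂, r₂, hr₂⟩ := h.span_last hr (Or.inr rfl)
      obtain ⟨C, hC⟩ := h.exists_parse hX hr₁
      obtain ⟨D, hD⟩ := h.exists_parse hX hr₂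
      have hci : InclusionAt X S (C, D) :=
        ⟨p, m, q, r, hr, ⟨m₁, m, r₁, hr₁, hC⟩, ⟨m₂, q, r₂, hr₂, hD⟩⟩
      have hread : Reads X p q (.incl :: (C.encode ++ D.encode)) :=
        ⟨h1, reads_append.2 ⟨m, hC.reads, hD.reads⟩⟩
      rcases h.tail_step hr (Or.inl rfl) with h2 | ⟨-, m', q', r', hr'⟩
      · refine ⟨[(C, D)], q, ?_, h2, by simpa using hci⟩
        simpa [encodeOntology] using hread
      · have hlt₁ := hC.lt
        have hlt₂ := hD.lt
        obtain ⟨O, q'', h3, h4, h5⟩ := ih q m' q' r' (by omega) hr'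
        refine ⟨(C, D) :: O, q'', ?_, h4, ?_⟩
        · have := reads_append.2 ⟨q, hread, h3⟩
          simpa [encodeOntology] using this
        · intro ci hci'
          rcases List.mem_cons.1 hci' with rfl | hci'
          · exact hci
          · exact h5 ci hci'
  exact key N p m q r (by omega) hr

theorem exists_input (hS : S.Nonempty) : ∃ (C : Concept n) (O : Ontology n) (q : ℕ),
    (allow = false → O = []) ∧ Reads X 0 q (C.encode ++ encodeOntology O) ∧ X q = none ∧
      ConceptAt X S 0 C ∧ ∀ ci ∈ O, InclusionAt X S ci := by
  obtain ⟨r₀, hr₀⟩ := hS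
  obtain ⟨r, hr, ht, hp⟩ := h start (by simp [conditions]) r₀ hr₀ r₀ hr₀
  obtain ⟨p, m, q, hr⟩ := h.exists_isSpanRow hr ht (Or.inl rfl)
  obtain rfl := (hr.p 0).1 hp
  obtain ⟨C, hC⟩ := h.exists_parse hX hr
  have hC' : ConceptAt X S 0 C := ⟨m, q, r, hr, hC⟩
  rcases h.tail_step hr (Or.inr ⟨rfl, rfl⟩) with h1 | ⟨ha, m', q', r', hr'⟩
  · refine ⟨C, [], q, fun _ => rfl, ?_, h1, hC', by simp⟩
    simpa [encodeOntology] using hC.reads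
  · obtain ⟨O, q'', h3, h4, h5⟩ := h.exists_ontology hX hr'
    exact ⟨C, O, q'', by simp [ha], reads_append.2 ⟨q, hC.reads, h3⟩, h4, hC', h5⟩

end Words

section Semantics

variable (h : Certifies L dk nk allow X S) (hX : ∃ N, ∀ i, N ≤ i → X i = none)
  {w w' d d' : ℕ → Bool} {r r' s : ℕ → CertCell n} {p m q : ℕ}

include h

theorem out_inn_eq (hr : IsModelRow S w d r) (hr' : IsModelRow S w d' r') (i : ℕ) :
    (r i).out = (r' i).out ∧ (r i).inn = (r' i).inn := by
  obtain ⟨_, -, hs⟩ := h functional (by simp [conditions]) r hr.mem r' hr'.mem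
  exact (hs ⟨⟨hr.tag, hr'.tag⟩, congrFun (hr.w.trans hr'.w.symm)⟩).1 i

theorem truth_eq (hr : IsModelRow S w d r) (hr' : IsModelRow S w d r') (i : ℕ) :
    (r i).t = (r' i).t ∧ (r i).c = (r' i).c := by
  obtain ⟨_, -, hs⟩ := h functional (by simp [conditions]) r hr.mem r' hr'.mem
  exact (hs ⟨⟨hr.tag, hr'.tag⟩, congrFun (hr.w.trans hr'.w.symm)⟩).2
    (congrFun (hr.d.trans hr'.d.symm)) i

theorem boolean_at (hr : IsModelRow S w d r) (hs : IsSpanRow .span S p m q s) :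
    (X p = some .neg → ((r p).t = true ↔ ¬ (r p).c = true)) ∧
    (X p = some .inter → ((r p).t = true ↔ (r (p + 1)).t = true ∧ (r p).c = true)) ∧
    (X p = some .desc → (r p).t = true → (r p).c = true) := by
  obtain ⟨_, -, hs'⟩ := h boolean (by simp [conditions]) r hr.mem s hs.mem
  exact hs' ⟨hr.tag, hs.tag⟩ p ((hs.p p).2 rfl)

theorem child_iff (hr : IsModelRow S w d r) (hs : IsSpanRow .span S p m q s)
    (hp : ¬ IsLeaf (X p)) : (r p).c = true ↔ (r m).t = true := by
  obtain ⟨_, -, hs'⟩ := h relocate (by simp [conditions]) r hr.mem s hs.mem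
  obtain ⟨h1, h2⟩ := hs' ⟨hr.tag, hs.tag, by
    rintro ⟨i, hi, hl⟩
    obtain rfl := (hs.p i).1 hi
    exact hp hl⟩
  constructor
  · intro hc
    obtain ⟨i, hi, ht⟩ := h1 ⟨p, (hs.p p).2 rfl, hc⟩
    obtain rfl := (hs.m i).1 hi
    exact ht
  · intro ht
    obtain ⟨i, hi, hc⟩ := h2 ⟨m, (hs.m m).2 rfl, ht⟩
    obtain rfl := (hs.p i).1 hi
    exact hc

include hX

/-- Truth is the same at all positions of the same atomic concept. -/
theorem truth_of_same_name {a : Letter n} (ha : a = .atom ∨ a = .nom) (hr : IsModelRow S w d r)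
    (hs : IsSpanRow .span S p m q s) (hp : X p = some a) {j q' A : ℕ} (hj : X j = some a)
    (hp' : Reads X (p + 1) q (encodeName A)) (hj' : Reads X (j + 1) q' (encodeName A))
    (ht : (r j).t = true) : (r p).t = true := by
  obtain ⟨-, -, r', hr'⟩ | ⟨h1, -⟩ | ⟨h1, -⟩ | ⟨h1, -⟩ := h.span_first hs
  · obtain ⟨B, hB, he⟩ := h.reads_name hX hr'
    obtain rfl := (reads_encodeName_unique hp' hB).1
    have hmem : sameName a ∈ conditions n L dk nk allow := by
      rcases ha with rfl | rfl <;> simp [conditions]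
    obtain ⟨_, -, hs'⟩ := h _ hmem r hr.mem r' hr'.mem
    exact hs' ⟨hr.tag, hr'.tag, j, he _ _ hj', hj, ht⟩ p ⟨(hr'.p _).2 rfl, hp⟩
  · rcases ha with rfl | rfl <;> rcases h1 with h1 | h1 | h1 | ⟨i, h1⟩ <;> simp [hp] at h1
  · rcases ha with rfl | rfl <;> simp [hp] at h1
  · rcases ha with rfl | rfl <;> simp [hp] at h1

theorem exists_ex_witness (hr : IsModelRow S w d r) (hs : IsSpanRow .span S p m q s)
    (hp : X p = some .ex) {A q' : ℕ} (hp' : Reads X (p + 1) q' (encodeName A))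
    (ht : (r p).t = true) : ∃ e r', IsModelRow S w e r' ∧ (r' p).c = true ∧
      ∀ j q'', X j = some .ex → Reads X (j + 1) q'' (encodeName A) → (r' j).c = true →
        (r j).t = true := by
  obtain ⟨h1 | h1, -⟩ | ⟨h1, -⟩ | ⟨-, s', hs'⟩ | ⟨h1, -⟩ := h.span_first hs
  · simp [hp] at h1
  · simp [hp] at h1
  · rcases h1 with h1 | h1 | h1 | ⟨i, h1⟩ <;> simp [hp] at h1
  · obtain ⟨B, hB, he⟩ := h.reads_name hX hs'
    obtain rfl := (reads_encodeName_unique hp' hB).1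
    obtain ⟨r', hr', hs''⟩ := h exWitness (by simp [conditions]) r hr.mem s' hs'.mem
    obtain ⟨⟨h1, h2⟩, h3, h4⟩ := hs'' ⟨hr.tag, hs'.tag, p, (hs'.p _).2 rfl, hp, ht⟩
    refine ⟨_, r', ⟨hr', h1, ?_, rfl⟩, h3 p ((hs'.p _).2 rfl), fun j q'' hj hj' hc => ?_⟩
    · rw [← hr.w]
      exact (funext h2).symm
    · exact h4 j ⟨he _ _ hj', hj, hc⟩
  · simp [hp] at h1

omit hX

theorem nom_unique (hr : IsModelRow S w d r) (hr' : IsModelRow S w d' r') {j : ℕ}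
    (hj : X j = some .nom) (ht : (r j).t = true) (ht' : (r' j).t = true) : d = d' := by
  obtain ⟨_, -, hs⟩ := h nomUnique (by simp [conditions]) r hr.mem r' hr'.mem
  rw [← hr.d, ← hr'.d]
  exact funext (hs ⟨⟨⟨hr.tag, hr'.tag⟩, congrFun (hr.w.trans hr'.w.symm)⟩, j, hj, ht, ht'⟩)

theorem exists_nom (hnk : nk = .totalNames) (hr : IsModelRow S w d r)
    (hs : IsSpanRow .span S p m q s) (hp : X p = some .nom) :
    ∃ e r', IsModelRow S w e r' ∧ (r' p).t = true := by
  obtain ⟨r', hr', hs'⟩ := h (nomTotal nk) (by simp [conditions]) r hr.mem s hs.mem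
  obtain ⟨⟨h1, h2⟩, h3⟩ := hs' ⟨hnk, hr.tag, hs.tag, p, (hs.p p).2 rfl, hp⟩
  exact ⟨_, r', ⟨hr', h1, (funext h2).symm.trans hr.w, rfl⟩, h3 p ((hs.p p).2 rfl)⟩

theorem desc_unique (hr : IsModelRow S w d r) (hr' : IsModelRow S w d' r') {j : ℕ}
    (hj : X j = some .desc) (ht : (r j).t = true) (hc : (r' j).c = true) : d = d' := by
  obtain ⟨_, -, hs⟩ := h descUnique (by simp [conditions]) r hr.mem r' hr'.mem
  rw [← hr.d, ← hr'.d]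
  exact funext (hs ⟨⟨⟨hr.tag, hr'.tag⟩, congrFun (hr.w.trans hr'.w.symm)⟩, j, hj, ht, hc⟩)

theorem exists_desc_witness (hr : IsModelRow S w d r) (hs : IsSpanRow .span S p m q s)
    (hp : X p = some .desc) (hc : (r p).c = true) (ht : ¬ (r p).t = true) :
    ∃ e r', IsModelRow S w e r' ∧ e ≠ d ∧ (r' p).c = true := by
  obtain ⟨r', hr', hs'⟩ := h descWitness (by simp [conditions]) r hr.mem s hs.mem
  obtain ⟨⟨h1, h2⟩, ⟨i, hi⟩, h3⟩ := hs' ⟨hr.tag, hs.tag, p, (hs.p p).2 rfl, hp, hc, ht⟩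
  refine ⟨_, r', ⟨hr', h1, (funext h2).symm.trans hr.w, rfl⟩, fun he => hi ?_,
    h3 p ((hs.p p).2 rfl)⟩
  exact (congrFun (he.trans hr.d.symm) i).symm

theorem truth_of_exU (hr : IsModelRow S w d r) (hr' : IsModelRow S w d' r') {j : ℕ}
    (hj : X j = some .exU) (hc : (r' j).c = true) : (r j).t = true := by
  obtain ⟨_, -, hs⟩ := h exUGlobal (by simp [conditions]) r hr.mem r' hr'.mem
  exact hs ⟨⟨hr.tag, hr'.tag⟩, congrFun (hr.w.trans hr'.w.symm)⟩ j ⟨hj, hc⟩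

theorem exists_exU_witness (hr : IsModelRow S w d r) (hs : IsSpanRow .span S p m q s)
    (hp : X p = some .exU) (ht : (r p).t = true) :
    ∃ e r', IsModelRow S w e r' ∧ (r' p).c = true := by
  obtain ⟨r', hr', hs'⟩ := h exUWitness (by simp [conditions]) r hr.mem s hs.mem
  obtain ⟨⟨h1, h2⟩, h3⟩ := hs' ⟨hr.tag, hs.tag, p, (hs.p p).2 rfl, hp, ht⟩
  exact ⟨_, r', ⟨hr', h1, (funext h2).symm.trans hr.w, rfl⟩, h3 p ((hs.p p).2 rfl)⟩

theorem exists_related (i : Fin n) (hr : IsModelRow S w d r) (hr' : IsModelRow S w' d' r')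
    (hR : ∀ j, (r j).out i = (r' j).inn i) : ∃ r'', IsModelRow S w' d r'' ∧
      ∀ j, X j = some (.dia i) → (r'' j).c = true → (r j).t = true := by
  obtain ⟨r'', hr'', hs⟩ := h (diaGlobal i) (by simp [conditions]) r hr.mem r' hr'.mem
  obtain ⟨⟨⟨h1, h2⟩, h3⟩, h4⟩ := hs ⟨⟨hr.tag, hr'.tag⟩, hR⟩
  exact ⟨r'', ⟨hr'', h1, (funext h3).symm.trans hr'.w, (funext h2).symm.trans hr.d⟩,
    fun j hj hc => h4 j ⟨hj, hc⟩⟩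

theorem exists_dia_witness (i : Fin n) (hr : IsModelRow S w d r) (hs : IsSpanRow .span S p m q s)
    (hp : X p = some (.dia i)) (ht : (r p).t = true) :
    ∃ v r', IsModelRow S v d r' ∧ (∀ j, (r j).out i = (r' j).inn i) ∧ (r' p).c = true := by
  obtain ⟨r', hr', hs'⟩ := h (diaWitness i) (by simp [conditions]) r hr.mem s hs.mem
  obtain ⟨⟨h1, h2⟩, h3, h4⟩ := hs' ⟨hr.tag, hs.tag, p, (hs.p p).2 rfl, hp, ht⟩
  exact ⟨_, r', ⟨hr', h1, rfl, (funext h2).symm.trans hr.d⟩, h3, h4 p ((hs.p p).2 rfl)⟩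

theorem out_eq_inn (hL : L = .S5) (hr : IsModelRow S w d r) (j : ℕ) : (r j).out = (r j).inn := by
  obtain ⟨_, -, hs⟩ := h (frame L) (by simp [conditions]) r hr.mem r hr.mem
  exact hs ⟨hL, hr.tag⟩ j

theorem exists_const (hdk : dk = .const) (hr : IsModelRow S w d r) (hr' : IsModelRow S w' d' r') :
    ∃ r'', IsModelRow S w' d r'' := by
  obtain ⟨r'', hr'', hs⟩ := h (constant dk) (by simp [conditions]) r hr.mem r' hr'.mem
  obtain ⟨⟨h1, h2⟩, h3⟩ := hs ⟨hdk, hr.tag, hr'.tag⟩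
  exact ⟨r'', hr'', h1, (funext h3).symm.trans hr'.w, (funext h2).symm.trans hr.d⟩

theorem incl_true (hr : IsModelRow S w d r) (hs : IsSpanRow .incl S p m q s)
    (ht : (r (p + 1)).t = true) : (r m).t = true := by
  obtain ⟨_, -, hs'⟩ := h inclTrue (by simp [conditions]) r hr.mem s hs.mem
  exact hs' ⟨hr.tag, hs.tag, p, (hs.p p).2 rfl, ht⟩ m ((hs.m m).2 rfl)

theorem exists_target (hS : S.Nonempty) : ∃ w d r, IsModelRow S w d r ∧ (r 0).t = true := by
  obtain ⟨r₀, hr₀⟩ := hS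
  obtain ⟨r, hr, h1, h2⟩ := h target (by simp [conditions]) r₀ hr₀ r₀ hr₀
  exact ⟨_, _, r, ⟨hr, h1, rfl, rfl⟩, h2⟩

end Semantics

end Certifies

namespace CertWorld

variable {S : Set (ℕ → CertCell n)}

/-- Some row for a world. -/
noncomputable def row (w : CertWorld S) : ℕ → CertCell n := w.2.choose_spec.choose

theorem isModelRow_row (w : CertWorld S) : ∃ d, IsModelRow S w.1 d w.row :=
  ⟨_, w.2.choose_spec.choose_spec⟩

end CertWorld

/-- The frame of a certificate. -/
def certFrame (S : Set (ℕ → CertCell n)) (hS : ∃ w d r, IsModelRow S w d r) : KripkeFrame n where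
  W := CertWorld S
  nonempty := by
    obtain ⟨w, d, r, hr⟩ := hS
    exact ⟨w, d, r, hr⟩
  R i w v := ∀ j, (w.row j).out i = (v.row j).inn i

namespace Certifies

variable {L : FrameClass} {dk : DomainKind} {nk : NameKind} {allow : Bool}
  {X : ℕ → Option (Letter n)} {S : Set (ℕ → CertCell n)}

theorem certFrame_rel_iff (h : Certifies L dk nk allow X S) {hS : ∃ w d r, IsModelRow S w d r}
    {i : Fin n} {w v : CertWorld S} {d e : ℕ → Bool} {r s : ℕ → CertCell n}
    (hr : IsModelRow S w.1 d r) (hs : IsModelRow S v.1 e s) :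
    (certFrame S hS).R i w v ↔ ∀ j, (r j).out i = (s j).inn i := by
  obtain ⟨_, hr'⟩ := w.isModelRow_row
  obtain ⟨_, hs'⟩ := v.isModelRow_row
  refine forall_congr' fun j => ?_
  rw [(h.out_inn_eq hr hr' j).1, (h.out_inn_eq hs hs' j).2]

open Classical in
/-- The interpretation given by a certificate. -/
noncomputable def interpretation (h : Certifies L dk nk allow X S)
    (hS : ∃ w d r, IsModelRow S w d r) : Interpretation (certFrame S hS) where
  Obj := ℕ → Bool
  dom w := {d | ∃ r, IsModelRow S w.1 d r}
  dom_nonempty w := w.2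
  dom_mono := by
    rintro i w v hR d ⟨r, hr⟩
    obtain ⟨e, s, hs⟩ := v.2
    obtain ⟨r', hr', -⟩ := h.exists_related i hr hs ((h.certFrame_rel_iff hr hs).1 hR)
    exact ⟨r', hr'⟩
  conc A w := {d | ∃ r j q, IsModelRow S w.1 d r ∧ X j = some .atom ∧
    Reads X (j + 1) q (encodeName A) ∧ (r j).t = true}
  conc_sub := by
    rintro A w d ⟨r, -, -, hr, -⟩
    exact ⟨r, hr⟩
  -- This is the largest relation that makes no restriction `∃A.C` true of an object for which the
  -- certificate declares it false.
  role A w d e := ∃ r s, IsModelRow S w.1 d r ∧ IsModelRow S w.1 e s ∧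
    ∀ j q, X j = some .ex → Reads X (j + 1) q (encodeName A) → (s j).c = true → (r j).t = true
  role_sub := by
    rintro A w d e ⟨r, s, hr, hs, -⟩
    exact ⟨⟨r, hr⟩, ⟨s, hs⟩⟩
  ind a w := if ha : ∃ d r j q, IsModelRow S w.1 d r ∧ X j = some .nom ∧
      Reads X (j + 1) q (encodeName a) ∧ (r j).t = true then some ha.choose
    -- Under total semantics, `exists_nom` excludes this case for names with a row for their
    -- nominal, so any object may be chosen.
    else if nk = .totalNames then some w.2.choose else none
  ind_mem := by
    intro a w d hd
    split_ifs at hd with h1 h2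
    · obtain rfl := Option.some.inj hd
      obtain ⟨r, -, -, hr, -⟩ := h1.choose_spec
      exact ⟨r, hr⟩
    · obtain rfl := Option.some.inj hd
      exact w.2.choose_spec

variable (h : Certifies L dk nk allow X S) (hX : ∃ N, ∀ i, N ≤ i → X i = none)
  (hS : ∃ w d r, IsModelRow S w d r)

include h hX in
theorem conceptAt_child {C C' : Concept n} {p m m' q q' : ℕ} {s : ℕ → CertCell n}
    (hs : IsSpanRow .span S p m q s) (hC : Parse X C p m q) (hp : ¬ IsLeaf (X p))
    (hC' : Parse X C' m m' q') : ConceptAt X S m C' := by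
  obtain ⟨m'', s', hs'⟩ := h.span_last hs (Or.inl ⟨rfl, hp⟩)
  obtain ⟨D, hD⟩ := h.exists_parse hX hs'
  obtain ⟨rfl, rfl, rfl⟩ := hC'.unique hD
  exact ⟨_, _, s', hs', hD⟩

theorem mem_nom_iff (hX : ∃ N, ∀ i, N ≤ i → X i = none) {a p q : ℕ}
    {s : ℕ → CertCell n} (hs : IsSpanRow .span S p q q s)
    (hp : X p = some .nom) (hp' : Reads X (p + 1) q (encodeName a)) {w : CertWorld S}
    {d : ℕ → Bool} {r : ℕ → CertCell n} (hr : IsModelRow S w.1 d r) :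
    (h.interpretation hS).ind a w = some d ↔ (r p).t = true := by
  simp only [interpretation]
  split_ifs with h1 h2
  · obtain ⟨r₀, j, q', hr₀, hj, hj', ht⟩ := h1.choose_spec
    have ht' := h.truth_of_same_name hX (Or.inr rfl) hr₀ hs hp hj hp' hj' ht
    rw [Option.some.injEq]
    constructor
    · intro he
      rw [he] at hr₀
      rwa [(h.truth_eq hr hr₀ p).1]
    · exact fun ht'' => h.nom_unique hr₀ hr hp ht' ht''
  · obtain ⟨e, r', hr', ht⟩ := h.exists_nom h2 hr hs hp
    exact absurd ⟨e, r', p, q, hr', hp, hp', ht⟩ h1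
  · constructor
    · simp
    · exact fun ht => absurd ⟨d, r, p, q, hr, hp, hp', ht⟩ h1

/-- Truth lemma for certificates, by induction on the concept. For compound concepts, `child_iff`
turns the track `t` at the last subconcept into the track `c` at `p`, where the condition for the
constructor applies. It is essential that all rows of a world and an object agree on truth
(`truth_eq`). -/
theorem mem_ext_iff (hX : ∃ N, ∀ i, N ≤ i → X i = none) (C : Concept n) :
    ∀ p, ConceptAt X S p C → ∀ (w : CertWorld S) (d : ℕ → Bool) (r : ℕ → CertCell n),
      IsModelRow S w.1 d r → (d ∈ (h.interpretation hS).ext C w ↔ (r p).t = true) := by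
  induction C with
  | atom A =>
    rintro p ⟨m, q, s, hs, hC⟩ w d r hr
    cases hC with
    | atom hp hp' =>
      constructor
      · rintro ⟨r', j, q', hr', hj, hj', ht⟩
        rw [← (h.truth_eq hr hr' j).1] at ht
        exact h.truth_of_same_name hX (Or.inl rfl) hr hs hp hj hp' hj' ht
      · exact fun ht => ⟨r, p, _, hr, hp, hp', ht⟩
  | nom a =>
    rintro p ⟨m, q, s, hs, hC⟩ w d r hr
    cases hC with
    | nom hp hp' => exact h.mem_nom_iff hS hX hs hp hp' hr
  | desc C ih =>
    rintro p ⟨m, q, s, hs, hC⟩ w d r hr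
    cases hC with
    | desc hp hC' =>
      have hl : ¬ IsLeaf (X p) := by simp [IsLeaf, hp]
      have key : ∀ (w : CertWorld S) (d : ℕ → Bool) (r : ℕ → CertCell n),
          IsModelRow S w.1 d r → (d ∈ (h.interpretation hS).ext C w ↔ (r p).c = true) :=
        fun w d r hr => (ih _ (h.conceptAt_child hX hs (.desc hp hC') hl hC') w d r hr).trans
          (h.child_iff hr hs hl).symm
      have hext : d ∈ (h.interpretation hS).ext (.desc C) w ↔
        (h.interpretation hS).ext C w = {d} := Iff.rfl
      rw [hext]
      constructor
      · intro he
        by_contra ht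
        have hd : (r p).c = true := (key w d r hr).1 (he ▸ Set.mem_singleton d)
        obtain ⟨e, r', hr', hne, hc⟩ := h.exists_desc_witness hr hs hp hd ht
        have := (key w e r' hr').2 hc
        rw [he] at this
        exact hne this
      · intro ht
        refine Set.Subset.antisymm (fun e he => ?_) (Set.singleton_subset_iff.2 ?_)
        · obtain ⟨r', hr'⟩ := (h.interpretation hS).ext_sub C w he
          exact (h.desc_unique hr hr' hp ht ((key w e r' hr').1 he)).symm
        · exact (key w d r hr).2 ((h.boolean_at hr hs).2.2 hp ht)
  | neg C ih =>
    rintro p ⟨m, q, s, hs, hC⟩ w d r hr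
    cases hC with
    | neg hp hC' =>
      have hl : ¬ IsLeaf (X p) := by simp [IsLeaf, hp]
      have key := (ih _ (h.conceptAt_child hX hs (.neg hp hC') hl hC') w d r hr).trans
        (h.child_iff hr hs hl).symm
      rw [(h.boolean_at hr hs).1 hp, ← key]
      exact ⟨fun hd => hd.2, fun hd => ⟨⟨r, hr⟩, hd⟩⟩
  | inter C D ih₁ ih₂ =>
    rintro p ⟨m, q, s, hs, hC⟩ w d r hr
    cases hC with
    | inter hp hC₁ hC₂ =>
      have hl : ¬ IsLeaf (X p) := by simp [IsLeaf, hp]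
      have key₂ := (ih₂ _ (h.conceptAt_child hX hs (.inter hp hC₁ hC₂) hl hC₂) w d r hr).trans
        (h.child_iff hr hs hl).symm
      have hC₁' : ConceptAt X S (p + 1) C := by
        obtain ⟨h1 | h1, -⟩ | ⟨h1, -⟩ | ⟨h1, -⟩ | ⟨-, m', s', hs'⟩ := h.span_first hs
        · simp [hp] at h1
        · simp [hp] at h1
        · rcases h1 with h1 | h1 | h1 | ⟨i, h1⟩ <;> simp [hp] at h1
        · simp [hp] at h1
        · obtain ⟨E, hE⟩ := h.exists_parse hX hs'
          obtain ⟨rfl, rfl, -⟩ := hC₁.unique hE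
          exact ⟨_, _, s', hs', hE⟩
      rw [(h.boolean_at hr hs).2.1 hp, ← key₂, ← ih₁ _ hC₁' w d r hr]
      rfl
  | ex A C ih =>
    rintro p ⟨m, q, s, hs, hC⟩ w d r hr
    cases hC with
    | ex hp hp' hC' =>
      have hl : ¬ IsLeaf (X p) := by simp [IsLeaf, hp]
      have key : ∀ (w : CertWorld S) (d : ℕ → Bool) (r : ℕ → CertCell n),
          IsModelRow S w.1 d r → (d ∈ (h.interpretation hS).ext C w ↔ (r p).c = true) :=
        fun w d r hr => (ih _ (h.conceptAt_child hX hs (.ex hp hp' hC') hl hC') w d r hr).trans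
          (h.child_iff hr hs hl).symm
      constructor
      · rintro ⟨-, e, ⟨r', s', hr', hs', hrole⟩, he⟩
        rw [(h.truth_eq hr hr' p).1]
        exact hrole p _ hp hp' ((key w e s' hs').1 he)
      · intro ht
        obtain ⟨e, r', hr', hc, hrole⟩ := h.exists_ex_witness hX hr hs hp hp' ht
        exact ⟨⟨r, hr⟩, e, ⟨r, r', hr, hr', hrole⟩, (key w e r' hr').2 hc⟩
  | exU C ih =>
    rintro p ⟨m, q, s, hs, hC⟩ w d r hr
    cases hC with
    | exU hp hC' =>
      have hl : ¬ IsLeaf (X p) := by simp [IsLeaf, hp]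
      have key : ∀ (w : CertWorld S) (d : ℕ → Bool) (r : ℕ → CertCell n),
          IsModelRow S w.1 d r → (d ∈ (h.interpretation hS).ext C w ↔ (r p).c = true) :=
        fun w d r hr => (ih _ (h.conceptAt_child hX hs (.exU hp hC') hl hC') w d r hr).trans
          (h.child_iff hr hs hl).symm
      constructor
      · rintro ⟨-, e, ⟨r', hr'⟩, he⟩
        exact h.truth_of_exU hr hr' hp ((key w e r' hr').1 he)
      · intro ht
        obtain ⟨e, r', hr', hc⟩ := h.exists_exU_witness hr hs hp ht
        exact ⟨⟨r, hr⟩, e, ⟨r', hr'⟩, (key w e r' hr').2 hc⟩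
  | dia i C ih =>
    rintro p ⟨m, q, s, hs, hC⟩ w d r hr
    cases hC with
    | dia hp hC' =>
      have hl : ¬ IsLeaf (X p) := by simp [IsLeaf, hp]
      have key : ∀ (w : CertWorld S) (d : ℕ → Bool) (r : ℕ → CertCell n),
          IsModelRow S w.1 d r → (d ∈ (h.interpretation hS).ext C w ↔ (r p).c = true) :=
        fun w d r hr => (ih _ (h.conceptAt_child hX hs (.dia hp hC') hl hC') w d r hr).trans
          (h.child_iff hr hs hl).symm
      constructor
      · rintro ⟨-, v, hR, hd⟩
        obtain ⟨r', hr'⟩ := (h.interpretation hS).ext_sub C v hd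
        obtain ⟨r'', hr'', ht⟩ := h.exists_related i hr hr' ((h.certFrame_rel_iff hr hr').1 hR)
        exact ht p hp ((key v d r'' hr'').1 hd)
      · intro ht
        obtain ⟨v, r', hr', hR, hc⟩ := h.exists_dia_witness i hr hs hp ht
        exact ⟨⟨r, hr⟩, ⟨v, d, r', hr'⟩, (h.certFrame_rel_iff (v := ⟨v, d, r', hr'⟩) hr hr').2 hR,
          (key ⟨v, d, r', hr'⟩ d r' hr').2 hc⟩

/-- Certificates are sound. -/
theorem satisfiable {x : List (Letter n)} {S : Set (ℕ → CertCell n)} (hne : S.Nonempty)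
    (h : Certifies L dk nk allow (fun i => x[i]?) S) :
    ∃ (C : Concept n) (O : Ontology n), (allow = false → O = []) ∧
      x = C.encode ++ encodeOntology O ∧ Satisfiable L dk nk O C := by
  have hX : ∃ N, ∀ i, N ≤ i → (fun i => x[i]?) i = none :=
    ⟨x.length, fun i hi => List.getElem?_eq_none hi⟩
  obtain ⟨C, O, q, hallow, hread, hq, hC, hO⟩ := h.exists_input hX hne
  obtain ⟨w₀, d₀, r₀, hr₀, ht₀⟩ := h.exists_target hne
  have hS : ∃ w d r, IsModelRow S w d r := ⟨w₀, d₀, r₀, hr₀⟩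
  refine ⟨C, O, hallow, ?_, certFrame S hS, h.interpretation hS, ?_, ?_, ?_, ?_, ?_⟩
  · obtain ⟨hq', v, hv⟩ := (reads_getElem?_iff (Nat.zero_le _)).1 hread
    rw [List.drop_zero] at hv
    -- No letter is written at the end `q` of the part that was read, so nothing of the input is
    -- left over.
    have hlen : x.length ≤ q := List.getElem?_eq_none_iff.1 hq
    have : v = [] := by
      have := congrArg List.length hv
      rw [List.length_append] at this
      exact List.eq_nil_of_length_eq_zero (by omega)
    rw [hv, this, List.append_nil]
  · cases L with
    | K => trivial
    | S5 =>
      have key : ∀ (w : CertWorld S) j, (w.row j).out = (w.row j).inn := fun w j => by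
        obtain ⟨_, hr⟩ := w.isModelRow_row
        exact h.out_eq_inn rfl hr j
      exact fun i => ⟨fun w j => congrFun (key w j) i,
        fun {w v} hR j =>
          (congrFun (key v j) i).trans ((hR j).symm.trans (congrFun (key w j) i)),
        fun {_ v _} hR hR' j => (hR j).trans ((congrFun (key v j) i).symm.trans (hR' j))⟩
  · cases dk with
    | const =>
      have key : ∀ w v : CertWorld S, (h.interpretation hS).dom w ⊆ (h.interpretation hS).dom v := by
        rintro w v d ⟨r, hr⟩
        obtain ⟨e, r', hr'⟩ := v.2
        exact h.exists_const rfl hr hr'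
      exact fun w v => Set.Subset.antisymm (key w v) (key v w)
    | expanding => trivial
  · cases nk with
    | totalNames =>
      intro a w
      simp only [interpretation]
      split_ifs <;> simp_all
    | partialNames => trivial
  · rintro ci hci w d hd
    obtain ⟨p, m, q', s, hs, hC₁, hC₂⟩ := hO ci hci
    obtain ⟨r, hr⟩ := (h.interpretation hS).ext_sub _ w hd
    exact (h.mem_ext_iff hS hX _ _ hC₂ w d r hr).2
      (h.incl_true hr hs ((h.mem_ext_iff hS hX _ _ hC₁ w d r hr).1 hd))
  · exact ⟨⟨w₀, d₀, r₀, hr₀⟩, d₀, (h.mem_ext_iff hS hX C 0 hC ⟨w₀, d₀, r₀, hr₀⟩ d₀ r₀ hr₀).2 ht₀⟩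

end Certifies

end ModalDL

/-! ### Completeness of certificates -/

namespace ModalDL

open CertFormula

variable {n : ℕ} {F : KripkeFrame n}

/-- Codes of the worlds and objects of an interpretation, and of its accessibility relations. -/
structure Coding (M : Interpretation F) where
  world : F.W → ℕ → Bool
  object : M.Obj → ℕ → Bool
  out : Fin n → F.W → ℕ → Bool
  inn : Fin n → F.W → ℕ → Bool
  world_injective : world.Injective
  object_injective : object.Injective
  rel_iff : ∀ i w v, F.R i w v ↔ out i w = inn i v

/-- The concept at the position `j` is true. -/
def TrueAt (M : Interpretation F) (X : ℕ → Option (Letter n)) (w : F.W) (d : M.Obj) (j : ℕ) :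
    Prop :=
  ∃ D m q, Parse X D j m q ∧ d ∈ M.ext D w

/-- The last immediate subconcept of the concept at the position `j` is true. -/
def ChildTrueAt (M : Interpretation F) (X : ℕ → Option (Letter n)) (w : F.W) (d : M.Obj) (j : ℕ) :
    Prop :=
  ∃ D m q, Parse X D j m q ∧ TrueAt M X w d m

/-- The same name, or the same final part of a name, is written at the positions `p` and `j`. -/
def SameName (X : ℕ → Option (Letter n)) (p j : ℕ) : Prop :=
  ∃ u q q', Reads X p q (nameWord u) ∧ Reads X j q' (nameWord u)

section Truth

variable {M : Interpretation F} {X : ℕ → Option (Letter n)} {w : F.W} {d : M.Obj}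
  {p m m' q q' : ℕ} {C D : Concept n}

theorem trueAt_iff (h : Parse X D p m q) : TrueAt M X w d p ↔ d ∈ M.ext D w := by
  constructor
  · rintro ⟨D', m', q', h', hd⟩
    rwa [(h.unique h').1]
  · exact fun hd => ⟨D, m, q, h, hd⟩

theorem childTrueAt_iff (h : Parse X C p m q) (h' : Parse X D m m' q') :
    ChildTrueAt M X w d p ↔ d ∈ M.ext D w := by
  rw [← trueAt_iff h']
  constructor
  · rintro ⟨C', m₁, q₁, h₁, ht⟩
    rwa [(h.unique h₁).2.1]
  · exact fun ht => ⟨C, m, q, h, ht⟩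

theorem Parse.lt_le (h : Parse X C p m q) : p < m ∧ m ≤ q := by
  cases h with
  | atom h1 h2 | nom h1 h2 =>
    have := h2.eq_add
    omega
  | desc h1 h2 | neg h1 h2 | exU h1 h2 | dia h1 h2 =>
    have := h2.lt
    omega
  | inter h1 h2 h3 =>
    have := h2.lt
    have := h3.lt
    omega
  | ex h1 h2 h3 =>
    have := h2.eq_add
    have := h3.lt
    omega

theorem SameName.eq {a b : ℕ} (h : SameName X p m) (hp : Reads X p q (encodeName a))
    (hm : Reads X m q' (encodeName b)) : a = b := by
  obtain ⟨u, q₁, q₂, h1, h2⟩ := h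
  have e1 := (reads_nameWord_unique (u' := a.bits) h1 hp).1
  have e2 := (reads_nameWord_unique (u' := b.bits) h2 hm).1
  refine encodeName_injective (n := n) ?_
  rw [encodeName, ← e1, e2]
  rfl

theorem SameName.exists_reads {a : ℕ} (h : SameName X p m) (hp : Reads X p q (encodeName a)) :
    ∃ q', Reads X m q' (encodeName a) := by
  obtain ⟨u, q₁, q₂, h1, h2⟩ := h
  obtain rfl := (reads_nameWord_unique (u' := a.bits) h1 hp).1
  exact ⟨q₂, h2⟩

end Truth

/-- The inclusions of the ontology `O` that are part of a final segment of the input. -/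
def InclusionSpan (O : Ontology n) (X : ℕ → Option (Letter n)) (p m q : ℕ) : Prop :=
  ∃ ci ∈ O, ∃ O' ⊆ O, ∃ m₁ m₂ q', X p = some .incl ∧ Parse X ci.1 (p + 1) m₁ m ∧
    Parse X ci.2 m m₂ q ∧ Reads X q q' (encodeOntology O') ∧ X q' = none

theorem exists_inclusionSpan {O O' : Ontology n} {X : ℕ → Option (Letter n)} {q q' : ℕ}
    (hO : O' ⊆ O) (h : Reads X q q' (encodeOntology O')) (hq : X q' = none) :
    X q = none ∨ O ≠ [] ∧ ∃ m' q₁, InclusionSpan O X q m' q₁ := by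
  rcases O' with _ | ⟨ci, O'⟩
  · left
    have : q' = q := h
    rwa [← this]
  · right
    have hci : ci ∈ O := hO List.mem_cons_self
    have h' : Reads X q q' (.incl :: ((ci.1.encode ++ ci.2.encode) ++ encodeOntology O')) := h
    obtain ⟨h1, h2⟩ := h'
    obtain ⟨q₁, h2, h3⟩ := reads_append.1 h2
    obtain ⟨m, h4, h5⟩ := reads_append.1 h2
    obtain ⟨m₁, h4⟩ := exists_parse_iff.2 h4
    obtain ⟨m₂, h5⟩ := exists_parse_iff.2 h5
    exact ⟨List.ne_nil_of_mem hci, m, q₁, ci, hci, O', fun _ h => hO (List.mem_cons_of_mem _ h),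
      m₁, m₂, q', h1, h4, h5, h3, hq⟩

/-! ### The rows of the certificate -/

namespace CertCell

/-- The cell without information. -/
def blank : CertCell n where
  tag := .model
  w := false
  d := false
  t := false
  c := false
  p := false
  m := false
  q := false
  e := false
  out := fun _ => false
  inn := fun _ => false

end CertCell

open Classical in
/-- The row for a world and an object. -/
noncomputable def modelRow {M : Interpretation F} (K : Coding M) (X : ℕ → Option (Letter n))
    (w : F.W) (d : M.Obj) : ℕ → CertCell n := fun j =>
  { (CertCell.blank : CertCell n) with
    w := K.world w j
    d := K.object d j
    t := decide (TrueAt M X w d j)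
    c := decide (ChildTrueAt M X w d j)
    out := fun i => K.out i w j
    inn := fun i => K.inn i w j }

open Classical in
/-- The row for a name. -/
noncomputable def nameRow (X : ℕ → Option (Letter n)) (p q : ℕ) : ℕ → CertCell n := fun j =>
  { (CertCell.blank : CertCell n) with
    tag := if j = 0 then .name else .model
    p := decide (j = p)
    q := decide (j = q)
    e := decide (SameName X p j) }

/-- The row for a concept or an inclusion. -/
def spanRow (T : RowTag) (p m q : ℕ) : ℕ → CertCell n := fun j =>
  { (CertCell.blank : CertCell n) with
    tag := if j = 0 then T else .model
    p := decide (j = p)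
    m := decide (j = m)
    q := decide (j = q) }

/-- All rows of the certificate. -/
inductive IsCertRow {M : Interpretation F} (K : Coding M) (O : Ontology n)
    (X : ℕ → Option (Letter n)) : (ℕ → CertCell n) → Prop
  | model {w d} : d ∈ M.dom w → IsCertRow K O X (modelRow K X w d)
  | name {p q u} : Reads X p q (nameWord u) → IsCertRow K O X (nameRow X p q)
  | span {C p m q} : Parse X C p m q → IsCertRow K O X (spanRow .span p m q)
  | incl {p m q} : InclusionSpan O X p m q → IsCertRow K O X (spanRow .incl p m q)

section Rows

variable {M : Interpretation F} {K : Coding M} {O : Ontology n} {X : ℕ → Option (Letter n)}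
  {r : ℕ → CertCell n} {w : F.W} {d : M.Obj} {j : ℕ}

open Classical in
theorem t_modelRow : (modelRow K X w d j).t = true ↔ TrueAt M X w d j := decide_eq_true_iff

open Classical in
theorem c_modelRow : (modelRow K X w d j).c = true ↔ ChildTrueAt M X w d j := decide_eq_true_iff

open Classical in
theorem e_nameRow {p q : ℕ} : (nameRow X p q j).e = true ↔ SameName X p j := decide_eq_true_iff

theorem existsUnique_decide (p : ℕ) : ∃! i, decide (i = p) = true :=
  ⟨p, decide_eq_true rfl, fun _ h => of_decide_eq_true h⟩

theorem IsCertRow.of_model (h : IsCertRow K O X r) (ht : (r 0).tag = .model) :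
    ∃ w d, d ∈ M.dom w ∧ r = modelRow K X w d := by
  cases h with
  | model hd => exact ⟨_, _, hd, rfl⟩
  | name _ | span _ | incl _ => cases ht

theorem IsCertRow.of_name (h : IsCertRow K O X r) (ht : (r 0).tag = .name) :
    ∃ p q u, Reads X p q (nameWord u) ∧ r = nameRow X p q := by
  cases h with
  | name hu => exact ⟨_, _, _, hu, rfl⟩
  | model _ | span _ | incl _ => cases ht

theorem IsCertRow.of_span (h : IsCertRow K O X r) (ht : (r 0).tag = .span) :
    ∃ C p m q, Parse X C p m q ∧ r = spanRow .span p m q := by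
  cases h with
  | span hC => exact ⟨_, _, _, _, hC, rfl⟩
  | model _ | name _ | incl _ => cases ht

theorem IsCertRow.of_incl (h : IsCertRow K O X r) (ht : (r 0).tag = .incl) :
    ∃ p m q, InclusionSpan O X p m q ∧ r = spanRow .incl p m q := by
  cases h with
  | incl hi => exact ⟨_, _, _, hi, rfl⟩
  | model _ | name _ | span _ => cases ht

end Rows

/-- The condition `φ` is true of the certificate. -/
def Fulfils {M : Interpretation F} (K : Coding M) (O : Ontology n) (X : ℕ → Option (Letter n))
    (φ : CertFormula n) : Prop :=
  ∀ r₁, IsCertRow K O X r₁ → ∀ r₂, IsCertRow K O X r₂ → ∃ r₃, IsCertRow K O X r₃ ∧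
    φ.Sat fun i => (X i, r₁ i, r₂ i, r₃ i)

section Words

variable {M : Interpretation F} {K : Coding M} {O : Ontology n} {X : ℕ → Option (Letter n)}

theorem fulfils_marked : Fulfils K O X marked := by
  intro r h r₂ _
  refine ⟨r, h, fun ht => ?_, fun ht => ?_⟩
  · obtain ⟨p, q, -, -, rfl⟩ := h.of_name ht
    exact ⟨existsUnique_decide p, existsUnique_decide q⟩
  · have hr : ∃ T p m q, r = spanRow T p m q := by
      rcases ht with ht | ht
      · obtain ⟨C, p, m, q, -, rfl⟩ := h.of_span ht
        exact ⟨_, p, m, q, rfl⟩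
      · obtain ⟨p, m, q, -, rfl⟩ := h.of_incl ht
        exact ⟨_, p, m, q, rfl⟩
    obtain ⟨T, p, m, q, rfl⟩ := hr
    exact ⟨existsUnique_decide p, existsUnique_decide m, existsUnique_decide q⟩

theorem fulfils_canonical (hX : ∀ i, ¬ (X i = some (.bit false) ∧ X (i + 1) = some .sep)) :
    Fulfils K O X canonical :=
  fun r h _ _ => ⟨r, h, hX⟩

/-- The certificate contains rows for all final parts of names, so the row for the rest of a name is
available. Equal rests after equal bits give equal words. -/
theorem fulfils_nameStep : Fulfils K O X nameStep := by
  intro r h r₂ _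
  by_cases ht : (r 0).tag = .name
  · obtain ⟨p, q, u, hu, rfl⟩ := h.of_name ht
    have key : ∀ b u, Reads X p q (nameWord (b :: u)) →
        (nameBit b).Sat fun i => (X i, nameRow X p q i, r₂ i, nameRow X (p + 1) q i) := by
      intro b u hu
      refine ⟨⟨p, decide_eq_true rfl, hu.1⟩, rfl, fun i hi => ?_, fun i hi => hi, ?_⟩
      · obtain rfl := of_decide_eq_true hi
        exact decide_eq_true rfl
      · rintro i ⟨hi, he⟩
        obtain ⟨u', q₁, q₂, h1, h2⟩ := e_nameRow.1 he
        exact e_nameRow.2 ⟨b :: u', q₁, q₂, ⟨hu.1, h1⟩, hi, h2⟩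
    rcases u with _ | ⟨_ | _, u⟩
    · refine ⟨_, h, fun _ => Or.inl ⟨⟨p, decide_eq_true rfl, hu.1, decide_eq_true hu.2.symm⟩, ?_⟩⟩
      intro i hi
      exact e_nameRow.2 ⟨[], q, i + 1, hu, hi, rfl⟩
    · exact ⟨_, .name hu.2, fun _ => Or.inr (Or.inr (key false u hu))⟩
    · exact ⟨_, .name hu.2, fun _ => Or.inr (Or.inl (key true u hu))⟩
  · exact ⟨r, h, fun h' => absurd h' ht⟩

theorem fulfils_spanFirst : Fulfils K O X spanFirst := by
  intro r h r₂ _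
  by_cases ht : (r 0).tag = .span
  · obtain ⟨C, p, m, q, hC, rfl⟩ := h.of_span ht
    have hp : ∀ i, decide (i = p) = true → decide (i + 1 = p + 1) = true := by simp
    cases hC with
    | atom h1 h2 =>
      exact ⟨_, .name (u := Nat.bits _) h2, fun _ =>
        Or.inl ⟨⟨p, decide_eq_true rfl, Or.inl h1⟩, rfl, hp, fun _ h => h, fun _ h => h⟩⟩
    | nom h1 h2 =>
      exact ⟨_, .name (u := Nat.bits _) h2, fun _ =>
        Or.inl ⟨⟨p, decide_eq_true rfl, Or.inr h1⟩, rfl, hp, fun _ h => h, fun _ h => h⟩⟩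
    | desc h1 _ =>
      exact ⟨_, h, fun _ => Or.inr (Or.inl ⟨p, decide_eq_true rfl, Or.inl h1, decide_eq_true rfl⟩)⟩
    | neg h1 _ =>
      exact ⟨_, h, fun _ =>
        Or.inr (Or.inl ⟨p, decide_eq_true rfl, Or.inr (Or.inl h1), decide_eq_true rfl⟩)⟩
    | exU h1 _ =>
      exact ⟨_, h, fun _ => Or.inr (Or.inl
        ⟨p, decide_eq_true rfl, Or.inr (Or.inr (Or.inl h1)), decide_eq_true rfl⟩)⟩
    | dia h1 _ =>
      exact ⟨_, h, fun _ => Or.inr (Or.inl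
        ⟨p, decide_eq_true rfl, Or.inr (Or.inr (Or.inr ⟨_, h1⟩)), decide_eq_true rfl⟩)⟩
    | ex h1 h2 _ =>
      exact ⟨_, .name (u := Nat.bits _) h2, fun _ => Or.inr (Or.inr (Or.inl
        ⟨⟨p, decide_eq_true rfl, h1⟩, rfl, hp, fun _ h => h⟩))⟩
    | inter h1 h2 _ =>
      exact ⟨_, .span h2, fun _ => Or.inr (Or.inr (Or.inr
        ⟨⟨p, decide_eq_true rfl, h1⟩, rfl, hp, fun _ h => h⟩))⟩
  · exact ⟨r, h, fun h' => absurd h' ht⟩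

theorem Parse.exists_last {C : Concept n} {p m q : ℕ} (hC : Parse X C p m q)
    (hp : ¬ IsLeaf (X p)) : ∃ D m', Parse X D m m' q := by
  cases hC with
  | atom h1 _ => exact absurd (Or.inl h1) hp
  | nom h1 _ => exact absurd (Or.inr h1) hp
  | desc _ h | neg _ h | exU _ h | dia _ h => exact ⟨_, _, h⟩
  | ex _ _ h | inter _ _ h => exact ⟨_, _, h⟩

theorem fulfils_spanLast : Fulfils K O X spanLast := by
  intro r h r₂ _
  by_cases ht : (r 0).tag = .span
  · obtain ⟨C, p, m, q, hC, rfl⟩ := h.of_span ht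
    by_cases hp : IsLeaf (X p)
    · exact ⟨_, h, fun h' => absurd ⟨p, decide_eq_true rfl, hp⟩ h'.2⟩
    · obtain ⟨D, m', hD⟩ := hC.exists_last hp
      exact ⟨_, .span hD, fun _ => ⟨rfl, fun _ h => h, fun _ h => h⟩⟩
  · exact ⟨r, h, fun h' => absurd h'.1 ht⟩

theorem fulfils_inclFirst : Fulfils K O X inclFirst := by
  intro r h r₂ _
  by_cases ht : (r 0).tag = .incl
  · obtain ⟨p, m, q, ⟨ci, hci, O', hO', m₁, m₂, q', h1, h2, h3, h4⟩, rfl⟩ := h.of_incl ht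
    have hp : ∀ i, decide (i = p) = true → decide (i + 1 = p + 1) = true := by simp
    exact ⟨_, .span h2, fun _ => ⟨⟨p, decide_eq_true rfl, h1⟩, rfl, hp, fun _ h => h⟩⟩
  · exact ⟨r, h, fun h' => absurd h' ht⟩

theorem fulfils_inclLast : Fulfils K O X inclLast := by
  intro r h r₂ _
  by_cases ht : (r 0).tag = .incl
  · obtain ⟨p, m, q, ⟨ci, hci, O', hO', m₁, m₂, q', h1, h2, h3, h4⟩, rfl⟩ := h.of_incl ht
    exact ⟨_, .span h3, fun _ => ⟨rfl, fun _ h => h, fun _ h => h⟩⟩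
  · exact ⟨r, h, fun h' => absurd h' ht⟩

/-- By unique readability a span that starts at `0` is the main concept, so the ontology follows it.
Rows for inclusions remember that the encoding of a part of the ontology follows, up to the end of
the input. -/
theorem fulfils_tail {allow : Bool} (hO : allow = false → O = []) {C : Concept n} {q q' : ℕ}
    (hC : Reads X 0 q C.encode) (h : Reads X q q' (encodeOntology O)) (hq : X q' = none) :
    Fulfils K O X (tail allow) := by
  intro r hr r₂ _
  have key : ∀ {T p m q}, r = spanRow T p m q →
      (X q = none ∨ O ≠ [] ∧ ∃ m' q₁, InclusionSpan O X q m' q₁) →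
      ∃ r₃, IsCertRow K O X r₃ ∧ (tail allow).Sat fun i => (X i, r i, r₂ i, r₃ i) := by
    rintro T p m q rfl (h1 | ⟨h1, m', q₁, h2⟩)
    · exact ⟨_, hr, fun _ => Or.inl ⟨q, decide_eq_true rfl, h1⟩⟩
    · refine ⟨_, .incl h2, fun _ => Or.inr ⟨?_, rfl, fun _ h => h⟩⟩
      cases allow with
      | false => exact absurd (hO rfl) h1
      | true => rfl
  cases hr with
  | incl hi =>
    obtain ⟨ci, hci, O', hO', m₁, m₂, q₁, h1, h2, h3, h4, h5⟩ := id hi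
    exact key rfl (exists_inclusionSpan hO' h4 h5)
  | @span D p m q₁ hD =>
    rcases Nat.eq_zero_or_pos p with rfl | hp
    · obtain ⟨m₁, hC⟩ := exists_parse_iff.2 hC
      obtain ⟨-, -, rfl⟩ := hC.unique hD
      exact key rfl (exists_inclusionSpan (fun _ h => h) h hq)
    · refine ⟨_, .span hD, ?_⟩
      rintro (h1 | ⟨-, h1⟩)
      · cases h1
      · exact absurd (of_decide_eq_true h1) hp.ne
  | model hd =>
    refine ⟨_, .model hd, ?_⟩
    rintro (h1 | ⟨h1, -⟩) <;> cases h1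
  | name hu =>
    refine ⟨_, .name hu, ?_⟩
    rintro (h1 | ⟨h1, -⟩) <;> cases h1

theorem fulfils_start {C : Concept n} {q : ℕ} (hC : Reads X 0 q C.encode) :
    Fulfils K O X start := by
  intro r _ r₂ _
  obtain ⟨m, hC⟩ := exists_parse_iff.2 hC
  exact ⟨_, .span hC, rfl, rfl⟩

end Words

end ModalDL

/-! ### The semantic conditions hold in the certificate of a model -/

namespace ModalDL

open CertFormula

variable {n : ℕ} {F : KripkeFrame n}

section Inversion

variable {X : ℕ → Option (Letter n)} {C : Concept n} {p m q : ℕ}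

theorem Parse.of_atom (h : Parse X C p m q) (hp : X p = some .atom) :
    ∃ A, C = .atom A ∧ Reads X (p + 1) q (encodeName A) := by
  cases h with
  | atom _ h2 => exact ⟨_, rfl, h2⟩
  | _ h1 => rw [hp] at h1; cases h1

theorem Parse.of_nom (h : Parse X C p m q) (hp : X p = some .nom) :
    ∃ a, C = .nom a ∧ Reads X (p + 1) q (encodeName a) := by
  cases h with
  | nom _ h2 => exact ⟨_, rfl, h2⟩
  | _ h1 => rw [hp] at h1; cases h1

theorem Parse.of_desc (h : Parse X C p m q) (hp : X p = some .desc) :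
    ∃ D m', C = .desc D ∧ Parse X D m m' q := by
  cases h with
  | desc _ h2 => exact ⟨_, _, rfl, h2⟩
  | _ h1 => rw [hp] at h1; cases h1

theorem Parse.of_neg (h : Parse X C p m q) (hp : X p = some .neg) :
    ∃ D m', C = .neg D ∧ Parse X D m m' q := by
  cases h with
  | neg _ h2 => exact ⟨_, _, rfl, h2⟩
  | _ h1 => rw [hp] at h1; cases h1

theorem Parse.of_inter (h : Parse X C p m q) (hp : X p = some .inter) :
    ∃ D E m₁ m₂, C = .inter D E ∧ Parse X D (p + 1) m₁ m ∧ Parse X E m m₂ q := by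
  cases h with
  | inter _ h2 h3 => exact ⟨_, _, _, _, rfl, h2, h3⟩
  | _ h1 => rw [hp] at h1; cases h1

theorem Parse.of_ex (h : Parse X C p m q) (hp : X p = some .ex) :
    ∃ r D m', C = .ex r D ∧ Reads X (p + 1) m (encodeName r) ∧ Parse X D m m' q := by
  cases h with
  | ex _ h2 h3 => exact ⟨_, _, _, rfl, h2, h3⟩
  | _ h1 => rw [hp] at h1; cases h1

theorem Parse.of_exU (h : Parse X C p m q) (hp : X p = some .exU) :
    ∃ D m', C = .exU D ∧ Parse X D m m' q := by
  cases h with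
  | exU _ h2 => exact ⟨_, _, rfl, h2⟩
  | _ h1 => rw [hp] at h1; cases h1

theorem Parse.of_dia {i : Fin n} (h : Parse X C p m q) (hp : X p = some (.dia i)) :
    ∃ D m', C = .dia i D ∧ Parse X D m m' q := by
  cases h with
  | dia h1 h2 =>
    rw [hp] at h1
    cases h1
    exact ⟨_, _, rfl, h2⟩
  | _ h1 => rw [hp] at h1; cases h1

end Inversion

section Semantics

variable {M : Interpretation F} {K : Coding M} {O : Ontology n} {X : ℕ → Option (Letter n)}

theorem fulfils_target {C : Concept n} {q : ℕ} (hC : Reads X 0 q C.encode)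
    (h : ∃ w, (M.ext C w).Nonempty) : Fulfils K O X target := by
  intro r _ r₂ _
  obtain ⟨w, d, hd⟩ := h
  obtain ⟨m, hC⟩ := exists_parse_iff.2 hC
  exact ⟨_, .model (M.ext_sub C w hd), rfl, t_modelRow.2 ((trueAt_iff hC).2 hd)⟩

theorem fulfils_functional : Fulfils K O X functional := by
  intro r h r₂ h₂
  refine ⟨r, h, ?_⟩
  rintro ⟨⟨t₁, t₂⟩, hw⟩
  obtain ⟨w, d, hd, rfl⟩ := h.of_model t₁
  obtain ⟨w', d', hd', rfl⟩ := h₂.of_model t₂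
  obtain rfl : w = w' := K.world_injective (funext hw)
  refine ⟨fun i => ⟨rfl, rfl⟩, fun ho => ?_⟩
  obtain rfl : d = d' := K.object_injective (funext ho)
  exact fun i => ⟨rfl, rfl⟩

theorem fulfils_boolean : Fulfils K O X boolean := by
  intro r h r₂ h₂
  refine ⟨r, h, ?_⟩
  rintro ⟨t₁, t₂⟩ i hi
  obtain ⟨w, d, hd, rfl⟩ := h.of_model t₁
  obtain ⟨C, p, m, q, hC, rfl⟩ := h₂.of_span t₂
  obtain rfl := of_decide_eq_true hi
  refine ⟨fun hp => ?_, fun hp => ?_, fun hp => ?_⟩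
  · obtain ⟨D, m', rfl, hD⟩ := hC.of_neg hp
    refine t_modelRow.trans ((trueAt_iff hC).trans ?_)
    refine Iff.trans ?_ (not_congr (c_modelRow.trans (childTrueAt_iff hC hD)).symm)
    exact ⟨fun h => h.2, fun h => ⟨hd, h⟩⟩
  · obtain ⟨D, E, m₁, m₂, rfl, hD, hE⟩ := hC.of_inter hp
    refine t_modelRow.trans ((trueAt_iff hC).trans ?_)
    exact and_congr (t_modelRow.trans (trueAt_iff hD)).symm
      (c_modelRow.trans (childTrueAt_iff hC hE)).symm
  · obtain ⟨D, m', rfl, hD⟩ := hC.of_desc hp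
    intro ht
    have ht' : M.ext D w = {d} := (trueAt_iff hC).1 (t_modelRow.1 ht)
    exact c_modelRow.2 ((childTrueAt_iff hC hD).2 (ht' ▸ Set.mem_singleton d))

theorem fulfils_relocate : Fulfils K O X relocate := by
  intro r h r₂ h₂
  refine ⟨r, h, ?_⟩
  rintro ⟨t₁, t₂, hl⟩
  obtain ⟨w, d, hd, rfl⟩ := h.of_model t₁
  obtain ⟨C, p, m, q, hC, rfl⟩ := h₂.of_span t₂
  obtain ⟨D, m', hD⟩ := hC.exists_last fun hp => hl ⟨p, decide_eq_true rfl, hp⟩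
  have key := (childTrueAt_iff (M := M) (w := w) (d := d) hC hD).trans (trueAt_iff hD).symm
  constructor
  · rintro ⟨i, hi, hc⟩
    obtain rfl := of_decide_eq_true hi
    exact ⟨m, decide_eq_true rfl, t_modelRow.2 (key.1 (c_modelRow.1 hc))⟩
  · rintro ⟨i, hi, ht⟩
    obtain rfl := of_decide_eq_true hi
    exact ⟨p, decide_eq_true rfl, c_modelRow.2 (key.2 (t_modelRow.1 ht))⟩

theorem fulfils_sameName {a : Letter n} (ha : a = .atom ∨ a = .nom) :
    Fulfils K O X (sameName a) := by
  intro r h r₂ h₂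
  refine ⟨r, h, ?_⟩
  rintro ⟨t₁, t₂, i, he, hi, ht⟩ j ⟨hj, hj'⟩
  obtain ⟨w, d, hd, rfl⟩ := h.of_model t₁
  obtain ⟨p, q, u, hu, rfl⟩ := h₂.of_name t₂
  obtain rfl := of_decide_eq_true hj
  obtain ⟨u, q₁, q₂, h1, h2⟩ := e_nameRow.1 he
  have hs : SameName X (i + 1) (j + 1) := ⟨u, q₂, q₁, h2, h1⟩
  obtain ⟨D, m, q', hD, hd'⟩ := t_modelRow.1 ht
  refine t_modelRow.2 ?_
  rcases ha with rfl | rfl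
  · obtain ⟨A, rfl, hA⟩ := hD.of_atom hi
    obtain ⟨q'', hq''⟩ := hs.exists_reads hA
    exact ⟨_, _, _, .atom hj' hq'', hd'⟩
  · obtain ⟨A, rfl, hA⟩ := hD.of_nom hi
    obtain ⟨q'', hq''⟩ := hs.exists_reads hA
    exact ⟨_, _, _, .nom hj' hq'', hd'⟩

theorem fulfils_nomUnique : Fulfils K O X nomUnique := by
  intro r h r₂ h₂
  refine ⟨r, h, ?_⟩
  rintro ⟨⟨⟨t₁, t₂⟩, hw⟩, j, hj, ht, ht'⟩
  obtain ⟨w, d, hd, rfl⟩ := h.of_model t₁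
  obtain ⟨w', d', hd', rfl⟩ := h₂.of_model t₂
  obtain rfl : w = w' := K.world_injective (funext hw)
  obtain ⟨D, m, q, hD, h1⟩ := t_modelRow.1 ht
  have h2 := (trueAt_iff hD).1 (t_modelRow.1 ht')
  obtain ⟨a, rfl, -⟩ := hD.of_nom hj
  obtain rfl : d = d' := by
    have e1 : M.ind a w = some d := h1
    have e2 : M.ind a w = some d' := h2
    exact Option.some.inj (e1.symm.trans e2)
  exact fun _ => rfl

theorem fulfils_nomTotal {nk : NameKind} (hnk : nk.Ok M) : Fulfils K O X (nomTotal nk) := by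
  intro r h r₂ h₂
  by_cases ht : nk = .totalNames ∧ (r 0).tag = .model ∧ (r₂ 0).tag = .span
  · obtain ⟨rfl, t₁, t₂⟩ := ht
    obtain ⟨w, d, hd, rfl⟩ := h.of_model t₁
    obtain ⟨C, p, m, q, hC, rfl⟩ := h₂.of_span t₂
    by_cases hp : X p = some .nom
    · obtain ⟨a, rfl, -⟩ := hC.of_nom hp
      obtain ⟨e, he⟩ := hnk a w
      refine ⟨_, .model (M.ind_mem a w e he), fun _ => ⟨⟨rfl, fun _ => rfl⟩, fun i hi => ?_⟩⟩
      obtain rfl := of_decide_eq_true hi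
      exact t_modelRow.2 ((trueAt_iff hC).2 he)
    · refine ⟨_, h, ?_⟩
      rintro ⟨-, -, -, i, hi, hi'⟩
      obtain rfl := of_decide_eq_true hi
      exact absurd hi' hp
  · exact ⟨_, h, fun h' => absurd ⟨h'.1, h'.2.1, h'.2.2.1⟩ ht⟩

theorem fulfils_descUnique : Fulfils K O X descUnique := by
  intro r h r₂ h₂
  refine ⟨r, h, ?_⟩
  rintro ⟨⟨⟨t₁, t₂⟩, hw⟩, j, hj, ht, hc⟩
  obtain ⟨w, d, hd, rfl⟩ := h.of_model t₁
  obtain ⟨w', d', hd', rfl⟩ := h₂.of_model t₂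
  obtain rfl : w = w' := K.world_injective (funext hw)
  obtain ⟨C, m, q, hC, h1⟩ := t_modelRow.1 ht
  obtain ⟨D, m', rfl, hD⟩ := hC.of_desc hj
  have h2 := (childTrueAt_iff hC hD).1 (c_modelRow.1 hc)
  have h1 : M.ext D w = {d} := h1
  rw [h1] at h2
  obtain rfl : d' = d := h2
  exact fun _ => rfl

theorem fulfils_descWitness : Fulfils K O X descWitness := by
  intro r h r₂ h₂
  by_cases ht : (r 0).tag = .model ∧ (r₂ 0).tag = .span
  · obtain ⟨t₁, t₂⟩ := ht
    obtain ⟨w, d, hd, rfl⟩ := h.of_model t₁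
    obtain ⟨C, p, m, q, hC, rfl⟩ := h₂.of_span t₂
    by_cases hp : X p = some .desc ∧ ChildTrueAt M X w d p ∧ ¬ TrueAt M X w d p
    · obtain ⟨hp, hc, ht⟩ := hp
      obtain ⟨D, m', rfl, hD⟩ := hC.of_desc hp
      rw [childTrueAt_iff hC hD] at hc
      have hne : ∃ e ∈ M.ext D w, e ≠ d := by
        by_contra! hne
        exact ht ((trueAt_iff hC).2
          (Set.Subset.antisymm (fun e he => hne e he) (Set.singleton_subset_iff.2 hc)))
      obtain ⟨e, he, hne⟩ := hne
      refine ⟨_, .model (M.ext_sub D w he), fun _ => ⟨⟨rfl, fun _ => rfl⟩, ?_, fun i hi => ?_⟩⟩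
      · exact Function.ne_iff.1 (K.object_injective.ne hne.symm)
      · obtain rfl := of_decide_eq_true hi
        exact c_modelRow.2 ((childTrueAt_iff hC hD).2 he)
    · refine ⟨_, h, ?_⟩
      rintro ⟨-, -, i, hi, h1, h2, h3⟩
      obtain rfl := of_decide_eq_true hi
      exact absurd ⟨h1, c_modelRow.1 h2, fun h' => h3 (t_modelRow.2 h')⟩ hp
  · exact ⟨_, h, fun h' => absurd ⟨h'.1, h'.2.1⟩ ht⟩

/-- The pair of the object and its witness really belongs to the role. Hence the witness makes all
restrictions with this role true whose bodies it satisfies, wherever they are written. -/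
theorem fulfils_exWitness : Fulfils K O X exWitness := by
  intro r h r₂ h₂
  by_cases ht : (r 0).tag = .model ∧ (r₂ 0).tag = .name
  · obtain ⟨t₁, t₂⟩ := ht
    obtain ⟨w, d, hd, rfl⟩ := h.of_model t₁
    obtain ⟨p, q, u, hu, rfl⟩ := h₂.of_name t₂
    by_cases hp : ∃ i, i + 1 = p ∧ X i = some .ex ∧ TrueAt M X w d i
    · obtain ⟨i, rfl, hi, C, m, q', hC, hm⟩ := hp
      obtain ⟨a, D, m', rfl, ha, hD⟩ := hC.of_ex hi
      obtain ⟨-, e, hr, he⟩ := hm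
      refine ⟨_, .model (M.role_sub _ _ _ _ hr).2, fun _ => ⟨⟨rfl, fun _ => rfl⟩, ?_, ?_⟩⟩
      · intro j hj
        obtain rfl : j = i := Nat.succ_injective (of_decide_eq_true hj)
        exact c_modelRow.2 ((childTrueAt_iff hC hD).2 he)
      · rintro j ⟨hs, hj, hc⟩
        obtain ⟨C', m₁, q₁, hC', hc⟩ := c_modelRow.1 hc
        obtain ⟨b, D', m₂, rfl, hb, hD'⟩ := hC'.of_ex hj
        obtain rfl := (e_nameRow.1 hs).eq ha hb
        exact t_modelRow.2 ((trueAt_iff hC').2 ⟨hd, e, hr, (trueAt_iff hD').1 hc⟩)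
    · refine ⟨_, h, ?_⟩
      rintro ⟨-, -, i, hi, h1, h2⟩
      exact absurd ⟨i, of_decide_eq_true hi, h1, t_modelRow.1 h2⟩ hp
  · exact ⟨_, h, fun h' => absurd ⟨h'.1, h'.2.1⟩ ht⟩

theorem fulfils_exUGlobal : Fulfils K O X exUGlobal := by
  intro r h r₂ h₂
  refine ⟨r, h, ?_⟩
  rintro ⟨⟨t₁, t₂⟩, hw⟩ j ⟨hj, hc⟩
  obtain ⟨w, d, hd, rfl⟩ := h.of_model t₁
  obtain ⟨w', d', hd', rfl⟩ := h₂.of_model t₂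
  obtain rfl : w = w' := K.world_injective (funext hw)
  obtain ⟨C, m, q, hC, hc⟩ := c_modelRow.1 hc
  obtain ⟨D, m', rfl, hD⟩ := hC.of_exU hj
  exact t_modelRow.2 ((trueAt_iff hC).2 ⟨hd, d', hd', (trueAt_iff hD).1 hc⟩)

theorem fulfils_exUWitness : Fulfils K O X exUWitness := by
  intro r h r₂ h₂
  by_cases ht : (r 0).tag = .model ∧ (r₂ 0).tag = .span
  · obtain ⟨t₁, t₂⟩ := ht
    obtain ⟨w, d, hd, rfl⟩ := h.of_model t₁
    obtain ⟨C, p, m, q, hC, rfl⟩ := h₂.of_span t₂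
    by_cases hp : X p = some .exU ∧ TrueAt M X w d p
    · obtain ⟨D, m', rfl, hD⟩ := hC.of_exU hp.1
      obtain ⟨-, e, hed, he⟩ := (trueAt_iff hC).1 hp.2
      refine ⟨_, .model hed, fun _ => ⟨⟨rfl, fun _ => rfl⟩, fun i hi => ?_⟩⟩
      obtain rfl := of_decide_eq_true hi
      exact c_modelRow.2 ((childTrueAt_iff hC hD).2 he)
    · refine ⟨_, h, ?_⟩
      rintro ⟨-, -, i, hi, h1, h2⟩
      obtain rfl := of_decide_eq_true hi
      exact absurd ⟨h1, t_modelRow.1 h2⟩ hp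
  · exact ⟨_, h, fun h' => absurd ⟨h'.1, h'.2.1⟩ ht⟩

theorem fulfils_diaGlobal (i : Fin n) : Fulfils K O X (diaGlobal i) := by
  intro r h r₂ h₂
  by_cases ht : ((r 0).tag = .model ∧ (r₂ 0).tag = .model) ∧ ∀ j, (r j).out i = (r₂ j).inn i
  · obtain ⟨⟨t₁, t₂⟩, hR⟩ := ht
    obtain ⟨w, d, hd, rfl⟩ := h.of_model t₁
    obtain ⟨v, e, he, rfl⟩ := h₂.of_model t₂
    have hR : F.R i w v := (K.rel_iff i w v).2 (funext hR)
    refine ⟨_, .model (M.dom_mono i w v hR hd), fun _ => ⟨⟨⟨rfl, fun _ => rfl⟩, fun _ => rfl⟩, ?_⟩⟩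
    rintro j ⟨hj, hc⟩
    obtain ⟨C, m, q, hC, hc⟩ := c_modelRow.1 hc
    obtain ⟨D, m', rfl, hD⟩ := hC.of_dia hj
    exact t_modelRow.2 ((trueAt_iff hC).2 ⟨hd, v, hR, (trueAt_iff hD).1 hc⟩)
  · exact ⟨_, h, fun h' => absurd h' ht⟩

theorem fulfils_diaWitness (i : Fin n) : Fulfils K O X (diaWitness i) := by
  intro r h r₂ h₂
  by_cases ht : (r 0).tag = .model ∧ (r₂ 0).tag = .span
  · obtain ⟨t₁, t₂⟩ := ht
    obtain ⟨w, d, hd, rfl⟩ := h.of_model t₁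
    obtain ⟨C, p, m, q, hC, rfl⟩ := h₂.of_span t₂
    by_cases hp : X p = some (.dia i) ∧ TrueAt M X w d p
    · obtain ⟨D, m', rfl, hD⟩ := hC.of_dia hp.1
      obtain ⟨-, v, hR, hm⟩ := (trueAt_iff hC).1 hp.2
      refine ⟨_, .model (M.ext_sub D v hm), fun _ => ⟨⟨rfl, fun _ => rfl⟩,
        congrFun ((K.rel_iff i w v).1 hR), fun j hj => ?_⟩⟩
      obtain rfl := of_decide_eq_true hj
      exact c_modelRow.2 ((childTrueAt_iff hC hD).2 hm)
    · refine ⟨_, h, ?_⟩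
      rintro ⟨-, -, j, hj, h1, h2⟩
      obtain rfl := of_decide_eq_true hj
      exact absurd ⟨h1, t_modelRow.1 h2⟩ hp
  · exact ⟨_, h, fun h' => absurd ⟨h'.1, h'.2.1⟩ ht⟩

theorem fulfils_frame {L : FrameClass} (hL : L = .S5 → K.out = K.inn) :
    Fulfils K O X (frame L) := by
  intro r h r₂ h₂
  refine ⟨r, h, ?_⟩
  rintro ⟨hS, t₁⟩ j
  obtain ⟨w, d, hd, rfl⟩ := h.of_model t₁
  exact funext fun i => congrFun (congrFun (congrFun (hL hS) i) w) j

theorem fulfils_constant {dk : DomainKind} (hdk : dk.Ok M) : Fulfils K O X (constant dk) := by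
  intro r h r₂ h₂
  by_cases ht : dk = .const ∧ (r 0).tag = .model ∧ (r₂ 0).tag = .model
  · obtain ⟨rfl, t₁, t₂⟩ := ht
    obtain ⟨w, d, hd, rfl⟩ := h.of_model t₁
    obtain ⟨v, e, he, rfl⟩ := h₂.of_model t₂
    have hd' : d ∈ M.dom v := by rwa [← hdk w v]
    exact ⟨_, .model hd', fun _ => ⟨⟨rfl, fun _ => rfl⟩, fun _ => rfl⟩⟩
  · exact ⟨_, h, fun h' => absurd h' ht⟩

theorem fulfils_inclTrue (hM : M.Models O) : Fulfils K O X inclTrue := by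
  intro r h r₂ h₂
  refine ⟨r, h, ?_⟩
  rintro ⟨t₁, t₂, j, hj, ht⟩ j' hj'
  obtain ⟨w, d, hd, rfl⟩ := h.of_model t₁
  obtain ⟨p, m, q, ⟨ci, hci, O', hO', m₁, m₂, q', h1, h2, h3, -⟩, rfl⟩ := h₂.of_incl t₂
  obtain rfl := of_decide_eq_true hj
  obtain rfl := of_decide_eq_true hj'
  exact t_modelRow.2 ((trueAt_iff h3).2 (hM ci hci w ((trueAt_iff h2).1 (t_modelRow.1 ht))))

/-- Certificates are complete. -/
theorem fulfils_conditions {L : FrameClass} {dk : DomainKind} {nk : NameKind} {allow : Bool}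
    {C : Concept n} {q q' : ℕ} (hcanon : ∀ i, ¬ (X i = some (.bit false) ∧ X (i + 1) = some .sep))
    (hallow : allow = false → O = []) (hC : Reads X 0 q C.encode)
    (hO : Reads X q q' (encodeOntology O)) (hq : X q' = none) (hL : L = .S5 → K.out = K.inn)
    (hdk : dk.Ok M) (hnk : nk.Ok M) (hM : M.Models O) (hne : ∃ w, (M.ext C w).Nonempty) :
    ∀ φ ∈ conditions n L dk nk allow, Fulfils K O X φ := by
  simp only [conditions, List.forall_mem_append, List.forall_mem_cons, List.forall_mem_map]
  exact ⟨⟨fulfils_marked, fulfils_canonical hcanon, fulfils_nameStep, fulfils_spanFirst,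
    fulfils_spanLast, fulfils_inclFirst, fulfils_inclLast, fulfils_tail hallow hC hO hq,
    fulfils_start hC, fulfils_target hC hne, fulfils_functional, fulfils_boolean, fulfils_relocate,
    fulfils_sameName (Or.inl rfl), fulfils_sameName (Or.inr rfl), fulfils_nomUnique,
    fulfils_nomTotal hnk, fulfils_descUnique, fulfils_descWitness, fulfils_exWitness,
    fulfils_exUGlobal, fulfils_exUWitness, fulfils_frame hL, fulfils_constant hdk,
    fulfils_inclTrue hM, by simp⟩, fun i _ => fulfils_diaGlobal i, fun i _ => fulfils_diaWitness i⟩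

end Semantics

/-! ### Encodings -/

/-- The bits of a name do not end in `false`. -/
def CanonicalPair (a b : Letter n) : Prop := ¬ (a = .bit false ∧ b = .sep)

theorem bits_ne_nil {a : ℕ} (ha : a ≠ 0) : a.bits ≠ [] := by
  intro h
  refine ha (Nat.eq_of_testBit_eq fun i => ?_)
  rw [Nat.testBit_eq_inth, Nat.testBit_eq_inth, h]
  simp

theorem isChain_encodeName (a : ℕ) : (encodeName a : List (Letter n)).IsChain CanonicalPair := by
  induction a using Nat.binaryRec' with
  | zero => simp [encodeName]
  | bit b a hb ih =>
    rw [encodeName, Nat.bits_append_bit a b hb, List.map_cons, List.cons_append, List.isChain_cons]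
    refine ⟨fun y hy => ?_, ih⟩
    rintro ⟨h1, rfl⟩
    cases b with
    | true => cases h1
    | false =>
      have ha : a ≠ 0 := fun ha => by simpa using hb ha
      obtain ⟨c, l, hl⟩ := List.exists_cons_of_ne_nil (bits_ne_nil ha)
      rw [hl] at hy
      simp at hy

theorem canonicalPair_of_ne {a b : Letter n} (h : a ≠ .bit false) : CanonicalPair a b :=
  fun h' => h h'.1

/-- Encodings are canonical and end with a separator. -/
def IsCanonicalWord (u : List (Letter n)) : Prop :=
  u.IsChain CanonicalPair ∧ u.getLast? = some .sep

/-- The first word ends with a separator, so the forbidden pair cannot arise at the junction. -/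
theorem IsCanonicalWord.append {u v : List (Letter n)} (hu : IsCanonicalWord u)
    (hv : IsCanonicalWord v) : IsCanonicalWord (u ++ v) := by
  refine ⟨List.isChain_append.2 ⟨hu.1, hv.1, fun a ha b _ => canonicalPair_of_ne ?_⟩, ?_⟩
  · rw [hu.2] at ha
    cases ha
    simp
  · rw [List.getLast?_append, hv.2]
    rfl

theorem IsCanonicalWord.cons {a : Letter n} {v : List (Letter n)} (ha : a ≠ .bit false)
    (hv : IsCanonicalWord v) : IsCanonicalWord (a :: v) := by
  refine ⟨List.isChain_cons.2 ⟨fun b _ => canonicalPair_of_ne ha, hv.1⟩, ?_⟩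
  rw [List.getLast?_cons, hv.2]
  rfl

theorem isCanonicalWord_encodeName (a : ℕ) : IsCanonicalWord (encodeName a : List (Letter n)) :=
  ⟨isChain_encodeName a, by simp [encodeName]⟩

theorem isCanonicalWord_encode (C : Concept n) : IsCanonicalWord C.encode := by
  induction C with
  | atom A | nom A => exact (isCanonicalWord_encodeName A).cons (by simp)
  | desc C ih | neg C ih | exU C ih | dia i C ih => exact ih.cons (by simp)
  | inter C D ih₁ ih₂ => exact (ih₁.append ih₂).cons (by simp)
  | ex r C ih => exact ((isCanonicalWord_encodeName r).append ih).cons (by simp)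

theorem isCanonicalWord_input (C : Concept n) (O : Ontology n) :
    IsCanonicalWord (C.encode ++ encodeOntology O) := by
  suffices h : encodeOntology O = [] ∨ IsCanonicalWord (encodeOntology O) by
    rcases h with h | h
    · rw [h, List.append_nil]
      exact isCanonicalWord_encode C
    · exact (isCanonicalWord_encode C).append h
  induction O with
  | nil => exact Or.inl rfl
  | cons ci O ih =>
    right
    have hci := ((isCanonicalWord_encode ci.1).append (isCanonicalWord_encode ci.2)).cons
      (a := .incl) (by simp)
    have e : encodeOntology (ci :: O) =
      (.incl :: (ci.1.encode ++ ci.2.encode)) ++ encodeOntology O := rfl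
    rw [e]
    rcases ih with h | h
    · rwa [h, List.append_nil]
    · exact hci.append h

theorem IsCanonicalWord.not_and {u : List (Letter n)} (h : IsCanonicalWord u) (i : ℕ) :
    ¬ (u[i]? = some (.bit false) ∧ u[i + 1]? = some .sep) := by
  rintro ⟨h1, h2⟩
  obtain ⟨hi, h1⟩ := List.getElem?_eq_some_iff.1 h1
  obtain ⟨hi', h2⟩ := List.getElem?_eq_some_iff.1 h2
  exact List.isChain_iff_getElem.1 h.1 i hi' ⟨h1, h2⟩

/-! ### Membership in NExpTime -/

theorem Reads.le_length {x u : List (Letter n)} {p q : ℕ}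
    (h : Reads (fun i => x[i]?) p q u) (hp : p ≤ x.length) : q ≤ x.length := by
  obtain ⟨rfl, v, hv⟩ := (reads_getElem?_iff hp).1 h
  have := congrArg List.length hv
  rw [List.length_drop, List.length_append] at this
  omega

/-- The rows of the certificate are blank from a position on. -/
theorem IsCertRow.eq_blank {M : Interpretation F} {K : Coding M} {O : Ontology n}
    {x : List (Letter n)} {ℓ : ℕ} (hℓ : x.length < ℓ)
    (hK : ∀ j, ℓ ≤ j → (∀ w, K.world w j = false) ∧ (∀ d, K.object d j = false) ∧
      ∀ i w, K.out i w j = false ∧ K.inn i w j = false)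
    {r : ℕ → CertCell n} (hr : IsCertRow K O (fun i => x[i]?) r) {j : ℕ} (hj : ℓ ≤ j) :
    r j = CertCell.blank := by
  have hlt : ∀ {p}, x[p]? ≠ none → p < x.length := fun {p} hp => by
    by_contra hp'
    exact hp (List.getElem?_eq_none (by omega))
  -- The mark `q` may be at `x.length`, one position behind the last letter. This is why `x.length <
  -- ℓ` has to be strict.
  have hparse : ∀ {C : Concept n} {p m q}, Parse (fun i => x[i]?) C p m q →
      p < x.length ∧ q ≤ x.length := fun h =>
    have h1 := hlt h.ne_none
    ⟨h1, h.reads.le_length h1.le⟩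
  have hj0 : j ≠ 0 := by omega
  cases hr with
  | @model w d hd =>
    obtain ⟨h1, h2, h3⟩ := hK j hj
    have ht : ¬ TrueAt M (fun i => x[i]?) w d j := by
      rintro ⟨D, m, q, hD, -⟩
      have := (hparse hD).1
      omega
    have hc : ¬ ChildTrueAt M (fun i => x[i]?) w d j := by
      rintro ⟨D, m, q, hD, -⟩
      have := (hparse hD).1
      omega
    simp [modelRow, CertCell.blank, h1, h2, h3, ht, hc]
  | @name p q u hu =>
    have hne : ∀ {p q u}, Reads (fun i => x[i]?) p q (nameWord u) → p < x.length := by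
      intro p q u h
      refine hlt ?_
      cases u with
      | nil => exact fun h0 => by simpa [h0] using h.1
      | cons b u => exact fun h0 => by simpa [h0] using h.1
    have h1 := hne hu
    have h2 := hu.le_length h1.le
    have he : ¬ SameName (fun i => x[i]?) p j := by
      rintro ⟨u, q₁, q₂, -, h3⟩
      have := hne h3
      omega
    have hp : j ≠ p := by omega
    have hq : j ≠ q := by omega
    simp [nameRow, CertCell.blank, hj0, he, hp, hq]
  | @span C p m q hC =>
    have h1 := hparse hC
    have h2 := hC.lt_le
    have hp : j ≠ p := by omega
    have hm : j ≠ m := by omega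
    have hq : j ≠ q := by omega
    simp [spanRow, CertCell.blank, hj0, hp, hm, hq]
  | @incl p m q hi =>
    obtain ⟨ci, hci, O', hO', m₁, m₂, q', h1, h2, h3, -⟩ := hi
    have e1 := hparse h3
    have e2 := (hparse h2).1
    have hp : j ≠ p := by omega
    have hm : j ≠ m := by omega
    have hq : j ≠ q := by omega
    simp [spanRow, CertCell.blank, hj0, hp, hm, hq]

/-- Satisfiability, where `allow` tells whether non-empty ontologies are admitted. -/
theorem inNExpTime_satisfiable (n : ℕ) (L : FrameClass) (dk : DomainKind) (nk : NameKind)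
    (allow : Bool) (hallow : allow = true → L = .S5 ∧ Subsingleton (Fin n)) :
    InNExpTime ({x | ∃ (C : Concept n) (O : Ontology n), (allow = false → O = []) ∧
      x = C.encode ++ encodeOntology O ∧ Satisfiable L dk nk O C} : Language (Letter n)) := by
  refine TapeProgram.inNExpTime_of_formulas CertCell.blank (conditions n L dk nk allow) _ (n + 9)
    (fun x S hne h => Certifies.satisfiable hne h) ?_
  rintro x ⟨C, O, hO, rfl, hsat⟩
  set x := C.encode ++ encodeOntology O with hx
  have hpos : 1 ≤ x.length := by
    rw [hx]
    cases C <;> simp [Concept.encode]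
  have hO' : O = [] ∨ L = .S5 ∧ Subsingleton (Fin n) := by
    cases allow with
    | false => exact Or.inl (hO rfl)
    | true => exact Or.inr (hallow rfl)
  obtain ⟨F, M, cw, cd, out, inn, hcw, hcd, hR, hS5, hdk, hnk, hM, hne, hb⟩ :=
    exists_small_interpretation hsat hO' rfl rfl
  let K : Coding M := ⟨cw, cd, out, inn, hcw, hcd, hR⟩
  have hlt : x.length < (n + 9) * x.length ^ 3 := by
    have h1 : x.length ≤ x.length ^ 3 := Nat.le_self_pow (by norm_num) _
    have h2 : 0 ≤ n * x.length ^ 3 := Nat.zero_le _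
    rw [add_mul]
    omega
  obtain ⟨q, hq, hq'⟩ := reads_append.1 ((reads_getElem?_iff (x := x) (Nat.zero_le _)).2
    ⟨rfl, [], by rw [List.drop_zero, List.append_nil]⟩ :
    Reads (fun i => x[i]?) 0 _ (C.encode ++ encodeOntology O))
  have hful := fulfils_conditions (K := K) (L := L) (isCanonicalWord_input C O).not_and hO hq hq'
    (by simp) hS5 hdk hnk hM hne
  refine ⟨List.length_pos_iff.1 hpos, _, {r | IsCertRow K O (fun i => x[i]?) r}, hlt.le, le_rfl,
    ?_, fun r hr i hi => IsCertRow.eq_blank hlt hb hr hi, hful⟩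
  obtain ⟨w, d, hd⟩ := hne
  exact ⟨_, .model (M.ext_sub C w hd)⟩

end ModalDL

/-! ### The two complexity bounds -/

theorem mainTheorem1 (dk : ModalDL.DomainKind) (nk : ModalDL.NameKind) :
    (∀ (n : ℕ) (L : ModalDL.FrameClass), InNExpTime (ModalDL.conceptSat n L dk nk)) ∧
      InNExpTime (ModalDL.conceptSatUnderOntology 1 ModalDL.FrameClass.S5 dk nk) := by
  refine ⟨fun n L => ?_, ?_⟩
  · refine Eq.subst (motive := fun l => InNExpTime l) (Set.ext fun x => ⟨?_, ?_⟩)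
      (ModalDL.inNExpTime_satisfiable n L dk nk false (by simp))
    · rintro ⟨C, O, hO, rfl, h⟩
      obtain rfl := hO rfl
      exact ⟨C, by simp [ModalDL.encodeOntology], h⟩
    · rintro ⟨C, rfl, h⟩
      exact ⟨C, [], fun _ => rfl, by simp [ModalDL.encodeOntology], h⟩
  · refine Eq.subst (motive := fun l => InNExpTime l) (Set.ext fun x => ⟨?_, ?_⟩)
      (ModalDL.inNExpTime_satisfiable 1 .S5 dk nk true (fun _ => ⟨rfl, inferInstance⟩))
    · rintro ⟨C, O, -, rfl, h⟩
      exact ⟨C, O, rfl, h⟩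
    · rintro ⟨C, O, rfl, h⟩
      exact ⟨C, O, by simp, rfl, h⟩
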